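/- **Theorem 3.9.** Let $k$ be a nonzero commutative ring and let $A$ be a Hopf algebra over $k$ that is flat as a $k$-module. (Write $\otimes=\otimes_k$, $*$ for convolution, and use Sweedler notation $\Delta(a)=a_1\otimes a_2$.) *Lazy cohomology.* A lazy 2-cocycle is a convolution-invertible linear map $\sigma:A\otimes A\to k$ such that for all $a,b,c\in A$: $\sigma(a,1)=\varepsilon(a)=\sigma(1,a)$; $\sigma(a_1,b_1)\,a_2b_2=\sigma(a_2,b_2)\,a_1b_1$; and $\sigma(a_1,b_1)\sigma(a_2b_2,c)=\sigma(b_1,c_1)\sigma(a,b_2c_2)$. These form a group $Z^2_L(A)$ under convolution. The convolution-invertible linear maps $\mu:A\to k$ with $\mu(1)=1$ and $\mu(a_1)a_2=a_1\mu(a_2)$ for all $a$ form a group $\mathrm{Reg}^1_L(A)$, and $\partial(\mu)(a,b)=\mu(a_1)\mu(b_1)\mu^{-1}(a_2b_2)$ defines a group morphism $\partial:\mathrm{Reg}^1_L(A)\to Z^2_L(A)$ with central image $B^2_L(A)$. Put $H^2_L(A)=Z^2_L(A)/B^2_L(A)$. *BiGalois objects.* An $A$-biGalois object is a nonzero $k$-algebra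 $Z$ with an $A$-$A$-bicomodule structure whose coactions $\lambda:Z\to A\otimes Z$ and $\rho:Z\to Z\otimes A$ are algebra maps, such that the canonical map identifies $k$ with the left coinvariants $\{z:\lambda(z)=1\otimes z\}$ and with the right coinvariants $\{z:\rho(z)=z\otimes 1\}$, and such that the maps $Z\otimes Z\to Z\otimes A$, $x\otimes y\mapsto (x\otimes 1)\rho(y)$, and $Z\otimes Z\to A\otimes Z$, $x\otimes y\mapsto\lambda(x)(1\otimes y)$, are bijective. Let $\mathrm{BiGal}(A)$ be the set of classes $[Z]$ of $A$-biGalois objects that are faithfully flat over $k$, up to isomorphism of $A$-bicomodule algebras, and let $\mathrm{Bicleft}(A)\subseteq\mathrm{BiGal}(A)$ be the set of those classes $[Z]$ for which $Z\cong A$ as $A$-bicomodules. For bicomodule algebras $Z,T$ let $Z\,\square_A\,T=\ker(\rho_Z\otimes\mathrm{id}_T-\mathrm{id}_Z\otimes\lambda_T)\subseteq Z\otimes T$ be the cotensor product, with the left coaction of $Z$ and the right coaction of $T$. For $\sigma\in Z^2_L(A)$ let $A(\sigma)$ be the $A$-bicomodule $A$ (both coactions being $\Delta$) with the product $a\cdot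 b=\sigma(a_1,b_1)\,a_2b_2$. Then: 1. if $Z$ and $T$ are faithfully flat $A$-biGalois objects, so is $Z\,\square_A\,T$, and $[Z][T]=[Z\,\square_A\,T]$ makes $\mathrm{BiGal}(A)$ a group (Schauenburg's biGalois group); 2. $\mathrm{Bicleft}(A)$ is a normal subgroup of $\mathrm{BiGal}(A)$; 3. for each $\sigma\in Z^2_L(A)$ the bicomodule algebra $A(\sigma)$ is a faithfully flat $A$-biGalois object, and $\sigma\mapsto[A(\sigma)]$ induces a group isomorphism $H^2_L(A)\cong\mathrm{Bicleft}(A)$. In particular, $H^2_L(A)$ is identified with a normal subgroup of $\mathrm{BiGal}(A)$. -/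

import Mathlib

open TensorProduct Coalgebra WithConv

universe u v

noncomputable section

namespace LazyCohomology

section Convolution

variable {k : Type*} [CommRing k]
variable {C D : Type*} [AddCommGroup C] [Module k C] [Coalgebra k C]
  [AddCommGroup D] [Module k D] [Coalgebra k D]
variable {B B' : Type*} [Ring B] [Algebra k B] [Ring B'] [Algebra k B']

/-- Precomposition with a coalgebra map, as a morphism of convolution monoids. -/
def pull (B : Type*) [Ring B] [Algebra k B] (f : C →ₗc[k] D) :
    WithConv (D →ₗ[k] B) →* WithConv (C →ₗ[k] B) where
  toFun φ := toConv (φ.ofConv ∘ₗ f.toLinearMap)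
  map_one' := by
    apply WithConv.ext; ext c
    simp [LinearMap.convOne_def]
  map_mul' φ ψ := by
    apply WithConv.ext
    exact LinearMap.convMul_comp_coalgHom_distrib φ ψ f

@[simp] lemma pull_apply (f : C →ₗc[k] D) (φ : WithConv (D →ₗ[k] B)) (c : C) :
    (pull B f φ) c = φ (f c) := rfl

/-- Postcomposition with an algebra map, as a morphism of convolution monoids. -/
def push (h : B →ₐ[k] B') : WithConv (C →ₗ[k] B) →* WithConv (C →ₗ[k] B') where
  toFun φ := toConv (h.toLinearMap ∘ₗ φ.ofConv)
  map_one' := by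
    apply WithConv.ext; ext c
    simp [LinearMap.convOne_def]
  map_mul' φ ψ := by
    apply WithConv.ext
    exact LinearMap.algHom_comp_convMul_distrib h φ ψ

@[simp] lemma push_apply (h : B →ₐ[k] B') (φ : WithConv (C →ₗ[k] B)) (c : C) :
    (push h φ) c = h (φ c) := rfl

/-- A functional `φ : C → k` seen as the `B`-valued map `c ↦ φ(c) 1`. -/
def scal (B : Type*) [Ring B] [Algebra k B] :
    WithConv (C →ₗ[k] k) →* WithConv (C →ₗ[k] B) := push (Algebra.ofId k B)

@[simp] lemma scal_apply (φ : WithConv (C →ₗ[k] k)) (c : C) :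
    (scal B φ) c = algebraMap k B (φ c) := rfl

lemma scal_mul_apply (φ : WithConv (C →ₗ[k] k)) (g : WithConv (C →ₗ[k] B)) (c : C) :
    (scal B φ * g) c =
      TensorProduct.lift (LinearMap.lsmul k B ∘ₗ φ.ofConv) (g.ofConv.lTensor C (comul c)) := by
  rw [LinearMap.convMul_apply]
  generalize comul (R := k) c = x
  induction x with
  | zero => simp
  | add x y hx hy => simp only [map_add, hx, hy]
  | tmul x y => simp [Algebra.smul_def]

lemma mul_scal_apply (φ : WithConv (C →ₗ[k] k)) (g : WithConv (C →ₗ[k] B)) (c : C) :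
    (g * scal B φ) c =
      TensorProduct.lift (LinearMap.lsmul k B ∘ₗ φ.ofConv).flip
        (g.ofConv.rTensor C (comul c)) := by
  rw [LinearMap.convMul_apply]
  generalize comul (R := k) c = x
  induction x with
  | zero => simp
  | add x y hx hy => simp only [map_add, hx, hy]
  | tmul x y => simp [Algebra.smul_def, Algebra.commutes]

/-- Postcomposition with a mere linear map is compatible with the left action of functionals. -/
lemma comp_scal_mul (L : B →ₗ[k] B') (φ : WithConv (C →ₗ[k] k)) (g : WithConv (C →ₗ[k] B)) :
    toConv (L ∘ₗ (scal B φ * g).ofConv) = scal B' φ * toConv (L ∘ₗ g.ofConv) := by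
  apply WithConv.ext; ext c
  change L ((scal B φ * g) c) = (scal B' φ * toConv (L ∘ₗ g.ofConv)) c
  rw [scal_mul_apply, scal_mul_apply]
  generalize comul (R := k) c = x
  induction x with
  | zero => simp
  | add x y hx hy => simp only [map_add, hx, hy]
  | tmul x y => simp

lemma comp_mul_scal (L : B →ₗ[k] B') (φ : WithConv (C →ₗ[k] k)) (g : WithConv (C →ₗ[k] B)) :
    toConv (L ∘ₗ (g * scal B φ).ofConv) = toConv (L ∘ₗ g.ofConv) * scal B' φ := by
  apply WithConv.ext; ext c
  change L ((g * scal B φ) c) = (toConv (L ∘ₗ g.ofConv) * scal B' φ) c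
  rw [mul_scal_apply, mul_scal_apply]
  generalize comul (R := k) c = x
  induction x with
  | zero => simp
  | add x y hx hy => simp only [map_add, hx, hy]
  | tmul x y => simp

lemma scal_self (φ : WithConv (C →ₗ[k] k)) : scal k φ = φ := rfl

lemma commute_comp {φ : WithConv (C →ₗ[k] k)} {g : WithConv (C →ₗ[k] B)}
    (h : Commute (scal B φ) g) (L : B →ₗ[k] B') :
    Commute (scal B' φ) (toConv (L ∘ₗ g.ofConv)) := by
  have := congrArg (fun x : WithConv (C →ₗ[k] B) ↦ toConv (L ∘ₗ x.ofConv)) h.eq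
  simp only [comp_scal_mul, comp_mul_scal] at this
  exact this

variable (k C D) in
/-- `c ⊗ d ↦ ε(d) c` -/
def prL : C ⊗[k] D →ₗc[k] C :=
  (Coalgebra.TensorProduct.rid k k C).toCoalgHom.comp
    (Coalgebra.TensorProduct.map (CoalgHom.id k C) (counitCoalgHom k D))

variable (k C D) in
/-- `c ⊗ d ↦ ε(c) d` -/
def prR : C ⊗[k] D →ₗc[k] D :=
  (Coalgebra.TensorProduct.lid k D).toCoalgHom.comp
    (Coalgebra.TensorProduct.map (counitCoalgHom k C) (CoalgHom.id k D))

@[simp] lemma prL_tmul (c : C) (d : D) : prL k C D (c ⊗ₜ d) = counit (R := k) d • c := rfl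
@[simp] lemma prR_tmul (c : C) (d : D) : prR k C D (c ⊗ₜ d) = counit (R := k) c • d := rfl

lemma scal_pull_prL (φ : WithConv (C →ₗ[k] k)) :
    scal (B ⊗[k] B') (pull k (prL k C D) φ) =
      toConv (TensorProduct.map (scal B φ).ofConv
        (1 : WithConv (D →ₗ[k] B')).ofConv) := by
  apply WithConv.ext
  apply TensorProduct.ext'
  intro c d
  change algebraMap k (B ⊗[k] B') (φ (prL k C D (c ⊗ₜ d))) =
    (algebraMap k B (φ c)) ⊗ₜ (algebraMap k B' (counit d))
  rw [prL_tmul, map_smul, Algebra.algebraMap_eq_smul_one, Algebra.algebraMap_eq_smul_one,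
    Algebra.algebraMap_eq_smul_one, TensorProduct.smul_tmul_smul, smul_eq_mul, mul_comm]
  rfl

lemma scal_pull_prR (φ : WithConv (D →ₗ[k] k)) :
    scal (B ⊗[k] B') (pull k (prR k C D) φ) =
      toConv (TensorProduct.map (1 : WithConv (C →ₗ[k] B)).ofConv (scal B' φ).ofConv) := by
  apply WithConv.ext
  apply TensorProduct.ext'
  intro c d
  change algebraMap k (B ⊗[k] B') (φ (prR k C D (c ⊗ₜ d))) =
    (algebraMap k B (counit c)) ⊗ₜ (algebraMap k B' (φ d))
  rw [prR_tmul, map_smul, Algebra.algebraMap_eq_smul_one, Algebra.algebraMap_eq_smul_one,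
    Algebra.algebraMap_eq_smul_one, TensorProduct.smul_tmul_smul, smul_eq_mul]
  rfl

lemma commute_prL_map {φ : WithConv (C →ₗ[k] k)} {g : WithConv (C →ₗ[k] B)}
    (h : Commute (scal B φ) g) (g' : WithConv (D →ₗ[k] B')) :
    Commute (scal (B ⊗[k] B') (pull k (prL k C D) φ))
      (toConv (TensorProduct.map g.ofConv g'.ofConv)) := by
  rw [scal_pull_prL]
  change _ * _ = _ * _
  rw [TensorProduct.map_convMul_map, TensorProduct.map_convMul_map, h.eq, one_mul, mul_one]

lemma commute_prR_map {φ : WithConv (D →ₗ[k] k)} {g' : WithConv (D →ₗ[k] B')}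
    (h : Commute (scal B' φ) g') (g : WithConv (C →ₗ[k] B)) :
    Commute (scal (B ⊗[k] B') (pull k (prR k C D) φ))
      (toConv (TensorProduct.map g.ofConv g'.ofConv)) := by
  rw [scal_pull_prR]
  change _ * _ = _ * _
  rw [TensorProduct.map_convMul_map, TensorProduct.map_convMul_map, h.eq, one_mul, mul_one]

lemma push_lmul_scal (χ : WithConv (C →ₗ[k] k)) :
    push (Algebra.TensorProduct.lmul' k (S := k)) (scal (k ⊗[k] k) χ) = χ := by
  apply WithConv.ext
  apply LinearMap.ext
  intro x
  change Algebra.TensorProduct.lmul' k (S := k) (algebraMap k (k ⊗[k] k) (χ x)) = χ x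
  simp

lemma commute_prL_prR (φ : WithConv (C →ₗ[k] k)) (ψ : WithConv (D →ₗ[k] k)) :
    Commute (pull k (prL k C D) φ) (pull k (prR k C D) ψ) := by
  have h := commute_prL_map (φ := φ) (Commute.one_right (scal k φ)) (scal k ψ)
  rw [← scal_pull_prR] at h
  have h2 := h.map (push (Algebra.TensorProduct.lmul' k (S := k)))
  rwa [push_lmul_scal, push_lmul_scal] at h2

end Convolution

section Cohomology

variable (k : Type u) (A : Type v) [CommRing k] [Ring A] [HopfAlgebra k A]

/-- `a ⊗ b ⊗ c ↦ ε(a) b ⊗ c` -/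
def face0 : (A ⊗[k] A) ⊗[k] A →ₗc[k] A ⊗[k] A :=
  (prR k A (A ⊗[k] A)).comp (Coalgebra.TensorProduct.assoc k k A A A).toCoalgHom

/-- `a ⊗ b ⊗ c ↦ ab ⊗ c` -/
def face1 : (A ⊗[k] A) ⊗[k] A →ₗc[k] A ⊗[k] A :=
  Coalgebra.TensorProduct.map (Bialgebra.mulCoalgHom k A) (CoalgHom.id k A)

/-- `a ⊗ b ⊗ c ↦ a ⊗ bc` -/
def face2 : (A ⊗[k] A) ⊗[k] A →ₗc[k] A ⊗[k] A :=
  (Coalgebra.TensorProduct.map (CoalgHom.id k A) (Bialgebra.mulCoalgHom k A)).comp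
    (Coalgebra.TensorProduct.assoc k k A A A).toCoalgHom

/-- `a ⊗ b ⊗ c ↦ ε(c) a ⊗ b` -/
def face3 : (A ⊗[k] A) ⊗[k] A →ₗc[k] A ⊗[k] A := prL k (A ⊗[k] A) A

variable {k A}

@[simp] lemma face0_tmul (a b c : A) :
    face0 k A ((a ⊗ₜ b) ⊗ₜ c) = counit (R := k) a • (b ⊗ₜ[k] c) := rfl
@[simp] lemma face1_tmul (a b c : A) :
    face1 k A ((a ⊗ₜ b) ⊗ₜ c) = (a * b) ⊗ₜ[k] c := rfl
@[simp] lemma face2_tmul (a b c : A) :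
    face2 k A ((a ⊗ₜ b) ⊗ₜ c) = a ⊗ₜ[k] (b * c) := rfl
@[simp] lemma face3_tmul (a b c : A) :
    face3 k A ((a ⊗ₜ b) ⊗ₜ c) = counit (R := k) c • (a ⊗ₜ[k] b) := rfl

variable (k A) in
/-- The convolution-invertible functionals on `A`. -/
abbrev Conv1 := (WithConv (A →ₗ[k] k))ˣ

variable (k A) in
/-- The convolution-invertible functionals on `A ⊗ A`. -/
abbrev Conv2 := (WithConv (A ⊗[k] A →ₗ[k] k))ˣ

variable (k A) in
/-- `a ↦ a ⊗ 1` -/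
def insL : A →ₗc[k] A ⊗[k] A :=
  (Coalgebra.TensorProduct.map (CoalgHom.id k A) (Bialgebra.unitBialgHom k A).toCoalgHom).comp
    (Coalgebra.TensorProduct.rid k k A).symm.toCoalgHom

variable (k A) in
/-- `a ↦ 1 ⊗ a` -/
def insR : A →ₗc[k] A ⊗[k] A :=
  (Coalgebra.TensorProduct.map (Bialgebra.unitBialgHom k A).toCoalgHom (CoalgHom.id k A)).comp
    (Coalgebra.TensorProduct.lid k A).symm.toCoalgHom

@[simp] lemma insL_apply (a : A) : insL k A a = a ⊗ₜ[k] (1 : A) := by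
  change a ⊗ₜ[k] (algebraMap k A 1) = _
  rw [map_one]

@[simp] lemma insR_apply (a : A) : insR k A a = (1 : A) ⊗ₜ[k] a := by
  change (algebraMap k A 1) ⊗ₜ[k] a = _
  rw [map_one]

variable (k A) in
/-- `Reg¹(A)`: the group of convolution-invertible `μ : A → k` with `μ(1) = 1`. -/
def Reg1 : Subgroup (Conv1 k A) where
  carrier := {μ | μ.val (1 : A) = 1}
  one_mem' := by simp
  mul_mem' {μ ν} hμ hν := by
    change μ.val (1 : A) = 1 at hμ
    change ν.val (1 : A) = 1 at hν
    change (μ.val * ν.val) (1 : A) = 1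
    simp [Algebra.TensorProduct.one_def, hμ, hν]
  inv_mem' {μ} hμ := by
    change μ.val (1 : A) = 1 at hμ
    change (μ⁻¹).val (1 : A) = 1
    have h : (μ.val * (μ⁻¹).val) (1 : A) = (1 : WithConv (A →ₗ[k] k)) (1 : A) := by
      rw [μ.mul_inv]
    rw [LinearMap.convMul_apply] at h
    simpa only [Bialgebra.comul_one, Algebra.TensorProduct.one_def, TensorProduct.map_tmul, hμ,
      LinearMap.mul'_apply, one_mul, LinearMap.convOne_apply, Bialgebra.counit_one, map_one] using h

lemma normalized_iff (σ : WithConv (A ⊗[k] A →ₗ[k] k)) :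
    (∀ a : A, σ (a ⊗ₜ 1) = counit (R := k) a ∧ σ (1 ⊗ₜ a) = counit (R := k) a) ↔
      pull k (insL k A) σ = 1 ∧ pull k (insR k A) σ = 1 := by
  constructor
  · intro h
    constructor
    · apply WithConv.ext; ext a
      rw [pull_apply, insL_apply]
      exact (h a).1
    · apply WithConv.ext; ext a
      rw [pull_apply, insR_apply]
      exact (h a).2
  · rintro ⟨h1, h2⟩ a
    constructor
    · have : (pull k (insL k A) σ) a = (1 : WithConv (A →ₗ[k] k)) a := by rw [h1]
      rwa [pull_apply, insL_apply] at this
    · have : (pull k (insR k A) σ) a = (1 : WithConv (A →ₗ[k] k)) a := by rw [h2]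
      rwa [pull_apply, insR_apply] at this

variable (k A) in
/-- `Reg²(A)`: the group of convolution-invertible `σ : A ⊗ A → k` with
`σ(a, 1) = ε(a) = σ(1, a)`. -/
def Reg2 : Subgroup (Conv2 k A) where
  carrier := {σ | ∀ a : A, σ.val (a ⊗ₜ 1) = counit (R := k) a ∧
    σ.val (1 ⊗ₜ a) = counit (R := k) a}
  one_mem' := by intro a; simp
  mul_mem' {σ τ} hσ hτ := by
    have h1 := (normalized_iff σ.val).1 hσ
    have h2 := (normalized_iff τ.val).1 hτ
    refine (normalized_iff (σ * τ).val).2 ⟨?_, ?_⟩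
    · rw [Units.val_mul, map_mul, h1.1, h2.1, one_mul]
    · rw [Units.val_mul, map_mul, h1.2, h2.2, one_mul]
  inv_mem' {σ} hσ := by
    have h1 := (normalized_iff σ.val).1 hσ
    refine (normalized_iff (σ⁻¹).val).2 ⟨?_, ?_⟩
    · rw [← one_mul (pull k (insL k A) _), ← h1.1, ← map_mul, σ.mul_inv, map_one, h1.1]
    · rw [← one_mul (pull k (insR k A) _), ← h1.2, ← map_mul, σ.mul_inv, map_one, h1.2]

/-- `μ * id = id * μ`, i.e. `μ(a₁) a₂ = a₁ μ(a₂)`. -/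
def IsLazy1 (μ : WithConv (A →ₗ[k] k)) : Prop :=
  scal A μ * toConv LinearMap.id = toConv LinearMap.id * scal A μ

/-- `σ * m = m * σ`, i.e. `σ(a₁, b₁) a₂ b₂ = a₁ b₁ σ(a₂, b₂)`, where `m` is the multiplication. -/
def IsLazy2 (σ : WithConv (A ⊗[k] A →ₗ[k] k)) : Prop :=
  scal A σ * toConv (LinearMap.mul' k A) = toConv (LinearMap.mul' k A) * scal A σ

/-- The left 2-cocycle condition `σ(a₁, b₁) σ(a₂b₂, c) = σ(b₁, c₁) σ(a, b₂c₂)`, written as an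
identity of functionals on `A ⊗ A ⊗ A`: the left hand side is the convolution product of
`(a, b, c) ↦ σ(a, b) ε(c)` and `(a, b, c) ↦ σ(ab, c)`, the right hand side that of
`(a, b, c) ↦ ε(a) σ(b, c)` and `(a, b, c) ↦ σ(a, bc)`. -/
def IsLeftCocycle (σ : WithConv (A ⊗[k] A →ₗ[k] k)) : Prop :=
  pull k (face3 k A) σ * pull k (face1 k A) σ = pull k (face0 k A) σ * pull k (face2 k A) σ


lemma commute_face3_face1 {σ : WithConv (A ⊗[k] A →ₗ[k] k)} (hσ : IsLazy2 σ)
    (φ : WithConv (A ⊗[k] A →ₗ[k] k)) :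
    Commute (pull k (face3 k A) σ) (pull k (face1 k A) φ) :=
  commute_comp (commute_prL_map (D := A) (show Commute _ _ from hσ) (toConv LinearMap.id)) φ.ofConv

lemma commute_face0_face2 {σ : WithConv (A ⊗[k] A →ₗ[k] k)} (hσ : IsLazy2 σ)
    (φ : WithConv (A ⊗[k] A →ₗ[k] k)) :
    Commute (pull k (face0 k A) σ) (pull k (face2 k A) φ) :=
  (commute_comp (commute_prR_map (C := A) (show Commute _ _ from hσ) (toConv LinearMap.id))
    φ.ofConv).map (pull k (Coalgebra.TensorProduct.assoc k k A A A).toCoalgHom)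

variable (k A) in
/-- `Z²_L(A)`: the group of lazy 2-cocycles, i.e. of the lazy elements of `Reg²(A)` that are
left 2-cocycles. -/
def Z2L : Subgroup (Conv2 k A) where
  carrier := {σ | σ ∈ Reg2 k A ∧ IsLazy2 σ.val ∧ IsLeftCocycle σ.val}
  one_mem' := by
    refine ⟨one_mem _, ?_, ?_⟩
    · simp [IsLazy2]
    · simp [IsLeftCocycle]
  mul_mem' {σ τ} hσ hτ := by
    refine ⟨mul_mem hσ.1 hτ.1, ?_, ?_⟩
    · have := Commute.mul_left (show Commute _ _ from hσ.2.1) (show Commute _ _ from hτ.2.1)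
      rw [← map_mul] at this
      exact this
    · have h3 := commute_face3_face1 hτ.2.1 σ.val
      have h0 := commute_face0_face2 hτ.2.1 σ.val
      have e1 := hσ.2.2
      have e2 := hτ.2.2
      unfold IsLeftCocycle at e1 e2 ⊢
      simp only [Units.val_mul, map_mul]
      rw [mul_assoc, ← mul_assoc (pull k (face3 k A) τ.val), h3.eq, mul_assoc, e2,
        ← mul_assoc, e1, mul_assoc, mul_assoc, ← mul_assoc (pull k (face2 k A) σ.val), ← h0.eq,
        mul_assoc]
  inv_mem' {σ} hσ := by
    have hl : IsLazy2 (σ⁻¹).val := by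
      have : Commute (Units.map (scal A) σ).val (toConv (LinearMap.mul' k A)) := hσ.2.1
      have := this.units_inv_left
      rwa [← map_inv] at this
    refine ⟨inv_mem hσ.1, hl, ?_⟩
    have h3 := commute_face3_face1 hl (σ⁻¹).val
    have h0 := commute_face0_face2 hl (σ⁻¹).val
    have e : Units.map (pull k (face3 k A)) σ * Units.map (pull k (face1 k A)) σ =
        Units.map (pull k (face0 k A)) σ * Units.map (pull k (face2 k A)) σ :=
      Units.ext hσ.2.2
    have e' := congrArg (fun x ↦ (x⁻¹).val) e
    simp only [mul_inv_rev, ← map_inv, Units.val_mul, Units.coe_map] at e'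
    unfold IsLeftCocycle
    rw [h3.eq, h0.eq]
    exact e'

variable (k A) in
/-- `Reg¹_L(A)`: the group of lazy elements of `Reg¹(A)`. -/
def Reg1L : Subgroup (Conv1 k A) where
  carrier := {μ | μ ∈ Reg1 k A ∧ IsLazy1 μ.val}
  one_mem' := ⟨one_mem _, by simp [IsLazy1]⟩
  mul_mem' {μ ν} hμ hν := by
    refine ⟨mul_mem hμ.1 hν.1, ?_⟩
    have := Commute.mul_left (show Commute _ _ from hμ.2) (show Commute _ _ from hν.2)
    rw [← map_mul] at this
    exact this
  inv_mem' {μ} hμ := by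
    refine ⟨inv_mem hμ.1, ?_⟩
    have : Commute (Units.map (scal A) μ).val (toConv LinearMap.id) := hμ.2
    have := this.units_inv_left
    rwa [← map_inv] at this

/-- The differential `∂(μ) = (μ ⊗ μ) * (μ⁻¹ ∘ m)`, i.e.
`∂(μ)(a, b) = μ(a₁) μ(b₁) μ⁻¹(a₂b₂)`. Here `μ ⊗ μ` is the convolution product of
`(a, b) ↦ μ(a) ε(b)` and `(a, b) ↦ ε(a) μ(b)`. -/
def diff (μ : Conv1 k A) : Conv2 k A :=
  Units.map (pull k (prL k A A)) μ * Units.map (pull k (prR k A A)) μ *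
    Units.map (pull k (Bialgebra.mulCoalgHom k A)) μ⁻¹


lemma units_commute {M : Type*} [Monoid M] {x y : Mˣ} (h : Commute x.val y.val) :
    Commute x y := Units.ext h

lemma prL_mul_prR_tmul (μ : WithConv (A →ₗ[k] k)) (a b : A) :
    (pull k (prL k A A) μ * pull k (prR k A A) μ) (a ⊗ₜ b) = μ a * μ b := by
  have h : scal (k ⊗[k] k) (pull k (prL k A A) μ * pull k (prR k A A) μ) =
      toConv (TensorProduct.map μ.ofConv μ.ofConv) := by
    rw [map_mul, scal_pull_prR, scal_pull_prL, TensorProduct.map_convMul_map, one_mul, mul_one]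
    rfl
  have h2 := congrArg (push (Algebra.TensorProduct.lmul' k (S := k))) h
  rw [push_lmul_scal] at h2
  rw [h2]
  simp

lemma mul_six {G : Type*} [Group G] (a b c : G) {a' b' : G} (c' : G) (ha : ∀ x, Commute a' x)
    (hb : ∀ x, Commute b' x) : a * a' * (b * b') * (c * c') = a * b * c * (a' * b' * c') := by
  simp only [mul_assoc]
  rw [(ha b).left_comm, (hb c).left_comm, (ha c).left_comm]

lemma commute_prL_of_lazy {μ : WithConv (A →ₗ[k] k)} (hμ : IsLazy1 μ)
    (g : WithConv (A ⊗[k] A →ₗ[k] A)) : Commute (scal A (pull k (prL k A A) μ)) g := by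
  have := commute_comp (commute_prL_map (D := A) (show Commute _ _ from hμ)
    (toConv LinearMap.id)) g.ofConv
  simpa using this

lemma commute_prR_of_lazy {μ : WithConv (A →ₗ[k] k)} (hμ : IsLazy1 μ)
    (g : WithConv (A ⊗[k] A →ₗ[k] A)) : Commute (scal A (pull k (prR k A A) μ)) g := by
  have := commute_comp (commute_prR_map (C := A) (show Commute _ _ from hμ)
    (toConv LinearMap.id)) g.ofConv
  simpa using this

lemma commute_prL_of_lazy' {μ : Conv1 k A} (hμ : IsLazy1 μ.val) (τ : Conv2 k A) :
    Commute (Units.map (pull k (prL k A A)) μ) τ := by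
  have := commute_comp (commute_prL_map (D := A) (show Commute _ _ from hμ)
    (toConv LinearMap.id)) τ.val.ofConv
  apply units_commute
  rw [scal_self, ofConv_toConv, ofConv_toConv, TensorProduct.map_id, LinearMap.comp_id] at this
  exact this

lemma commute_prR_of_lazy' {μ : Conv1 k A} (hμ : IsLazy1 μ.val) (τ : Conv2 k A) :
    Commute (Units.map (pull k (prR k A A)) μ) τ := by
  have := commute_comp (commute_prR_map (C := A) (show Commute _ _ from hμ)
    (toConv LinearMap.id)) τ.val.ofConv
  apply units_commute
  rw [scal_self, ofConv_toConv, ofConv_toConv, TensorProduct.map_id, LinearMap.comp_id] at this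
  exact this

lemma commute_mul_of_lazy {σ : Conv2 k A} (hσ : IsLazy2 σ.val) (μ : Conv1 k A) :
    Commute σ (Units.map (pull k (Bialgebra.mulCoalgHom k A)) μ) := by
  apply units_commute
  exact commute_comp (show Commute _ _ from hσ) μ.val.ofConv

lemma isLazy2_diff {μ : Conv1 k A} (hμ : IsLazy1 μ.val) : IsLazy2 (diff μ).val := by
  have h1 := commute_prL_of_lazy hμ (toConv (LinearMap.mul' k A))
  have h2 := commute_prR_of_lazy hμ (toConv (LinearMap.mul' k A))
  have h3 : Commute (Units.map (scal A) (Units.map (pull k (Bialgebra.mulCoalgHom k A)) μ)).val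
      (toConv (LinearMap.mul' k A)) :=
    (show Commute (scal A μ.val) (toConv LinearMap.id) from hμ).map
      (pull A (Bialgebra.mulCoalgHom k A))
  have h3 := h3.units_inv_left
  have := (h1.mul_left h2).mul_left h3
  rw [← map_inv, ← map_inv, ← map_mul] at this
  unfold IsLazy2 diff
  rw [Units.val_mul, Units.val_mul, map_mul (scal A)]
  exact this

lemma pull_pull {C D E : Type*} [AddCommGroup C] [Module k C] [Coalgebra k C]
    [AddCommGroup D] [Module k D] [Coalgebra k D] [AddCommGroup E] [Module k E] [Coalgebra k E]
    (f : C →ₗc[k] D) (g : D →ₗc[k] E) (φ : WithConv (E →ₗ[k] k)) :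
    pull k f (pull k g φ) = pull k (g.comp f) φ := rfl

lemma pull_face_congr {C : Type*} [AddCommGroup C] [Module k C] [Coalgebra k C]
    {f g : A ⊗[k] A →ₗc[k] C} {p q : (A ⊗[k] A) ⊗[k] A →ₗc[k] A ⊗[k] A}
    (h : ∀ a b c : A, f (p ((a ⊗ₜ b) ⊗ₜ c)) = g (q ((a ⊗ₜ b) ⊗ₜ c)))
    (μ : (WithConv (C →ₗ[k] k))ˣ) :
    Units.map (pull k p) (Units.map (pull k f) μ) =
      Units.map (pull k q) (Units.map (pull k g) μ) := by
  apply Units.ext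
  apply WithConv.ext
  apply TensorProduct.ext_threefold
  intro a b c
  exact congrArg μ.val.ofConv (h a b c)

lemma isLeftCocycle_diff (μ : Conv1 k A) : IsLeftCocycle (diff μ).val := by
  suffices h : Units.map (pull k (face3 k A)) (diff μ) * Units.map (pull k (face1 k A)) (diff μ) =
      Units.map (pull k (face0 k A)) (diff μ) * Units.map (pull k (face2 k A)) (diff μ) from
    congrArg Units.val h
  have ha : Units.map (pull k (face2 k A)) (Units.map (pull k (prL k A A)) μ) =
      Units.map (pull k (face3 k A)) (Units.map (pull k (prL k A A)) μ) :=
    pull_face_congr (fun a b c ↦ by simp [smul_smul, mul_comm]) μ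
  have hb : Units.map (pull k (face3 k A)) (Units.map (pull k (prR k A A)) μ) =
      Units.map (pull k (face0 k A)) (Units.map (pull k (prL k A A)) μ) :=
    pull_face_congr (fun a b c ↦ by simp [smul_smul, mul_comm]) μ
  have hc : Units.map (pull k (face1 k A)) (Units.map (pull k (prR k A A)) μ) =
      Units.map (pull k (face0 k A)) (Units.map (pull k (prR k A A)) μ) :=
    pull_face_congr (fun a b c ↦ by simp [mul_smul]) μ
  have hx : Units.map (pull k (face3 k A)) (Units.map (pull k (Bialgebra.mulCoalgHom k A)) μ) =
      Units.map (pull k (face1 k A)) (Units.map (pull k (prL k A A)) μ) :=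
    pull_face_congr (fun a b c ↦ by simp) μ
  have hy : Units.map (pull k (face0 k A)) (Units.map (pull k (Bialgebra.mulCoalgHom k A)) μ) =
      Units.map (pull k (face2 k A)) (Units.map (pull k (prR k A A)) μ) :=
    pull_face_congr (fun a b c ↦ by simp) μ
  have hz : Units.map (pull k (face1 k A)) (Units.map (pull k (Bialgebra.mulCoalgHom k A)) μ) =
      Units.map (pull k (face2 k A)) (Units.map (pull k (Bialgebra.mulCoalgHom k A)) μ) :=
    pull_face_congr (fun a b c ↦ by simp [mul_assoc]) μ
  have hcomm : Commute (Units.map (pull k (face2 k A)) (Units.map (pull k (prL k A A)) μ))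
      (Units.map (pull k (face0 k A)) (diff μ)) := by
    apply units_commute
    have := (commute_prL_prR (D := A ⊗[k] A) μ.val (diff μ).val).map
      (pull k (Coalgebra.TensorProduct.assoc k k A A A).toCoalgHom)
    have e : pull k (face2 k A) (pull k (prL k A A) μ.val) =
        pull k (Coalgebra.TensorProduct.assoc k k A A A).toCoalgHom
          (pull k (prL k A (A ⊗[k] A)) μ.val) := by
      apply WithConv.ext
      apply TensorProduct.ext_threefold
      intro a b c
      change μ.val.ofConv (counit (R := k) (b * c) • a) =
        μ.val.ofConv (counit (R := k) (b ⊗ₜ[k] c) • a)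
      simp [mul_comm]
    rw [← e] at this
    exact this
  have key : Units.map (pull k (face0 k A)) (diff μ) * Units.map (pull k (face2 k A)) (diff μ) =
      Units.map (pull k (face2 k A)) (Units.map (pull k (prL k A A)) μ) *
      (Units.map (pull k (face0 k A)) (diff μ)) *
      Units.map (pull k (face2 k A)) (Units.map (pull k (prR k A A)) μ) *
      (Units.map (pull k (face2 k A)) (Units.map (pull k (Bialgebra.mulCoalgHom k A)) μ))⁻¹ := by
    rw [hcomm.eq]
    simp only [diff, map_mul, map_inv, mul_assoc]
  rw [key]
  simp only [diff, map_mul, map_inv, ha, hb, hc, hx, hy, hz]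
  group

variable (k A) in
/-- The differential as a group morphism `Reg¹_L(A) → Z²_L(A)`. -/
def diffHom : Reg1L k A →* Z2L k A where
  toFun μ := ⟨diff μ.val, by
    refine ⟨?_, isLazy2_diff μ.2.2, isLeftCocycle_diff _⟩
    have e1 : μ.val.val (1 : A) = 1 := μ.2.1
    have hL : ∀ (f : A →ₗc[k] A ⊗[k] A) (p : A ⊗[k] A →ₗc[k] A),
        (∀ a, p (f a) = a) → Units.map (pull k f) (Units.map (pull k p) μ.val) = μ.val := by
      intro f p h
      apply Units.ext; apply WithConv.ext; ext a
      exact congrArg μ.val.val.ofConv (h a)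
    have hR : ∀ (f : A →ₗc[k] A ⊗[k] A) (p : A ⊗[k] A →ₗc[k] A),
        (∀ a, p (f a) = counit (R := k) a • 1) →
          Units.map (pull k f) (Units.map (pull k p) μ.val) = 1 := by
      intro f p h
      apply Units.ext; apply WithConv.ext; ext a
      refine (congrArg μ.val.val.ofConv (h a)).trans ?_
      rw [map_smul, e1]
      simp
    refine (normalized_iff _).2 ⟨?_, ?_⟩
    · suffices h : Units.map (pull k (insL k A)) (diff μ.val) = 1 from congrArg Units.val h
      simp only [diff, map_mul, map_inv]
      rw [hL _ _ (fun a ↦ by simp), hR _ (prR k A A) (fun a ↦ by simp), hL _ _ (fun a ↦ by simp)]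
      simp
    · suffices h : Units.map (pull k (insR k A)) (diff μ.val) = 1 from congrArg Units.val h
      simp only [diff, map_mul, map_inv]
      rw [hR _ (prL k A A) (fun a ↦ by simp), hL _ _ (fun a ↦ by simp), hL _ _ (fun a ↦ by simp)]
      simp⟩
  map_one' := by
    apply Subtype.ext
    simp [diff]
  map_mul' μ ν := by
    apply Subtype.ext
    have h1 := commute_prL_of_lazy' ν.2.2
    have h2 := commute_prR_of_lazy' ν.2.2
    have h3 : Commute ν.val μ.val := by
      apply units_commute
      exact commute_comp (show Commute _ _ from ν.2.2) μ.val.val.ofConv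
    have h4 := (h3.map (Units.map (pull k (Bialgebra.mulCoalgHom k A)))).inv_inv
    change diff (μ.val * ν.val) = diff μ.val * diff ν.val
    simp only [diff, map_mul, map_inv, mul_inv_rev]
    rw [h4.eq]
    exact mul_six _ _ _ _ h1 h2

lemma diffHom_comm (μ : Reg1L k A) (σ : Z2L k A) : Commute (diffHom k A μ) σ := by
  have : Commute (diff μ.val) σ.val :=
    ((commute_prL_of_lazy' μ.2.2 _).mul_left (commute_prR_of_lazy' μ.2.2 _)).mul_left
      (commute_mul_of_lazy σ.2.2.1 _).symm
  exact Subtype.ext this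

variable (k A) in
/-- `B²_L(A) = ∂(Reg¹_L(A))`, a central subgroup of `Z²_L(A)`. -/
def B2L : Subgroup (Z2L k A) := (diffHom k A).range

instance : (B2L k A).Normal where
  conj_mem := by
    rintro _ ⟨μ, rfl⟩ σ
    rw [← (diffHom_comm μ σ).eq, mul_inv_cancel_right]
    exact ⟨μ, rfl⟩

variable (k A) in
/-- The second lazy cohomology group `H²_L(A) = Z²_L(A) / B²_L(A)`. -/
abbrev H2L := Z2L k A ⧸ B2L k A

end Cohomology

section Bicomodule

variable (k : Type u) (A : Type v) [CommRing k] [Ring A] [HopfAlgebra k A]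

/-- An `A`-bicomodule algebra: a `k`-algebra `Z` with coactions `λ : Z → A ⊗ Z` and
`ρ : Z → Z ⊗ A` that are algebra maps and make `Z` an `A`-`A`-bicomodule. -/
structure BicomoduleAlgebra where
  carrier : Type v
  [ring : Ring carrier]
  [algebra : Algebra k carrier]
  lcoact : carrier →ₐ[k] A ⊗[k] carrier
  rcoact : carrier →ₐ[k] carrier ⊗[k] A
  lcoassoc : ∀ z, TensorProduct.assoc k A A carrier (comul.rTensor carrier (lcoact z)) =
    lcoact.toLinearMap.lTensor A (lcoact z)
  lcounit : ∀ z, counit.rTensor carrier (lcoact z) = 1 ⊗ₜ[k] z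
  rcoassoc : ∀ z, TensorProduct.assoc k carrier A A (rcoact.toLinearMap.rTensor A (rcoact z)) =
    comul.lTensor carrier (rcoact z)
  rcounit : ∀ z, counit.lTensor carrier (rcoact z) = z ⊗ₜ[k] 1
  bicomodule : ∀ z, TensorProduct.assoc k A carrier A (lcoact.toLinearMap.rTensor A (rcoact z)) =
    rcoact.toLinearMap.lTensor A (lcoact z)

namespace BicomoduleAlgebra

instance : CoeSort (BicomoduleAlgebra k A) (Type v) := ⟨carrier⟩

attribute [instance] ring algebra

variable {k A}

/-- Isomorphism of bicomodule algebras: a bijective algebra map that is left and right colinear. -/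
def Isomorphic (Z T : BicomoduleAlgebra k A) : Prop :=
  ∃ f : Z ≃ₐ[k] T,
    (∀ z, T.lcoact (f z) = f.toLinearMap.lTensor A (Z.lcoact z)) ∧
    (∀ z, T.rcoact (f z) = f.toLinearMap.rTensor A (Z.rcoact z))

lemma Isomorphic.refl (Z : BicomoduleAlgebra k A) : Isomorphic Z Z := by
  refine ⟨AlgEquiv.refl, fun z ↦ ?_, fun z ↦ ?_⟩
  · exact (LinearMap.lTensor_id_apply A _ (Z.lcoact z)).symm
  · exact (LinearMap.rTensor_id_apply A _ (Z.rcoact z)).symm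

lemma Isomorphic.symm {Z T : BicomoduleAlgebra k A} (h : Isomorphic Z T) : Isomorphic T Z := by
  obtain ⟨f, hl, hr⟩ := h
  have e : f.symm.toLinearMap ∘ₗ f.toLinearMap = LinearMap.id := by ext; simp
  refine ⟨f.symm, fun t ↦ ?_, fun t ↦ ?_⟩
  · have := hl (f.symm t)
    rw [AlgEquiv.apply_symm_apply] at this
    rw [this, ← LinearMap.comp_apply, ← LinearMap.lTensor_comp, e, LinearMap.lTensor_id]
    rfl
  · have := hr (f.symm t)
    rw [AlgEquiv.apply_symm_apply] at this
    rw [this, ← LinearMap.comp_apply, ← LinearMap.rTensor_comp, e, LinearMap.rTensor_id]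
    rfl

lemma Isomorphic.trans {Z T U : BicomoduleAlgebra k A} (h : Isomorphic Z T)
    (h' : Isomorphic T U) : Isomorphic Z U := by
  obtain ⟨f, hl, hr⟩ := h
  obtain ⟨g, hl', hr'⟩ := h'
  refine ⟨f.trans g, fun t ↦ ?_, fun t ↦ ?_⟩
  · change U.lcoact (g (f t)) = (g.toLinearMap ∘ₗ f.toLinearMap).lTensor A (Z.lcoact t)
    rw [hl', hl, LinearMap.lTensor_comp]
    rfl
  · change U.rcoact (g (f t)) = (g.toLinearMap ∘ₗ f.toLinearMap).rTensor A (Z.rcoact t)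
    rw [hr', hr, LinearMap.rTensor_comp]
    rfl

/-- `κ_r : Z ⊗ Z → Z ⊗ A`, `x ⊗ y ↦ (x ⊗ 1) ρ(y)`. -/
def kappaR (Z : BicomoduleAlgebra k A) : Z ⊗[k] Z →ₗ[k] Z ⊗[k] A :=
  (LinearMap.mul' k Z).rTensor A ∘ₗ (TensorProduct.assoc k Z Z A).symm.toLinearMap ∘ₗ
    Z.rcoact.toLinearMap.lTensor Z

/-- `κ_l : Z ⊗ Z → A ⊗ Z`, `x ⊗ y ↦ λ(x) (1 ⊗ y)`. -/
def kappaL (Z : BicomoduleAlgebra k A) : Z ⊗[k] Z →ₗ[k] A ⊗[k] Z :=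
  (LinearMap.mul' k Z).lTensor A ∘ₗ (TensorProduct.assoc k A Z Z).toLinearMap ∘ₗ
    Z.lcoact.toLinearMap.rTensor Z

/-- `Z` is a right `A`-Galois object: `Z ≠ 0`, `Z^{co A} = k` and `κ_r` is bijective. -/
structure IsRightGalois (Z : BicomoduleAlgebra k A) : Prop where
  nontrivial : Nontrivial Z
  algebraMap_injective : Function.Injective (algebraMap k Z)
  coinvariants : ∀ z : Z, Z.rcoact z = z ⊗ₜ 1 → ∃ c : k, algebraMap k Z c = z
  bijective : Function.Bijective Z.kappaR

/-- `Z` is a left `A`-Galois object: `Z ≠ 0`, `^{co A}Z = k` and `κ_l` is bijective. -/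
structure IsLeftGalois (Z : BicomoduleAlgebra k A) : Prop where
  nontrivial : Nontrivial Z
  algebraMap_injective : Function.Injective (algebraMap k Z)
  coinvariants : ∀ z : Z, Z.lcoact z = 1 ⊗ₜ z → ∃ c : k, algebraMap k Z c = z
  bijective : Function.Bijective Z.kappaL

/-- `Z` is a `k`-faithfully flat `A`-biGalois object. -/
structure IsBiGalois (Z : BicomoduleAlgebra k A) : Prop where
  left : Z.IsLeftGalois
  right : Z.IsRightGalois
  faithfullyFlat : Module.FaithfullyFlat k Z

/-- The binormal basis property: `Z ≅ A` as an `A`-bicomodule. -/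
def IsBicleft (Z : BicomoduleAlgebra k A) : Prop :=
  ∃ ψ : A ≃ₗ[k] Z,
    (∀ a, Z.lcoact (ψ a) = ψ.toLinearMap.lTensor A (comul a)) ∧
    (∀ a, Z.rcoact (ψ a) = ψ.toLinearMap.rTensor A (comul a))

section Restrict

variable (W : BicomoduleAlgebra k A) (S : Subalgebra k W)

/-- The inclusion `A ⊗ S → A ⊗ W`. -/
def inclL : A ⊗[k] S →ₐ[k] A ⊗[k] W := Algebra.TensorProduct.map (AlgHom.id k A) S.val

/-- The inclusion `S ⊗ A → W ⊗ A`. -/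
def inclR : S ⊗[k] A →ₐ[k] W ⊗[k] A := Algebra.TensorProduct.map S.val (AlgHom.id k A)

lemma inclL_apply (x : A ⊗[k] S) : inclL W S x = S.val.toLinearMap.lTensor A x := rfl

lemma inclR_apply (x : S ⊗[k] A) : inclR W S x = S.val.toLinearMap.rTensor A x := rfl

variable [Module.Flat k A]

lemma inclL_injective : Function.Injective (inclL W S) :=
  Module.Flat.lTensor_preserves_injective_linearMap (M := A) S.val.toLinearMap
    Subtype.val_injective

lemma inclR_injective : Function.Injective (inclR W S) :=
  Module.Flat.rTensor_preserves_injective_linearMap (M := A) S.val.toLinearMap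
    Subtype.val_injective

variable (hl : ∀ s : S, W.lcoact s ∈ (inclL W S).range)
  (hr : ∀ s : S, W.rcoact s ∈ (inclR W S).range)

/-- The left coaction restricted to `S`. -/
def restrictL : S →ₐ[k] A ⊗[k] S :=
  (AlgEquiv.ofInjective (inclL W S) (inclL_injective W S)).symm.toAlgHom.comp
    ((W.lcoact.comp S.val).codRestrict (inclL W S).range hl)

/-- The right coaction restricted to `S`. -/
def restrictR : S →ₐ[k] S ⊗[k] A :=
  (AlgEquiv.ofInjective (inclR W S) (inclR_injective W S)).symm.toAlgHom.comp
    ((W.rcoact.comp S.val).codRestrict (inclR W S).range hr)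

lemma inclL_restrictL (s : S) : inclL W S (restrictL W S hl s) = W.lcoact s :=
  congrArg Subtype.val ((AlgEquiv.ofInjective (inclL W S) (inclL_injective W S)).apply_symm_apply
    ((W.lcoact.comp S.val).codRestrict (inclL W S).range hl s))

lemma inclR_restrictR (s : S) : inclR W S (restrictR W S hr s) = W.rcoact s :=
  congrArg Subtype.val ((AlgEquiv.ofInjective (inclR W S) (inclR_injective W S)).apply_symm_apply
    ((W.rcoact.comp S.val).codRestrict (inclR W S).range hr s))

/-- For `A` flat, a subalgebra `S` of a bicomodule algebra `W` with `λ(S) ⊆ A ⊗ S` and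
`ρ(S) ⊆ S ⊗ A` is a bicomodule algebra. -/
def restrict : BicomoduleAlgebra k A where
  carrier := S
  lcoact := restrictL W S hl
  rcoact := restrictR W S hr
  lcoassoc s := by
    have hinj : Function.Injective ((S.val.toLinearMap.lTensor A).lTensor A) :=
      Module.Flat.lTensor_preserves_injective_linearMap (M := A) _ (inclL_injective W S)
    apply hinj
    have h1 : ∀ y : A ⊗[k] S, (S.val.toLinearMap.lTensor A).lTensor A
        (TensorProduct.assoc k A A S (comul.rTensor S y)) =
        TensorProduct.assoc k A A W (comul.rTensor W (inclL W S y)) := by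
      intro y
      induction y with
      | zero => simp
      | add x y hx hy => simp only [map_add, hx, hy]
      | tmul a s =>
        change _ = TensorProduct.assoc k A A W (comul a ⊗ₜ[k] (s : W))
        rw [LinearMap.rTensor_tmul]
        generalize comul (R := k) a = w
        induction w with
        | zero => simp
        | add x y hx hy => simp only [map_add, add_tmul, hx, hy]
        | tmul a b => rfl
    rw [h1, inclL_restrictL, W.lcoassoc, ← LinearMap.comp_apply, ← LinearMap.lTensor_comp,
      ← inclL_restrictL W S hl s, inclL_apply, ← LinearMap.comp_apply, ← LinearMap.lTensor_comp]
    congr 2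
    ext s
    exact (inclL_restrictL W S hl s).symm
  lcounit s := by
    have hinj : Function.Injective (S.val.toLinearMap.lTensor k) :=
      Module.Flat.lTensor_preserves_injective_linearMap (M := k) _ Subtype.val_injective
    apply hinj
    have h1 : ∀ y : A ⊗[k] S, S.val.toLinearMap.lTensor k (counit.rTensor S y) =
        counit.rTensor W (inclL W S y) := by
      intro y
      induction y with
      | zero => simp
      | add x y hx hy => simp only [map_add, hx, hy]
      | tmul a s => rfl
    rw [h1, inclL_restrictL, W.lcounit]
    rfl
  rcoassoc s := by
    have hinj : Function.Injective (S.val.toLinearMap.rTensor (A ⊗[k] A)) :=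
      Module.Flat.rTensor_preserves_injective_linearMap (M := A ⊗[k] A) _ Subtype.val_injective
    apply hinj
    have h1 : ∀ y : S ⊗[k] A, S.val.toLinearMap.rTensor (A ⊗[k] A) (comul.lTensor S y) =
        comul.lTensor W (inclR W S y) := by
      intro y
      induction y with
      | zero => simp
      | add x y hx hy => simp only [map_add, hx, hy]
      | tmul s a => rfl
    have h2 : ∀ y : (S ⊗[k] A) ⊗[k] A, S.val.toLinearMap.rTensor (A ⊗[k] A)
        (TensorProduct.assoc k S A A y) =
        TensorProduct.assoc k W A A ((S.val.toLinearMap.rTensor A).rTensor A y) := by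
      intro y
      exact LinearMap.congr_fun (TensorProduct.ext_threefold (fun s a b ↦ rfl) :
        S.val.toLinearMap.rTensor (A ⊗[k] A) ∘ₗ (TensorProduct.assoc k S A A).toLinearMap =
        (TensorProduct.assoc k W A A).toLinearMap ∘ₗ (S.val.toLinearMap.rTensor A).rTensor A) y
    rw [h1, inclR_restrictR, ← W.rcoassoc, h2, ← LinearMap.comp_apply, ← LinearMap.rTensor_comp,
      ← inclR_restrictR W S hr s, inclR_apply, ← LinearMap.comp_apply, ← LinearMap.rTensor_comp]
    congr 3
    ext s
    exact inclR_restrictR W S hr s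
  rcounit s := by
    have hinj : Function.Injective (S.val.toLinearMap.rTensor k) :=
      Module.Flat.rTensor_preserves_injective_linearMap (M := k) _ Subtype.val_injective
    apply hinj
    have h1 : ∀ y : S ⊗[k] A, S.val.toLinearMap.rTensor k (counit.lTensor S y) =
        counit.lTensor W (inclR W S y) := by
      intro y
      induction y with
      | zero => simp
      | add x y hx hy => simp only [map_add, hx, hy]
      | tmul a s => rfl
    rw [h1, inclR_restrictR, W.rcounit]
    rfl
  bicomodule s := by
    have hinj : Function.Injective ((S.val.toLinearMap.rTensor A).lTensor A) :=
      Module.Flat.lTensor_preserves_injective_linearMap (M := A) _ (inclR_injective W S)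
    apply hinj
    have h2 : ∀ y : (A ⊗[k] S) ⊗[k] A, (S.val.toLinearMap.rTensor A).lTensor A
        (TensorProduct.assoc k A S A y) =
        TensorProduct.assoc k A W A ((S.val.toLinearMap.lTensor A).rTensor A y) := by
      intro y
      exact LinearMap.congr_fun (TensorProduct.ext_threefold (fun s a b ↦ rfl) :
        (S.val.toLinearMap.rTensor A).lTensor A ∘ₗ (TensorProduct.assoc k A S A).toLinearMap =
        (TensorProduct.assoc k A W A).toLinearMap ∘ₗ (S.val.toLinearMap.lTensor A).rTensor A) y
    have e1 : S.val.toLinearMap.lTensor A ∘ₗ (restrictL W S hl).toLinearMap =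
        W.lcoact.toLinearMap ∘ₗ S.val.toLinearMap := by
      ext s; exact inclL_restrictL W S hl s
    have e2 : S.val.toLinearMap.rTensor A ∘ₗ (restrictR W S hr).toLinearMap =
        W.rcoact.toLinearMap ∘ₗ S.val.toLinearMap := by
      ext s; exact inclR_restrictR W S hr s
    rw [h2, ← LinearMap.comp_apply (LinearMap.rTensor A _), ← LinearMap.rTensor_comp, e1,
      LinearMap.rTensor_comp, LinearMap.comp_apply, ← inclR_apply, inclR_restrictR, W.bicomodule,
      ← inclL_restrictL W S hl, inclL_apply, ← LinearMap.comp_apply, ← LinearMap.lTensor_comp,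
      ← LinearMap.comp_apply, ← LinearMap.lTensor_comp, e2]

end Restrict

end BicomoduleAlgebra

end Bicomodule

section Cotensor

variable {k : Type u} {A : Type v} [CommRing k] [Ring A] [HopfAlgebra k A]

namespace BicomoduleAlgebra

/-- `λ_Z ⊗ id : Z ⊗ T → A ⊗ (Z ⊗ T)` -/
def tensorL (Z T : BicomoduleAlgebra k A) : Z ⊗[k] T →ₐ[k] A ⊗[k] (Z ⊗[k] T) :=
  (Algebra.TensorProduct.assoc k k k A Z T).toAlgHom.comp
    (Algebra.TensorProduct.map Z.lcoact (AlgHom.id k T))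

/-- `id ⊗ ρ_T : Z ⊗ T → (Z ⊗ T) ⊗ A` -/
def tensorR (Z T : BicomoduleAlgebra k A) : Z ⊗[k] T →ₐ[k] (Z ⊗[k] T) ⊗[k] A :=
  (Algebra.TensorProduct.assoc k k k Z T A).symm.toAlgHom.comp
    (Algebra.TensorProduct.map (AlgHom.id k Z) T.rcoact)

lemma assoc_tmul_eq {M N P : Type*} [AddCommGroup M] [Module k M] [AddCommGroup N] [Module k N]
    [AddCommGroup P] [Module k P] (w : M ⊗[k] N) (p : P) :
    TensorProduct.assoc k M N P (w ⊗ₜ p) = ((TensorProduct.mk k N P).flip p).lTensor M w := by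
  induction w with
  | zero => simp
  | add x y hx hy => simp only [map_add, add_tmul, hx, hy]
  | tmul a b => rfl

lemma assoc_symm_tmul_eq {M N P : Type*} [AddCommGroup M] [Module k M] [AddCommGroup N]
    [Module k N] [AddCommGroup P] [Module k P] (m : M) (w : N ⊗[k] P) :
    (TensorProduct.assoc k M N P).symm (m ⊗ₜ w) = (TensorProduct.mk k M N m).rTensor P w := by
  induction w with
  | zero => simp
  | add x y hx hy => simp only [map_add, tmul_add, hx, hy]
  | tmul a b => rfl

lemma tensorL_tmul (Z T : BicomoduleAlgebra k A) (z : Z) (t : T) :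
    tensorL Z T (z ⊗ₜ t) = ((TensorProduct.mk k Z T).flip t).lTensor A (Z.lcoact z) :=
  assoc_tmul_eq (Z.lcoact z) t

lemma tensorR_tmul (Z T : BicomoduleAlgebra k A) (z : Z) (t : T) :
    tensorR Z T (z ⊗ₜ t) = (TensorProduct.mk k Z T z).rTensor A (T.rcoact t) :=
  assoc_symm_tmul_eq z (T.rcoact t)

/-- `Z ⊗ T` with the left coaction of `Z` and the right coaction of `T`. -/
def tensor (Z T : BicomoduleAlgebra k A) : BicomoduleAlgebra k A where
  carrier := Z ⊗[k] T
  lcoact := tensorL Z T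
  rcoact := tensorR Z T
  lcoassoc x := by
    induction x with
    | zero => simp
    | add x y hx hy => simp only [map_add, hx, hy]
    | tmul z t =>
      have e : (tensorL Z T).toLinearMap ∘ₗ (TensorProduct.mk k Z T).flip t =
          ((TensorProduct.mk k Z T).flip t).lTensor A ∘ₗ Z.lcoact.toLinearMap := by
        ext z; exact tensorL_tmul Z T z t
      rw [tensorL_tmul, ← LinearMap.comp_apply (LinearMap.lTensor A _), ← LinearMap.lTensor_comp, e,
        LinearMap.lTensor_comp, LinearMap.comp_apply, ← Z.lcoassoc]
      generalize Z.lcoact z = w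
      induction w with
      | zero => simp
      | add x y hx hy => simp only [map_add, hx, hy]
      | tmul a z =>
        simp only [LinearMap.lTensor_tmul, LinearMap.rTensor_tmul]
        generalize comul (R := k) a = y
        induction y with
        | zero => simp
        | add x y hx hy => simp only [map_add, add_tmul, hx, hy]
        | tmul a b => rfl
  lcounit x := by
    induction x with
    | zero => simp
    | add x y hx hy => simp only [map_add, hx, hy, tmul_add]
    | tmul z t =>
      have h := congrArg (((TensorProduct.mk k Z T).flip t).lTensor k) (Z.lcounit z)
      rw [tensorL_tmul]
      refine Eq.trans ?_ h
      generalize Z.lcoact z = w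
      induction w with
      | zero => simp
      | add x y hx hy => simp only [map_add, hx, hy]
      | tmul a z => rfl
  rcoassoc x := by
    induction x with
    | zero => simp
    | add x y hx hy => simp only [map_add, hx, hy]
    | tmul z t =>
      have e : (tensorR Z T).toLinearMap ∘ₗ TensorProduct.mk k Z T z =
          (TensorProduct.mk k Z T z).rTensor A ∘ₗ T.rcoact.toLinearMap := by
        ext t; exact tensorR_tmul Z T z t
      have h := congrArg ((TensorProduct.mk k Z T z).rTensor (A ⊗[k] A)) (T.rcoassoc t)
      rw [tensorR_tmul, ← LinearMap.comp_apply (LinearMap.rTensor A _), ← LinearMap.rTensor_comp, e,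
        LinearMap.rTensor_comp, LinearMap.comp_apply]
      refine Eq.trans ?_ (h.trans ?_)
      · generalize T.rcoact.toLinearMap.rTensor A (T.rcoact t) = w
        exact LinearMap.congr_fun (TensorProduct.ext_threefold (fun s a b ↦ rfl) :
          (TensorProduct.assoc k (Z ⊗[k] T) A A).toLinearMap ∘ₗ
            ((TensorProduct.mk k Z T z).rTensor A).rTensor A =
          (TensorProduct.mk k Z T z).rTensor (A ⊗[k] A) ∘ₗ
            (TensorProduct.assoc k T A A).toLinearMap) w
      · generalize T.rcoact t = w
        induction w with
        | zero => simp
        | add x y hx hy => simp only [map_add, hx, hy]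
        | tmul a z => rfl
  rcounit x := by
    induction x with
    | zero => simp
    | add x y hx hy => simp only [map_add, hx, hy, add_tmul]
    | tmul z t =>
      have h := congrArg ((TensorProduct.mk k Z T z).rTensor k) (T.rcounit t)
      rw [tensorR_tmul]
      refine Eq.trans ?_ h
      generalize T.rcoact t = w
      induction w with
      | zero => simp
      | add x y hx hy => simp only [map_add, hx, hy]
      | tmul a z => rfl
  bicomodule x := by
    induction x with
    | zero => simp
    | add x y hx hy => simp only [map_add, hx, hy]
    | tmul z t =>
      rw [tensorR_tmul, tensorL_tmul, ← LinearMap.comp_apply (LinearMap.rTensor A _),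
        ← LinearMap.rTensor_comp, ← LinearMap.comp_apply (LinearMap.lTensor A _),
        ← LinearMap.lTensor_comp]
      have e1 : (tensorL Z T).toLinearMap ∘ₗ TensorProduct.mk k Z T z =
          (TensorProduct.assoc k A Z T).toLinearMap ∘ₗ
            TensorProduct.mk k (A ⊗[k] Z) T (Z.lcoact z) := rfl
      have e2 : (tensorR Z T).toLinearMap ∘ₗ (TensorProduct.mk k Z T).flip t =
          (TensorProduct.assoc k Z T A).symm.toLinearMap ∘ₗ
            (TensorProduct.mk k Z (T ⊗[k] A)).flip (T.rcoact t) := rfl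
      rw [e1, e2]
      generalize Z.lcoact z = w
      generalize T.rcoact t = y
      induction w with
      | zero => simp
      | add x y hx hy =>
        simp only [map_add, ← hx, ← hy, LinearMap.comp_add, LinearMap.rTensor_add,
          LinearMap.add_apply]
      | tmul a z =>
        induction y with
        | zero => simp
        | add x y hx hy =>
          simp only [map_add, hx, hy, LinearMap.comp_add, LinearMap.lTensor_add,
            LinearMap.add_apply]
        | tmul t b => rfl

/-- `ρ_Z ⊗ id : Z ⊗ T → Z ⊗ (A ⊗ T)` -/
def cotensorL (Z T : BicomoduleAlgebra k A) : Z ⊗[k] T →ₐ[k] Z ⊗[k] (A ⊗[k] T) :=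
  (Algebra.TensorProduct.assoc k k k Z A T).toAlgHom.comp
    (Algebra.TensorProduct.map Z.rcoact (AlgHom.id k T))

/-- `id ⊗ λ_T : Z ⊗ T → Z ⊗ (A ⊗ T)` -/
def cotensorR (Z T : BicomoduleAlgebra k A) : Z ⊗[k] T →ₐ[k] Z ⊗[k] (A ⊗[k] T) :=
  Algebra.TensorProduct.map (AlgHom.id k Z) T.lcoact

/-- The underlying algebra of the cotensor product `Z □_A T`: the subalgebra of `Z ⊗ T` on which
`ρ_Z ⊗ id` and `id ⊗ λ_T` agree. -/
def cotensorSubalgebra (Z T : BicomoduleAlgebra k A) : Subalgebra k (tensor Z T) :=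
  AlgHom.equalizer (cotensorL Z T) (cotensorR Z T)

lemma exact_equalizer {R P : Type*} [Ring R] [Algebra k R] [Ring P] [Algebra k P]
    (f g : R →ₐ[k] P) :
    Function.Exact (AlgHom.equalizer f g).val.toLinearMap (f.toLinearMap - g.toLinearMap) := by
  intro x
  constructor
  · intro h
    exact ⟨⟨x, sub_eq_zero.1 h⟩, rfl⟩
  · rintro ⟨y, rfl⟩
    exact sub_eq_zero.2 y.2

lemma cotensorL_tensorL (Z T : BicomoduleAlgebra k A) (x : Z ⊗[k] T) :
    (cotensorL Z T).toLinearMap.lTensor A (tensorL Z T x) =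
      TensorProduct.assoc k A Z (A ⊗[k] T)
        (Z.lcoact.toLinearMap.rTensor (A ⊗[k] T) (cotensorL Z T x)) := by
  induction x with
  | zero => simp
  | add x y hx hy => simp only [map_add, hx, hy]
  | tmul z t =>
    have e : (cotensorL Z T).toLinearMap ∘ₗ (TensorProduct.mk k Z T).flip t =
        ((TensorProduct.mk k A T).flip t).lTensor Z ∘ₗ Z.rcoact.toLinearMap := by
      ext z; exact assoc_tmul_eq (Z.rcoact z) t
    have e' : cotensorL Z T (z ⊗ₜ t) = ((TensorProduct.mk k A T).flip t).lTensor Z (Z.rcoact z) :=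
      assoc_tmul_eq (Z.rcoact z) t
    rw [tensorL_tmul, ← LinearMap.comp_apply (LinearMap.lTensor A _), ← LinearMap.lTensor_comp, e,
      LinearMap.lTensor_comp, LinearMap.comp_apply, ← Z.bicomodule, e']
    generalize Z.rcoact z = w
    induction w with
    | zero => simp
    | add x y hx hy => simp only [map_add, hx, hy]
    | tmul z a =>
      simp only [LinearMap.lTensor_tmul, LinearMap.rTensor_tmul]
      generalize Z.lcoact.toLinearMap z = y
      induction y with
      | zero => simp
      | add x y hx hy => simp only [map_add, add_tmul, hx, hy]
      | tmul a b => rfl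

lemma cotensorR_tensorL (Z T : BicomoduleAlgebra k A) (x : Z ⊗[k] T) :
    (cotensorR Z T).toLinearMap.lTensor A (tensorL Z T x) =
      TensorProduct.assoc k A Z (A ⊗[k] T)
        (Z.lcoact.toLinearMap.rTensor (A ⊗[k] T) (cotensorR Z T x)) := by
  induction x with
  | zero => simp
  | add x y hx hy => simp only [map_add, hx, hy]
  | tmul z t =>
    rw [tensorL_tmul]
    change _ = TensorProduct.assoc k A Z (A ⊗[k] T) (Z.lcoact z ⊗ₜ T.lcoact t)
    generalize Z.lcoact z = w
    induction w with
    | zero => simp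
    | add x y hx hy => simp only [map_add, add_tmul, hx, hy]
    | tmul a z => rfl

/-- The right coaction of `T` on the last factor of `Z ⊗ (A ⊗ T)`. -/
def cotensorAux (Z T : BicomoduleAlgebra k A) :
    Z ⊗[k] (A ⊗[k] T) →ₗ[k] (Z ⊗[k] (A ⊗[k] T)) ⊗[k] A :=
  (TensorProduct.assoc k Z (A ⊗[k] T) A).symm.toLinearMap ∘ₗ
    ((TensorProduct.assoc k A T A).symm.toLinearMap ∘ₗ T.rcoact.toLinearMap.lTensor A).lTensor Z

lemma cotensorL_tensorR (Z T : BicomoduleAlgebra k A) (x : Z ⊗[k] T) :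
    (cotensorL Z T).toLinearMap.rTensor A (tensorR Z T x) =
      cotensorAux Z T (cotensorL Z T x) := by
  induction x with
  | zero => simp
  | add x y hx hy => simp only [map_add, hx, hy]
  | tmul z t =>
    have e : (cotensorL Z T).toLinearMap ∘ₗ TensorProduct.mk k Z T z =
        (TensorProduct.assoc k Z A T).toLinearMap ∘ₗ
          TensorProduct.mk k (Z ⊗[k] A) T (Z.rcoact z) := rfl
    have e' : cotensorL Z T (z ⊗ₜ t) = TensorProduct.assoc k Z A T (Z.rcoact z ⊗ₜ t) := rfl
    rw [tensorR_tmul, ← LinearMap.comp_apply (LinearMap.rTensor A _), ← LinearMap.rTensor_comp, e,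
      e']
    generalize Z.rcoact z = w
    induction w with
    | zero => simp
    | add x y hx hy =>
      simp only [map_add, hx, hy, LinearMap.comp_add, LinearMap.rTensor_add,
        LinearMap.add_apply, add_tmul]
    | tmul z a =>
      change _ = (TensorProduct.assoc k Z (A ⊗[k] T) A).symm
        (z ⊗ₜ ((TensorProduct.assoc k A T A).symm (a ⊗ₜ T.rcoact t)))
      generalize T.rcoact t = y
      induction y with
      | zero => simp
      | add x y hx hy => simp only [map_add, tmul_add, hx, hy]
      | tmul t b => rfl

lemma cotensorR_tensorR (Z T : BicomoduleAlgebra k A) (x : Z ⊗[k] T) :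
    (cotensorR Z T).toLinearMap.rTensor A (tensorR Z T x) =
      cotensorAux Z T (cotensorR Z T x) := by
  induction x with
  | zero => simp
  | add x y hx hy => simp only [map_add, hx, hy]
  | tmul z t =>
    have e : (cotensorR Z T).toLinearMap ∘ₗ TensorProduct.mk k Z T z =
        TensorProduct.mk k Z (A ⊗[k] T) z ∘ₗ T.lcoact.toLinearMap := rfl
    have e' : cotensorAux Z T (cotensorR Z T (z ⊗ₜ t)) =
        (TensorProduct.assoc k Z (A ⊗[k] T) A).symm (z ⊗ₜ (TensorProduct.assoc k A T A).symm
          (T.rcoact.toLinearMap.lTensor A (T.lcoact t))) := rfl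
    rw [tensorR_tmul, ← LinearMap.comp_apply (LinearMap.rTensor A _), ← LinearMap.rTensor_comp, e,
      e', ← T.bicomodule, LinearEquiv.symm_apply_apply, assoc_symm_tmul_eq, LinearMap.rTensor_comp,
      LinearMap.comp_apply]

variable [Module.Flat k A]

lemma mem_range_inclL (W : BicomoduleAlgebra k A) {P : Type*} [Ring P] [Algebra k P]
    (f g : W →ₐ[k] P) (y : A ⊗[k] W)
    (h : f.toLinearMap.lTensor A y = g.toLinearMap.lTensor A y) :
    y ∈ (inclL W (AlgHom.equalizer f g)).range := by
  refine (Module.Flat.lTensor_exact A (exact_equalizer f g) y).1 ?_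
  rw [LinearMap.lTensor_sub, LinearMap.sub_apply, h, sub_self]

lemma mem_range_inclR (W : BicomoduleAlgebra k A) {P : Type*} [Ring P] [Algebra k P]
    (f g : W →ₐ[k] P) (y : W ⊗[k] A)
    (h : f.toLinearMap.rTensor A y = g.toLinearMap.rTensor A y) :
    y ∈ (inclR W (AlgHom.equalizer f g)).range := by
  refine (Module.Flat.rTensor_exact A (exact_equalizer f g) y).1 ?_
  rw [LinearMap.rTensor_sub, LinearMap.sub_apply, h, sub_self]

lemma cotensor_lcoact_mem (Z T : BicomoduleAlgebra k A) (s : cotensorSubalgebra Z T) :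
    (tensor Z T).lcoact s ∈ (inclL (tensor Z T) (cotensorSubalgebra Z T)).range := by
  refine mem_range_inclL (tensor Z T) (cotensorL Z T) (cotensorR Z T) _ ?_
  have hs : cotensorL Z T s.1 = cotensorR Z T s.1 := s.2
  exact (cotensorL_tensorL Z T s.1).trans
    ((congrArg (fun y ↦ TensorProduct.assoc k A Z (A ⊗[k] T)
      (Z.lcoact.toLinearMap.rTensor (A ⊗[k] T) y)) hs).trans (cotensorR_tensorL Z T s.1).symm)

lemma cotensor_rcoact_mem (Z T : BicomoduleAlgebra k A) (s : cotensorSubalgebra Z T) :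
    (tensor Z T).rcoact s ∈ (inclR (tensor Z T) (cotensorSubalgebra Z T)).range := by
  refine mem_range_inclR (tensor Z T) (cotensorL Z T) (cotensorR Z T) _ ?_
  have hs : cotensorL Z T s.1 = cotensorR Z T s.1 := s.2
  exact (cotensorL_tensorR Z T s.1).trans
    ((congrArg (cotensorAux Z T) hs).trans (cotensorR_tensorR Z T s.1).symm)

/-- The cotensor product `Z □_A T` of bicomodule algebras over a flat Hopf algebra, with the left
coaction of `Z` and the right coaction of `T`. -/
def cotensor (Z T : BicomoduleAlgebra k A) : BicomoduleAlgebra k A :=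
  restrict (tensor Z T) (cotensorSubalgebra Z T) (cotensor_lcoact_mem Z T)
    (cotensor_rcoact_mem Z T)

end BicomoduleAlgebra

end Cotensor

section Twist

variable {k : Type u} {A : Type v} [CommRing k] [Ring A] [HopfAlgebra k A]

/-- The product `a ⊗ b ↦ σ(a₁, b₁) a₂ b₂` on `A`. -/
def twistMul (σ : Conv2 k A) : WithConv (A ⊗[k] A →ₗ[k] A) :=
  scal A σ.val * toConv (LinearMap.mul' k A)

/-- The underlying module of `A(σ)`, a copy of `A`. -/
def Twist (_σ : Z2L k A) : Type v := A

namespace Twist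

variable (σ : Z2L k A)

instance : AddCommGroup (Twist σ) := inferInstanceAs (AddCommGroup A)

instance : Module k (Twist σ) := inferInstanceAs (Module k A)

/-- The identity map `A → A(σ)`. -/
def of : A ≃ₗ[k] Twist σ := LinearEquiv.refl k A

lemma twistMul_one_tmul (a : A) : twistMul σ.val (1 ⊗ₜ a) = a := by
  have h : pull A (insR k A) (twistMul σ.val) = toConv LinearMap.id := by
    have h1 : pull A (insR k A) (scal A σ.val.val) = 1 := by
      change scal A (pull k (insR k A) σ.val.val) = 1
      rw [((normalized_iff σ.val.val).1 σ.2.1).2, map_one]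
    rw [twistMul, map_mul, h1, one_mul]
    apply WithConv.ext; ext a
    rw [pull_apply, insR_apply]
    simp
  have := congrArg (fun φ : WithConv (A →ₗ[k] A) ↦ φ a) h
  simpa using this

lemma twistMul_tmul_one (a : A) : twistMul σ.val (a ⊗ₜ 1) = a := by
  have h : pull A (insL k A) (twistMul σ.val) = toConv LinearMap.id := by
    have h1 : pull A (insL k A) (scal A σ.val.val) = 1 := by
      change scal A (pull k (insL k A) σ.val.val) = 1
      rw [((normalized_iff σ.val.val).1 σ.2.1).1, map_one]
    rw [twistMul, map_mul, h1, one_mul]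
    apply WithConv.ext; ext a
    rw [pull_apply, insL_apply]
    simp
  have := congrArg (fun φ : WithConv (A →ₗ[k] A) ↦ φ a) h
  simpa using this

lemma twistMul_assoc (a b c : A) :
    twistMul σ.val (twistMul σ.val (a ⊗ₜ b) ⊗ₜ c) =
      twistMul σ.val (a ⊗ₜ twistMul σ.val (b ⊗ₜ c)) := by
  set M : WithConv (A ⊗[k] A →ₗ[k] A) := toConv (LinearMap.mul' k A) with hM
  set T := twistMul σ.val with hT
  have hL : toConv (T.ofConv ∘ₗ TensorProduct.map T.ofConv LinearMap.id) =
      scal A (pull k (face3 k A) σ.val.val * pull k (face1 k A) σ.val.val) *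
        pull A (face1 k A) M := by
    have h1 : toConv (TensorProduct.map T.ofConv (LinearMap.id : A →ₗ[k] A)) =
        scal (A ⊗[k] A) (pull k (face3 k A) σ.val.val) *
          toConv (TensorProduct.map M.ofConv (LinearMap.id : A →ₗ[k] A)) := by
      have := TensorProduct.map_convMul_map (f := scal A σ.val.val) (h := M)
        (g := (1 : WithConv (A →ₗ[k] A))) (k := toConv LinearMap.id)
      rw [one_mul] at this
      rw [face3, scal_pull_prL]
      exact this.symm
    have h2 := comp_scal_mul T.ofConv (pull k (face3 k A) σ.val.val)
      (toConv (TensorProduct.map M.ofConv (LinearMap.id : A →ₗ[k] A)))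
    rw [← h1] at h2
    refine h2.trans ?_
    have h3 : toConv (T.ofConv ∘ₗ TensorProduct.map M.ofConv (LinearMap.id : A →ₗ[k] A)) =
        scal A (pull k (face1 k A) σ.val.val) * pull A (face1 k A) M :=
      map_mul (pull A (face1 k A)) (scal A σ.val.val) M
    rw [map_mul, mul_assoc, ← h3]
  have hR : toConv (T.ofConv ∘ₗ TensorProduct.map LinearMap.id T.ofConv ∘ₗ
        (TensorProduct.assoc k A A A).toLinearMap) =
      scal A (pull k (face0 k A) σ.val.val * pull k (face2 k A) σ.val.val) *
        pull A (face2 k A) M := by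
    have h1 : toConv (TensorProduct.map (LinearMap.id : A →ₗ[k] A) T.ofConv) =
        scal (A ⊗[k] A) (pull k (prR k A (A ⊗[k] A)) σ.val.val) *
          toConv (TensorProduct.map (LinearMap.id : A →ₗ[k] A) M.ofConv) := by
      have := TensorProduct.map_convMul_map (g := scal A σ.val.val) (k := M)
        (f := (1 : WithConv (A →ₗ[k] A))) (h := toConv LinearMap.id)
      rw [one_mul] at this
      rw [scal_pull_prR]
      exact this.symm
    have h2 := comp_scal_mul T.ofConv (pull k (prR k A (A ⊗[k] A)) σ.val.val)
      (toConv (TensorProduct.map (LinearMap.id : A →ₗ[k] A) M.ofConv))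
    rw [← h1] at h2
    have h4 := congrArg (pull A (Coalgebra.TensorProduct.assoc k k A A A).toCoalgHom) h2
    rw [map_mul] at h4
    refine h4.trans ?_
    have h3 : pull A (Coalgebra.TensorProduct.assoc k k A A A).toCoalgHom
        (toConv (T.ofConv ∘ₗ TensorProduct.map (LinearMap.id : A →ₗ[k] A) M.ofConv)) =
        scal A (pull k (face2 k A) σ.val.val) * pull A (face2 k A) M :=
      map_mul (pull A (face2 k A)) (scal A σ.val.val) M
    rw [map_mul, mul_assoc, ← h3]
    rfl
  have hm : pull A (face1 k A) M = pull A (face2 k A) M := by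
    apply WithConv.ext
    apply TensorProduct.ext_threefold
    intro a b c
    exact mul_assoc a b c
  have hc : pull k (face3 k A) σ.val.val * pull k (face1 k A) σ.val.val = _ := σ.2.2.2
  rw [hc, hm, ← hR] at hL
  exact congrArg (fun φ : WithConv ((A ⊗[k] A) ⊗[k] A →ₗ[k] A) ↦ φ ((a ⊗ₜ b) ⊗ₜ c)) hL

instance : Mul (Twist σ) :=
  ⟨fun x y ↦ of σ (twistMul σ.val ((of σ).symm x ⊗ₜ (of σ).symm y))⟩

instance : One (Twist σ) := ⟨of σ 1⟩

lemma mul_def (x y : Twist σ) :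
    x * y = of σ (twistMul σ.val ((of σ).symm x ⊗ₜ (of σ).symm y)) := rfl

lemma one_def : (1 : Twist σ) = of σ 1 := rfl

instance : Ring (Twist σ) where
  __ := (inferInstance : AddCommGroup (Twist σ))
  left_distrib x y z := by simp only [mul_def, map_add, tmul_add]
  right_distrib x y z := by simp only [mul_def, map_add, add_tmul]
  zero_mul x := by simp only [mul_def, map_zero, zero_tmul]
  mul_zero x := by simp only [mul_def, map_zero, tmul_zero]
  mul_assoc x y z := by
    simp only [mul_def, LinearEquiv.symm_apply_apply, twistMul_assoc]
  one_mul x := by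
    simp only [mul_def, one_def, LinearEquiv.symm_apply_apply, twistMul_one_tmul,
      LinearEquiv.apply_symm_apply]
  mul_one x := by
    simp only [mul_def, one_def, LinearEquiv.symm_apply_apply, twistMul_tmul_one,
      LinearEquiv.apply_symm_apply]

instance : Algebra k (Twist σ) :=
  Algebra.ofModule
    (fun r x y ↦ by simp only [mul_def, map_smul, ← smul_tmul'])
    (fun r x y ↦ by simp only [mul_def, map_smul, tmul_smul])

/-- `f ⊗ g` after the comultiplication is a convolution product. -/
lemma map_comul_eq {C B B' : Type*} [AddCommGroup C] [Module k C] [Coalgebra k C]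
    [Ring B] [Algebra k B] [Ring B'] [Algebra k B'] (f : WithConv (C →ₗ[k] B))
    (g : WithConv (C →ₗ[k] B')) :
    toConv (TensorProduct.map f.ofConv g.ofConv ∘ₗ comul) =
      push Algebra.TensorProduct.includeLeft f * push Algebra.TensorProduct.includeRight g := by
  apply WithConv.ext; ext c
  rw [LinearMap.convMul_apply]
  change TensorProduct.map f.ofConv g.ofConv (comul c) = _
  generalize comul (R := k) c = w
  induction w with
  | zero => simp
  | add x y hx hy => simp only [map_add, hx, hy]
  | tmul x y => simp

lemma push_scal {C B B' : Type*} [AddCommGroup C] [Module k C] [Coalgebra k C]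
    [Ring B] [Algebra k B] [Ring B'] [Algebra k B'] (h : B →ₐ[k] B') (φ : WithConv (C →ₗ[k] k)) :
    push h (scal B φ) = scal B' φ := by
  apply WithConv.ext; ext c
  simp

lemma comul_twistMul (x : A ⊗[k] A) :
    comul (R := k) (twistMul σ.val x) =
      TensorProduct.map (twistMul σ.val).ofConv (LinearMap.mul' k A) (comul x) := by
  have hm : toConv (comul ∘ₗ LinearMap.mul' k A) =
      toConv (TensorProduct.map (LinearMap.mul' k A) (LinearMap.mul' k A) ∘ₗ comul) :=
    congrArg toConv (Bialgebra.mulCoalgHom k A).map_comp_comul.symm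
  have h : toConv (comul ∘ₗ (twistMul σ.val).ofConv) =
      toConv (TensorProduct.map (twistMul σ.val).ofConv (LinearMap.mul' k A) ∘ₗ comul) := by
    have e1 := comp_scal_mul comul σ.val.val (toConv (LinearMap.mul' k A))
    have e2 := map_comul_eq (twistMul σ.val) (toConv (LinearMap.mul' k A))
    have e3 := map_comul_eq (toConv (LinearMap.mul' k A)) (toConv (LinearMap.mul' k A))
    rw [twistMul] at e2 ⊢
    rw [e1, e2, map_mul, push_scal, mul_assoc, ← e3]
    exact congrArg _ hm
  exact congrArg (fun φ : WithConv (A ⊗[k] A →ₗ[k] A ⊗[k] A) ↦ φ x) h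

lemma comul_twistMul' (x : A ⊗[k] A) :
    comul (R := k) (twistMul σ.val x) =
      TensorProduct.map (LinearMap.mul' k A) (twistMul σ.val).ofConv (comul x) := by
  have hm : toConv (comul ∘ₗ LinearMap.mul' k A) =
      toConv (TensorProduct.map (LinearMap.mul' k A) (LinearMap.mul' k A) ∘ₗ comul) :=
    congrArg toConv (Bialgebra.mulCoalgHom k A).map_comp_comul.symm
  have hl : scal A σ.val.val * toConv (LinearMap.mul' k A) =
    toConv (LinearMap.mul' k A) * scal A σ.val.val := σ.2.2.1
  have h : toConv (comul ∘ₗ (twistMul σ.val).ofConv) =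
      toConv (TensorProduct.map (LinearMap.mul' k A) (twistMul σ.val).ofConv ∘ₗ comul) := by
    have e1 := comp_scal_mul comul σ.val.val (toConv (LinearMap.mul' k A))
    have e2 := map_comul_eq (toConv (LinearMap.mul' k A)) (twistMul σ.val)
    have e3 := map_comul_eq (toConv (LinearMap.mul' k A)) (toConv (LinearMap.mul' k A))
    have e4 : push (Algebra.TensorProduct.includeLeft : A →ₐ[k] A ⊗[k] A)
        (toConv (LinearMap.mul' k A)) * scal (A ⊗[k] A) σ.val.val =
        scal (A ⊗[k] A) σ.val.val * push (Algebra.TensorProduct.includeLeft : A →ₐ[k] A ⊗[k] A)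
        (toConv (LinearMap.mul' k A)) := by
      rw [← push_scal (Algebra.TensorProduct.includeLeft : A →ₐ[k] A ⊗[k] A), ← map_mul, ← hl,
        map_mul]
    rw [twistMul] at e2 ⊢
    rw [e1, e2, map_mul, push_scal, ← mul_assoc, e4, mul_assoc, ← e3]
    exact congrArg _ hm
  exact congrArg (fun φ : WithConv (A ⊗[k] A →ₗ[k] A ⊗[k] A) ↦ φ x) h

/-- `Δ : A(σ) → A(σ) ⊗ A` -/
def rcoact : Twist σ →ₐ[k] Twist σ ⊗[k] A :=
  AlgHom.ofLinearMap ((of σ).toLinearMap.rTensor A ∘ₗ comul ∘ₗ (of σ).symm.toLinearMap)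
    (by
      change (of σ).toLinearMap.rTensor A (comul ((of σ).symm (of σ 1))) = _
      rw [LinearEquiv.symm_apply_apply, Bialgebra.comul_one]
      rfl)
    (by
      intro x y
      change (of σ).toLinearMap.rTensor A (comul ((of σ).symm (of σ (twistMul σ.val _)))) =
        (of σ).toLinearMap.rTensor A (comul ((of σ).symm x)) *
          (of σ).toLinearMap.rTensor A (comul ((of σ).symm y))
      rw [LinearEquiv.symm_apply_apply, comul_twistMul, TensorProduct.comul_tmul]
      generalize comul (R := k) ((of σ).symm x) = u
      generalize comul (R := k) ((of σ).symm y) = w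
      induction u with
      | zero => simp
      | add x y hx hy => simp only [map_add, add_tmul, add_mul, hx, hy]
      | tmul a b =>
        induction w with
        | zero => simp
        | add x y hx hy => simp only [map_add, tmul_add, mul_add, hx, hy]
        | tmul c d =>
          rw [AlgebraTensorModule.tensorTensorTensorComm_tmul, TensorProduct.map_tmul]
          simp only [LinearMap.rTensor_tmul, Algebra.TensorProduct.tmul_mul_tmul]
          rfl)

/-- `Δ : A(σ) → A ⊗ A(σ)` -/
def lcoact : Twist σ →ₐ[k] A ⊗[k] Twist σ :=
  AlgHom.ofLinearMap ((of σ).toLinearMap.lTensor A ∘ₗ comul ∘ₗ (of σ).symm.toLinearMap)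
    (by
      change (of σ).toLinearMap.lTensor A (comul ((of σ).symm (of σ 1))) = _
      rw [LinearEquiv.symm_apply_apply, Bialgebra.comul_one]
      rfl)
    (by
      intro x y
      change (of σ).toLinearMap.lTensor A (comul ((of σ).symm (of σ (twistMul σ.val _)))) =
        (of σ).toLinearMap.lTensor A (comul ((of σ).symm x)) *
          (of σ).toLinearMap.lTensor A (comul ((of σ).symm y))
      rw [LinearEquiv.symm_apply_apply, comul_twistMul', TensorProduct.comul_tmul]
      generalize comul (R := k) ((of σ).symm x) = u
      generalize comul (R := k) ((of σ).symm y) = w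
      induction u with
      | zero => simp
      | add x y hx hy => simp only [map_add, add_tmul, add_mul, hx, hy]
      | tmul a b =>
        induction w with
        | zero => simp
        | add x y hx hy => simp only [map_add, tmul_add, mul_add, hx, hy]
        | tmul c d =>
          rw [AlgebraTensorModule.tensorTensorTensorComm_tmul, TensorProduct.map_tmul]
          simp only [LinearMap.lTensor_tmul, Algebra.TensorProduct.tmul_mul_tmul]
          rfl)

lemma lcoact_of (a : A) : lcoact σ (of σ a) = (of σ).toLinearMap.lTensor A (comul a) := rfl

lemma rcoact_of (a : A) : rcoact σ (of σ a) = (of σ).toLinearMap.rTensor A (comul a) := rfl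

lemma lcoact_comp_of : (lcoact σ).toLinearMap ∘ₗ (of σ).toLinearMap =
    (of σ).toLinearMap.lTensor A ∘ₗ comul := rfl

lemma rcoact_comp_of : (rcoact σ).toLinearMap ∘ₗ (of σ).toLinearMap =
    (of σ).toLinearMap.rTensor A ∘ₗ comul := rfl

/-- The bicomodule algebra `A(σ)`: the module `A` with the product
`a · b = σ(a₁, b₁) a₂ b₂` and with `Δ` as left and right coaction. -/
def bicomoduleAlgebra : BicomoduleAlgebra k A where
  carrier := Twist σ
  lcoact := lcoact σ
  rcoact := rcoact σ
  lcoassoc z := by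
    obtain ⟨a, rfl⟩ := (of σ).surjective z
    rw [lcoact_of, ← LinearMap.comp_apply (LinearMap.lTensor A (lcoact σ).toLinearMap),
      ← LinearMap.lTensor_comp, lcoact_comp_of, LinearMap.lTensor_comp, LinearMap.comp_apply, ← Coalgebra.coassoc_apply]
    generalize comul (R := k) a = w
    induction w with
    | zero => simp
    | add x y hx hy => simp only [map_add, hx, hy]
    | tmul a z =>
      simp only [LinearMap.lTensor_tmul, LinearMap.rTensor_tmul]
      generalize comul (R := k) a = y
      induction y with
      | zero => simp
      | add x y hx hy => simp only [map_add, add_tmul, hx, hy]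
      | tmul a b => rfl
  lcounit z := by
    obtain ⟨a, rfl⟩ := (of σ).surjective z
    have h := congrArg ((of σ).toLinearMap.lTensor k) (Coalgebra.rTensor_counit_comul (R := k) a)
    rw [lcoact_of]
    refine Eq.trans ?_ h
    generalize comul (R := k) a = w
    induction w with
    | zero => simp
    | add x y hx hy => simp only [map_add, hx, hy]
    | tmul a z => rfl
  rcoassoc z := by
    obtain ⟨a, rfl⟩ := (of σ).surjective z
    have h := congrArg ((of σ).toLinearMap.rTensor (A ⊗[k] A))
      (Coalgebra.coassoc_apply (R := k) a)
    rw [rcoact_of, ← LinearMap.comp_apply (LinearMap.rTensor A _), ← LinearMap.rTensor_comp,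
      rcoact_comp_of, LinearMap.rTensor_comp, LinearMap.comp_apply]
    refine Eq.trans ?_ (h.trans ?_)
    · generalize comul.rTensor A (comul (R := k) a) = w
      exact LinearMap.congr_fun (TensorProduct.ext_threefold (fun s a b ↦ rfl) :
        (TensorProduct.assoc k (Twist σ) A A).toLinearMap ∘ₗ
          ((of σ).toLinearMap.rTensor A).rTensor A =
        (of σ).toLinearMap.rTensor (A ⊗[k] A) ∘ₗ
          (TensorProduct.assoc k A A A).toLinearMap) w
    · generalize comul (R := k) a = w
      induction w with
      | zero => simp
      | add x y hx hy => simp only [map_add, hx, hy]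
      | tmul a z => rfl
  rcounit z := by
    obtain ⟨a, rfl⟩ := (of σ).surjective z
    have h := congrArg ((of σ).toLinearMap.rTensor k) (Coalgebra.lTensor_counit_comul (R := k) a)
    rw [rcoact_of]
    refine Eq.trans ?_ h
    generalize comul (R := k) a = w
    induction w with
    | zero => simp
    | add x y hx hy => simp only [map_add, hx, hy]
    | tmul a z => rfl
  bicomodule z := by
    obtain ⟨a, rfl⟩ := (of σ).surjective z
    have h := congrArg (((of σ).toLinearMap.rTensor A).lTensor A)
      (Coalgebra.coassoc_apply (R := k) a)
    rw [rcoact_of, lcoact_of, ← LinearMap.comp_apply (LinearMap.rTensor A _),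
      ← LinearMap.rTensor_comp, lcoact_comp_of, LinearMap.rTensor_comp, LinearMap.comp_apply,
      ← LinearMap.comp_apply (LinearMap.lTensor A _), ← LinearMap.lTensor_comp, rcoact_comp_of,
      LinearMap.lTensor_comp, LinearMap.comp_apply]
    refine Eq.trans ?_ h
    generalize comul.rTensor A (comul (R := k) a) = w
    exact LinearMap.congr_fun (TensorProduct.ext_threefold (fun s a b ↦ rfl) :
      (TensorProduct.assoc k A (Twist σ) A).toLinearMap ∘ₗ
        ((of σ).toLinearMap.lTensor A).rTensor A =
      ((of σ).toLinearMap.rTensor A).lTensor A ∘ₗ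
        (TensorProduct.assoc k A A A).toLinearMap) w

end Twist

end Twist

section BiGal

variable (k : Type u) (A : Type v) [CommRing k] [Ring A] [HopfAlgebra k A]

/-- The `k`-faithfully flat `A`-biGalois objects. -/
def BiGaloisObject := {Z : BicomoduleAlgebra k A // Z.IsBiGalois}

/-- Isomorphism of biGalois objects (as bicomodule algebras). -/
instance biGaloisSetoid : Setoid (BiGaloisObject k A) where
  r Z T := Z.1.Isomorphic T.1
  iseqv := ⟨fun Z ↦ .refl Z.1, fun h ↦ h.symm, fun h h' ↦ h.trans h'⟩

/-- The set `BiGal(A)` of isomorphism classes of `k`-faithfully flat `A`-biGalois objects. -/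
def BiGal := Quotient (biGaloisSetoid k A)

variable {k A}

/-- The class `[Z]` in `BiGal(A)`. -/
def BiGal.mk (Z : BicomoduleAlgebra k A) (h : Z.IsBiGalois) : BiGal k A := Quotient.mk _ ⟨Z, h⟩

variable (k A) in
/-- The set `Bicleft(A)` of classes of bicleft biGalois objects. -/
def Bicleft : Set (BiGal k A) :=
  {x | ∃ (Z : BicomoduleAlgebra k A) (h : Z.IsBiGalois), Z.IsBicleft ∧ BiGal.mk Z h = x}

end BiGal

end LazyCohomology

end

/-!
The biGalois group and its subgroup of bicleft objects.

**Cotensor products.** Bijectivity of `κ_r : Z ⊗ Z → Z ⊗ A` turns the equalizer that defines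
`Z □ T`, tensored with `Z`, into the one that defines `A □ T ≅ T`. So `x ⊗ w ↦ (x ⊗ 1) w` is an
isomorphism `Z ⊗ (Z □ T) ≅ Z ⊗ T` (`untwistR_bijective`), and symmetrically
`(Z □ T) ⊗ T ≅ Z ⊗ T` (`untwistL_bijective`). Under these isomorphisms the Galois maps of `Z □ T`
become those of `T` and of `Z`, and faithfully flat descent shows that `Z □ T` is faithfully flat
with bijective Galois maps. The coinvariants need no separate argument: a coinvariant `z` satisfies
`κ(z ⊗ 1) = κ(1 ⊗ z)`, hence `z ⊗ 1 = 1 ⊗ z`, and descent makes it a scalar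
(`isBiGalois_of_bijective`). Both iterated cotensor products are the same subalgebra of
`Z ⊗ T ⊗ U` (`cotensor_assoc`), and the coaction identifies `Z` with `A □ Z` (`unit_cotensor`).

**Inverses.** If the antipode `S` is bijective, the inverse of `Z` is `Zᵒᵖ` with its coactions
exchanged by means of `S⁻¹`. Bijectivity of `S` is not available here, so the inverse is instead
the subalgebra `inverseObject` of `A ⊗ Zᵒᵖ ⊗ A` cut out by two equations that involve only `S`;
for bijective `S` it consists of the elements `S⁻¹(z₁) ⊗ z₀ ⊗ S⁻¹(z₋₁)`. In `Z ⊗ A ⊗ Zᵒᵖ ⊗ A` the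
cotensor condition first leaves `Z ⊗ Zᵒᵖ ⊗ A`, which the left Galois map identifies with
`A ⊗ Z ⊗ A`. There one of the equations says that the factor `Z` is coinvariant, leaving `A ⊗ A`,
and the other one cuts out `A □ A ≅ A`. Hence `A ≅ Z □ inverseObject` by
`a ↦ κ⁻¹(a₁ ⊗ 1) ⊗ a₂` followed by a coaction (`cotensor_inverseObject`), and the mirror image of
this argument gives a left inverse (`inverseObject_cotensor`). That the inverse is itself biGalois
follows by descent from its products with `Z` (`IsBiGalois.exists_inverse`).

**Bicleft objects.** A bicolinear isomorphism `ψ : A ≅ Z`, normalized by `ψ(1) = 1`, transports the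
product of `Z` to a map `M : A ⊗ A → A` that is colinear on both sides, and therefore of the form
`σ(a₁, b₁) a₂ b₂ = a₁ b₁ σ(a₂, b₂)` with `σ = ε ∘ M`; associativity is the cocycle condition. The
Galois maps of `Z` become the two actions of `σ` on `A ⊗ A` followed by the bijective Galois maps
of `A` (`kappaR_map_eq`, `kappaL_map_eq`), so `Z` is Galois on both sides exactly when `σ` is
invertible for convolution. Thus the `A(σ)` are biGalois and exhaust the bicleft objects
(`IsBicleft.exists_twist`). The comultiplication is an isomorphism `A(στ) ≅ A(σ) □ A(τ)`
(`Twist.cotensor`). The bicolinear automorphisms of `A` are the actions of lazy functionals, and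
such an action is multiplicative from `A(σ)` to `A` exactly when `σ` is a coboundary
(`Twist.isomorphic_unit_iff`), which determines the kernel of `σ ↦ [A(σ)]`. The image is normal
because the bicomodule `Z □ T □ Z⁻¹` depends only on the bicomodule `T`, so that for `T ≅ A` it is
isomorphic to `Z □ A □ Z⁻¹ ≅ A` (`normal_range_twistHom`).
-/

noncomputable section

namespace LazyCohomology

namespace BicomoduleAlgebra

variable {k : Type u} {A : Type v} [CommRing k] [Ring A] [HopfAlgebra k A]

/-! ### Additivity of linear maps and algebra maps

Direct instances: on iterated tensor products the generic search for them is slow. -/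

section Additivity

variable {R M N : Type*} [CommSemiring R]

instance linearMapZeroHomClass [AddCommMonoid M] [Module R M] [AddCommMonoid N] [Module R N] :
    ZeroHomClass (M →ₗ[R] N) M N := ⟨LinearMap.map_zero⟩

instance linearMapAddHomClass [AddCommMonoid M] [Module R M] [AddCommMonoid N] [Module R N] :
    AddHomClass (M →ₗ[R] N) M N := ⟨LinearMap.map_add⟩

instance linearEquivZeroHomClass [AddCommMonoid M] [Module R M] [AddCommMonoid N] [Module R N] :
    ZeroHomClass (M ≃ₗ[R] N) M N := ⟨LinearEquiv.map_zero⟩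

instance linearEquivAddHomClass [AddCommMonoid M] [Module R M] [AddCommMonoid N] [Module R N] :
    AddHomClass (M ≃ₗ[R] N) M N := ⟨LinearEquiv.map_add⟩

instance algHomZeroHomClass [Semiring M] [Algebra R M] [Semiring N] [Algebra R N] :
    ZeroHomClass (M →ₐ[R] N) M N := ⟨fun f ↦ f.toLinearMap.map_zero⟩

instance algHomAddHomClass [Semiring M] [Algebra R M] [Semiring N] [Algebra R N] :
    AddHomClass (M →ₐ[R] N) M N := ⟨fun f ↦ f.toLinearMap.map_add⟩

end Additivity

/-! ### Bicolinear maps and faithfully flat descent -/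

/-- A linear map between bicomodule algebras that is left and right colinear. -/
def IsBicolinear {Z T : BicomoduleAlgebra k A} (f : Z →ₗ[k] T) : Prop :=
  (∀ z, T.lcoact (f z) = f.lTensor A (Z.lcoact z)) ∧
    (∀ z, T.rcoact (f z) = f.rTensor A (Z.rcoact z))

lemma IsBicolinear.comp {Z T U : BicomoduleAlgebra k A} {g : T →ₗ[k] U} {f : Z →ₗ[k] T}
    (hg : IsBicolinear g) (hf : IsBicolinear f) : IsBicolinear (Z := Z) (T := U) (g ∘ₗ f) := by
  refine ⟨fun z ↦ ?_, fun z ↦ ?_⟩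
  · rw [LinearMap.comp_apply, hg.1, hf.1, LinearMap.lTensor_comp, LinearMap.comp_apply]
  · rw [LinearMap.comp_apply, hg.2, hf.2, LinearMap.rTensor_comp, LinearMap.comp_apply]

/-- Two bicomodule algebras are isomorphic as bicomodules, ignoring the products. -/
def BicomoduleIso (Z T : BicomoduleAlgebra k A) : Prop :=
  ∃ e : Z ≃ₗ[k] T, IsBicolinear (Z := Z) (T := T) e.toLinearMap

lemma IsBicolinear.symm {Z T : BicomoduleAlgebra k A} {e : Z ≃ₗ[k] T}
    (h : IsBicolinear (Z := Z) (T := T) e.toLinearMap) :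
    IsBicolinear (Z := T) (T := Z) e.symm.toLinearMap := by
  have h0 : e.symm.toLinearMap ∘ₗ e.toLinearMap = LinearMap.id := by ext; simp
  refine ⟨fun t ↦ ?_, fun t ↦ ?_⟩
  · have := h.1 (e.symm t)
    rw [LinearEquiv.coe_coe, LinearEquiv.apply_symm_apply] at this
    rw [this, ← LinearMap.comp_apply, ← LinearMap.lTensor_comp, h0, LinearMap.lTensor_id]
    rfl
  · have := h.2 (e.symm t)
    rw [LinearEquiv.coe_coe, LinearEquiv.apply_symm_apply] at this
    rw [this, ← LinearMap.comp_apply, ← LinearMap.rTensor_comp, h0, LinearMap.rTensor_id]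
    rfl

lemma BicomoduleIso.symm {Z T : BicomoduleAlgebra k A} (h : BicomoduleIso Z T) :
    BicomoduleIso T Z := by
  obtain ⟨e, he⟩ := h
  exact ⟨e.symm, he.symm⟩

lemma BicomoduleIso.trans {Z T U : BicomoduleAlgebra k A} (h : BicomoduleIso Z T)
    (h' : BicomoduleIso T U) : BicomoduleIso Z U := by
  obtain ⟨e, he⟩ := h
  obtain ⟨e', he'⟩ := h'
  exact ⟨e.trans e', he'.comp he⟩

lemma Isomorphic.bicomoduleIso {Z T : BicomoduleAlgebra k A} (h : Isomorphic Z T) :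
    BicomoduleIso Z T := by
  obtain ⟨f, hl, hr⟩ := h
  exact ⟨f.toLinearEquiv, hl, hr⟩

section Flat

variable [Module.Flat k A]

/-- Injective bicolinear maps with the same range identify their sources. -/
lemma exists_linearEquiv_of_range_eq {X Y W : BicomoduleAlgebra k A} {i : X →ₗ[k] W}
    {j : Y →ₗ[k] W} (hi : Function.Injective i) (hj : Function.Injective j)
    (ci : IsBicolinear i) (cj : IsBicolinear j) (h : LinearMap.range i = LinearMap.range j) :
    ∃ e : X ≃ₗ[k] Y, IsBicolinear (Z := X) (T := Y) e.toLinearMap ∧ ∀ x, j (e x) = i x := by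
  let e : X ≃ₗ[k] Y := (LinearEquiv.ofInjective i hi).trans
    ((LinearEquiv.ofEq _ _ h).trans (LinearEquiv.ofInjective j hj).symm)
  have he : ∀ x, j (e x) = i x := fun x ↦
    congrArg Subtype.val ((LinearEquiv.ofInjective j hj).apply_symm_apply
      (LinearEquiv.ofEq _ _ h (LinearEquiv.ofInjective i hi x)))
  have hc : j ∘ₗ e.toLinearMap = i := LinearMap.ext he
  refine ⟨e, ⟨fun x ↦ ?_, fun x ↦ ?_⟩, he⟩
  · apply Module.Flat.lTensor_preserves_injective_linearMap (M := A) j hj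
    rw [← cj.1, ← LinearMap.comp_apply (LinearMap.lTensor A j), ← LinearMap.lTensor_comp, hc,
      ← ci.1]
    exact congrArg _ (he x)
  · apply Module.Flat.rTensor_preserves_injective_linearMap (M := A) j hj
    rw [← cj.2, ← LinearMap.comp_apply (LinearMap.rTensor A j), ← LinearMap.rTensor_comp, hc,
      ← ci.2]
    exact congrArg _ (he x)

/-- Comodule algebras are compared by embedding both in a common ambient one. -/
lemma isomorphic_of_range_eq {X Y W : BicomoduleAlgebra k A} {i : X →ₐ[k] W}
    {j : Y →ₐ[k] W} (hi : Function.Injective i) (hj : Function.Injective j)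
    (ci : IsBicolinear i.toLinearMap) (cj : IsBicolinear j.toLinearMap)
    (h : ∀ w, (∃ x, i x = w) ↔ ∃ y, j y = w) : Isomorphic X Y := by
  obtain ⟨e, he, hje⟩ := exists_linearEquiv_of_range_eq (i := i.toLinearMap) (j := j.toLinearMap)
    hi hj ci cj (by ext w; exact h w)
  replace hje : ∀ x, j (e x) = i x := hje
  refine ⟨AlgEquiv.ofLinearEquiv e (hj ?_) fun x y ↦ hj ?_, he.1, he.2⟩
  · rw [hje, map_one, map_one]
  · rw [hje, map_mul i, map_mul j, hje, hje]

end Flat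

lemma kappaR_tmul (Z : BicomoduleAlgebra k A) (x y : Z) :
    Z.kappaR (x ⊗ₜ y) = (x ⊗ₜ 1) * Z.rcoact y := by
  change (LinearMap.mul' k Z).rTensor A ((TensorProduct.assoc k Z Z A).symm (x ⊗ₜ Z.rcoact y)) = _
  generalize Z.rcoact y = w
  induction w with
  | zero => simp
  | add a b ha hb => simp only [tmul_add, map_add, mul_add, ha, hb]
  | tmul a b => simp

lemma kappaL_tmul (Z : BicomoduleAlgebra k A) (x y : Z) :
    Z.kappaL (x ⊗ₜ y) = Z.lcoact x * (1 ⊗ₜ y) := by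
  change (LinearMap.mul' k Z).lTensor A ((TensorProduct.assoc k A Z Z) (Z.lcoact x ⊗ₜ y)) = _
  generalize Z.lcoact x = w
  induction w with
  | zero => simp
  | add a b ha hb => simp only [add_tmul, map_add, add_mul, ha, hb]
  | tmul a b => simp

/-- Faithfully flat descent of elements: the equalizer of `x ↦ x ⊗ 1` and `x ↦ 1 ⊗ x` is `k`. -/
lemma exists_algebraMap_eq_of_tmul_one {Z : Type*} [Ring Z] [Algebra k Z]
    [Module.FaithfullyFlat k Z] {z : Z} (h : z ⊗ₜ[k] (1 : Z) = 1 ⊗ₜ z) :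
    ∃ c : k, algebraMap k Z c = z := by
  have hex : Function.Exact (Algebra.linearMap k Z)
      ((TensorProduct.mk k Z Z).flip 1 - TensorProduct.mk k Z Z 1) := by
    apply Module.FaithfullyFlat.lTensor_reflects_exact k Z
    intro w
    constructor
    · intro hw
      -- multiplying the first two factors splits the sequence after tensoring with `Z`
      refine ⟨(TensorProduct.rid k Z).symm (LinearMap.mul' k Z w), ?_⟩
      have key : (LinearMap.mul' k Z).rTensor Z ((TensorProduct.assoc k Z Z Z).symm
          (LinearMap.lTensor Z ((TensorProduct.mk k Z Z).flip 1 - TensorProduct.mk k Z Z 1) w)) =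
          LinearMap.mul' k Z w ⊗ₜ 1 - w := by
        clear hw
        induction w with
        | zero => simp
        | add a b ha hb =>
          simp only [map_add, ha, hb, add_tmul]
          abel
        | tmul a b => simp
      rw [hw] at key
      simp only [map_zero] at key
      rw [eq_comm, sub_eq_zero] at key
      rw [← key]
      generalize LinearMap.mul' k Z w = y
      simp
    · rintro ⟨y, rfl⟩
      induction y with
      | zero => simp
      | add a b ha hb => simp only [map_add, ha, hb, add_zero]
      | tmul a b =>
        simp only [LinearMap.lTensor_tmul, LinearMap.sub_apply, Algebra.linearMap_apply,
          LinearMap.flip_apply, TensorProduct.mk_apply]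
        rw [Algebra.algebraMap_eq_smul_one, smul_tmul, sub_self, tmul_zero]
  exact (hex z).1 (by simp [h])

/-- Over a faithfully flat `Z` the coinvariants are automatically trivial, so that being biGalois
is the bijectivity of the two Galois maps. -/
lemma isBiGalois_of_bijective [Nontrivial k] {Z : BicomoduleAlgebra k A}
    (hf : Module.FaithfullyFlat k Z) (hl : Function.Bijective Z.kappaL)
    (hr : Function.Bijective Z.kappaR) : Z.IsBiGalois := by
  have hi : Function.Injective (algebraMap k Z) := by
    rw [injective_iff_map_eq_zero]
    intro c hc
    rw [← Module.FaithfullyFlat.one_tmul_eq_zero_iff k k (A := Z) c, ← mul_one c, ← smul_eq_mul,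
      ← smul_tmul, ← Algebra.algebraMap_eq_smul_one, hc, zero_tmul]
  have hn : Nontrivial Z := hi.nontrivial
  refine ⟨⟨hn, hi, fun z hz ↦ ?_, hl⟩, ⟨hn, hi, fun z hz ↦ ?_, hr⟩, hf⟩
  · apply exists_algebraMap_eq_of_tmul_one
    apply hl.1
    simp [kappaL_tmul, hz]
  · apply exists_algebraMap_eq_of_tmul_one
    apply hr.1
    simp [kappaR_tmul, hz]

lemma faithfullyFlat_tensorProduct (P M : Type*) [AddCommGroup P] [Module k P]
    [AddCommGroup M] [Module k M] [Module.FaithfullyFlat k P]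
    [Module.FaithfullyFlat k M] : Module.FaithfullyFlat k (P ⊗[k] M) := by
  rw [Module.FaithfullyFlat.iff_flat_and_lTensor_faithful]
  refine ⟨inferInstance, fun N _ _ hN ↦ ?_⟩
  have : Nontrivial (P ⊗[k] (M ⊗[k] N)) := inferInstance
  exact (TensorProduct.assoc k P M N).toEquiv.nontrivial

/-- If `P` is faithfully flat, then so is `M` as soon as `P ⊗ M` is. -/
lemma faithfullyFlat_of_tensorProduct_left (P M : Type*) [AddCommGroup P] [Module k P]
    [AddCommGroup M] [Module k M] [Module.FaithfullyFlat k P]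
    (h : Module.FaithfullyFlat k (P ⊗[k] M)) : Module.FaithfullyFlat k M := by
  rw [Module.FaithfullyFlat.iff_flat_and_lTensor_faithful]
  refine ⟨Module.Flat.iff_lTensor_exact.2 fun N₁ N₂ N₃ _ _ _ _ _ _ f g hfg ↦ ?_,
    fun N _ _ hN ↦ ?_⟩
  · apply Module.FaithfullyFlat.lTensor_reflects_exact k P
    have h1 := Module.Flat.lTensor_exact (P ⊗[k] M) hfg
    rw [LinearMap.lTensor_tensor, LinearMap.lTensor_tensor] at h1
    intro x
    have h2 := h1 ((TensorProduct.assoc k P M N₂).symm x)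
    simp only [LinearMap.comp_apply, LinearEquiv.coe_coe, LinearEquiv.apply_symm_apply,
      LinearEquiv.map_eq_zero_iff, Set.mem_range] at h2
    rw [h2]
    constructor
    · rintro ⟨y, hy⟩
      exact ⟨TensorProduct.assoc k P M N₁ y, (TensorProduct.assoc k P M N₂).symm.injective hy⟩
    · rintro ⟨y, rfl⟩
      exact ⟨(TensorProduct.assoc k P M N₁).symm y, by simp⟩
  · have h1 : Nontrivial ((P ⊗[k] M) ⊗[k] N) := inferInstance
    have h2 : Nontrivial (P ⊗[k] (M ⊗[k] N)) :=
      (TensorProduct.assoc k P M N).symm.toEquiv.nontrivial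
    exact (Module.FaithfullyFlat.nontrivial_tensorProduct_iff_right k P).1 h2

/-! ### The inclusion of the cotensor product -/

section Inclusion

variable [Module.Flat k A] (Z T : BicomoduleAlgebra k A)

/-- The inclusion `Z □ T → Z ⊗ T`. -/
def cotensorVal : (cotensor Z T) →ₐ[k] Z ⊗[k] T := (cotensorSubalgebra Z T).val

lemma cotensorVal_injective : Function.Injective (cotensorVal Z T) := Subtype.val_injective

variable {Z T} in
lemma exists_cotensorVal_iff (u : Z ⊗[k] T) :
    (∃ w, cotensorVal Z T w = u) ↔ cotensorL Z T u = cotensorR Z T u :=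
  ⟨by rintro ⟨w, rfl⟩; exact w.2, fun h ↦ ⟨⟨u, h⟩, rfl⟩⟩

lemma cotensorL_cotensorVal (w : cotensor Z T) :
    cotensorL Z T (cotensorVal Z T w) = cotensorR Z T (cotensorVal Z T w) := w.2

lemma lTensor_cotensorVal_lcoact (w : cotensor Z T) :
    (cotensorVal Z T).toLinearMap.lTensor A ((cotensor Z T).lcoact w) =
      tensorL Z T (cotensorVal Z T w) :=
  inclL_restrictL (tensor Z T) (cotensorSubalgebra Z T) (cotensor_lcoact_mem Z T) w

lemma rTensor_cotensorVal_rcoact (w : cotensor Z T) :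
    (cotensorVal Z T).toLinearMap.rTensor A ((cotensor Z T).rcoact w) =
      tensorR Z T (cotensorVal Z T w) :=
  inclR_restrictR (tensor Z T) (cotensorSubalgebra Z T) (cotensor_rcoact_mem Z T) w

lemma isBicolinear_cotensorVal :
    IsBicolinear (Z := cotensor Z T) (T := tensor Z T) (cotensorVal Z T).toLinearMap :=
  ⟨fun w ↦ (lTensor_cotensorVal_lcoact Z T w).symm,
    fun w ↦ (rTensor_cotensorVal_rcoact Z T w).symm⟩

lemma exact_cotensorVal : Function.Exact (cotensorVal Z T).toLinearMap
    ((cotensorL Z T).toLinearMap - (cotensorR Z T).toLinearMap) := by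
  intro u
  rw [LinearMap.sub_apply, sub_eq_zero]
  exact (exists_cotensorVal_iff u).symm

end Inclusion

/-! ### Untwisting the cotensor product over a Galois object

If `κ_r` of `Z` is bijective then `Z ⊗ (Z □ T) ≅ Z ⊗ T` by `x ⊗ w ↦ (x ⊗ 1) w`, and if `κ_l` of `T`
is bijective then `(Z □ T) ⊗ T ≅ Z ⊗ T` by `w ⊗ x ↦ w (1 ⊗ x)`. -/

section Untwist

variable (Z T : BicomoduleAlgebra k A)

/-- `x ⊗ (z ⊗ m) ↦ x z₀ ⊗ z₁ ⊗ m` -/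
def galoisR (M : Type*) [AddCommGroup M] [Module k M] :
    Z ⊗[k] (Z ⊗[k] M) →ₗ[k] Z ⊗[k] (A ⊗[k] M) :=
  (TensorProduct.assoc k Z A M).toLinearMap ∘ₗ Z.kappaR.rTensor M ∘ₗ
    (TensorProduct.assoc k Z Z M).symm.toLinearMap

/-- `(m ⊗ t) ⊗ x ↦ m ⊗ t₋₁ ⊗ t₀ x` -/
def galoisL (M : Type*) [AddCommGroup M] [Module k M] :
    (M ⊗[k] T) ⊗[k] T →ₗ[k] M ⊗[k] (A ⊗[k] T) :=
  T.kappaL.lTensor M ∘ₗ (TensorProduct.assoc k M T T).toLinearMap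

variable {Z T}

lemma galoisR_bijective (hZ : Function.Bijective Z.kappaR) (M : Type*) [AddCommGroup M]
    [Module k M] : Function.Bijective (Z.galoisR M) := by
  have h : Function.Bijective (Z.kappaR.rTensor M) :=
    (LinearEquiv.rTensor M (LinearEquiv.ofBijective Z.kappaR hZ)).bijective
  exact (TensorProduct.assoc k Z A M).bijective.comp
    (h.comp (TensorProduct.assoc k Z Z M).symm.bijective)

lemma galoisL_bijective (hT : Function.Bijective T.kappaL) (M : Type*) [AddCommGroup M]
    [Module k M] : Function.Bijective (T.galoisL M) := by
  have h : Function.Bijective (T.kappaL.lTensor M) :=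
    (LinearEquiv.lTensor M (LinearEquiv.ofBijective T.kappaL hT)).bijective
  exact h.comp (TensorProduct.assoc k M T T).bijective

variable (Z T)

lemma cotensorL_tmul (z : Z) (t : T) :
    cotensorL Z T (z ⊗ₜ t) = TensorProduct.assoc k Z A T (Z.rcoact z ⊗ₜ t) := rfl

lemma cotensorR_tmul (z : Z) (t : T) : cotensorR Z T (z ⊗ₜ t) = z ⊗ₜ T.lcoact t := rfl

lemma galoisR_tmul (x : Z) (u : Z ⊗[k] T) :
    Z.galoisR T (x ⊗ₜ u) = (x ⊗ₜ 1) * cotensorL Z T u := by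
  induction u with
  | zero => simp
  | add a b ha hb => simp only [tmul_add, map_add, mul_add, ha, hb]
  | tmul z t =>
    rw [cotensorL_tmul]
    change TensorProduct.assoc k Z A T (Z.kappaR (x ⊗ₜ z) ⊗ₜ t) = _
    rw [kappaR_tmul]
    generalize Z.rcoact z = w
    induction w with
    | zero => simp
    | add a b ha hb => simp only [add_tmul, map_add, mul_add, ha, hb]
    | tmul a b => simp

lemma galoisL_tmul (u : Z ⊗[k] T) (x : T) :
    T.galoisL Z (u ⊗ₜ x) = cotensorR Z T u * (1 ⊗ₜ (1 ⊗ₜ x)) := by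
  induction u with
  | zero => simp
  | add a b ha hb => simp only [add_tmul, map_add, add_mul, ha, hb]
  | tmul z t =>
    rw [cotensorR_tmul]
    change z ⊗ₜ T.kappaL (t ⊗ₜ x) = _
    rw [kappaL_tmul, Algebra.TensorProduct.tmul_mul_tmul, mul_one]

/-- Under `galoisR`, the two maps whose equalizer is `Z □ T` become `Δ` and `λ_T`, applied beside
the factor `Z`: the cotensor product over a Galois object is that over `A`, which is `T`. -/
lemma galoisR_lTensor_cotensorL (s : Z ⊗[k] (Z ⊗[k] T)) :
    Z.galoisR (A ⊗[k] T) ((cotensorL Z T).toLinearMap.lTensor Z s) =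
      ((TensorProduct.assoc k A A T).toLinearMap ∘ₗ comul.rTensor T).lTensor Z
        (Z.galoisR T s) := by
  refine LinearMap.congr_fun (f := Z.galoisR (A ⊗[k] T) ∘ₗ (cotensorL Z T).toLinearMap.lTensor Z)
    (g := ((TensorProduct.assoc k A A T).toLinearMap ∘ₗ comul.rTensor T).lTensor Z ∘ₗ
      Z.galoisR T) (TensorProduct.ext_threefold' fun x z t ↦ ?_) s
  -- `z ⊗ a ⊗ b ↦ xz ⊗ a ⊗ b ⊗ t`
  let F : Z ⊗[k] (A ⊗[k] A) →ₗ[k] Z ⊗[k] (A ⊗[k] (A ⊗[k] T)) :=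
    TensorProduct.map (LinearMap.mulLeft k x) (((TensorProduct.mk k A T).flip t).lTensor A)
  have h := congrArg F (Z.rcoassoc z)
  refine Eq.trans ?_ (h.trans ?_)
  · change Z.galoisR (A ⊗[k] T) (x ⊗ₜ (TensorProduct.assoc k Z A T (Z.rcoact z ⊗ₜ t))) = _
    generalize Z.rcoact z = w
    induction w with
    | zero => simp
    | add a b ha hb => simp only [add_tmul, tmul_add, map_add, ha, hb]
    | tmul z a =>
      change TensorProduct.assoc k Z A (A ⊗[k] T) (Z.kappaR (x ⊗ₜ z) ⊗ₜ (a ⊗ₜ t)) =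
        F (TensorProduct.assoc k Z A A (Z.rcoact z ⊗ₜ a))
      rw [kappaR_tmul]
      generalize Z.rcoact z = w
      induction w with
      | zero => simp
      | add a b ha hb => simp only [add_tmul, mul_add, map_add, ha, hb]
      | tmul z b => simp [F]
  · change _ = ((TensorProduct.assoc k A A T).toLinearMap ∘ₗ comul.rTensor T).lTensor Z
      (TensorProduct.assoc k Z A T (Z.kappaR (x ⊗ₜ z) ⊗ₜ t))
    rw [kappaR_tmul]
    generalize Z.rcoact z = w
    induction w with
    | zero => simp
    | add a b ha hb => simp only [add_tmul, mul_add, map_add, ha, hb]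
    | tmul z a =>
      simp only [LinearMap.lTensor_tmul, Algebra.TensorProduct.tmul_mul_tmul, one_mul,
        TensorProduct.assoc_tmul, LinearMap.comp_apply, LinearMap.rTensor_tmul, F,
        TensorProduct.map_tmul, LinearMap.mulLeft_apply, LinearEquiv.coe_coe]
      rw [assoc_tmul_eq]

lemma galoisR_lTensor_cotensorR (s : Z ⊗[k] (Z ⊗[k] T)) :
    Z.galoisR (A ⊗[k] T) ((cotensorR Z T).toLinearMap.lTensor Z s) =
      (T.lcoact.toLinearMap.lTensor A).lTensor Z (Z.galoisR T s) := by
  refine LinearMap.congr_fun (f := Z.galoisR (A ⊗[k] T) ∘ₗ (cotensorR Z T).toLinearMap.lTensor Z)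
    (g := (T.lcoact.toLinearMap.lTensor A).lTensor Z ∘ₗ Z.galoisR T)
    (TensorProduct.ext_threefold' fun x z t ↦ ?_) s
  change TensorProduct.assoc k Z A (A ⊗[k] T) (Z.kappaR (x ⊗ₜ z) ⊗ₜ T.lcoact t) =
    (T.lcoact.toLinearMap.lTensor A).lTensor Z (TensorProduct.assoc k Z A T
      (Z.kappaR (x ⊗ₜ z) ⊗ₜ t))
  generalize Z.kappaR (x ⊗ₜ z) = w
  induction w with
  | zero => simp
  | add a b ha hb => simp only [add_tmul, map_add, ha, hb]
  | tmul z a => simp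

/-- Under `galoisL`, the two maps whose equalizer is `Z □ T` become `Δ` and `ρ_Z`, applied beside
the factor `T`. -/
lemma galoisL_rTensor_cotensorR (s : (Z ⊗[k] T) ⊗[k] T) :
    (T.galoisL A).lTensor Z (TensorProduct.assoc k Z (A ⊗[k] T) T
      ((cotensorR Z T).toLinearMap.rTensor T s)) =
      ((TensorProduct.assoc k A A T).toLinearMap ∘ₗ comul.rTensor T).lTensor Z
        (T.galoisL Z s) := by
  refine LinearMap.congr_fun (f := (T.galoisL A).lTensor Z ∘ₗ
      (TensorProduct.assoc k Z (A ⊗[k] T) T).toLinearMap ∘ₗ (cotensorR Z T).toLinearMap.rTensor T)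
    (g := ((TensorProduct.assoc k A A T).toLinearMap ∘ₗ comul.rTensor T).lTensor Z ∘ₗ
      T.galoisL Z) (TensorProduct.ext_threefold fun z t x ↦ ?_) s
  change z ⊗ₜ T.galoisL A (T.lcoact t ⊗ₜ x) =
    z ⊗ₜ TensorProduct.assoc k A A T (comul.rTensor T (T.kappaL (t ⊗ₜ x)))
  congr 1
  -- `a ⊗ b ⊗ t ↦ a ⊗ b ⊗ tx`
  let F : A ⊗[k] (A ⊗[k] T) →ₗ[k] A ⊗[k] (A ⊗[k] T) :=
    ((LinearMap.mulRight k x).lTensor A).lTensor A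
  have h := congrArg F (T.lcoassoc t)
  refine Eq.trans ?_ (h.symm.trans ?_)
  · generalize T.lcoact t = w
    induction w with
    | zero => simp
    | add a b ha hb => simp only [add_tmul, map_add, ha, hb]
    | tmul a t =>
      change a ⊗ₜ T.kappaL (t ⊗ₜ x) = a ⊗ₜ (LinearMap.mulRight k x).lTensor A (T.lcoact t)
      rw [kappaL_tmul]
      congr 1
      generalize T.lcoact t = w
      induction w with
      | zero => simp
      | add a b ha hb => simp only [add_mul, map_add, ha, hb]
      | tmul a t => simp
  · rw [kappaL_tmul]
    generalize T.lcoact t = w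
    induction w with
    | zero => simp
    | add a b ha hb => simp only [add_mul, map_add, ha, hb]
    | tmul a t =>
      simp only [LinearMap.rTensor_tmul, Algebra.TensorProduct.tmul_mul_tmul, mul_one]
      rw [assoc_tmul_eq, assoc_tmul_eq]
      generalize comul (R := k) a = c
      induction c with
      | zero => simp
      | add a b ha hb => simp only [map_add, ha, hb]
      | tmul a b => simp [F]

lemma galoisL_rTensor_cotensorL (s : (Z ⊗[k] T) ⊗[k] T) :
    (T.galoisL A).lTensor Z (TensorProduct.assoc k Z (A ⊗[k] T) T
      ((cotensorL Z T).toLinearMap.rTensor T s)) =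
      TensorProduct.assoc k Z A (A ⊗[k] T)
        (Z.rcoact.toLinearMap.rTensor (A ⊗[k] T) (T.galoisL Z s)) := by
  refine LinearMap.congr_fun (f := (T.galoisL A).lTensor Z ∘ₗ
      (TensorProduct.assoc k Z (A ⊗[k] T) T).toLinearMap ∘ₗ (cotensorL Z T).toLinearMap.rTensor T)
    (g := (TensorProduct.assoc k Z A (A ⊗[k] T)).toLinearMap ∘ₗ
      Z.rcoact.toLinearMap.rTensor (A ⊗[k] T) ∘ₗ T.galoisL Z)
    (TensorProduct.ext_threefold fun z t x ↦ ?_) s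
  change (T.galoisL A).lTensor Z (TensorProduct.assoc k Z (A ⊗[k] T) T
    (TensorProduct.assoc k Z A T (Z.rcoact z ⊗ₜ t) ⊗ₜ x)) =
    TensorProduct.assoc k Z A (A ⊗[k] T) (Z.rcoact z ⊗ₜ T.kappaL (t ⊗ₜ x))
  generalize Z.rcoact z = w
  induction w with
  | zero => simp
  | add a b ha hb => simp only [add_tmul, map_add, ha, hb]
  | tmul z a => rfl

lemma mul'_rTensor_assoc_symm (x : Z) (u : Z ⊗[k] T) :
    (LinearMap.mul' k Z).rTensor T ((TensorProduct.assoc k Z Z T).symm (x ⊗ₜ u)) =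
      (x ⊗ₜ 1) * u := by
  induction u with
  | zero => simp
  | add a b ha hb => simp only [tmul_add, map_add, mul_add, ha, hb]
  | tmul z t => simp

lemma mul'_lTensor_assoc (u : Z ⊗[k] T) (x : T) :
    (LinearMap.mul' k T).lTensor Z ((TensorProduct.assoc k Z T T) (u ⊗ₜ x)) =
      u * (1 ⊗ₜ x) := by
  induction u with
  | zero => simp
  | add a b ha hb => simp only [add_tmul, map_add, add_mul, ha, hb]
  | tmul z t => simp

lemma counit_galoisR (s : Z ⊗[k] (Z ⊗[k] T)) :
    ((TensorProduct.lid k T).toLinearMap ∘ₗ counit.rTensor T).lTensor Z (Z.galoisR T s) =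
      (LinearMap.mul' k Z).rTensor T ((TensorProduct.assoc k Z Z T).symm s) := by
  refine LinearMap.congr_fun (f := ((TensorProduct.lid k T).toLinearMap ∘ₗ
      counit.rTensor T).lTensor Z ∘ₗ Z.galoisR T)
    (g := (LinearMap.mul' k Z).rTensor T ∘ₗ (TensorProduct.assoc k Z Z T).symm.toLinearMap)
    (TensorProduct.ext_threefold' fun x z t ↦ ?_) s
  change _ = (x * z) ⊗ₜ[k] t
  have h := congrArg (fun y ↦ (x * (TensorProduct.rid k Z y)) ⊗ₜ[k] t) (Z.rcounit z)
  simp only [TensorProduct.rid_tmul, one_smul] at h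
  rw [← h]
  change ((TensorProduct.lid k T).toLinearMap ∘ₗ counit.rTensor T).lTensor Z
    (TensorProduct.assoc k Z A T (Z.kappaR (x ⊗ₜ z) ⊗ₜ t)) = _
  rw [kappaR_tmul]
  generalize Z.rcoact z = w
  induction w with
  | zero => simp
  | add a b ha hb => simp only [add_tmul, mul_add, map_add, ha, hb]
  | tmul z a => simp [smul_tmul']

lemma counit_galoisL (s : (Z ⊗[k] T) ⊗[k] T) :
    ((TensorProduct.lid k T).toLinearMap ∘ₗ counit.rTensor T).lTensor Z (T.galoisL Z s) =
      (LinearMap.mul' k T).lTensor Z ((TensorProduct.assoc k Z T T) s) := by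
  refine LinearMap.congr_fun (f := ((TensorProduct.lid k T).toLinearMap ∘ₗ
      counit.rTensor T).lTensor Z ∘ₗ T.galoisL Z)
    (g := (LinearMap.mul' k T).lTensor Z ∘ₗ (TensorProduct.assoc k Z T T).toLinearMap)
    (TensorProduct.ext_threefold fun z t x ↦ ?_) s
  change z ⊗ₜ (TensorProduct.lid k T (counit.rTensor T (T.kappaL (t ⊗ₜ x)))) = z ⊗ₜ[k] (t * x)
  congr 1
  have h := congrArg (fun y ↦ (TensorProduct.lid k T y) * x) (T.lcounit t)
  simp only [TensorProduct.lid_tmul, one_smul] at h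
  rw [← h, kappaL_tmul]
  generalize T.lcoact t = w
  induction w with
  | zero => simp
  | add a b ha hb => simp only [add_mul, map_add, ha, hb]
  | tmul z a => simp

variable [Module.Flat k A]

/-- `x ⊗ w ↦ (x ⊗ 1) w` -/
def untwistR : Z ⊗[k] (cotensor Z T) →ₗ[k] Z ⊗[k] T :=
  (LinearMap.mul' k Z).rTensor T ∘ₗ (TensorProduct.assoc k Z Z T).symm.toLinearMap ∘ₗ
    (cotensorVal Z T).toLinearMap.lTensor Z

/-- `w ⊗ x ↦ w (1 ⊗ x)` -/
def untwistL : (cotensor Z T) ⊗[k] T →ₗ[k] Z ⊗[k] T :=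
  (LinearMap.mul' k T).lTensor Z ∘ₗ (TensorProduct.assoc k Z T T).toLinearMap ∘ₗ
    (cotensorVal Z T).toLinearMap.rTensor T

lemma untwistR_tmul (x : Z) (w : cotensor Z T) :
    untwistR Z T (x ⊗ₜ w) = (x ⊗ₜ 1) * cotensorVal Z T w :=
  mul'_rTensor_assoc_symm Z T x (cotensorVal Z T w)

lemma untwistL_tmul (w : cotensor Z T) (x : T) :
    untwistL Z T (w ⊗ₜ x) = cotensorVal Z T w * (1 ⊗ₜ x) :=
  mul'_lTensor_assoc Z T (cotensorVal Z T w) x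

lemma galoisR_eq_cotensorR_untwistR (s : Z ⊗[k] (cotensor Z T)) :
    Z.galoisR T ((cotensorVal Z T).toLinearMap.lTensor Z s) =
      cotensorR Z T (untwistR Z T s) := by
  induction s with
  | zero => simp
  | add a b ha hb => simp only [map_add, ha, hb]
  | tmul x w =>
    rw [LinearMap.lTensor_tmul, galoisR_tmul, untwistR_tmul, map_mul, cotensorR_tmul, map_one]
    exact congrArg _ (cotensorL_cotensorVal Z T w)

lemma galoisL_eq_cotensorL_untwistL (s : (cotensor Z T) ⊗[k] T) :
    T.galoisL Z ((cotensorVal Z T).toLinearMap.rTensor T s) =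
      cotensorL Z T (untwistL Z T s) := by
  induction s with
  | zero => simp
  | add a b ha hb => simp only [map_add, ha, hb]
  | tmul w x =>
    rw [LinearMap.rTensor_tmul, galoisL_tmul, untwistL_tmul, map_mul, cotensorL_tmul, map_one]
    exact congrArg (· * _) (cotensorL_cotensorVal Z T w).symm

variable {Z T}

/-- `Z ⊗ (Z □ T) ≅ Z ⊗ T` if `κ_r` of `Z` is bijective. For surjectivity, `galoisR` is inverted at
the image of the right-hand side under the coaction of `T`. -/
lemma untwistR_bijective [Module.Flat k Z] (hZ : Function.Bijective Z.kappaR) :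
    Function.Bijective (untwistR Z T) := by
  have hval : Function.Injective ((cotensorVal Z T).toLinearMap.lTensor Z) :=
    Module.Flat.lTensor_preserves_injective_linearMap (M := Z) _ (cotensorVal_injective Z T)
  constructor
  · rw [← LinearMap.ker_eq_bot, LinearMap.ker_eq_bot']
    intro s hs
    apply hval
    apply (galoisR_bijective hZ T).1
    rw [galoisR_eq_cotensorR_untwistR, hs, map_zero, map_zero, map_zero]
  · intro y
    obtain ⟨w, hw⟩ := (galoisR_bijective hZ T).2 (cotensorR Z T y)
    have hmem : ∃ s, (cotensorVal Z T).toLinearMap.lTensor Z s = w := by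
      refine (Module.Flat.lTensor_exact Z (exact_cotensorVal Z T) w).1 ?_
      rw [LinearMap.lTensor_sub, LinearMap.sub_apply, sub_eq_zero]
      apply (galoisR_bijective hZ (A ⊗[k] T)).1
      rw [galoisR_lTensor_cotensorL, galoisR_lTensor_cotensorR, hw]
      clear hw
      induction y with
      | zero => simp
      | add a b ha hb => simp only [map_add, ha, hb]
      | tmul z t => exact congrArg (fun y ↦ z ⊗ₜ[k] y) (T.lcoassoc t)
    obtain ⟨s, hs⟩ := hmem
    refine ⟨s, ?_⟩
    rw [untwistR, LinearMap.comp_apply, LinearMap.comp_apply, LinearEquiv.coe_coe, hs,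
      ← counit_galoisR, hw]
    clear hs hw
    induction y with
    | zero => simp
    | add a b ha hb => simp only [map_add, ha, hb]
    | tmul z t =>
      rw [cotensorR_tmul, LinearMap.lTensor_tmul, LinearMap.comp_apply, T.lcounit]
      simp

/-- `(Z □ T) ⊗ T ≅ Z ⊗ T` if `κ_l` of `T` is bijective. -/
lemma untwistL_bijective [Module.Flat k T] (hT : Function.Bijective T.kappaL) :
    Function.Bijective (untwistL Z T) := by
  have hval : Function.Injective ((cotensorVal Z T).toLinearMap.rTensor T) :=
    Module.Flat.rTensor_preserves_injective_linearMap (M := T) _ (cotensorVal_injective Z T)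
  constructor
  · rw [← LinearMap.ker_eq_bot, LinearMap.ker_eq_bot']
    intro s hs
    apply hval
    apply (galoisL_bijective hT Z).1
    rw [galoisL_eq_cotensorL_untwistL, hs, map_zero, map_zero, map_zero]
  · intro y
    obtain ⟨w, hw⟩ := (galoisL_bijective hT Z).2 (cotensorL Z T y)
    have hmem : ∃ s, (cotensorVal Z T).toLinearMap.rTensor T s = w := by
      refine (Module.Flat.rTensor_exact T (exact_cotensorVal Z T) w).1 ?_
      rw [LinearMap.rTensor_sub]
      refine (sub_eq_zero (a := (cotensorL Z T).toLinearMap.rTensor T w)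
        (b := (cotensorR Z T).toLinearMap.rTensor T w)).2 ?_
      have hb : Function.Bijective ((T.galoisL A).lTensor Z) :=
        (LinearEquiv.lTensor Z (LinearEquiv.ofBijective _ (galoisL_bijective hT A))).bijective
      apply (TensorProduct.assoc k Z (A ⊗[k] T) T).injective
      apply hb.1
      rw [galoisL_rTensor_cotensorL, galoisL_rTensor_cotensorR, hw]
      clear hw
      induction y with
      | zero => simp
      | add a b ha hb => simp only [map_add, ha, hb]
      | tmul z t =>
        -- `z ⊗ a ⊗ b ↦ z ⊗ a ⊗ b ⊗ t`
        let F : Z ⊗[k] (A ⊗[k] A) →ₗ[k] Z ⊗[k] (A ⊗[k] (A ⊗[k] T)) :=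
          (((TensorProduct.mk k A T).flip t).lTensor A).lTensor Z
        have h := congrArg F (Z.rcoassoc z)
        rw [cotensorL_tmul]
        refine Eq.trans ?_ (h.trans ?_)
        · generalize Z.rcoact z = w
          induction w with
          | zero => simp
          | add a b ha hb => simp only [add_tmul, map_add, ha, hb]
          | tmul z a =>
            change TensorProduct.assoc k Z A (A ⊗[k] T) (Z.rcoact z ⊗ₜ (a ⊗ₜ t)) =
              F (TensorProduct.assoc k Z A A (Z.rcoact z ⊗ₜ a))
            generalize Z.rcoact z = w
            induction w with
            | zero => simp
            | add a b ha hb => simp only [add_tmul, map_add, ha, hb]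
            | tmul z a => rfl
        · generalize Z.rcoact z = w
          induction w with
          | zero => simp
          | add a b ha hb => simp only [add_tmul, map_add, ha, hb]
          | tmul z a =>
            exact congrArg (fun y ↦ z ⊗ₜ[k] y) (assoc_tmul_eq (comul (R := k) a) t).symm
    obtain ⟨s, hs⟩ := hmem
    refine ⟨s, ?_⟩
    rw [untwistL, LinearMap.comp_apply, LinearMap.comp_apply, LinearEquiv.coe_coe, hs,
      ← counit_galoisL, hw]
    clear hs hw
    induction y with
    | zero => simp
    | add a b ha hb => simp only [map_add, ha, hb]
    | tmul z t =>
      have h := congrArg (fun y ↦ (TensorProduct.rid k Z y) ⊗ₜ[k] t) (Z.rcounit z)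
      simp only [TensorProduct.rid_tmul, one_smul] at h
      refine Eq.trans ?_ h
      rw [cotensorL_tmul]
      generalize Z.rcoact z = w
      induction w with
      | zero => simp
      | add a b ha hb => simp only [add_tmul, map_add, ha, hb]
      | tmul z a => simp [smul_tmul']

end Untwist

/-! ### The Galois maps of a cotensor product -/

section GaloisCotensor

lemma rTensor_bijective_iff {M N : Type*} [AddCommGroup M] [Module k M] [AddCommGroup N]
    [Module k N] (P : Type*) [AddCommGroup P] [Module k P] [Module.FaithfullyFlat k P]
    {f : M →ₗ[k] N} : Function.Bijective (f.rTensor P) ↔ Function.Bijective f := by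
  rw [← Module.FaithfullyFlat.lTensor_bijective_iff_bijective k P (f := f), Function.Bijective,
    Function.Bijective, LinearMap.lTensor_inj_iff_rTensor_inj,
    LinearMap.lTensor_surj_iff_rTensor_surj]

lemma tensorR_tmul_eq (Z T : BicomoduleAlgebra k A) (z : Z) (t : T) :
    tensorR Z T (z ⊗ₜ t) = (TensorProduct.assoc k Z T A).symm (z ⊗ₜ T.rcoact t) := rfl

lemma tensorL_tmul_eq (Z T : BicomoduleAlgebra k A) (z : Z) (t : T) :
    tensorL Z T (z ⊗ₜ t) = TensorProduct.assoc k A Z T (Z.lcoact z ⊗ₜ t) := rfl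

/-- `(z ⊗ t) ⊗ (z' ⊗ t') ↦ zz' ⊗ κ_r(t ⊗ t')` is a product in `(Z ⊗ T) ⊗ A`. -/
lemma kappaR_leftComm_mul (Z T : BicomoduleAlgebra k A) (z : Z) (t : T) (v : Z ⊗[k] T) :
    (TensorProduct.assoc k Z T A).symm (T.kappaR.lTensor Z
      (TensorProduct.leftComm k T Z T (t ⊗ₜ ((z ⊗ₜ 1) * v)))) =
      ((z ⊗ₜ t) ⊗ₜ 1) * tensorR Z T v := by
  induction v with
  | zero => simp
  | add a b ha hb => simp only [tmul_add, map_add, mul_add, ha, hb]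
  | tmul z' t' =>
    rw [tensorR_tmul_eq, Algebra.TensorProduct.tmul_mul_tmul, TensorProduct.leftComm_tmul,
      LinearMap.lTensor_tmul, kappaR_tmul, one_mul]
    generalize T.rcoact t' = w
    induction w with
    | zero => simp
    | add a b ha hb => simp only [tmul_add, map_add, mul_add, ha, hb]
    | tmul a b => simp

/-- `(z ⊗ t) ⊗ (z' ⊗ t') ↦ κ_l(z ⊗ z') ⊗ tt'` is a product in `A ⊗ (Z ⊗ T)`. -/
lemma kappaL_leftComm_mul (Z T : BicomoduleAlgebra k A) (z' : Z) (t' : T) (v : Z ⊗[k] T) :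
    TensorProduct.assoc k A Z T (Z.kappaL.rTensor T ((TensorProduct.assoc k Z Z T).symm
      (TensorProduct.leftComm k Z Z T (z' ⊗ₜ (v * (1 ⊗ₜ t')))))) =
      tensorL Z T v * (1 ⊗ₜ (z' ⊗ₜ t')) := by
  induction v with
  | zero => simp
  | add a b ha hb => simp only [add_mul, tmul_add, map_add, ha, hb]
  | tmul z t =>
    rw [tensorL_tmul_eq, Algebra.TensorProduct.tmul_mul_tmul, TensorProduct.leftComm_tmul,
      TensorProduct.assoc_symm_tmul, LinearMap.rTensor_tmul, kappaL_tmul, mul_one]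
    generalize Z.lcoact z = w
    induction w with
    | zero => simp
    | add a b ha hb => simp only [add_tmul, map_add, add_mul, ha, hb]
    | tmul a b => simp

variable [Module.Flat k A] (Z T : BicomoduleAlgebra k A)

lemma cotensorVal_kappaR (w w' : cotensor Z T) :
    (cotensorVal Z T).toLinearMap.rTensor A ((cotensor Z T).kappaR (w ⊗ₜ w')) =
      (cotensorVal Z T w ⊗ₜ 1) * tensorR Z T (cotensorVal Z T w') := by
  rw [kappaR_tmul, ← rTensor_cotensorVal_rcoact]
  generalize (cotensor Z T).rcoact w' = p
  induction p with
  | zero => simp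
  | add a b ha hb => simp only [map_add, mul_add, ha, hb]
  | tmul a b => simp

lemma cotensorVal_kappaL (w w' : cotensor Z T) :
    (cotensorVal Z T).toLinearMap.lTensor A ((cotensor Z T).kappaL (w ⊗ₜ w')) =
      tensorL Z T (cotensorVal Z T w) * (1 ⊗ₜ cotensorVal Z T w') := by
  rw [kappaL_tmul, ← lTensor_cotensorVal_lcoact]
  generalize (cotensor Z T).lcoact w = p
  induction p with
  | zero => simp
  | add a b ha hb => simp only [map_add, add_mul, ha, hb]
  | tmul a b => simp

/-- Up to untwisting, `Z ⊗ κ_r` for `Z □ T` is `Z ⊗ κ_r` for `T`. -/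
lemma untwistR_kappaR (s : Z ⊗[k] ((cotensor Z T) ⊗[k] (cotensor Z T))) :
    (untwistR Z T).rTensor A ((TensorProduct.assoc k Z (cotensor Z T) A).symm
      ((cotensor Z T).kappaR.lTensor Z s)) =
    (TensorProduct.assoc k Z T A).symm (T.kappaR.lTensor Z (TensorProduct.leftComm k T Z T
      ((untwistR Z T).lTensor T (TensorProduct.leftComm k Z T (cotensor Z T)
        (TensorProduct.assoc k Z T (cotensor Z T) ((untwistR Z T).rTensor (cotensor Z T)
          ((TensorProduct.assoc k Z (cotensor Z T) (cotensor Z T)).symm s))))))) := by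
  induction s with
  | zero => simp
  | add a b ha hb => simp only [map_add, ha, hb]
  | tmul x s =>
    induction s with
    | zero => simp
    | add a b ha hb => simp only [tmul_add, map_add, ha, hb]
    | tmul w w' =>
      have h1 : ∀ p : (cotensor Z T) ⊗[k] A, (untwistR Z T).rTensor A
          ((TensorProduct.assoc k Z (cotensor Z T) A).symm (x ⊗ₜ p)) =
          ((x ⊗ₜ 1) ⊗ₜ 1) * (cotensorVal Z T).toLinearMap.rTensor A p := by
        intro p
        induction p with
        | zero => simp
        | add a b ha hb => simp only [tmul_add, map_add, mul_add, ha, hb]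
        | tmul a b =>
          rw [TensorProduct.assoc_symm_tmul, LinearMap.rTensor_tmul, untwistR_tmul,
            LinearMap.rTensor_tmul, Algebra.TensorProduct.tmul_mul_tmul, one_mul]
          rfl
      rw [LinearMap.lTensor_tmul, h1, cotensorVal_kappaR, TensorProduct.assoc_symm_tmul,
        LinearMap.rTensor_tmul, untwistR_tmul, ← mul_assoc,
        Algebra.TensorProduct.tmul_mul_tmul, one_mul]
      generalize ((x ⊗ₜ 1) * cotensorVal Z T w : Z ⊗[k] T) = v
      induction v with
      | zero => simp
      | add a b ha hb => simp only [add_tmul, map_add, add_mul, ha, hb]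
      | tmul z t =>
        rw [TensorProduct.assoc_tmul, TensorProduct.leftComm_tmul, LinearMap.lTensor_tmul,
          untwistR_tmul, kappaR_leftComm_mul]

/-- Up to untwisting, `κ_l ⊗ T` for `Z □ T` is `κ_l ⊗ T` for `Z`. -/
lemma untwistL_kappaL (s : ((cotensor Z T) ⊗[k] (cotensor Z T)) ⊗[k] T) :
    (untwistL Z T).lTensor A (TensorProduct.assoc k A (cotensor Z T) T
      ((cotensor Z T).kappaL.rTensor T s)) =
    TensorProduct.assoc k A Z T (Z.kappaL.rTensor T ((TensorProduct.assoc k Z Z T).symm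
      (TensorProduct.leftComm k Z Z T ((untwistL Z T).lTensor Z
        (TensorProduct.leftComm k (cotensor Z T) Z T ((untwistL Z T).lTensor (cotensor Z T)
          (TensorProduct.assoc k (cotensor Z T) (cotensor Z T) T s))))))) := by
  induction s with
  | zero => simp
  | add a b ha hb => simp only [map_add, ha, hb]
  | tmul s x =>
    induction s with
    | zero => simp
    | add a b ha hb => simp only [add_tmul, map_add, ha, hb]
    | tmul w w' =>
      have h1 : ∀ p : A ⊗[k] (cotensor Z T), (untwistL Z T).lTensor A
          (TensorProduct.assoc k A (cotensor Z T) T (p ⊗ₜ x)) =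
          (cotensorVal Z T).toLinearMap.lTensor A p * (1 ⊗ₜ (1 ⊗ₜ x)) := by
        intro p
        induction p with
        | zero => simp
        | add a b ha hb => simp only [add_tmul, map_add, add_mul, ha, hb]
        | tmul a b =>
          rw [TensorProduct.assoc_tmul, LinearMap.lTensor_tmul, untwistL_tmul,
            LinearMap.lTensor_tmul, Algebra.TensorProduct.tmul_mul_tmul, mul_one]
          rfl
      rw [LinearMap.rTensor_tmul, h1, cotensorVal_kappaL, TensorProduct.assoc_tmul,
        LinearMap.lTensor_tmul, untwistL_tmul, mul_assoc,
        Algebra.TensorProduct.tmul_mul_tmul, one_mul]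
      generalize (cotensorVal Z T w' * (1 ⊗ₜ x) : Z ⊗[k] T) = v
      induction v with
      | zero => simp
      | add a b ha hb => simp only [tmul_add, map_add, mul_add, ha, hb]
      | tmul z t =>
        rw [TensorProduct.leftComm_tmul, LinearMap.lTensor_tmul,
          untwistL_tmul, kappaL_leftComm_mul]

variable {Z T}

/-- Faithfully flat descent along `Z` for the right Galois map of `Z □ T`. -/
lemma kappaR_cotensor_bijective_iff [Module.FaithfullyFlat k Z]
    (hZ : Function.Bijective Z.kappaR) :
    Function.Bijective (cotensor Z T).kappaR ↔ Function.Bijective T.kappaR := by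
  let α := LinearEquiv.ofBijective _ (untwistR_bijective (Z := Z) (T := T) hZ)
  let e1 := (TensorProduct.assoc k Z (cotensor Z T) A).symm.trans (α.rTensor A)
  let e2 := (TensorProduct.assoc k Z (cotensor Z T) (cotensor Z T)).symm.trans
    ((α.rTensor (cotensor Z T)).trans ((TensorProduct.assoc k Z T (cotensor Z T)).trans
      ((TensorProduct.leftComm k Z T (cotensor Z T)).trans ((α.lTensor T).trans
        (TensorProduct.leftComm k T Z T)))))
  have h : e1 ∘ (cotensor Z T).kappaR.lTensor Z =
      (TensorProduct.assoc k Z T A).symm ∘ T.kappaR.lTensor Z ∘ e2 :=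
    funext fun s ↦ untwistR_kappaR Z T s
  rw [← Module.FaithfullyFlat.lTensor_bijective_iff_bijective k Z (f := (cotensor Z T).kappaR),
    ← Module.FaithfullyFlat.lTensor_bijective_iff_bijective k Z (f := T.kappaR),
    ← e1.bijective.of_comp_iff', h,
    (TensorProduct.assoc k Z T A).symm.bijective.of_comp_iff', e2.bijective.of_comp_iff]

/-- Faithfully flat descent along `T` for the left Galois map of `Z □ T`. -/
lemma kappaL_cotensor_bijective_iff [Module.FaithfullyFlat k T]
    (hT : Function.Bijective T.kappaL) :
    Function.Bijective (cotensor Z T).kappaL ↔ Function.Bijective Z.kappaL := by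
  let β := LinearEquiv.ofBijective _ (untwistL_bijective (Z := Z) (T := T) hT)
  let e1 := (TensorProduct.assoc k A (cotensor Z T) T).trans (β.lTensor A)
  let e2 := (TensorProduct.assoc k (cotensor Z T) (cotensor Z T) T).trans
    ((β.lTensor (cotensor Z T)).trans ((TensorProduct.leftComm k (cotensor Z T) Z T).trans
      ((β.lTensor Z).trans ((TensorProduct.leftComm k Z Z T).trans
        (TensorProduct.assoc k Z Z T).symm))))
  have h : e1 ∘ (cotensor Z T).kappaL.rTensor T =
      (TensorProduct.assoc k A Z T) ∘ Z.kappaL.rTensor T ∘ e2 :=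
    funext fun s ↦ untwistL_kappaL Z T s
  rw [← rTensor_bijective_iff T (f := (cotensor Z T).kappaL),
    ← rTensor_bijective_iff T (f := Z.kappaL),
    ← e1.bijective.of_comp_iff', h,
    (TensorProduct.assoc k A Z T).bijective.of_comp_iff', e2.bijective.of_comp_iff]

lemma faithfullyFlat_cotensor [Module.FaithfullyFlat k Z] [Module.FaithfullyFlat k T]
    (hZ : Function.Bijective Z.kappaR) : Module.FaithfullyFlat k (cotensor Z T) := by
  have := faithfullyFlat_tensorProduct (k := k) Z T
  exact faithfullyFlat_of_tensorProduct_left Z _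
    (Module.FaithfullyFlat.of_linearEquiv k _
      (LinearEquiv.ofBijective _ (untwistR_bijective (Z := Z) (T := T) hZ)))

lemma faithfullyFlat_of_cotensor [Module.FaithfullyFlat k Z]
    (hZ : Function.Bijective Z.kappaR) (h : Module.FaithfullyFlat k (cotensor Z T)) :
    Module.FaithfullyFlat k T := by
  have := faithfullyFlat_tensorProduct (k := k) Z (cotensor Z T)
  exact faithfullyFlat_of_tensorProduct_left Z _
    (Module.FaithfullyFlat.of_linearEquiv k _
      (LinearEquiv.ofBijective _ (untwistR_bijective (Z := Z) (T := T) hZ)).symm)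

/-- The cotensor product of biGalois objects is biGalois. -/
lemma IsBiGalois.cotensor [Nontrivial k] (hZ : Z.IsBiGalois) (hT : T.IsBiGalois) :
    (cotensor Z T).IsBiGalois := by
  have := hZ.faithfullyFlat
  have := hT.faithfullyFlat
  exact isBiGalois_of_bijective (faithfullyFlat_cotensor hZ.right.bijective)
    ((kappaL_cotensor_bijective_iff hT.left.bijective).2 hZ.left.bijective)
    ((kappaR_cotensor_bijective_iff hZ.right.bijective).2 hT.right.bijective)

end GaloisCotensor

/-! ### Functoriality, associativity and unit of the cotensor product -/

section Functoriality

variable {Z T Z' T' : BicomoduleAlgebra k A} {f : Z →ₗ[k] Z'} {g : T →ₗ[k] T'}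

lemma isBicolinear_id (Z : BicomoduleAlgebra k A) : IsBicolinear (LinearMap.id : Z →ₗ[k] Z) :=
  ⟨fun _ ↦ (LinearMap.lTensor_id_apply A _ _).symm,
    fun _ ↦ (LinearMap.rTensor_id_apply A _ _).symm⟩

lemma tensorL_map (hf : IsBicolinear f) (u : Z ⊗[k] T) :
    tensorL Z' T' (TensorProduct.map f g u) =
      (TensorProduct.map f g).lTensor A (tensorL Z T u) := by
  induction u with
  | zero => simp
  | add a b ha hb => simp only [map_add, ha, hb]
  | tmul z t =>
    rw [TensorProduct.map_tmul, tensorL_tmul_eq, tensorL_tmul_eq, hf.1]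
    generalize Z.lcoact z = w
    induction w with
    | zero => simp
    | add a b ha hb => simp only [add_tmul, map_add, ha, hb]
    | tmul a b => rfl

lemma tensorR_map (hg : IsBicolinear g) (u : Z ⊗[k] T) :
    tensorR Z' T' (TensorProduct.map f g u) =
      (TensorProduct.map f g).rTensor A (tensorR Z T u) := by
  induction u with
  | zero => simp
  | add a b ha hb => simp only [map_add, ha, hb]
  | tmul z t =>
    rw [TensorProduct.map_tmul, tensorR_tmul_eq, tensorR_tmul_eq, hg.2]
    generalize T.rcoact t = w
    induction w with
    | zero => simp
    | add a b ha hb => simp only [tmul_add, map_add, ha, hb]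
    | tmul a b => rfl

lemma isBicolinear_map (hf : IsBicolinear f) (hg : IsBicolinear g) :
    IsBicolinear (Z := tensor Z T) (T := tensor Z' T') (TensorProduct.map f g) :=
  ⟨tensorL_map hf, tensorR_map hg⟩

lemma cotensorL_map (hf : IsBicolinear f) (u : Z ⊗[k] T) :
    cotensorL Z' T' (TensorProduct.map f g u) =
      TensorProduct.map f (g.lTensor A) (cotensorL Z T u) := by
  induction u with
  | zero => simp
  | add a b ha hb => simp only [map_add, ha, hb]
  | tmul z t =>
    rw [TensorProduct.map_tmul, cotensorL_tmul, cotensorL_tmul, hf.2]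
    generalize Z.rcoact z = w
    induction w with
    | zero => simp
    | add a b ha hb => simp only [add_tmul, map_add, ha, hb]
    | tmul a b => rfl

lemma cotensorR_map (hg : IsBicolinear g) (u : Z ⊗[k] T) :
    cotensorR Z' T' (TensorProduct.map f g u) =
      TensorProduct.map f (g.lTensor A) (cotensorR Z T u) := by
  induction u with
  | zero => simp
  | add a b ha hb => simp only [map_add, ha, hb]
  | tmul z t => rw [TensorProduct.map_tmul, cotensorR_tmul, cotensorR_tmul, hg.1]; rfl

variable [Module.Flat k A]

lemma exists_map_cotensorVal_iff {e : Z ≃ₗ[k] Z'} {e' : T ≃ₗ[k] T'}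
    (h : IsBicolinear (Z := Z) (T := Z') e.toLinearMap)
    (h' : IsBicolinear (Z := T) (T := T') e'.toLinearMap) (u : Z' ⊗[k] T') :
    (∃ w, TensorProduct.map e.toLinearMap e'.toLinearMap (cotensorVal Z T w) = u) ↔
      ∃ w, cotensorVal Z' T' w = u := by
  constructor
  · rintro ⟨w, rfl⟩
    rw [exists_cotensorVal_iff, cotensorL_map h, cotensorR_map h', cotensorL_cotensorVal]
  · intro hu
    rw [exists_cotensorVal_iff] at hu
    obtain ⟨w, hw⟩ := (exists_cotensorVal_iff (Z := Z) (T := T)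
      (TensorProduct.map e.symm.toLinearMap e'.symm.toLinearMap u)).2
      (by rw [cotensorL_map h.symm, cotensorR_map h'.symm, hu])
    refine ⟨w, ?_⟩
    rw [hw]
    exact (TensorProduct.congr e e').apply_symm_apply u

lemma BicomoduleIso.cotensor (h : BicomoduleIso Z Z') (h' : BicomoduleIso T T') :
    BicomoduleIso (cotensor Z T) (cotensor Z' T') := by
  obtain ⟨e, he⟩ := h
  obtain ⟨e', he'⟩ := h'
  have hinj : Function.Injective (TensorProduct.map e.toLinearMap e'.toLinearMap) :=
    (TensorProduct.congr e e').injective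
  obtain ⟨E, hE, -⟩ := exists_linearEquiv_of_range_eq (W := tensor Z' T')
    (i := TensorProduct.map e.toLinearMap e'.toLinearMap ∘ₗ (cotensorVal Z T).toLinearMap)
    (j := (cotensorVal Z' T').toLinearMap) (hinj.comp (cotensorVal_injective Z T))
    (cotensorVal_injective Z' T')
    ((isBicolinear_map he he').comp (isBicolinear_cotensorVal Z T))
    (isBicolinear_cotensorVal Z' T')
    (Submodule.ext fun u ↦ exists_map_cotensorVal_iff he he' u)
  exact ⟨E, hE⟩

lemma Isomorphic.cotensor (h : Isomorphic Z Z') (h' : Isomorphic T T') :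
    Isomorphic (cotensor Z T) (cotensor Z' T') := by
  obtain ⟨e, he⟩ := h
  obtain ⟨e', he'⟩ := h'
  have hinj : Function.Injective (Algebra.TensorProduct.map e.toAlgHom e'.toAlgHom) :=
    (TensorProduct.congr e.toLinearEquiv e'.toLinearEquiv).injective
  refine isomorphic_of_range_eq (W := tensor Z' T')
    (i := (Algebra.TensorProduct.map e.toAlgHom e'.toAlgHom).comp (cotensorVal Z T))
    (j := cotensorVal Z' T') (hinj.comp (cotensorVal_injective Z T))
    (cotensorVal_injective Z' T')
    (IsBicolinear.comp (T := tensor Z T) (isBicolinear_map (f := e.toLinearMap)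
      (g := e'.toLinearMap) he he') (isBicolinear_cotensorVal Z T))
    (isBicolinear_cotensorVal Z' T') fun u ↦ ?_
  exact exists_map_cotensorVal_iff (e := e.toLinearEquiv) (e' := e'.toLinearEquiv) he he' u

end Functoriality

section Kernel

variable [Module.Flat k A] {Z T X W : BicomoduleAlgebra k A} {P : Type*} [AddCommGroup P]
  [Module k P] {i : X →ₗ[k] W} {D : W →ₗ[k] P}

/-- If `X` is the kernel of `D` on `W`, then `Z □ X` is cut out in `Z ⊗ W` by the cotensor condition
and `Z ⊗ D`. -/
lemma exists_lTensor_cotensorVal_iff [Module.Flat k Z] (hi : Function.Injective i)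
    (ci : IsBicolinear i) (hD : Function.Exact i D) (u : Z ⊗[k] W) :
    (∃ w, i.lTensor Z (cotensorVal Z X w) = u) ↔
      cotensorL Z W u = cotensorR Z W u ∧ D.lTensor Z u = 0 := by
  have cid := isBicolinear_id Z
  constructor
  · rintro ⟨w, rfl⟩
    refine ⟨?_, ?_⟩
    · rw [LinearMap.lTensor, cotensorL_map cid, cotensorR_map ci, cotensorL_cotensorVal]
    · rw [← LinearMap.comp_apply, ← LinearMap.lTensor_comp, hD.linearMap_comp_eq_zero]
      simp
  · rintro ⟨h1, h2⟩
    obtain ⟨s, rfl⟩ := (Module.Flat.lTensor_exact Z hD u).1 h2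
    have hinj : Function.Injective ((i.lTensor A).lTensor Z) :=
      Module.Flat.lTensor_preserves_injective_linearMap (M := Z) _
        (Module.Flat.lTensor_preserves_injective_linearMap (M := A) _ hi)
    rw [LinearMap.lTensor, cotensorL_map cid, cotensorR_map ci] at h1
    obtain ⟨w, rfl⟩ := (exists_cotensorVal_iff s).2 (hinj h1)
    exact ⟨w, rfl⟩

/-- If `X` is the kernel of `D` on `W`, then `X □ T` is cut out in `W ⊗ T` by the cotensor condition
and `D ⊗ T`. -/
lemma exists_rTensor_cotensorVal_iff [Module.Flat k T] (hi : Function.Injective i)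
    (ci : IsBicolinear i) (hD : Function.Exact i D) (u : W ⊗[k] T) :
    (∃ w, i.rTensor T (cotensorVal X T w) = u) ↔
      cotensorL W T u = cotensorR W T u ∧ D.rTensor T u = 0 := by
  have cid := isBicolinear_id T
  constructor
  · rintro ⟨w, rfl⟩
    refine ⟨?_, ?_⟩
    · rw [LinearMap.rTensor, cotensorL_map ci, cotensorR_map cid, cotensorL_cotensorVal]
    · rw [← LinearMap.comp_apply, ← LinearMap.rTensor_comp, hD.linearMap_comp_eq_zero]
      simp
  · rintro ⟨h1, h2⟩
    obtain ⟨s, rfl⟩ := (Module.Flat.rTensor_exact T hD u).1 h2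
    have hinj : Function.Injective (i.rTensor (A ⊗[k] T)) :=
      Module.Flat.rTensor_preserves_injective_linearMap (M := A ⊗[k] T) _ hi
    rw [LinearMap.rTensor, cotensorL_map ci, cotensorR_map cid, LinearMap.lTensor_id] at h1
    obtain ⟨w, rfl⟩ := (exists_cotensorVal_iff s).2 (hinj h1)
    exact ⟨w, rfl⟩

end Kernel

section Assoc

variable (Z T U : BicomoduleAlgebra k A)

lemma isBicolinear_assoc_symm : IsBicolinear (Z := tensor Z (tensor T U))
    (T := tensor (tensor Z T) U) (TensorProduct.assoc k Z T U).symm.toLinearMap := by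
  constructor
  · intro u
    refine LinearMap.congr_fun (f := (tensorL (tensor Z T) U).toLinearMap ∘ₗ
        (TensorProduct.assoc k Z T U).symm.toLinearMap)
      (g := (TensorProduct.assoc k Z T U).symm.toLinearMap.lTensor A ∘ₗ
        (tensorL Z (tensor T U)).toLinearMap) (TensorProduct.ext_threefold' fun z t u ↦ ?_) u
    change TensorProduct.assoc k A (Z ⊗[k] T) U
      (TensorProduct.assoc k A Z T (Z.lcoact z ⊗ₜ t) ⊗ₜ u) =
      (TensorProduct.assoc k Z T U).symm.toLinearMap.lTensor A
        (TensorProduct.assoc k A Z (T ⊗[k] U) (Z.lcoact z ⊗ₜ (t ⊗ₜ u)))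
    generalize Z.lcoact z = w
    induction w with
    | zero => simp
    | add a b ha hb => simp only [add_tmul, map_add, ha, hb]
    | tmul a b => rfl
  · intro u
    refine LinearMap.congr_fun (f := (tensorR (tensor Z T) U).toLinearMap ∘ₗ
        (TensorProduct.assoc k Z T U).symm.toLinearMap)
      (g := (TensorProduct.assoc k Z T U).symm.toLinearMap.rTensor A ∘ₗ
        (tensorR Z (tensor T U)).toLinearMap) (TensorProduct.ext_threefold' fun z t u ↦ ?_) u
    change (TensorProduct.assoc k (Z ⊗[k] T) U A).symm ((z ⊗ₜ t) ⊗ₜ U.rcoact u) =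
      (TensorProduct.assoc k Z T U).symm.toLinearMap.rTensor A
        ((TensorProduct.assoc k Z (T ⊗[k] U) A).symm
          (z ⊗ₜ (TensorProduct.assoc k T U A).symm (t ⊗ₜ U.rcoact u)))
    generalize U.rcoact u = w
    induction w with
    | zero => simp
    | add a b ha hb => simp only [tmul_add, map_add, ha, hb]
    | tmul a b => rfl

lemma cotensorL_assoc (u : Z ⊗[k] T ⊗[k] U) :
    cotensorL Z (tensor T U) (TensorProduct.assoc k Z T U u) =
      (TensorProduct.assoc k A T U).toLinearMap.lTensor Z (TensorProduct.assoc k Z (A ⊗[k] T) U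
        ((cotensorL Z T).toLinearMap.rTensor U u)) := by
  refine LinearMap.congr_fun (f := (cotensorL Z (tensor T U)).toLinearMap ∘ₗ
      (TensorProduct.assoc k Z T U).toLinearMap)
    (g := (TensorProduct.assoc k A T U).toLinearMap.lTensor Z ∘ₗ
      (TensorProduct.assoc k Z (A ⊗[k] T) U).toLinearMap ∘ₗ
      (cotensorL Z T).toLinearMap.rTensor U) (TensorProduct.ext_threefold fun z t u ↦ ?_) u
  change TensorProduct.assoc k Z A (T ⊗[k] U) (Z.rcoact z ⊗ₜ (t ⊗ₜ u)) =
    (TensorProduct.assoc k A T U).toLinearMap.lTensor Z (TensorProduct.assoc k Z (A ⊗[k] T) U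
      (TensorProduct.assoc k Z A T (Z.rcoact z ⊗ₜ t) ⊗ₜ u))
  generalize Z.rcoact z = w
  induction w with
  | zero => simp
  | add a b ha hb => simp only [add_tmul, map_add, ha, hb]
  | tmul a b => rfl

lemma cotensorR_assoc (u : Z ⊗[k] T ⊗[k] U) :
    cotensorR Z (tensor T U) (TensorProduct.assoc k Z T U u) =
      (TensorProduct.assoc k A T U).toLinearMap.lTensor Z (TensorProduct.assoc k Z (A ⊗[k] T) U
        ((cotensorR Z T).toLinearMap.rTensor U u)) :=
  LinearMap.congr_fun (f := (cotensorR Z (tensor T U)).toLinearMap ∘ₗ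
      (TensorProduct.assoc k Z T U).toLinearMap)
    (g := (TensorProduct.assoc k A T U).toLinearMap.lTensor Z ∘ₗ
      (TensorProduct.assoc k Z (A ⊗[k] T) U).toLinearMap ∘ₗ
      (cotensorR Z T).toLinearMap.rTensor U) (TensorProduct.ext_threefold fun _ _ _ ↦ rfl) u

lemma assoc_cotensorL (u : Z ⊗[k] T ⊗[k] U) :
    TensorProduct.assoc k Z T (A ⊗[k] U) (cotensorL (tensor Z T) U u) =
      (cotensorL T U).toLinearMap.lTensor Z (TensorProduct.assoc k Z T U u) := by
  refine LinearMap.congr_fun (f := (TensorProduct.assoc k Z T (A ⊗[k] U)).toLinearMap ∘ₗ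
      (cotensorL (tensor Z T) U).toLinearMap)
    (g := (cotensorL T U).toLinearMap.lTensor Z ∘ₗ (TensorProduct.assoc k Z T U).toLinearMap)
    (TensorProduct.ext_threefold fun z t u ↦ ?_) u
  change TensorProduct.assoc k Z T (A ⊗[k] U) (TensorProduct.assoc k (Z ⊗[k] T) A U
    ((TensorProduct.assoc k Z T A).symm (z ⊗ₜ T.rcoact t) ⊗ₜ u)) =
    z ⊗ₜ TensorProduct.assoc k T A U (T.rcoact t ⊗ₜ u)
  generalize T.rcoact t = w
  induction w with
  | zero => simp
  | add a b ha hb => simp only [add_tmul, tmul_add, map_add, ha, hb]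
  | tmul a b => rfl

lemma assoc_cotensorR (u : Z ⊗[k] T ⊗[k] U) :
    TensorProduct.assoc k Z T (A ⊗[k] U) (cotensorR (tensor Z T) U u) =
      (cotensorR T U).toLinearMap.lTensor Z (TensorProduct.assoc k Z T U u) :=
  LinearMap.congr_fun (f := (TensorProduct.assoc k Z T (A ⊗[k] U)).toLinearMap ∘ₗ
      (cotensorR (tensor Z T) U).toLinearMap)
    (g := (cotensorR T U).toLinearMap.lTensor Z ∘ₗ (TensorProduct.assoc k Z T U).toLinearMap)
    (TensorProduct.ext_threefold fun _ _ _ ↦ rfl) u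

/-- The equations defining the two iterated cotensor products, compared in `Z ⊗ T ⊗ U`. -/
lemma cotensor_assoc_conditions (u : Z ⊗[k] T ⊗[k] U) :
    (cotensorL Z (tensor T U) (TensorProduct.assoc k Z T U u) =
        cotensorR Z (tensor T U) (TensorProduct.assoc k Z T U u) ∧
      (cotensorL T U).toLinearMap.lTensor Z (TensorProduct.assoc k Z T U u) =
        (cotensorR T U).toLinearMap.lTensor Z (TensorProduct.assoc k Z T U u)) ↔
    cotensorL (tensor Z T) U u = cotensorR (tensor Z T) U u ∧
      (cotensorL Z T).toLinearMap.rTensor U u = (cotensorR Z T).toLinearMap.rTensor U u := by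
  have hE : Function.Injective ((TensorProduct.assoc k A T U).toLinearMap.lTensor Z) :=
    ((TensorProduct.assoc k A T U).lTensor Z).injective
  refine and_comm.trans (and_congr ?_ ?_)
  · exact (Eq.congr (assoc_cotensorL Z T U u).symm (assoc_cotensorR Z T U u).symm).trans
      (TensorProduct.assoc k Z T (A ⊗[k] U)).injective.eq_iff
  · exact (Eq.congr (cotensorL_assoc Z T U u) (cotensorR_assoc Z T U u)).trans
      (hE.eq_iff.trans (TensorProduct.assoc k Z (A ⊗[k] T) U).injective.eq_iff)

variable [Module.Flat k A]

lemma exists_cotensorVal_left_iff [Module.Flat k U] (u : Z ⊗[k] T ⊗[k] U) :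
    (∃ w, (cotensorVal Z T).toLinearMap.rTensor U (cotensorVal (cotensor Z T) U w) = u) ↔
      cotensorL (tensor Z T) U u = cotensorR (tensor Z T) U u ∧
      (cotensorL Z T).toLinearMap.rTensor U u = (cotensorR Z T).toLinearMap.rTensor U u := by
  refine (exists_rTensor_cotensorVal_iff (T := U) (X := cotensor Z T) (W := tensor Z T)
    (cotensorVal_injective Z T) (isBicolinear_cotensorVal Z T) (exact_cotensorVal Z T) u).trans
    (and_congr_right fun _ ↦ ?_)
  have e := LinearMap.congr_fun (LinearMap.rTensor_sub (Q := U) (cotensorL Z T).toLinearMap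
    (cotensorR Z T).toLinearMap) u
  exact ⟨fun h ↦ sub_eq_zero.1 (e.symm.trans h), fun h ↦ e.trans (sub_eq_zero.2 h)⟩

lemma exists_cotensorVal_right_iff [Module.Flat k Z] (u : Z ⊗[k] (T ⊗[k] U)) :
    (∃ w, (cotensorVal T U).toLinearMap.lTensor Z (cotensorVal Z (cotensor T U) w) = u) ↔
      cotensorL Z (tensor T U) u = cotensorR Z (tensor T U) u ∧
      (cotensorL T U).toLinearMap.lTensor Z u = (cotensorR T U).toLinearMap.lTensor Z u := by
  refine (exists_lTensor_cotensorVal_iff (Z := Z) (X := cotensor T U) (W := tensor T U)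
    (cotensorVal_injective T U) (isBicolinear_cotensorVal T U) (exact_cotensorVal T U) u).trans
    (and_congr_right fun _ ↦ ?_)
  have e := LinearMap.congr_fun (LinearMap.lTensor_sub (M := Z) (cotensorL T U).toLinearMap
    (cotensorR T U).toLinearMap) u
  exact ⟨fun h ↦ sub_eq_zero.1 (e.symm.trans h), fun h ↦ e.trans (sub_eq_zero.2 h)⟩

/-- Both iterated cotensor products are the same subalgebra of `Z ⊗ T ⊗ U`. -/
lemma cotensor_assoc [Module.Flat k Z] [Module.Flat k U] :
    Isomorphic (cotensor (cotensor Z T) U) (cotensor Z (cotensor T U)) := by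
  refine isomorphic_of_range_eq (W := tensor (tensor Z T) U)
    (i := (Algebra.TensorProduct.map (cotensorVal Z T) (AlgHom.id k U)).comp
      (cotensorVal (cotensor Z T) U))
    (j := (Algebra.TensorProduct.assoc k k k Z T U).symm.toAlgHom.comp
      ((Algebra.TensorProduct.map (AlgHom.id k Z) (cotensorVal T U)).comp
        (cotensorVal Z (cotensor T U)))) ?_ ?_ ?_ ?_ fun u ↦ ?_
  · exact (Module.Flat.rTensor_preserves_injective_linearMap (M := U)
      (cotensorVal Z T).toLinearMap (cotensorVal_injective Z T)).comp (cotensorVal_injective _ _)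
  · exact (TensorProduct.assoc k Z T U).symm.injective.comp
      ((Module.Flat.lTensor_preserves_injective_linearMap (M := Z)
        (cotensorVal T U).toLinearMap (cotensorVal_injective T U)).comp
        (cotensorVal_injective _ _))
  · exact IsBicolinear.comp (T := tensor (cotensor Z T) U)
      (isBicolinear_map (Z' := tensor Z T) (isBicolinear_cotensorVal Z T) (isBicolinear_id U))
      (isBicolinear_cotensorVal _ _)
  · exact IsBicolinear.comp (T := tensor Z (tensor T U)) (isBicolinear_assoc_symm Z T U)
      (IsBicolinear.comp (T := tensor Z (cotensor T U))
      (isBicolinear_map (T' := tensor T U) (isBicolinear_id Z) (isBicolinear_cotensorVal T U))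
      (isBicolinear_cotensorVal _ _))
  · refine (exists_cotensorVal_left_iff Z T U u).trans ?_
    have h := (exists_cotensorVal_right_iff Z T U (TensorProduct.assoc k Z T U u)).trans
      (cotensor_assoc_conditions Z T U u)
    refine h.symm.trans (exists_congr fun w ↦ ?_)
    exact (LinearEquiv.symm_apply_eq (TensorProduct.assoc k Z T U)).symm

end Assoc

section Unit

variable (k A) in
/-- The bicomodule algebra `A`, with both coactions given by `Δ`. -/
def unit : BicomoduleAlgebra k A where
  carrier := A
  lcoact := Bialgebra.comulAlgHom k A
  rcoact := Bialgebra.comulAlgHom k A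
  lcoassoc := Coalgebra.coassoc_apply
  lcounit := Coalgebra.rTensor_counit_comul
  rcoassoc := Coalgebra.coassoc_apply
  rcounit := Coalgebra.lTensor_counit_comul
  bicomodule := Coalgebra.coassoc_apply

lemma isBicolinear_lcoact (Z : BicomoduleAlgebra k A) :
    IsBicolinear (Z := Z) (T := tensor (unit k A) Z) Z.lcoact.toLinearMap := by
  refine ⟨Z.lcoassoc, fun z ↦ ?_⟩
  change (TensorProduct.assoc k A Z A).symm (Z.rcoact.toLinearMap.lTensor A (Z.lcoact z)) = _
  rw [← Z.bicomodule, LinearEquiv.symm_apply_apply]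
  rfl

lemma lcoact_injective (Z : BicomoduleAlgebra k A) : Function.Injective Z.lcoact := by
  intro x y h
  have h1 := Z.lcounit x
  rw [h, Z.lcounit] at h1
  simpa using (congrArg (TensorProduct.lid k Z) h1).symm

/-- An element of `A □ Z` is the coaction of its image under `ε ⊗ Z`. -/
lemma exists_lcoact_eq_of_cotensor {Z : BicomoduleAlgebra k A} {u : A ⊗[k] Z}
    (h : TensorProduct.assoc k A A Z (comul.rTensor Z u) = Z.lcoact.toLinearMap.lTensor A u) :
    ∃ z, Z.lcoact z = u := by
  refine ⟨TensorProduct.lid k Z (counit.rTensor Z u), ?_⟩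
  have h1 : ∀ u : A ⊗[k] Z, TensorProduct.lid k (A ⊗[k] Z) (counit.rTensor (A ⊗[k] Z)
      (TensorProduct.assoc k A A Z (comul.rTensor Z u))) = u := by
    intro u
    induction u with
    | zero => simp
    | add a b ha hb => simp only [map_add, ha, hb]
    | tmul a z =>
      have h2 := congrArg (fun y ↦ (TensorProduct.lid k A y) ⊗ₜ[k] z)
        (Coalgebra.rTensor_counit_comul (R := k) a)
      simp only [TensorProduct.lid_tmul, one_smul] at h2
      refine Eq.trans ?_ h2
      rw [LinearMap.rTensor_tmul]
      generalize comul (R := k) a = w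
      induction w with
      | zero => simp
      | add a b ha hb => simp only [add_tmul, map_add, ha, hb]
      | tmul a b => simp [smul_tmul']
  have h2 : ∀ u : A ⊗[k] Z, TensorProduct.lid k (A ⊗[k] Z) (counit.rTensor (A ⊗[k] Z)
      (Z.lcoact.toLinearMap.lTensor A u)) =
        Z.lcoact (TensorProduct.lid k Z (counit.rTensor Z u)) := by
    intro u
    induction u with
    | zero => simp
    | add a b ha hb => simp only [map_add, ha, hb]
    | tmul a z => simp
  rw [← h2, ← h, h1]

variable [Module.Flat k A]

/-- The coaction identifies `Z` with `A □ Z`. -/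
lemma unit_cotensor (Z : BicomoduleAlgebra k A) : Isomorphic (cotensor (unit k A) Z) Z := by
  refine isomorphic_of_range_eq (W := tensor (unit k A) Z) (i := cotensorVal (unit k A) Z)
    (j := Z.lcoact) (cotensorVal_injective _ _) (lcoact_injective Z)
    (isBicolinear_cotensorVal _ _) (isBicolinear_lcoact Z) fun u ↦ ?_
  refine (exists_cotensorVal_iff (Z := unit k A) (T := Z) u).trans
    ⟨fun h ↦ exists_lcoact_eq_of_cotensor (A := A) h, ?_⟩
  rintro ⟨z, rfl⟩
  exact Z.lcoassoc z

end Unit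

/-! ### The inverse of a biGalois object -/

section Equalizer

lemma lTensor_prod_ext {M P Q : Type*} [AddCommGroup M] [Module k M] [AddCommGroup P]
    [Module k P] [AddCommGroup Q] [Module k Q] {y y' : M ⊗[k] (P × Q)}
    (h1 : (LinearMap.fst k P Q).lTensor M y = (LinearMap.fst k P Q).lTensor M y')
    (h2 : (LinearMap.snd k P Q).lTensor M y = (LinearMap.snd k P Q).lTensor M y') : y = y' := by
  have h : ∀ y : M ⊗[k] (P × Q), (LinearMap.inl k P Q).lTensor M
      ((LinearMap.fst k P Q).lTensor M y) + (LinearMap.inr k P Q).lTensor M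
        ((LinearMap.snd k P Q).lTensor M y) = y := by
    intro y
    simp only [← LinearMap.comp_apply, ← LinearMap.lTensor_comp, ← LinearMap.add_apply,
      ← LinearMap.lTensor_add]
    have : LinearMap.inl k P Q ∘ₗ LinearMap.fst k P Q +
      LinearMap.inr k P Q ∘ₗ LinearMap.snd k P Q = LinearMap.id := by ext <;> simp
    rw [this, LinearMap.lTensor_id, LinearMap.id_apply]
  rw [← h y, ← h y', h1, h2]

lemma rTensor_prod_ext {M P Q : Type*} [AddCommGroup M] [Module k M] [AddCommGroup P]
    [Module k P] [AddCommGroup Q] [Module k Q] {y y' : (P × Q) ⊗[k] M}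
    (h1 : (LinearMap.fst k P Q).rTensor M y = (LinearMap.fst k P Q).rTensor M y')
    (h2 : (LinearMap.snd k P Q).rTensor M y = (LinearMap.snd k P Q).rTensor M y') : y = y' := by
  have h : ∀ y : (P × Q) ⊗[k] M, (LinearMap.inl k P Q).rTensor M
      ((LinearMap.fst k P Q).rTensor M y) + (LinearMap.inr k P Q).rTensor M
        ((LinearMap.snd k P Q).rTensor M y) = y := by
    intro y
    simp only [← LinearMap.comp_apply, ← LinearMap.rTensor_comp, ← LinearMap.add_apply,
      ← LinearMap.rTensor_add]
    have : LinearMap.inl k P Q ∘ₗ LinearMap.fst k P Q +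
      LinearMap.inr k P Q ∘ₗ LinearMap.snd k P Q = LinearMap.id := by ext <;> simp
    rw [this, LinearMap.rTensor_id, LinearMap.id_apply]
  rw [← h y, ← h y', h1, h2]

lemma lTensor_prod_sub_eq_zero_iff {M W P Q : Type*} [AddCommGroup M] [Module k M]
    [AddCommGroup W] [Module k W] [AddCommGroup P] [Module k P] [AddCommGroup Q] [Module k Q]
    (f f' : W →ₗ[k] P) (g g' : W →ₗ[k] Q) (u : M ⊗[k] W) :
    ((f - f').prod (g - g')).lTensor M u = 0 ↔
      f.lTensor M u = f'.lTensor M u ∧ g.lTensor M u = g'.lTensor M u := by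
  rw [← sub_eq_zero (a := f.lTensor M u), ← sub_eq_zero (a := g.lTensor M u),
    ← LinearMap.sub_apply, ← LinearMap.sub_apply, ← LinearMap.lTensor_sub, ← LinearMap.lTensor_sub]
  have e1 := LinearMap.congr_fun (LinearMap.lTensor_comp M (LinearMap.fst k P Q)
    ((f - f').prod (g - g'))) u
  have e2 := LinearMap.congr_fun (LinearMap.lTensor_comp M (LinearMap.snd k P Q)
    ((f - f').prod (g - g'))) u
  rw [LinearMap.fst_prod, LinearMap.comp_apply] at e1
  rw [LinearMap.snd_prod, LinearMap.comp_apply] at e2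
  rw [e1, e2]
  refine ⟨fun h ↦ by rw [h, map_zero, map_zero]; exact ⟨rfl, rfl⟩, fun h ↦ ?_⟩
  exact lTensor_prod_ext (h.1.trans (map_zero _).symm) (h.2.trans (map_zero _).symm)

lemma rTensor_prod_sub_eq_zero_iff {M W P Q : Type*} [AddCommGroup M] [Module k M]
    [AddCommGroup W] [Module k W] [AddCommGroup P] [Module k P] [AddCommGroup Q] [Module k Q]
    (f f' : W →ₗ[k] P) (g g' : W →ₗ[k] Q) (u : W ⊗[k] M) :
    ((f - f').prod (g - g')).rTensor M u = 0 ↔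
      f.rTensor M u = f'.rTensor M u ∧ g.rTensor M u = g'.rTensor M u := by
  rw [← sub_eq_zero (a := f.rTensor M u), ← sub_eq_zero (a := g.rTensor M u),
    ← LinearMap.sub_apply, ← LinearMap.sub_apply, ← LinearMap.rTensor_sub, ← LinearMap.rTensor_sub]
  have e1 := LinearMap.congr_fun (LinearMap.rTensor_comp M (LinearMap.fst k P Q)
    ((f - f').prod (g - g'))) u
  have e2 := LinearMap.congr_fun (LinearMap.rTensor_comp M (LinearMap.snd k P Q)
    ((f - f').prod (g - g'))) u
  rw [LinearMap.fst_prod, LinearMap.comp_apply] at e1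
  rw [LinearMap.snd_prod, LinearMap.comp_apply] at e2
  rw [e1, e2]
  refine ⟨fun h ↦ by rw [h, map_zero, map_zero]; exact ⟨rfl, rfl⟩, fun h ↦ ?_⟩
  exact rTensor_prod_ext (h.1.trans (map_zero _).symm) (h.2.trans (map_zero _).symm)

variable {W : BicomoduleAlgebra k A} {P Q : Type v} [AddCommGroup P] [Module k P] [AddCommGroup Q]
  [Module k Q] {f f' : W →ₗ[k] P} {g g' : W →ₗ[k] Q} {R : Subalgebra k W}

variable (f f' g g' R) in
/-- The subalgebra `R` is where `f = f'` and `g = g'`, and each pair of maps still agrees after the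
coactions where it agrees. -/
structure IsStableEqualizer : Prop where
  mem_iff : ∀ w, w ∈ R ↔ f w = f' w ∧ g w = g' w
  leftFst : ∀ w, f w = f' w → f.lTensor A (W.lcoact w) = f'.lTensor A (W.lcoact w)
  leftSnd : ∀ w, g w = g' w → g.lTensor A (W.lcoact w) = g'.lTensor A (W.lcoact w)
  rightFst : ∀ w, f w = f' w → f.rTensor A (W.rcoact w) = f'.rTensor A (W.rcoact w)
  rightSnd : ∀ w, g w = g' w → g.rTensor A (W.rcoact w) = g'.rTensor A (W.rcoact w)

lemma exact_val_of_isStableEqualizer (h : IsStableEqualizer f f' g g' R) :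
    Function.Exact R.val.toLinearMap ((f - f').prod (g - g')) := by
  have e : ∀ u : W, (f u - f' u, g u - g' u) = 0 ↔ u ∈ R := fun u ↦ by
    rw [h.mem_iff, ← sub_eq_zero (a := f u), ← sub_eq_zero (a := g u)]
    exact Prod.ext_iff
  exact fun u ↦ (e u).trans ⟨fun h ↦ ⟨⟨u, h⟩, rfl⟩, by rintro ⟨w, rfl⟩; exact w.2⟩

variable [Module.Flat k A]

lemma equalizer_lcoact_mem (h : IsStableEqualizer f f' g g' R) (s : R) :
    W.lcoact s ∈ (inclL W R).range := by
  obtain ⟨h1, h2⟩ := (h.mem_iff s.1).1 s.2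
  exact (Module.Flat.lTensor_exact A (exact_val_of_isStableEqualizer h) _).1
    ((lTensor_prod_sub_eq_zero_iff f f' g g' _).2 ⟨h.leftFst _ h1, h.leftSnd _ h2⟩)

lemma equalizer_rcoact_mem (h : IsStableEqualizer f f' g g' R) (s : R) :
    W.rcoact s ∈ (inclR W R).range := by
  obtain ⟨h1, h2⟩ := (h.mem_iff s.1).1 s.2
  exact (Module.Flat.rTensor_exact A (exact_val_of_isStableEqualizer h) _).1
    ((rTensor_prod_sub_eq_zero_iff f f' g g' _).2 ⟨h.rightFst _ h1, h.rightSnd _ h2⟩)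

variable (h : IsStableEqualizer f f' g g' R)

/-- The subalgebra on which `f = f'` and `g = g'`, as a bicomodule algebra. -/
def equalizer : BicomoduleAlgebra k A :=
  restrict W R (equalizer_lcoact_mem h) (equalizer_rcoact_mem h)

/-- The inclusion of an equalizer. -/
def equalizerVal : equalizer h →ₐ[k] W := R.val

lemma equalizerVal_injective : Function.Injective (equalizerVal h) := Subtype.val_injective

lemma isBicolinear_equalizerVal : IsBicolinear (equalizerVal h).toLinearMap :=
  ⟨fun w ↦ (inclL_restrictL W _ (equalizer_lcoact_mem h) w).symm,
    fun w ↦ (inclR_restrictR W _ (equalizer_rcoact_mem h) w).symm⟩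

lemma exact_equalizerVal :
    Function.Exact (equalizerVal h).toLinearMap ((f - f').prod (g - g')) :=
  exact_val_of_isStableEqualizer h

/-- The cotensor product of `Z` with an equalizer, inside `Z ⊗ W`. -/
lemma exists_lTensor_equalizerVal_iff (Z : BicomoduleAlgebra k A) [Module.Flat k Z]
    (u : Z ⊗[k] W) :
    (∃ w, (equalizerVal h).toLinearMap.lTensor Z (cotensorVal Z (equalizer h) w) = u) ↔
      cotensorL Z W u = cotensorR Z W u ∧
      f.lTensor Z u = f'.lTensor Z u ∧
      g.lTensor Z u = g'.lTensor Z u :=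
  (exists_lTensor_cotensorVal_iff (Z := Z) (X := equalizer h) (W := W)
    (equalizerVal_injective h) (isBicolinear_equalizerVal h) (exact_equalizerVal h) u).trans
    (and_congr_right fun _ ↦ lTensor_prod_sub_eq_zero_iff _ _ _ _ u)

/-- The cotensor product of an equalizer with `Z`, inside `W ⊗ Z`. -/
lemma exists_rTensor_equalizerVal_iff (Z : BicomoduleAlgebra k A) [Module.Flat k Z]
    (u : W ⊗[k] Z) :
    (∃ w, (equalizerVal h).toLinearMap.rTensor Z (cotensorVal (equalizer h) Z w) = u) ↔
      cotensorL W Z u = cotensorR W Z u ∧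
      f.rTensor Z u = f'.rTensor Z u ∧
      g.rTensor Z u = g'.rTensor Z u :=
  (exists_rTensor_cotensorVal_iff (T := Z) (X := equalizer h) (W := W)
    (equalizerVal_injective h) (isBicolinear_equalizerVal h) (exact_equalizerVal h) u).trans
    (and_congr_right fun _ ↦ rTensor_prod_sub_eq_zero_iff _ _ _ _ u)

end Equalizer

section Inverse

variable {Y C : Type v} [Ring Y] [Algebra k Y] [Ring C] [Algebra k C]
  (S : A →ₐ[k] C) (ρ : Y →ₐ[k] C ⊗[k] Y) (l : Y →ₐ[k] Y ⊗[k] C)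

/-- The algebra map `a ↦ a₁ ⊗ S(a₂)`. -/
def antipodeRight : A →ₐ[k] A ⊗[k] C :=
  (Algebra.TensorProduct.map (AlgHom.id k A) S).comp (Bialgebra.comulAlgHom k A)

/-- The algebra map `a ↦ S(a₁) ⊗ a₂`. -/
def antipodeLeft : A →ₐ[k] C ⊗[k] A :=
  (Algebra.TensorProduct.map S (AlgHom.id k A)).comp (Bialgebra.comulAlgHom k A)

variable (k A) in
/-- An algebra with the trivial coactions `r ↦ 1 ⊗ r` and `r ↦ r ⊗ 1`. -/
def trivial (R : Type v) [Ring R] [Algebra k R] : BicomoduleAlgebra k A where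
  carrier := R
  lcoact := Algebra.TensorProduct.includeRight
  rcoact := Algebra.TensorProduct.includeLeft
  lcoassoc z := by simp [Algebra.TensorProduct.one_def]
  lcounit z := by simp
  rcoassoc z := by simp [Algebra.TensorProduct.one_def]
  rcounit z := by simp
  bicomodule z := by simp

variable (k A Y) in
/-- The bicomodule algebra `A ⊗ Y ⊗ A`, coacted on through the outer factors. -/
def ambient : BicomoduleAlgebra k A :=
  tensor (unit k A) (tensor (trivial k A Y) (unit k A))

variable (k A Y) in
/-- The left coaction of `A ⊗ Y ⊗ A`. -/
def ambientL : A ⊗[k] (Y ⊗[k] A) →ₗ[k] A ⊗[k] (A ⊗[k] (Y ⊗[k] A)) :=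
  (TensorProduct.assoc k A A (Y ⊗[k] A)).toLinearMap ∘ₗ comul.rTensor (Y ⊗[k] A)

variable (k A Y) in
/-- The right coaction of `A ⊗ Y ⊗ A`. -/
def ambientR : A ⊗[k] (Y ⊗[k] A) →ₗ[k] (A ⊗[k] (Y ⊗[k] A)) ⊗[k] A :=
  (TensorProduct.assoc k A (Y ⊗[k] A) A).symm.toLinearMap ∘ₗ
      ((TensorProduct.assoc k Y A A).symm.toLinearMap ∘ₗ comul.lTensor Y).lTensor A

variable (Y) in
/-- `a ⊗ y ⊗ b ↦ (a₁ ⊗ S(a₂)) ⊗ (y ⊗ b)` -/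
def leftAntipode : A ⊗[k] (Y ⊗[k] A) →ₐ[k] (A ⊗[k] C) ⊗[k] (Y ⊗[k] A) :=
  Algebra.TensorProduct.map (antipodeRight S) (AlgHom.id k (Y ⊗[k] A))

/-- `a ⊗ y ⊗ b ↦ (a ⊗ y₁) ⊗ (y₀ ⊗ b)` -/
def leftCoaction : A ⊗[k] (Y ⊗[k] A) →ₐ[k] (A ⊗[k] C) ⊗[k] (Y ⊗[k] A) :=
  (Algebra.TensorProduct.assoc k k k A C (Y ⊗[k] A)).symm.toAlgHom.comp
    (Algebra.TensorProduct.map (AlgHom.id k A)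
      ((Algebra.TensorProduct.assoc k k k C Y A).toAlgHom.comp
        (Algebra.TensorProduct.map ρ (AlgHom.id k A))))

variable (Y) in
/-- `a ⊗ y ⊗ b ↦ a ⊗ (y ⊗ (S(b₁) ⊗ b₂))` -/
def rightAntipode : A ⊗[k] (Y ⊗[k] A) →ₐ[k] A ⊗[k] (Y ⊗[k] (C ⊗[k] A)) :=
  Algebra.TensorProduct.map (AlgHom.id k A)
    (Algebra.TensorProduct.map (AlgHom.id k Y) (antipodeLeft S))

/-- `a ⊗ y ⊗ b ↦ a ⊗ (y₀ ⊗ (y₋₁ ⊗ b))` -/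
def rightCoaction : A ⊗[k] (Y ⊗[k] A) →ₐ[k] A ⊗[k] (Y ⊗[k] (C ⊗[k] A)) :=
  Algebra.TensorProduct.map (AlgHom.id k A)
    ((Algebra.TensorProduct.assoc k k k Y C A).toAlgHom.comp
      (Algebra.TensorProduct.map l (AlgHom.id k A)))

variable (k A Y C) in
/-- The coaction of the first factor of `(A ⊗ C) ⊗ (Y ⊗ A)`. -/
def coactFirst₁ : (A ⊗[k] C) ⊗[k] (Y ⊗[k] A) →ₗ[k] A ⊗[k] ((A ⊗[k] C) ⊗[k] (Y ⊗[k] A)) :=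
  (TensorProduct.assoc k A (A ⊗[k] C) (Y ⊗[k] A)).toLinearMap ∘ₗ
    ((TensorProduct.assoc k A A C).toLinearMap ∘ₗ comul.rTensor C).rTensor (Y ⊗[k] A)

variable (k A Y C) in
/-- The coaction of the first factor of `A ⊗ (Y ⊗ (C ⊗ A))`. -/
def coactFirst₂ : A ⊗[k] (Y ⊗[k] (C ⊗[k] A)) →ₗ[k] A ⊗[k] (A ⊗[k] (Y ⊗[k] (C ⊗[k] A))) :=
  (TensorProduct.assoc k A A (Y ⊗[k] (C ⊗[k] A))).toLinearMap ∘ₗ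
    comul.rTensor (Y ⊗[k] (C ⊗[k] A))

lemma leftAntipode_lcoact (u : A ⊗[k] (Y ⊗[k] A)) :
    (leftAntipode Y S).toLinearMap.lTensor A ((ambientL k A Y) u) =
      coactFirst₁ k A Y C ((leftAntipode Y S) u) := by
  change _ = TensorProduct.assoc k A (A ⊗[k] C) (Y ⊗[k] A)
        (((TensorProduct.assoc k A A C).toLinearMap ∘ₗ comul.rTensor C).rTensor
          (Y ⊗[k] A) ((leftAntipode Y S) u))
  induction u with
  | zero => simp
  | add a b ha hb => simp only [map_add, ha, hb]
  | tmul a q =>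
    -- `a ⊗ b ⊗ c ↦ a ⊗ ((b ⊗ S(c)) ⊗ q)`
    let F : A ⊗[k] (A ⊗[k] A) →ₗ[k] A ⊗[k] ((A ⊗[k] C) ⊗[k] (Y ⊗[k] A)) :=
      ((TensorProduct.mk k _ (Y ⊗[k] A)).flip q ∘ₗ
        S.toLinearMap.lTensor A).lTensor A
    have h := congrArg F (Coalgebra.coassoc_apply (R := k) a)
    change (leftAntipode Y S).toLinearMap.lTensor A
        (TensorProduct.assoc k A A (Y ⊗[k] A) (comul a ⊗ₜ q)) =
      TensorProduct.assoc k A (A ⊗[k] C) (Y ⊗[k] A)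
      (((TensorProduct.assoc k A A C).toLinearMap ∘ₗ comul.rTensor C).rTensor (Y ⊗[k] A)
        (S.toLinearMap.lTensor A (comul a) ⊗ₜ q))
    refine Eq.trans ?_ (h.symm.trans ?_)
    · generalize comul (R := k) a = w
      induction w with
      | zero => simp
      | add a b ha hb => simp only [add_tmul, map_add, ha, hb]
      | tmul a b => rfl
    · generalize comul (R := k) a = w
      induction w with
      | zero => simp
      | add a b ha hb => simp only [add_tmul, map_add, ha, hb]
      | tmul a b =>
        simp only [LinearMap.rTensor_tmul, LinearMap.lTensor_tmul, LinearMap.comp_apply]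
        generalize comul (R := k) a = w
        induction w with
        | zero => simp
        | add a b ha hb => simp only [add_tmul, map_add, ha, hb]
        | tmul a b => rfl

lemma leftCoaction_lcoact (u : A ⊗[k] (Y ⊗[k] A)) :
    (leftCoaction ρ).toLinearMap.lTensor A ((ambientL k A Y) u) =
      coactFirst₁ k A Y C ((leftCoaction ρ) u) := by
  change _ = TensorProduct.assoc k A (A ⊗[k] C) (Y ⊗[k] A)
        (((TensorProduct.assoc k A A C).toLinearMap ∘ₗ comul.rTensor C).rTensor
          (Y ⊗[k] A) ((leftCoaction ρ) u))
  induction u with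
  | zero => simp
  | add a b ha hb => simp only [map_add, ha, hb]
  | tmul a q =>
    change (leftCoaction ρ).toLinearMap.lTensor A
      (TensorProduct.assoc k A A (Y ⊗[k] A) (comul a ⊗ₜ q)) = _
    have h : ∀ a, (leftCoaction ρ) (a ⊗ₜ q) = (TensorProduct.assoc k A C (Y ⊗[k] A)).symm
      (a ⊗ₜ TensorProduct.assoc k C Y A (ρ.toLinearMap.rTensor A q)) := fun _ ↦ rfl
    have h' : ∀ w : A ⊗[k] A, (leftCoaction ρ).toLinearMap.lTensor A
        (TensorProduct.assoc k A A (Y ⊗[k] A) (w ⊗ₜ q)) =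
        (TensorProduct.assoc k A C (Y ⊗[k] A)).symm.toLinearMap.lTensor A
          (TensorProduct.assoc k A A _ (w ⊗ₜ
            TensorProduct.assoc k C Y A (ρ.toLinearMap.rTensor A q))) := by
      intro w
      induction w with
      | zero => simp
      | add a b ha hb => simp only [add_tmul, map_add, ha, hb]
      | tmul a b => rfl
    rw [h, h']
    generalize TensorProduct.assoc k C Y A (ρ.toLinearMap.rTensor A q) = y
    induction y with
    | zero => simp
    | add a b ha hb => simp only [tmul_add, map_add, ha, hb]
    | tmul c q =>
      rw [TensorProduct.assoc_symm_tmul, LinearMap.rTensor_tmul, LinearMap.comp_apply,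
        LinearMap.rTensor_tmul]
      generalize comul (R := k) a = w
      induction w with
      | zero => simp
      | add a b ha hb => simp only [add_tmul, map_add, ha, hb]
      | tmul a b => rfl

/-- A map acting only on the last factors of `A ⊗ Q` commutes with the coaction of `A`. -/
lemma lTensor_lTensor_assoc_comul {Q P : Type*} [AddCommGroup Q] [Module k Q] [AddCommGroup P]
    [Module k P] (f : Q →ₗ[k] P) (u : A ⊗[k] Q) :
    (f.lTensor A).lTensor A (TensorProduct.assoc k A A Q (comul.rTensor Q u)) =
      TensorProduct.assoc k A A P (comul.rTensor P (f.lTensor A u)) := by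
  induction u with
  | zero => simp
  | add a b ha hb => simp only [map_add, ha, hb]
  | tmul a q =>
    simp only [LinearMap.rTensor_tmul, LinearMap.lTensor_tmul]
    generalize comul (R := k) a = w
    induction w with
    | zero => simp
    | add a b ha hb => simp only [add_tmul, map_add, ha, hb]
    | tmul a b => rfl

lemma rightAntipode_lcoact (u : A ⊗[k] (Y ⊗[k] A)) :
    (rightAntipode Y S).toLinearMap.lTensor A ((ambientL k A Y) u) =
      coactFirst₂ k A Y C ((rightAntipode Y S) u) :=
  lTensor_lTensor_assoc_comul
    (Algebra.TensorProduct.map (AlgHom.id k Y) (antipodeLeft S)).toLinearMap u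

lemma rightCoaction_lcoact (u : A ⊗[k] (Y ⊗[k] A)) :
    (rightCoaction l).toLinearMap.lTensor A ((ambientL k A Y) u) =
      coactFirst₂ k A Y C ((rightCoaction l) u) :=
  lTensor_lTensor_assoc_comul ((Algebra.TensorProduct.assoc k k k Y C A).toAlgHom.comp
      (Algebra.TensorProduct.map l (AlgHom.id k A))).toLinearMap u

variable (k A Y C) in
/-- The coaction of the last factor of `(A ⊗ C) ⊗ (Y ⊗ A)`. -/
def coactLast₁ : (A ⊗[k] C) ⊗[k] (Y ⊗[k] A) →ₗ[k]
    ((A ⊗[k] C) ⊗[k] (Y ⊗[k] A)) ⊗[k] A :=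
  (TensorProduct.assoc k (A ⊗[k] C) (Y ⊗[k] A) A).symm.toLinearMap ∘ₗ
    ((TensorProduct.assoc k Y A A).symm.toLinearMap ∘ₗ
      comul.lTensor Y).lTensor (A ⊗[k] C)

variable (k A Y C) in
/-- The coaction of the last factor of `A ⊗ (Y ⊗ (C ⊗ A))`. -/
def coactLast₂ : A ⊗[k] (Y ⊗[k] (C ⊗[k] A)) →ₗ[k]
    (A ⊗[k] (Y ⊗[k] (C ⊗[k] A))) ⊗[k] A :=
  (TensorProduct.assoc k A (Y ⊗[k] (C ⊗[k] A)) A).symm.toLinearMap ∘ₗ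
    ((TensorProduct.assoc k Y (C ⊗[k] A) A).symm.toLinearMap ∘ₗ
      ((TensorProduct.assoc k C A A).symm.toLinearMap ∘ₗ
        comul.lTensor C).lTensor Y).lTensor A

lemma leftAntipode_rcoact (u : A ⊗[k] (Y ⊗[k] A)) :
    (leftAntipode Y S).toLinearMap.rTensor A ((ambientR k A Y) u) =
      (coactLast₁ k A Y C) ((leftAntipode Y S) u) := by
  refine LinearMap.congr_fun (f := (leftAntipode Y S).toLinearMap.rTensor A ∘ₗ
    (ambientR k A Y)) (g := (coactLast₁ k A Y C) ∘ₗ (leftAntipode Y S).toLinearMap)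
    (TensorProduct.ext_threefold' fun a y b ↦ ?_) u
  change (leftAntipode Y S).toLinearMap.rTensor A ((TensorProduct.assoc k A (Y ⊗[k] A) A).symm
      (a ⊗ₜ (TensorProduct.assoc k Y A A).symm (y ⊗ₜ comul b))) =
    (TensorProduct.assoc k (A ⊗[k] C) (Y ⊗[k] A) A).symm (antipodeRight S a ⊗ₜ
      (TensorProduct.assoc k Y A A).symm (y ⊗ₜ comul b))
  generalize comul (R := k) b = w
  induction w with
  | zero => simp
  | add a b ha hb => simp only [tmul_add, map_add, ha, hb]
  | tmul b c => rfl

lemma leftCoaction_rcoact (u : A ⊗[k] (Y ⊗[k] A)) :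
    (leftCoaction ρ).toLinearMap.rTensor A ((ambientR k A Y) u) =
      (coactLast₁ k A Y C) ((leftCoaction ρ) u) := by
  refine LinearMap.congr_fun (f := (leftCoaction ρ).toLinearMap.rTensor A ∘ₗ
    (ambientR k A Y)) (g := (coactLast₁ k A Y C) ∘ₗ (leftCoaction ρ).toLinearMap)
    (TensorProduct.ext_threefold' fun a y b ↦ ?_) u
  have h : ∀ b, (leftCoaction ρ) (a ⊗ₜ (y ⊗ₜ b)) = (TensorProduct.assoc k A C (Y ⊗[k] A)).symm
      (a ⊗ₜ TensorProduct.assoc k C Y A (ρ y ⊗ₜ b)) := fun _ ↦ rfl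
  rw [LinearMap.comp_apply, LinearMap.comp_apply, AlgHom.toLinearMap_apply, h]
  change (leftCoaction ρ).toLinearMap.rTensor A ((TensorProduct.assoc k A (Y ⊗[k] A) A).symm
      (a ⊗ₜ (TensorProduct.assoc k Y A A).symm (y ⊗ₜ comul b))) = _
  have h' : ∀ w : A ⊗[k] A, (leftCoaction ρ).toLinearMap.rTensor A
      ((TensorProduct.assoc k A (Y ⊗[k] A) A).symm
        (a ⊗ₜ (TensorProduct.assoc k Y A A).symm (y ⊗ₜ w))) =
      ((TensorProduct.assoc k A C (Y ⊗[k] A)).symm.toLinearMap ∘ₗ TensorProduct.mk k A _ a ∘ₗ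
        (TensorProduct.assoc k C Y A).toLinearMap ∘ₗ
          TensorProduct.mk k _ A (ρ y)).rTensor A w := by
    intro w
    induction w with
    | zero => simp
    | add a b ha hb => simp only [tmul_add, map_add, ha, hb]
    | tmul b c => rfl
  rw [h']
  generalize ρ y = v
  induction v with
  | zero => simp
  | add a b ha hb =>
    simp only [map_add, add_tmul, tmul_add, ← ha, ← hb, LinearMap.comp_add, LinearMap.rTensor_add,
      LinearMap.add_apply]
  | tmul c y =>
    change _ = (TensorProduct.assoc k (A ⊗[k] C) (Y ⊗[k] A) A).symm ((a ⊗ₜ c) ⊗ₜ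
      (TensorProduct.assoc k Y A A).symm (y ⊗ₜ comul b))
    generalize comul (R := k) b = w
    induction w with
    | zero => simp
    | add a b ha hb => simp only [tmul_add, map_add, ha, hb]
    | tmul b c => rfl

lemma rightAntipode_rcoact (u : A ⊗[k] (Y ⊗[k] A)) :
    (rightAntipode Y S).toLinearMap.rTensor A ((ambientR k A Y) u) =
      (coactLast₂ k A Y C) ((rightAntipode Y S) u) := by
  refine LinearMap.congr_fun (f := (rightAntipode Y S).toLinearMap.rTensor A ∘ₗ
    (ambientR k A Y)) (g := (coactLast₂ k A Y C) ∘ₗ (rightAntipode Y S).toLinearMap)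
    (TensorProduct.ext_threefold' fun a y b ↦ ?_) u
  -- `a' ⊗ b ⊗ c ↦ a ⊗ y ⊗ S(a') ⊗ b ⊗ c`
  let F : A ⊗[k] (A ⊗[k] A) →ₗ[k] (A ⊗[k] (Y ⊗[k] (C ⊗[k] A))) ⊗[k] A :=
    (TensorProduct.mk k A _ a ∘ₗ TensorProduct.mk k Y _ y).rTensor A ∘ₗ
      (TensorProduct.assoc k C A A).symm.toLinearMap ∘ₗ
        S.toLinearMap.rTensor (A ⊗[k] A)
  have h := congrArg F (Coalgebra.coassoc_apply (R := k) b)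
  refine Eq.trans ?_ (h.trans ?_)
  · change (rightAntipode Y S).toLinearMap.rTensor A ((TensorProduct.assoc k A (Y ⊗[k] A) A).symm
      (a ⊗ₜ (TensorProduct.assoc k Y A A).symm (y ⊗ₜ comul b))) = _
    generalize comul (R := k) b = w
    induction w with
    | zero => simp
    | add a b ha hb => simp only [tmul_add, map_add, ha, hb]
    | tmul b c =>
      change (a ⊗ₜ (y ⊗ₜ S.toLinearMap.rTensor A (comul b))) ⊗ₜ c
        = F (TensorProduct.assoc k A A A (comul b ⊗ₜ c))
      generalize comul (R := k) b = w
      induction w with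
      | zero => simp
      | add a b ha hb => simp only [tmul_add, add_tmul, map_add, ha, hb]
      | tmul b c => rfl
  · change _ = (coactLast₂ k A Y C) (a ⊗ₜ (y ⊗ₜ
      S.toLinearMap.rTensor A (comul b)))
    generalize comul (R := k) b = w
    induction w with
    | zero => simp
    | add a b ha hb => simp only [tmul_add, map_add, ha, hb]
    | tmul b c =>
      change F (b ⊗ₜ comul c) = (TensorProduct.assoc k A (Y ⊗[k] (C ⊗[k] A)) A).symm
        (a ⊗ₜ (TensorProduct.assoc k Y (C ⊗[k] A) A).symm
          (y ⊗ₜ (TensorProduct.assoc k C A A).symm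
            (S b ⊗ₜ comul c)))
      generalize comul (R := k) c = w
      induction w with
      | zero => simp
      | add a b ha hb => simp only [tmul_add, map_add, ha, hb]
      | tmul b c => rfl

lemma rightCoaction_rcoact (u : A ⊗[k] (Y ⊗[k] A)) :
    (rightCoaction l).toLinearMap.rTensor A ((ambientR k A Y) u) =
      (coactLast₂ k A Y C) ((rightCoaction l) u) := by
  refine LinearMap.congr_fun (f := (rightCoaction l).toLinearMap.rTensor A ∘ₗ
    (ambientR k A Y)) (g := (coactLast₂ k A Y C) ∘ₗ (rightCoaction l).toLinearMap)
    (TensorProduct.ext_threefold' fun a y b ↦ ?_) u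
  change (rightCoaction l).toLinearMap.rTensor A ((TensorProduct.assoc k A (Y ⊗[k] A) A).symm
      (a ⊗ₜ (TensorProduct.assoc k Y A A).symm (y ⊗ₜ comul b))) =
    (coactLast₂ k A Y C) (a ⊗ₜ TensorProduct.assoc k Y C A (l y ⊗ₜ b))
  have h' : ∀ w : A ⊗[k] A, (rightCoaction l).toLinearMap.rTensor A
      ((TensorProduct.assoc k A (Y ⊗[k] A) A).symm
        (a ⊗ₜ (TensorProduct.assoc k Y A A).symm (y ⊗ₜ w))) =
      (TensorProduct.mk k A _ a ∘ₗ (TensorProduct.assoc k Y C A).toLinearMap ∘ₗ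
          TensorProduct.mk k _ A (l y)).rTensor A w := by
    intro w
    induction w with
    | zero => simp
    | add a b ha hb => simp only [tmul_add, map_add, ha, hb]
    | tmul b c => rfl
  rw [h']
  generalize l y = v
  induction v with
  | zero => simp
  | add a b ha hb =>
    simp only [map_add, add_tmul, tmul_add, ← ha, ← hb, LinearMap.comp_add, LinearMap.rTensor_add,
      LinearMap.add_apply]
  | tmul y c =>
    change _ = (TensorProduct.assoc k A (Y ⊗[k] (C ⊗[k] A)) A).symm
        (a ⊗ₜ (TensorProduct.assoc k Y (C ⊗[k] A) A).symm
          (y ⊗ₜ (TensorProduct.assoc k C A A).symm (c ⊗ₜ comul b)))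
    generalize comul (R := k) b = w
    induction w with
    | zero => simp
    | add a b ha hb => simp only [tmul_add, map_add, ha, hb]
    | tmul b c => rfl

/-- The subalgebra of `A ⊗ Y ⊗ A` cut out by `a₁ ⊗ S(a₂) ⊗ y ⊗ b = a ⊗ y₁ ⊗ y₀ ⊗ b` and
`a ⊗ y ⊗ S(b₁) ⊗ b₂ = a ⊗ y₀ ⊗ y₋₁ ⊗ b`. -/
def inverseSubalgebra : Subalgebra k (A ⊗[k] (Y ⊗[k] A)) :=
  AlgHom.equalizer (leftAntipode Y S) (leftCoaction ρ) ⊓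
    AlgHom.equalizer (rightAntipode Y S) (rightCoaction l)

variable (k A Y) in
/-- `IsStableEqualizer` for maps on `A ⊗ Y ⊗ A`. -/
abbrev IsAmbientEqualizer {P Q : Type v} [AddCommGroup P] [Module k P] [AddCommGroup Q]
    [Module k Q] (f f' : A ⊗[k] (Y ⊗[k] A) →ₗ[k] P) (g g' : A ⊗[k] (Y ⊗[k] A) →ₗ[k] Q)
    (R : Subalgebra k (A ⊗[k] (Y ⊗[k] A))) : Prop :=
  IsStableEqualizer (W := ambient k A Y) f f' g g' R

lemma isAmbientEqualizer_inverse : IsAmbientEqualizer k A Y (leftAntipode Y S).toLinearMap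
    (leftCoaction ρ).toLinearMap (rightAntipode Y S).toLinearMap (rightCoaction l).toLinearMap
    (inverseSubalgebra S ρ l) where
  mem_iff _ := Iff.rfl
  leftFst w hw := (leftAntipode_lcoact (A := A) S w).trans
    ((congrArg (coactFirst₁ k A Y C) hw).trans (leftCoaction_lcoact (A := A) ρ w).symm)
  leftSnd w hw := (rightAntipode_lcoact (A := A) S w).trans
    ((congrArg (coactFirst₂ k A Y C) hw).trans (rightCoaction_lcoact (A := A) l w).symm)
  rightFst w hw := (leftAntipode_rcoact (A := A) S w).trans
    ((congrArg (coactLast₁ k A Y C) hw).trans (leftCoaction_rcoact (A := A) ρ w).symm)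
  rightSnd w hw := (rightAntipode_rcoact (A := A) S w).trans
    ((congrArg (coactLast₂ k A Y C) hw).trans (rightCoaction_rcoact (A := A) l w).symm)

variable [Module.Flat k A]

/-- The sub-bicomodule algebra of `A ⊗ Y ⊗ A` cut out by `a₁ ⊗ S(a₂) ⊗ y ⊗ b = a ⊗ y₁ ⊗ y₀ ⊗ b` and
`a ⊗ y ⊗ S(b₁) ⊗ b₂ = a ⊗ y₀ ⊗ y₋₁ ⊗ b`. For `Y = Zᵒᵖ` with the coactions of `Z` it turns out to be
inverse to `Z`. If the antipode is bijective, its elements are the `S⁻¹(z₁) ⊗ z₀ ⊗ S⁻¹(z₋₁)`; with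
this description no inverse of the antipode is needed. -/
def inverseObject : BicomoduleAlgebra k A :=
  equalizer (isAmbientEqualizer_inverse S ρ l)

/-- The inclusion of the inverse object into `A ⊗ Y ⊗ A`. -/
def inverseVal : inverseObject S ρ l →ₐ[k] ambient k A Y :=
  equalizerVal (isAmbientEqualizer_inverse S ρ l)

lemma inverseVal_injective : Function.Injective (inverseVal S ρ l) := Subtype.val_injective

lemma isBicolinear_inverseVal : IsBicolinear (inverseVal S ρ l).toLinearMap :=
  isBicolinear_equalizerVal (isAmbientEqualizer_inverse S ρ l)

/-- The cotensor product of `Z` with the inverse object, inside `Z ⊗ (A ⊗ Y ⊗ A)`. -/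
lemma exists_lTensor_inverseVal_iff (Z : BicomoduleAlgebra k A) [Module.Flat k Z]
    (u : Z ⊗[k] (A ⊗[k] (Y ⊗[k] A))) :
    (∃ w, (inverseVal S ρ l).toLinearMap.lTensor Z (cotensorVal Z (inverseObject S ρ l) w) = u) ↔
      cotensorL Z (ambient k A Y) u = (ambientL k A Y).lTensor Z u ∧
      (leftAntipode Y S).toLinearMap.lTensor Z u = (leftCoaction ρ).toLinearMap.lTensor Z u ∧
      (rightAntipode Y S).toLinearMap.lTensor Z u = (rightCoaction l).toLinearMap.lTensor Z u :=
  exists_lTensor_equalizerVal_iff (isAmbientEqualizer_inverse S ρ l) Z u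

/-- The cotensor product of the inverse object with `Z`, inside `(A ⊗ Y ⊗ A) ⊗ Z`. -/
lemma exists_rTensor_inverseVal_iff (Z : BicomoduleAlgebra k A) [Module.Flat k Z]
    (u : (A ⊗[k] (Y ⊗[k] A)) ⊗[k] Z) :
    (∃ w, (inverseVal S ρ l).toLinearMap.rTensor Z (cotensorVal (inverseObject S ρ l) Z w) = u) ↔
      TensorProduct.assoc k (A ⊗[k] (Y ⊗[k] A)) A Z ((ambientR k A Y).rTensor Z u) =
        Z.lcoact.toLinearMap.lTensor (A ⊗[k] (Y ⊗[k] A)) u ∧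
      (leftAntipode Y S).toLinearMap.rTensor Z u = (leftCoaction ρ).toLinearMap.rTensor Z u ∧
      (rightAntipode Y S).toLinearMap.rTensor Z u = (rightCoaction l).toLinearMap.rTensor Z u :=
  exists_rTensor_equalizerVal_iff (isAmbientEqualizer_inverse S ρ l) Z u

end Inverse

/-! ### Coactions on tensor products with a module -/

section Coact

variable (Z : BicomoduleAlgebra k A) (M : Type*) {N : Type*} [AddCommGroup M] [Module k M]
  [AddCommGroup N] [Module k N]

/-- `z ⊗ m ↦ z₀ ⊗ (z₁ ⊗ m)` -/
def coactR : Z ⊗[k] M →ₗ[k] Z ⊗[k] (A ⊗[k] M) :=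
  (TensorProduct.assoc k Z A M).toLinearMap ∘ₗ Z.rcoact.toLinearMap.rTensor M

/-- `m ⊗ z ↦ (m ⊗ z₋₁) ⊗ z₀` -/
def coactL : M ⊗[k] Z →ₗ[k] (M ⊗[k] A) ⊗[k] Z :=
  (TensorProduct.assoc k M A Z).symm.toLinearMap ∘ₗ Z.lcoact.toLinearMap.lTensor M

lemma coactR_tmul (z : Z) (m : M) :
    Z.coactR M (z ⊗ₜ m) = TensorProduct.assoc k Z A M (Z.rcoact z ⊗ₜ m) := rfl

lemma coactL_tmul (z : Z) (m : M) :
    Z.coactL M (m ⊗ₜ z) = (TensorProduct.assoc k M A Z).symm (m ⊗ₜ Z.lcoact z) := rfl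

variable (k A) in
/-- `a ⊗ m ↦ a₁ ⊗ (a₂ ⊗ m)` -/
def comulR : A ⊗[k] M →ₗ[k] A ⊗[k] (A ⊗[k] M) :=
  (TensorProduct.assoc k A A M).toLinearMap ∘ₗ comul.rTensor M

variable (k A) in
/-- `m ⊗ a ↦ (m ⊗ a₁) ⊗ a₂` -/
def comulL : M ⊗[k] A →ₗ[k] (M ⊗[k] A) ⊗[k] A :=
  (TensorProduct.assoc k M A A).symm.toLinearMap ∘ₗ comul.lTensor M

variable (k A) in
/-- `a ⊗ m ↦ ε(a) m` -/
def counitR : A ⊗[k] M →ₗ[k] M := (TensorProduct.lid k M).toLinearMap ∘ₗ counit.rTensor M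

variable (k A) in
/-- `m ⊗ a ↦ ε(a) m` -/
def counitL : M ⊗[k] A →ₗ[k] M := (TensorProduct.rid k M).toLinearMap ∘ₗ counit.lTensor M

variable {M} in
lemma coactR_lTensor (f : M →ₗ[k] N) (v : Z ⊗[k] M) :
    Z.coactR N (f.lTensor Z v) = (f.lTensor A).lTensor Z (Z.coactR M v) := by
  induction v with
  | zero => simp only [map_zero]
  | add a b ha hb => simp only [map_add, ha, hb]
  | tmul z m =>
    rw [LinearMap.lTensor_tmul, coactR_tmul, coactR_tmul]
    generalize Z.rcoact z = w
    induction w with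
    | zero => simp only [zero_tmul, map_zero]
    | add a b ha hb => simp only [add_tmul, map_add, ha, hb]
    | tmul a b => rfl

variable {M} in
lemma coactL_rTensor (f : M →ₗ[k] N) (v : M ⊗[k] Z) :
    Z.coactL N (f.rTensor Z v) = (f.rTensor A).rTensor Z (Z.coactL M v) := by
  induction v with
  | zero => simp only [map_zero]
  | add a b ha hb => simp only [map_add, ha, hb]
  | tmul m z =>
    rw [LinearMap.rTensor_tmul, coactL_tmul, coactL_tmul]
    generalize Z.lcoact z = w
    induction w with
    | zero => simp only [tmul_zero, map_zero]
    | add a b ha hb => simp only [tmul_add, map_add, ha, hb]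
    | tmul a b => rfl

lemma coactR_coactR (v : Z ⊗[k] M) :
    Z.coactR (A ⊗[k] M) (Z.coactR M v) = (comulR k A M).lTensor Z (Z.coactR M v) := by
  induction v with
  | zero => simp only [map_zero]
  | add a b ha hb => simp only [map_add, ha, hb]
  | tmul z m =>
    rw [coactR_tmul]
    have h := congrArg ((((TensorProduct.assoc k A A M).toLinearMap ∘ₗ
      (TensorProduct.mk k (A ⊗[k] A) M).flip m)).lTensor Z) (Z.rcoassoc z)
    refine Eq.trans ?_ (h.trans ?_)
    · generalize Z.rcoact z = w
      induction w with
      | zero => simp only [zero_tmul, map_zero]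
      | add a b ha hb => simp only [add_tmul, map_add, ha, hb]
      | tmul z a =>
        rw [TensorProduct.assoc_tmul, coactR_tmul, LinearMap.rTensor_tmul]
        change TensorProduct.assoc k Z A (A ⊗[k] M) (Z.rcoact z ⊗ₜ (a ⊗ₜ m)) =
          ((TensorProduct.assoc k A A M).toLinearMap ∘ₗ
            (TensorProduct.mk k (A ⊗[k] A) M).flip m).lTensor Z
              (TensorProduct.assoc k Z A A (Z.rcoact z ⊗ₜ a))
        generalize Z.rcoact z = w
        induction w with
        | zero => simp only [zero_tmul, map_zero]
        | add a b ha hb => simp only [add_tmul, map_add, ha, hb]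
        | tmul z a => rfl
    · generalize Z.rcoact z = w
      induction w with
      | zero => simp only [zero_tmul, map_zero]
      | add a b ha hb => simp only [add_tmul, map_add, ha, hb]
      | tmul z a => rfl

lemma coactL_coactL (v : M ⊗[k] Z) :
    Z.coactL (M ⊗[k] A) (Z.coactL M v) = (comulL k A M).rTensor Z (Z.coactL M v) := by
  induction v with
  | zero => simp only [map_zero]
  | add a b ha hb => simp only [map_add, ha, hb]
  | tmul m z =>
    rw [coactL_tmul]
    have h := congrArg ((((TensorProduct.assoc k M A A).symm.toLinearMap ∘ₗ
      TensorProduct.mk k M (A ⊗[k] A) m)).rTensor Z ∘ₗ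
        (TensorProduct.assoc k A A Z).symm.toLinearMap) (Z.lcoassoc z)
    refine (Eq.trans ?_ (h.trans ?_)).symm
    · rw [LinearMap.comp_apply, LinearEquiv.coe_coe, LinearEquiv.symm_apply_apply]
      generalize Z.lcoact z = w
      induction w with
      | zero => simp only [tmul_zero, map_zero]
      | add a b ha hb => simp only [tmul_add, map_add, ha, hb]
      | tmul z a => rfl
    · generalize Z.lcoact z = w
      induction w with
      | zero => simp only [tmul_zero, map_zero]
      | add a b ha hb => simp only [tmul_add, map_add, ha, hb]
      | tmul a z =>
        rw [TensorProduct.assoc_symm_tmul, coactL_tmul, LinearMap.lTensor_tmul]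
        change ((TensorProduct.assoc k M A A).symm.toLinearMap ∘ₗ
            TensorProduct.mk k M (A ⊗[k] A) m).rTensor Z
              ((TensorProduct.assoc k A A Z).symm (a ⊗ₜ Z.lcoact z)) =
          (TensorProduct.assoc k (M ⊗[k] A) A Z).symm ((m ⊗ₜ a) ⊗ₜ Z.lcoact z)
        generalize Z.lcoact z = w
        induction w with
        | zero => simp only [tmul_zero, map_zero]
        | add a b ha hb => simp only [tmul_add, map_add, ha, hb]
        | tmul z a => rfl

lemma counitR_coactR (v : Z ⊗[k] M) : (counitR k A M).lTensor Z (Z.coactR M v) = v := by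
  induction v with
  | zero => simp only [map_zero]
  | add a b ha hb => simp only [map_add, ha, hb]
  | tmul z m =>
    have h := congrArg (fun w ↦ TensorProduct.rid k Z w ⊗ₜ[k] m) (Z.rcounit z)
    simp only [TensorProduct.rid_tmul, one_smul] at h
    refine Eq.trans ?_ h
    rw [coactR_tmul]
    generalize Z.rcoact z = w
    induction w with
    | zero => simp only [zero_tmul, map_zero]
    | add a b ha hb => simp only [add_tmul, map_add, ha, hb]
    | tmul z a => simp [counitR, smul_tmul']

lemma counitL_coactL (v : M ⊗[k] Z) : (counitL k A M).rTensor Z (Z.coactL M v) = v := by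
  induction v with
  | zero => simp only [map_zero]
  | add a b ha hb => simp only [map_add, ha, hb]
  | tmul m z =>
    have h := congrArg (fun w ↦ m ⊗ₜ[k] TensorProduct.lid k Z w) (Z.lcounit z)
    simp only [TensorProduct.lid_tmul, one_smul] at h
    refine Eq.trans ?_ h
    rw [coactL_tmul]
    generalize Z.lcoact z = w
    induction w with
    | zero => simp only [tmul_zero, map_zero]
    | add a b ha hb => simp only [tmul_add, map_add, ha, hb]
    | tmul z a => simp [counitL, smul_tmul']

lemma coactR_injective : Function.Injective (Z.coactR M) :=
  Function.LeftInverse.injective (counitR_coactR Z M)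

lemma coactL_injective : Function.Injective (Z.coactL M) :=
  Function.LeftInverse.injective (counitL_coactL Z M)

lemma counitR_comulR : (counitR k A M).lTensor A ∘ₗ comulR k A M = LinearMap.id :=
  LinearMap.ext (counitR_coactR (unit k A) M)

lemma counitL_comulL : (counitL k A M).rTensor A ∘ₗ comulL k A M = LinearMap.id :=
  LinearMap.ext (counitL_coactL (unit k A) M)

variable {Z M} in
lemma exists_coactR_eq {u : Z ⊗[k] (A ⊗[k] M)}
    (h : Z.coactR (A ⊗[k] M) u = (comulR k A M).lTensor Z u) : ∃ v, Z.coactR M v = u := by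
  refine ⟨(counitR k A M).lTensor Z u, ?_⟩
  rw [coactR_lTensor, h, ← LinearMap.lTensor_comp_apply, counitR_comulR, LinearMap.lTensor_id_apply]

variable {Z M} in
lemma exists_coactL_eq {u : (M ⊗[k] A) ⊗[k] Z}
    (h : Z.coactL (M ⊗[k] A) u = (comulL k A M).rTensor Z u) : ∃ v, Z.coactL M v = u := by
  refine ⟨(counitL k A M).rTensor Z u, ?_⟩
  rw [coactL_rTensor, h, ← LinearMap.rTensor_comp_apply, counitL_comulL, LinearMap.rTensor_id_apply]

/-- `z ⊗ c ↦ z₀ ⊗ z₁ c` -/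
def shearR : Z ⊗[k] A →ₗ[k] Z ⊗[k] A := (LinearMap.mul' k A).lTensor Z ∘ₗ Z.coactR A

/-- `c ⊗ z ↦ c z₋₁ ⊗ z₀` -/
def shearL : A ⊗[k] Z →ₗ[k] A ⊗[k] Z := (LinearMap.mul' k A).rTensor Z ∘ₗ Z.coactL A

/-- `z ⊗ c ↦ z₀ ⊗ S(z₁) c`, the inverse of `shearR`. -/
def unshearR : Z ⊗[k] A →ₗ[k] Z ⊗[k] A :=
  (LinearMap.mul' k A ∘ₗ (HopfAlgebra.antipode k (A := A)).rTensor A).lTensor Z ∘ₗ Z.coactR A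

/-- `c ⊗ z ↦ c S(z₋₁) ⊗ z₀`, the inverse of `shearL`. -/
def unshearL : A ⊗[k] Z →ₗ[k] A ⊗[k] Z :=
  (LinearMap.mul' k A ∘ₗ (HopfAlgebra.antipode k (A := A)).lTensor A).rTensor Z ∘ₗ Z.coactL A

lemma unshearR_shearR (v : Z ⊗[k] A) : Z.unshearR (Z.shearR v) = v := by
  have e : (LinearMap.mul' k A ∘ₗ (HopfAlgebra.antipode k (A := A)).rTensor A) ∘ₗ
      (LinearMap.mul' k A).lTensor A ∘ₗ comulR k A A = counitR k A A := by
    refine TensorProduct.ext' fun a b ↦ ?_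
    have h := congrArg (· * b) (HopfAlgebra.mul_antipode_rTensor_comul_apply (R := k) a)
    have h' : counitR k A A (a ⊗ₜ b) = algebraMap k A (counit a) * b := by
      simp [counitR, Algebra.smul_def]
    rw [h']
    refine Eq.trans ?_ h
    simp only [comulR, LinearMap.comp_apply, LinearMap.rTensor_tmul, LinearEquiv.coe_coe]
    generalize comul (R := k) a = w
    induction w with
    | zero => simp
    | add a b ha hb => simp only [add_tmul, map_add, add_mul, ha, hb]
    | tmul a a' => simp [mul_assoc]
  rw [unshearR, shearR, LinearMap.comp_apply, LinearMap.comp_apply, coactR_lTensor, coactR_coactR,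
    ← LinearMap.lTensor_comp_apply, ← LinearMap.lTensor_comp_apply, LinearMap.comp_assoc, e,
    counitR_coactR]

lemma shearR_unshearR (v : Z ⊗[k] A) : Z.shearR (Z.unshearR v) = v := by
  have e : LinearMap.mul' k A ∘ₗ (LinearMap.mul' k A ∘ₗ
      (HopfAlgebra.antipode k (A := A)).rTensor A).lTensor A ∘ₗ comulR k A A = counitR k A A := by
    refine TensorProduct.ext' fun a b ↦ ?_
    have h := congrArg (· * b) (HopfAlgebra.mul_antipode_lTensor_comul_apply (R := k) a)
    have h' : counitR k A A (a ⊗ₜ b) = algebraMap k A (counit a) * b := by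
      simp [counitR, Algebra.smul_def]
    rw [h']
    refine Eq.trans ?_ h
    simp only [comulR, LinearMap.comp_apply, LinearMap.rTensor_tmul, LinearEquiv.coe_coe]
    generalize comul (R := k) a = w
    induction w with
    | zero => simp
    | add a b ha hb => simp only [add_tmul, map_add, add_mul, ha, hb]
    | tmul a a' => simp [mul_assoc]
  rw [unshearR, shearR, LinearMap.comp_apply, LinearMap.comp_apply, coactR_lTensor, coactR_coactR,
    ← LinearMap.lTensor_comp_apply, ← LinearMap.lTensor_comp_apply, LinearMap.comp_assoc, e,
    counitR_coactR]

lemma unshearL_shearL (v : A ⊗[k] Z) : Z.unshearL (Z.shearL v) = v := by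
  have e : (LinearMap.mul' k A ∘ₗ (HopfAlgebra.antipode k (A := A)).lTensor A) ∘ₗ
      (LinearMap.mul' k A).rTensor A ∘ₗ comulL k A A = counitL k A A := by
    refine TensorProduct.ext' fun b a ↦ ?_
    have h := congrArg (b * ·) (HopfAlgebra.mul_antipode_lTensor_comul_apply (R := k) a)
    have h' : counitL k A A (b ⊗ₜ a) = b * algebraMap k A (counit a) := by
      simp [counitL, Algebra.smul_def, Algebra.commutes]
    rw [h']
    refine Eq.trans ?_ h
    simp only [comulL, LinearMap.comp_apply, LinearMap.lTensor_tmul, LinearEquiv.coe_coe]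
    generalize comul (R := k) a = w
    induction w with
    | zero => simp
    | add a b ha hb => simp only [tmul_add, map_add, mul_add, ha, hb]
    | tmul a a' => simp [mul_assoc]
  rw [unshearL, shearL, LinearMap.comp_apply, LinearMap.comp_apply, coactL_rTensor, coactL_coactL,
    ← LinearMap.rTensor_comp_apply, ← LinearMap.rTensor_comp_apply, LinearMap.comp_assoc, e,
    counitL_coactL]

lemma shearL_unshearL (v : A ⊗[k] Z) : Z.shearL (Z.unshearL v) = v := by
  have e : LinearMap.mul' k A ∘ₗ (LinearMap.mul' k A ∘ₗ
      (HopfAlgebra.antipode k (A := A)).lTensor A).rTensor A ∘ₗ comulL k A A = counitL k A A := by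
    refine TensorProduct.ext' fun b a ↦ ?_
    have h := congrArg (b * ·) (HopfAlgebra.mul_antipode_rTensor_comul_apply (R := k) a)
    have h' : counitL k A A (b ⊗ₜ a) = b * algebraMap k A (counit a) := by
      simp [counitL, Algebra.smul_def, Algebra.commutes]
    rw [h']
    refine Eq.trans ?_ h
    simp only [comulL, LinearMap.comp_apply, LinearMap.lTensor_tmul, LinearEquiv.coe_coe]
    generalize comul (R := k) a = w
    induction w with
    | zero => simp
    | add a b ha hb => simp only [tmul_add, map_add, mul_add, ha, hb]
    | tmul a a' => simp [mul_assoc]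
  rw [unshearL, shearL, LinearMap.comp_apply, LinearMap.comp_apply, coactL_rTensor, coactL_coactL,
    ← LinearMap.rTensor_comp_apply, ← LinearMap.rTensor_comp_apply, LinearMap.comp_assoc, e,
    counitL_coactL]

lemma shearR_injective : Function.Injective Z.shearR :=
  Function.LeftInverse.injective (unshearR_shearR Z)

lemma shearL_injective : Function.Injective Z.shearL :=
  Function.LeftInverse.injective (unshearL_shearL Z)

/-- `z₀ ⊗ z₁ S(z₂) = z ⊗ 1` -/
lemma shearR_antipode (z : Z) :
    Z.shearR ((HopfAlgebra.antipode k (A := A)).lTensor Z (Z.rcoact z)) = z ⊗ₜ 1 := by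
  rw [← shearR_unshearR Z (z ⊗ₜ 1)]
  congr 1
  rw [unshearR, LinearMap.comp_apply, coactR_tmul]
  generalize Z.rcoact z = w
  induction w with
  | zero => simp only [zero_tmul, map_zero]
  | add a b ha hb => simp only [add_tmul, map_add, ha, hb]
  | tmul z a => simp

/-- `S(z₋₂) z₋₁ ⊗ z₀ = 1 ⊗ z` -/
lemma shearL_antipode (z : Z) :
    Z.shearL ((HopfAlgebra.antipode k (A := A)).rTensor Z (Z.lcoact z)) = 1 ⊗ₜ z := by
  rw [← shearL_unshearL Z (1 ⊗ₜ z)]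
  congr 1
  rw [unshearL, LinearMap.comp_apply, coactL_tmul]
  generalize Z.lcoact z = w
  induction w with
  | zero => simp only [tmul_zero, map_zero]
  | add a b ha hb => simp only [tmul_add, map_add, ha, hb]
  | tmul z a => simp

lemma shearR_tmul (z : Z) (c : A) : Z.shearR (z ⊗ₜ c) = Z.rcoact z * (1 ⊗ₜ c) := by
  rw [shearR, LinearMap.comp_apply, coactR_tmul]
  generalize Z.rcoact z = w
  induction w with
  | zero => simp only [zero_tmul, map_zero, zero_mul]
  | add a b ha hb => simp only [add_tmul, map_add, add_mul, ha, hb]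
  | tmul z a => simp

lemma shearL_tmul (z : Z) (c : A) : Z.shearL (c ⊗ₜ z) = (c ⊗ₜ 1) * Z.lcoact z := by
  rw [shearL, LinearMap.comp_apply, coactL_tmul]
  generalize Z.lcoact z = w
  induction w with
  | zero => simp only [tmul_zero, map_zero, mul_zero]
  | add a b ha hb => simp only [tmul_add, map_add, mul_add, ha, hb]
  | tmul z a => simp

end Coact

/-! ### The equations of the inverse object in `Z ⊗ (A ⊗ Y ⊗ A)` -/

section Right

variable (Z : BicomoduleAlgebra k A) {Y C : Type v} [Ring Y] [Algebra k Y] [Ring C] [Algebra k C]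
  (S : A →ₐ[k] C) (ρ : Y →ₐ[k] C ⊗[k] Y) (l : Y →ₐ[k] Y ⊗[k] C)

/-- `y ⊗ b ↦ y₁ ⊗ (y₀ ⊗ b)` -/
def coactFst : Y ⊗[k] A →ₗ[k] C ⊗[k] (Y ⊗[k] A) :=
  (TensorProduct.assoc k C Y A).toLinearMap ∘ₗ ρ.toLinearMap.rTensor A

/-- `y ⊗ b ↦ y₀ ⊗ (y₋₁ ⊗ b)` -/
def coactSnd : Y ⊗[k] A →ₗ[k] Y ⊗[k] (C ⊗[k] A) :=
  (TensorProduct.assoc k Y C A).toLinearMap ∘ₗ l.toLinearMap.rTensor A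

lemma assoc_comp_leftAntipode :
    (TensorProduct.assoc k A C (Y ⊗[k] A)).toLinearMap ∘ₗ (leftAntipode Y S).toLinearMap =
      (S.toLinearMap.rTensor (Y ⊗[k] A)).lTensor A ∘ₗ comulR k A (Y ⊗[k] A) := by
  refine TensorProduct.ext' fun a q ↦ ?_
  change TensorProduct.assoc k A C (Y ⊗[k] A) (S.toLinearMap.lTensor A (comul a) ⊗ₜ q) =
    (S.toLinearMap.rTensor (Y ⊗[k] A)).lTensor A
      (TensorProduct.assoc k A A (Y ⊗[k] A) (comul a ⊗ₜ q))
  generalize comul (R := k) a = w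
  induction w with
  | zero => simp only [zero_tmul, map_zero]
  | add a b ha hb => simp only [add_tmul, map_add, ha, hb]
  | tmul a b => rfl

lemma assoc_comp_leftCoaction :
    (TensorProduct.assoc k A C (Y ⊗[k] A)).toLinearMap ∘ₗ (leftCoaction ρ).toLinearMap =
      (coactFst (A := A) ρ).lTensor A :=
  TensorProduct.ext' fun a q ↦ (TensorProduct.assoc k A C (Y ⊗[k] A)).apply_symm_apply
    (a ⊗ₜ coactFst ρ q)

lemma rightAntipode_eq : (rightAntipode Y S).toLinearMap =
    ((antipodeLeft S).toLinearMap.lTensor Y).lTensor A := rfl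

lemma rightCoaction_eq : (rightCoaction l).toLinearMap = (coactSnd (A := A) l).lTensor A := rfl

/-- The equations cutting out the inverse object, on elements coming from `Z ⊗ (Y ⊗ A)`. -/
lemma coactR_conditions_iff (v : Z ⊗[k] (Y ⊗[k] A)) :
    ((leftAntipode Y S).toLinearMap.lTensor Z (Z.coactR (Y ⊗[k] A) v) =
        (leftCoaction ρ).toLinearMap.lTensor Z (Z.coactR (Y ⊗[k] A) v) ∧
      (rightAntipode Y S).toLinearMap.lTensor Z (Z.coactR (Y ⊗[k] A) v) =
        (rightCoaction l).toLinearMap.lTensor Z (Z.coactR (Y ⊗[k] A) v)) ↔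
    (S.toLinearMap.rTensor (Y ⊗[k] A)).lTensor Z (Z.coactR (Y ⊗[k] A) v) =
        (coactFst ρ).lTensor Z v ∧
      ((antipodeLeft S).toLinearMap.lTensor Y).lTensor Z v = (coactSnd l).lTensor Z v := by
  refine and_congr ?_ ?_
  · have hE : Function.Injective
        ((TensorProduct.assoc k A C (Y ⊗[k] A)).toLinearMap.lTensor Z) :=
      ((TensorProduct.assoc k A C (Y ⊗[k] A)).lTensor Z).injective
    rw [← hE.eq_iff, ← LinearMap.lTensor_comp_apply, ← LinearMap.lTensor_comp_apply,
      assoc_comp_leftAntipode, assoc_comp_leftCoaction, LinearMap.lTensor_comp_apply,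
      ← coactR_coactR, ← coactR_lTensor, ← coactR_lTensor,
      (coactR_injective Z (C ⊗[k] (Y ⊗[k] A))).eq_iff]
  · rw [rightAntipode_eq, rightCoaction_eq, ← coactR_lTensor, ← coactR_lTensor,
      (coactR_injective Z (Y ⊗[k] (C ⊗[k] A))).eq_iff]

variable (p : Y ≃ₗ[k] Z) (q : C ≃ₗ[k] A)

/-- `x ⊗ y ↦ λ(x) (1 ⊗ y)`, where `y` is read in `Z`. -/
def kappaLOp : Z ⊗[k] Y →ₗ[k] A ⊗[k] Z := Z.kappaL ∘ₗ p.toLinearMap.lTensor Z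

lemma kappaLOp_tmul (x : Z) (y : Y) :
    kappaLOp Z p (x ⊗ₜ y) = Z.lcoact x * (1 ⊗ₜ p y) := kappaL_tmul Z x (p y)

/-- `x ⊗ c ⊗ y ⊗ b ↦ x₋₁ ⊗ x₀ y ⊗ x₁ c ⊗ b`. This injective map turns the first equation of the
inverse object, on elements of `Z ⊗ (Y ⊗ A)`, into coinvariance in the factor `Z` of
`κ(x ⊗ y) ⊗ b`. -/
def transferFst : Z ⊗[k] (C ⊗[k] (Y ⊗[k] A)) →ₗ[k] (A ⊗[k] Z) ⊗[k] (A ⊗[k] A) :=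
  (kappaLOp Z p).rTensor (A ⊗[k] A) ∘ₗ (TensorProduct.tensorTensorTensorComm k Z A Y A).toLinearMap
    ∘ₗ (Z.shearR ∘ₗ q.toLinearMap.lTensor Z).rTensor (Y ⊗[k] A) ∘ₗ
      (TensorProduct.assoc k Z C (Y ⊗[k] A)).symm.toLinearMap

lemma transferFst_tmul (x : Z) (c : C) (y : Y) (b : A) :
    transferFst Z p q (x ⊗ₜ (c ⊗ₜ (y ⊗ₜ b))) = (kappaLOp Z p).rTensor (A ⊗[k] A)
      (TensorProduct.tensorTensorTensorComm k Z A Y A (Z.shearR (x ⊗ₜ q c) ⊗ₜ (y ⊗ₜ b))) := rfl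

/-- The algebra map `a ⊗ z ↦ a ⊗ z₀ ⊗ z₁`. -/
def rcoactSnd : A ⊗[k] Z →ₐ[k] (A ⊗[k] Z) ⊗[k] A :=
  (Algebra.TensorProduct.assoc k k k A Z A).symm.toAlgHom.comp
    (Algebra.TensorProduct.map (AlgHom.id k A) Z.rcoact)

lemma rcoactSnd_kappaL (x y : Z) : rcoactSnd Z (Z.kappaL (x ⊗ₜ y)) =
    Algebra.TensorProduct.map Z.lcoact (AlgHom.id k A) (Z.rcoact x) *
      Algebra.TensorProduct.map Algebra.TensorProduct.includeRight (AlgHom.id k A)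
        (Z.rcoact y) := by
  rw [kappaL_tmul, map_mul]
  congr 1
  · exact ((TensorProduct.assoc k A Z A).symm_apply_eq.2 (Z.bicomodule x).symm)

/-- `x ⊗ y ⊗ b ↦ κ(x ⊗ y) ⊗ b` -/
def kappaLFst : Z ⊗[k] (Y ⊗[k] A) →ₗ[k] (A ⊗[k] Z) ⊗[k] A :=
  (kappaLOp Z p).rTensor A ∘ₗ (TensorProduct.assoc k Z Y A).symm.toLinearMap

variable {S ρ l p q}

lemma transferFst_antipode (hS : ∀ a, q (S a) = HopfAlgebra.antipode k a)
    (v : Z ⊗[k] (Y ⊗[k] A)) :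
    transferFst Z p q ((S.toLinearMap.rTensor (Y ⊗[k] A)).lTensor Z (Z.coactR (Y ⊗[k] A) v)) =
      (TensorProduct.mk k A A 1).lTensor (A ⊗[k] Z) (kappaLFst Z p v) := by
  refine LinearMap.congr_fun (f := transferFst Z p q ∘ₗ
    (S.toLinearMap.rTensor (Y ⊗[k] A)).lTensor Z ∘ₗ Z.coactR (Y ⊗[k] A))
    (g := (TensorProduct.mk k A A 1).lTensor (A ⊗[k] Z) ∘ₗ kappaLFst Z p)
    (TensorProduct.ext_threefold' fun x y b ↦ ?_) v
  have h : ∀ w : Z ⊗[k] A, transferFst Z p q ((S.toLinearMap.rTensor (Y ⊗[k] A)).lTensor Z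
      (TensorProduct.assoc k Z A (Y ⊗[k] A) (w ⊗ₜ (y ⊗ₜ b)))) =
      (kappaLOp Z p).rTensor (A ⊗[k] A) (TensorProduct.tensorTensorTensorComm k Z A Y A
        (Z.shearR ((HopfAlgebra.antipode k (A := A)).lTensor Z w) ⊗ₜ (y ⊗ₜ b))) := by
    intro w
    induction w with
    | zero => simp only [zero_tmul, map_zero]
    | add a b ha hb => simp only [add_tmul, map_add, ha, hb]
    | tmul z a =>
      rw [LinearMap.lTensor_tmul, ← hS]
      rfl
  refine (h (Z.rcoact x)).trans ?_
  rw [shearR_antipode]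
  rfl

lemma transferFst_coaction (hρ : ∀ y, TensorProduct.map q.toLinearMap p.toLinearMap (ρ y) =
      TensorProduct.comm k Z A (Z.rcoact (p y))) (v : Z ⊗[k] (Y ⊗[k] A)) :
    transferFst Z p q ((coactFst ρ).lTensor Z v) =
      TensorProduct.assoc k (A ⊗[k] Z) A A
        ((rcoactSnd Z).toLinearMap.rTensor A (kappaLFst Z p v)) := by
  refine LinearMap.congr_fun (f := transferFst Z p q ∘ₗ (coactFst ρ).lTensor Z)
    (g := (TensorProduct.assoc k (A ⊗[k] Z) A A).toLinearMap ∘ₗ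
      (rcoactSnd Z).toLinearMap.rTensor A ∘ₗ kappaLFst Z p)
    (TensorProduct.ext_threefold' fun x y b ↦ ?_) v
  have h1 : ∀ (w : Z ⊗[k] A) (c : C) (y : Y), (kappaLOp Z p).rTensor (A ⊗[k] A)
      (TensorProduct.tensorTensorTensorComm k Z A Y A ((w * (1 ⊗ₜ q c)) ⊗ₜ (y ⊗ₜ b))) =
      TensorProduct.assoc k (A ⊗[k] Z) A A
        ((Algebra.TensorProduct.map Z.lcoact (AlgHom.id k A) w *
          Algebra.TensorProduct.map Algebra.TensorProduct.includeRight (AlgHom.id k A)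
            (p y ⊗ₜ q c)) ⊗ₜ b) := by
    intro w c y
    induction w with
    | zero => simp only [zero_mul, zero_tmul, map_zero]
    | add a b ha hb => simp only [add_mul, add_tmul, map_add, ha, hb]
    | tmul z a =>
      simp only [Algebra.TensorProduct.tmul_mul_tmul, mul_one, Algebra.TensorProduct.map_tmul,
        TensorProduct.tensorTensorTensorComm_tmul, LinearMap.rTensor_tmul, kappaLOp_tmul,
        AlgHom.id_apply, Algebra.TensorProduct.includeRight_apply, TensorProduct.assoc_tmul]
  have h2 : ∀ t : C ⊗[k] Y, transferFst Z p q (x ⊗ₜ TensorProduct.assoc k C Y A (t ⊗ₜ b)) =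
      TensorProduct.assoc k (A ⊗[k] Z) A A
        ((Algebra.TensorProduct.map Z.lcoact (AlgHom.id k A) (Z.rcoact x) *
          Algebra.TensorProduct.map Algebra.TensorProduct.includeRight (AlgHom.id k A)
            ((TensorProduct.comm k Z A).symm
              (TensorProduct.map q.toLinearMap p.toLinearMap t))) ⊗ₜ b) := by
    intro t
    induction t with
    | zero => simp only [zero_tmul, map_zero, tmul_zero, mul_zero]
    | add a b ha hb => simp only [add_tmul, map_add, tmul_add, mul_add, ha, hb]
    | tmul c y =>
      rw [TensorProduct.assoc_tmul, transferFst_tmul, shearR_tmul, h1]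
      rfl
  refine (h2 (ρ y)).trans ?_
  rw [hρ, LinearEquiv.symm_apply_apply, ← rcoactSnd_kappaL]
  rfl

end Right

section Right

variable (Z : BicomoduleAlgebra k A) {Y C : Type v} [Ring Y] [Algebra k Y] [Ring C] [Algebra k C]
  (S : A →ₐ[k] C) (ρ : Y →ₐ[k] C ⊗[k] Y) (l : Y →ₐ[k] Y ⊗[k] C) (p : Y ≃ₗ[k] Z) (q : C ≃ₗ[k] A)

lemma shearR_bijective : Function.Bijective Z.shearR :=
  ⟨shearR_injective Z, Function.RightInverse.surjective (shearR_unshearR Z)⟩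

lemma shearL_bijective : Function.Bijective Z.shearL :=
  ⟨shearL_injective Z, Function.RightInverse.surjective (shearL_unshearL Z)⟩

variable (k A) in
/-- `a ⊗ c ↦ a₁ ⊗ a₂ c` -/
def comulShearR : A ⊗[k] A →ₗ[k] A ⊗[k] A := (unit k A).shearR

variable (k A) in
/-- `c ⊗ a ↦ c a₁ ⊗ a₂` -/
def comulShearL : A ⊗[k] A →ₗ[k] A ⊗[k] A := (unit k A).shearL

lemma comulShearR_tmul (a c : A) : comulShearR k A (a ⊗ₜ c) = comul (R := k) a * (1 ⊗ₜ c) :=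
  shearR_tmul (unit k A) a c

lemma comulShearL_tmul (c a : A) : comulShearL k A (c ⊗ₜ a) = (c ⊗ₜ 1) * comul (R := k) a :=
  shearL_tmul (unit k A) a c

lemma comulShearR_bijective : Function.Bijective (comulShearR k A) := shearR_bijective (unit k A)

lemma comulShearL_bijective : Function.Bijective (comulShearL k A) := shearL_bijective (unit k A)

lemma comulShearR_antipode (a : A) :
    comulShearR k A ((HopfAlgebra.antipode k (A := A)).lTensor A (comul a)) = a ⊗ₜ 1 :=
  shearR_antipode (unit k A) a

lemma comulShearL_antipode (a : A) :
    comulShearL k A ((HopfAlgebra.antipode k (A := A)).rTensor A (comul a)) = 1 ⊗ₜ a :=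
  shearL_antipode (unit k A) a

/-- `x ⊗ y ⊗ c ⊗ b ↦ x₋₂ ⊗ x₋₁ c b₁ ⊗ x₀ y ⊗ b₂`. This injective map turns the second equation of
the inverse object, on elements whose image under `κ` is in `A ⊗ 1 ⊗ A`, into the condition that
cuts out `A □ A` in `A ⊗ A`. -/
def transferSnd : Z ⊗[k] (Y ⊗[k] (C ⊗[k] A)) →ₗ[k] (A ⊗[k] A) ⊗[k] (Z ⊗[k] A) :=
  (comulShearR k A).rTensor (Z ⊗[k] A) ∘ₗ
    (TensorProduct.tensorTensorTensorComm k A Z A A).toLinearMap ∘ₗ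
      TensorProduct.map (kappaLOp Z p) ((comulShearL k A) ∘ₗ q.toLinearMap.rTensor A) ∘ₗ
        (TensorProduct.assoc k Z Y (C ⊗[k] A)).symm.toLinearMap

lemma transferSnd_tmul (x : Z) (y : Y) (w : C ⊗[k] A) :
    transferSnd Z p q (x ⊗ₜ (y ⊗ₜ w)) = (comulShearR k A).rTensor (Z ⊗[k] A)
      (TensorProduct.tensorTensorTensorComm k A Z A A
        (kappaLOp Z p (x ⊗ₜ y) ⊗ₜ (comulShearL k A) (q.toLinearMap.rTensor A w))) := rfl

variable (k) in
/-- `(a ⊗ c) ⊗ z ⊗ b ↦ (a ⊗ c b₁) ⊗ (z ⊗ b₂)` -/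
def mulComul (M : Type v) [AddCommGroup M] [Module k M] :
    ((A ⊗[k] A) ⊗[k] M) ⊗[k] A →ₗ[k] (A ⊗[k] A) ⊗[k] (M ⊗[k] A) :=
  ((LinearMap.mul' k A).lTensor A ∘ₗ (TensorProduct.assoc k A A A).toLinearMap).rTensor
    (M ⊗[k] A) ∘ₗ (TensorProduct.tensorTensorTensorComm k (A ⊗[k] A) M A A).toLinearMap ∘ₗ
      comul.lTensor ((A ⊗[k] A) ⊗[k] M)

variable {S l p q}

lemma transferSnd_antipode (hS : ∀ a, q (S a) = HopfAlgebra.antipode k a)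
    (v : Z ⊗[k] (Y ⊗[k] A)) :
    transferSnd Z p q (((antipodeLeft S).toLinearMap.lTensor Y).lTensor Z v) =
      comul.rTensor (Z ⊗[k] A) (TensorProduct.assoc k A Z A (kappaLFst Z p v)) := by
  refine LinearMap.congr_fun (f := transferSnd Z p q ∘ₗ
    ((antipodeLeft S).toLinearMap.lTensor Y).lTensor Z)
    (g := comul.rTensor (Z ⊗[k] A) ∘ₗ (TensorProduct.assoc k A Z A).toLinearMap ∘ₗ kappaLFst Z p)
    (TensorProduct.ext_threefold' fun x y b ↦ ?_) v
  have h : ∀ w : A ⊗[k] A, q.toLinearMap.rTensor A (S.toLinearMap.rTensor A w) =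
      (HopfAlgebra.antipode k (A := A)).rTensor A w := by
    intro w
    rw [← LinearMap.rTensor_comp_apply]
    congr 2
    exact LinearMap.ext hS
  change transferSnd Z p q (x ⊗ₜ (y ⊗ₜ (S.toLinearMap.rTensor A (comul b)))) =
    comul.rTensor (Z ⊗[k] A) (TensorProduct.assoc k A Z A (kappaLOp Z p (x ⊗ₜ y) ⊗ₜ b))
  rw [transferSnd_tmul, h, comulShearL_antipode]
  generalize kappaLOp Z p (x ⊗ₜ y) = w
  induction w with
  | zero => simp only [zero_tmul, map_zero]
  | add a b ha hb => simp only [add_tmul, map_add, ha, hb]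
  | tmul a z =>
    refine (congrArg (· ⊗ₜ[k] (z ⊗ₜ[k] b)) (comulShearR_tmul a 1)).trans ?_
    exact congrArg (· ⊗ₜ[k] (z ⊗ₜ[k] b)) (mul_one (comul (R := k) a))

lemma transferSnd_coaction (hl : ∀ y, TensorProduct.map p.toLinearMap q.toLinearMap (l y) =
      TensorProduct.comm k A Z (Z.lcoact (p y))) (v : Z ⊗[k] (Y ⊗[k] A)) :
    transferSnd Z p q ((coactSnd l).lTensor Z v) =
      mulComul k Z ((Z.coactL A).rTensor A (kappaLFst Z p v)) := by
  refine LinearMap.congr_fun (f := transferSnd Z p q ∘ₗ (coactSnd l).lTensor Z)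
    (g := mulComul k Z ∘ₗ (Z.coactL A).rTensor A ∘ₗ kappaLFst Z p)
    (TensorProduct.ext_threefold' fun x y b ↦ ?_) v
  -- `(a ⊗ z) ⊗ (c ⊗ z') ↦ (a₁ ⊗ a₂ c) ⊗ z z'`
  let H : (A ⊗[k] Z) ⊗[k] (A ⊗[k] Z) →ₗ[k] (A ⊗[k] A) ⊗[k] Z :=
    TensorProduct.map (comulShearR k A) (LinearMap.mul' k Z) ∘ₗ
      (TensorProduct.tensorTensorTensorComm k A Z A Z).toLinearMap
  have h1 : ∀ t : Y ⊗[k] C, transferSnd Z p q (x ⊗ₜ TensorProduct.assoc k Y C A (t ⊗ₜ b)) =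
      mulComul k Z (H (Z.lcoact x ⊗ₜ ((TensorProduct.comm k A Z).symm
        (TensorProduct.map p.toLinearMap q.toLinearMap t))) ⊗ₜ b) := by
    intro t
    induction t with
    | zero => simp only [zero_tmul, map_zero, tmul_zero]
    | add a b ha hb => simp only [add_tmul, map_add, tmul_add, ha, hb]
    | tmul y c =>
      rw [TensorProduct.assoc_tmul, transferSnd_tmul, kappaLOp_tmul]
      change (comulShearR k A).rTensor (Z ⊗[k] A) (TensorProduct.tensorTensorTensorComm k A Z A A
        ((Z.lcoact x * (1 ⊗ₜ p y)) ⊗ₜ (comulShearL k A) (q c ⊗ₜ b))) =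
          mulComul k Z (H (Z.lcoact x ⊗ₜ (q c ⊗ₜ p y)) ⊗ₜ b)
      rw [comulShearL_tmul]
      generalize Z.lcoact x = s
      induction s with
      | zero => simp only [zero_tmul, map_zero, zero_mul]
      | add a b ha hb => simp only [add_tmul, add_mul, map_add, ha, hb]
      | tmul a z =>
        rw [show H ((a ⊗ₜ z) ⊗ₜ (q c ⊗ₜ p y)) = (comul (R := k) a * (1 ⊗ₜ q c)) ⊗ₜ (z * p y) from
          congrArg (· ⊗ₜ[k] (z * p y)) (comulShearR_tmul a (q c))]
        rw [Algebra.TensorProduct.tmul_mul_tmul, mul_one, mulComul, LinearMap.comp_apply,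
          LinearMap.comp_apply, LinearMap.lTensor_tmul]
        generalize comul (R := k) b = r
        induction r with
        | zero => simp only [tmul_zero, map_zero, mul_zero]
        | add a b ha hb => simp only [tmul_add, mul_add, map_add, ha, hb]
        | tmul b b' =>
          rw [Algebra.TensorProduct.tmul_mul_tmul, one_mul]
          refine (congrArg (· ⊗ₜ[k] ((z * p y) ⊗ₜ[k] b'))
            (comulShearR_tmul a (q c * b))).trans ?_
          refine congrArg (· ⊗ₜ[k] ((z * p y) ⊗ₜ[k] b')) ?_
          change comul (R := k) a * (1 ⊗ₜ (q c * b)) = (LinearMap.mul' k A).lTensor A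
            (TensorProduct.assoc k A A A ((comul (R := k) a * (1 ⊗ₜ q c)) ⊗ₜ b))
          generalize comul (R := k) a = e
          induction e with
          | zero => simp only [zero_tmul, map_zero, zero_mul]
          | add a b ha hb => simp only [add_tmul, add_mul, map_add, ha, hb]
          | tmul e e' => simp [mul_assoc]
  have h2 : ∀ s : A ⊗[k] Z, H (Z.lcoact x ⊗ₜ s) =
      (TensorProduct.assoc k A A Z).symm (Z.lcoact.toLinearMap.lTensor A (Z.lcoact x) *
        1 ⊗ₜ s) := by
    intro s
    rw [← Z.lcoassoc]
    induction s with
    | zero => simp only [tmul_zero, map_zero, mul_zero]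
    | add a b ha hb => simp only [tmul_add, mul_add, map_add, ha, hb]
    | tmul c z' =>
      generalize Z.lcoact x = s
      induction s with
      | zero => simp only [zero_tmul, map_zero, zero_mul]
      | add a b ha hb => simp only [add_tmul, add_mul, map_add, ha, hb]
      | tmul a z =>
        rw [show H ((a ⊗ₜ z) ⊗ₜ (c ⊗ₜ z')) = (comul (R := k) a * (1 ⊗ₜ c)) ⊗ₜ (z * z') from
          congrArg (· ⊗ₜ[k] (z * z')) (comulShearR_tmul a c), LinearMap.rTensor_tmul]
        generalize comul (R := k) a = e
        induction e with
        | zero => simp only [zero_tmul, map_zero, zero_mul]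
        | add a b ha hb => simp only [add_tmul, add_mul, map_add, ha, hb]
        | tmul e e' => simp
  refine (h1 (l y)).trans ?_
  rw [hl, LinearEquiv.symm_apply_apply, h2]
  change _ = mulComul k Z (Z.coactL A (kappaLOp Z p (x ⊗ₜ y)) ⊗ₜ b)
  rw [kappaLOp_tmul]
  congr 2
  change _ = (TensorProduct.assoc k A A Z).symm (Z.lcoact.toLinearMap.lTensor A _)
  congr 1
  generalize Z.lcoact x = s
  induction s with
  | zero => simp only [map_zero, zero_mul]
  | add a b ha hb => simp only [add_mul, map_add, ha, hb]
  | tmul a z => simp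

lemma kappaLOp_bijective (hZ : Function.Bijective Z.kappaL) :
    Function.Bijective (kappaLOp Z p) :=
  hZ.comp (p.lTensor Z).bijective

lemma kappaLFst_bijective (hZ : Function.Bijective Z.kappaL) :
    Function.Bijective (kappaLFst (A := A) Z p) :=
  ((LinearEquiv.ofBijective _ (kappaLOp_bijective Z (p := p) hZ)).rTensor A).bijective.comp
    (TensorProduct.assoc k Z Y A).symm.bijective

lemma transferFst_injective (hZ : Function.Bijective Z.kappaL) :
    Function.Injective (transferFst Z p q) :=
  ((LinearEquiv.ofBijective _ (kappaLOp_bijective Z (p := p) hZ)).rTensor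
    (A ⊗[k] A)).injective.comp ((TensorProduct.tensorTensorTensorComm k Z A Y A).injective.comp
      ((((q.lTensor Z).trans (LinearEquiv.ofBijective _ (shearR_bijective Z))).rTensor
        (Y ⊗[k] A)).injective.comp (TensorProduct.assoc k Z C (Y ⊗[k] A)).symm.injective))

lemma transferSnd_injective (hZ : Function.Bijective Z.kappaL) :
    Function.Injective (transferSnd Z p q) :=
  ((LinearEquiv.ofBijective _ comulShearR_bijective).rTensor
    (Z ⊗[k] A)).injective.comp ((TensorProduct.tensorTensorTensorComm k A Z A A).injective.comp
      ((TensorProduct.congr (LinearEquiv.ofBijective _ (kappaLOp_bijective Z (p := p) hZ))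
        ((q.rTensor A).trans
          (LinearEquiv.ofBijective _ comulShearL_bijective))).injective.comp
            (TensorProduct.assoc k Z Y (C ⊗[k] A)).symm.injective))

end Right

/-! ### The cotensor product of a Galois object with its inverse -/

section Right

variable (Z : BicomoduleAlgebra k A) {Y C : Type v} [Ring Y] [Algebra k Y] [Ring C] [Algebra k C]

/-- `Y` and `C` are, via `p` and `q`, the opposite algebras of `Z` and `A`, the map `S` is the
antipode, and `ρ` and `l` are the coactions of `Z` with the tensor factors exchanged. -/
structure IsOpposite (S : A →ₐ[k] C) (ρ : Y →ₐ[k] C ⊗[k] Y) (l : Y →ₐ[k] Y ⊗[k] C)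
    (p : Y ≃ₗ[k] Z) (q : C ≃ₗ[k] A) : Prop where
  antipode : ∀ a, q (S a) = HopfAlgebra.antipode k a
  rcoact : ∀ y, TensorProduct.map q.toLinearMap p.toLinearMap (ρ y) =
    TensorProduct.comm k Z A (Z.rcoact (p y))
  lcoact : ∀ y, TensorProduct.map p.toLinearMap q.toLinearMap (l y) =
    TensorProduct.comm k A Z (Z.lcoact (p y))
  mul : ∀ y y', p (y * y') = p y' * p y
  one : p 1 = 1

variable {Z} {S : A →ₐ[k] C} {ρ : Y →ₐ[k] C ⊗[k] Y} {l : Y →ₐ[k] Y ⊗[k] C}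
  {p : Y ≃ₗ[k] Z} {q : C ≃ₗ[k] A}

/-- `Y` stands for the opposite algebra of `Z`, which makes `b ↦ κ⁻¹(b ⊗ 1)` multiplicative. -/
lemma kappaLOp_mul (h : IsOpposite Z S ρ l p q) (t t' : Z ⊗[k] Y) {b : A}
    (hb : kappaLOp Z p t' = b ⊗ₜ 1) : kappaLOp Z p (t * t') = kappaLOp Z p t * (b ⊗ₜ 1) := by
  rw [← hb]
  induction t with
  | zero => simp only [map_zero, zero_mul]
  | add x y hx hy => simp only [map_add, add_mul, hx, hy]
  | tmul x y =>
    have e : ∀ t' : Z ⊗[k] Y, kappaLOp Z p ((x ⊗ₜ y) * t') =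
        Z.lcoact x * kappaLOp Z p t' * (1 ⊗ₜ p y) := by
      intro t'
      induction t' with
      | zero => simp only [map_zero, mul_zero, zero_mul]
      | add x y hx hy => simp only [map_add, mul_add, add_mul, hx, hy]
      | tmul x' y' =>
        rw [Algebra.TensorProduct.tmul_mul_tmul, kappaLOp_tmul, kappaLOp_tmul, h.mul, map_mul,
          mul_assoc, mul_assoc, mul_assoc, Algebra.TensorProduct.tmul_mul_tmul, mul_one]
    rw [e, kappaLOp_tmul, hb, mul_assoc, mul_assoc, Algebra.TensorProduct.tmul_mul_tmul,
      Algebra.TensorProduct.tmul_mul_tmul, one_mul, mul_one, one_mul, mul_one]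

variable (hZ : Function.Bijective Z.kappaL)

/-- The algebra map `A → Z ⊗ Y` with `b ↦ κ⁻¹(b ⊗ 1)`. -/
def translationL (h : IsOpposite Z S ρ l p q) : A →ₐ[k] Z ⊗[k] Y :=
  AlgHom.ofLinearMap ((LinearEquiv.ofBijective _ (kappaLOp_bijective Z (p := p) hZ)).symm ∘ₗ
    (TensorProduct.mk k A Z).flip 1)
    ((LinearEquiv.symm_apply_eq _).2 (by
      change (1 : A) ⊗ₜ[k] (1 : Z) = kappaLOp Z p (1 ⊗ₜ 1)
      rw [kappaLOp_tmul, map_one Z.lcoact, h.one, one_mul]))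
    (fun a b ↦ (LinearEquiv.symm_apply_eq _).2 (by
      have e : ∀ b, kappaLOp Z p ((LinearEquiv.ofBijective _
          (kappaLOp_bijective Z (p := p) hZ)).symm (b ⊗ₜ 1)) = b ⊗ₜ 1 := fun b ↦
        (LinearEquiv.ofBijective _ (kappaLOp_bijective Z (p := p) hZ)).apply_symm_apply (b ⊗ₜ 1)
      refine Eq.symm ((kappaLOp_mul h _ _ (e b)).trans ?_)
      refine (congrArg (· * (b ⊗ₜ[k] (1 : Z))) (e a)).trans ?_
      rw [Algebra.TensorProduct.tmul_mul_tmul, mul_one]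
      rfl))

lemma kappaLOp_translationL (h : IsOpposite Z S ρ l p q) (b : A) :
    kappaLOp Z p (translationL hZ h b) = b ⊗ₜ 1 :=
  (LinearEquiv.ofBijective _ (kappaLOp_bijective Z (p := p) hZ)).apply_symm_apply (b ⊗ₜ 1)

lemma lTensor_kappaLOp_lcoact (t : Z ⊗[k] Y) :
    (kappaLOp Z p).lTensor A (TensorProduct.assoc k A Z Y (Z.lcoact.toLinearMap.rTensor Y t)) =
      TensorProduct.assoc k A A Z (comul.rTensor Z (kappaLOp Z p t)) := by
  induction t with
  | zero => simp only [map_zero]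
  | add x y hx hy => simp only [map_add, hx, hy]
  | tmul x y =>
    rw [kappaLOp_tmul]
    have e : TensorProduct.assoc k A A Z (comul.rTensor Z (Z.lcoact x * (1 ⊗ₜ p y))) =
        TensorProduct.assoc k A A Z (comul.rTensor Z (Z.lcoact x)) * (1 ⊗ₜ (1 ⊗ₜ p y)) := by
      generalize Z.lcoact x = s
      induction s with
      | zero => simp only [map_zero, zero_mul]
      | add a b ha hb => simp only [add_mul, map_add, ha, hb]
      | tmul a z =>
        rw [Algebra.TensorProduct.tmul_mul_tmul, mul_one, LinearMap.rTensor_tmul,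
          LinearMap.rTensor_tmul]
        generalize comul (R := k) a = w
        induction w with
        | zero => simp only [zero_tmul, map_zero, zero_mul]
        | add a b ha hb => simp only [add_tmul, add_mul, map_add, ha, hb]
        | tmul a b => simp
    rw [e, Z.lcoassoc, LinearMap.rTensor_tmul, AlgHom.toLinearMap_apply]
    generalize Z.lcoact x = s
    induction s with
    | zero => simp only [zero_tmul, map_zero, zero_mul]
    | add a b ha hb => simp only [add_tmul, add_mul, map_add, ha, hb]
    | tmul a z =>
      rw [TensorProduct.assoc_tmul, LinearMap.lTensor_tmul, LinearMap.lTensor_tmul, kappaLOp_tmul,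
        Algebra.TensorProduct.tmul_mul_tmul, mul_one]
      rfl

lemma lcoact_translationL (h : IsOpposite Z S ρ l p q) (b : A) :
    TensorProduct.assoc k A Z Y (Z.lcoact.toLinearMap.rTensor Y (translationL hZ h b)) =
      (translationL hZ h).toLinearMap.lTensor A (comul b) := by
  refine ((LinearEquiv.ofBijective _ (kappaLOp_bijective Z (p := p) hZ)).lTensor A).injective ?_
  refine (lTensor_kappaLOp_lcoact _).trans ?_
  rw [kappaLOp_translationL, LinearMap.rTensor_tmul]
  change _ = (kappaLOp Z p).lTensor A _
  generalize comul (R := k) b = w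
  induction w with
  | zero => simp only [zero_tmul, map_zero]
  | add a b ha hb => simp only [add_tmul, map_add, ha, hb]
  | tmul a b =>
    rw [LinearMap.lTensor_tmul, LinearMap.lTensor_tmul, AlgHom.toLinearMap_apply,
      kappaLOp_translationL, TensorProduct.assoc_tmul]

/-- `a ⊗ b ↦ κ⁻¹(a ⊗ 1) ⊗ b` as an algebra map `A ⊗ A → Z ⊗ (Y ⊗ A)`. -/
def extendL (h : IsOpposite Z S ρ l p q) : A ⊗[k] A →ₐ[k] Z ⊗[k] (Y ⊗[k] A) :=
  (Algebra.TensorProduct.assoc k k k Z Y A).toAlgHom.comp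
    (Algebra.TensorProduct.map (translationL hZ h) (AlgHom.id k A))

lemma extendL_tmul (h : IsOpposite Z S ρ l p q) (a b : A) :
    extendL hZ h (a ⊗ₜ b) = TensorProduct.assoc k Z Y A (translationL hZ h a ⊗ₜ b) := rfl

variable (Z) in
/-- `a ⊗ b ↦ (a ⊗ 1) ⊗ b` -/
def insertOne : A ⊗[k] A →ₗ[k] (A ⊗[k] Z) ⊗[k] A :=
  ((TensorProduct.mk k A Z).flip 1).rTensor A

lemma kappaLFst_extendL (h : IsOpposite Z S ρ l p q) (ω : A ⊗[k] A) :
    kappaLFst Z p (extendL hZ h ω) = insertOne Z ω := by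
  induction ω with
  | zero => simp only [map_zero]
  | add x y hx hy => simp only [map_add, hx, hy]
  | tmul a b =>
    rw [extendL_tmul, kappaLFst, LinearMap.comp_apply, LinearEquiv.coe_coe,
      LinearEquiv.symm_apply_apply, LinearMap.rTensor_tmul, kappaLOp_translationL]
    rfl

lemma lcoact_extendL (h : IsOpposite Z S ρ l p q) (ω : A ⊗[k] A) :
    TensorProduct.assoc k A Z (Y ⊗[k] A)
      (Z.lcoact.toLinearMap.rTensor (Y ⊗[k] A) (extendL hZ h ω)) =
    (extendL hZ h).toLinearMap.lTensor A (TensorProduct.assoc k A A A (comul.rTensor A ω)) := by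
  induction ω with
  | zero => simp only [map_zero]
  | add x y hx hy => simp only [map_add, hx, hy]
  | tmul a b =>
    have e : ∀ t : Z ⊗[k] Y, TensorProduct.assoc k A Z (Y ⊗[k] A)
        (Z.lcoact.toLinearMap.rTensor (Y ⊗[k] A) (TensorProduct.assoc k Z Y A (t ⊗ₜ b))) =
        (((TensorProduct.assoc k Z Y A).toLinearMap ∘ₗ
          (TensorProduct.mk k (Z ⊗[k] Y) A).flip b)).lTensor A
          (TensorProduct.assoc k A Z Y (Z.lcoact.toLinearMap.rTensor Y t)) := by
      intro t
      induction t with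
      | zero => simp only [zero_tmul, map_zero]
      | add a b ha hb => simp only [add_tmul, map_add, ha, hb]
      | tmul x y =>
        rw [TensorProduct.assoc_tmul, LinearMap.rTensor_tmul, LinearMap.rTensor_tmul]
        generalize Z.lcoact.toLinearMap x = s
        induction s with
        | zero => simp only [zero_tmul, map_zero]
        | add a b ha hb => simp only [add_tmul, map_add, ha, hb]
        | tmul a z => rfl
    rw [extendL_tmul, e, lcoact_translationL, LinearMap.rTensor_tmul]
    generalize comul (R := k) a = w
    induction w with
    | zero => simp only [zero_tmul, map_zero]
    | add a b ha hb => simp only [add_tmul, map_add, ha, hb]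
    | tmul a c => rfl

lemma rcoact_extendL (h : IsOpposite Z S ρ l p q) (ω : A ⊗[k] A) :
    (TensorProduct.assoc k Z (Y ⊗[k] A) A).symm
      (((TensorProduct.assoc k Y A A).symm.toLinearMap ∘ₗ comul.lTensor Y).lTensor Z
        (extendL hZ h ω)) =
    (extendL hZ h).toLinearMap.rTensor A
      ((TensorProduct.assoc k A A A).symm (comul.lTensor A ω)) := by
  induction ω with
  | zero => simp only [map_zero]
  | add x y hx hy => simp only [map_add, hx, hy]
  | tmul a b =>
    have e : ∀ w : A ⊗[k] A, (extendL hZ h).toLinearMap.rTensor A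
        ((TensorProduct.assoc k A A A).symm (a ⊗ₜ w)) =
        ((TensorProduct.assoc k Z Y A).toLinearMap ∘ₗ
          TensorProduct.mk k (Z ⊗[k] Y) A (translationL hZ h a)).rTensor A w := by
      intro w
      induction w with
      | zero => simp only [tmul_zero, map_zero]
      | add a b ha hb => simp only [tmul_add, map_add, ha, hb]
      | tmul b c => rfl
    rw [LinearMap.lTensor_tmul, e, extendL_tmul]
    generalize translationL hZ h a = t
    induction t with
    | zero => simp only [zero_tmul, map_zero, LinearMap.comp_zero, LinearMap.rTensor_zero,
        LinearMap.zero_apply]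
    | add x y hx hy =>
      simp only [add_tmul, map_add, LinearMap.comp_add, LinearMap.rTensor_add,
        LinearMap.add_apply, hx, hy]
    | tmul x y =>
      rw [TensorProduct.assoc_tmul, LinearMap.lTensor_tmul, LinearMap.comp_apply,
        LinearMap.lTensor_tmul]
      generalize comul (R := k) b = w
      induction w with
      | zero => simp only [tmul_zero, map_zero]
      | add a b ha hb => simp only [tmul_add, map_add, ha, hb]
      | tmul b c => rfl

lemma insertOne_injective [Module.Flat k A] (hi : Function.Injective (algebraMap k Z)) :
    Function.Injective (insertOne (A := A) Z) :=
  Module.Flat.rTensor_preserves_injective_linearMap (M := A) _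
    (Algebra.TensorProduct.includeLeft_injective (S := k) (A := A) (B := Z) hi)

/-- Elements of `A ⊗ Z ⊗ A` that are coinvariant in the middle factor come from `A ⊗ A`. -/
lemma exists_insertOne_eq [Module.Flat k A]
    (hc : ∀ z : Z, Z.rcoact z = z ⊗ₜ 1 → ∃ c : k, algebraMap k Z c = z)
    {w : (A ⊗[k] Z) ⊗[k] A} (hw : (TensorProduct.mk k A A 1).lTensor (A ⊗[k] Z) w =
      TensorProduct.assoc k (A ⊗[k] Z) A A ((rcoactSnd Z).toLinearMap.rTensor A w)) :
    ∃ ω, insertOne Z ω = w := by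
  have hex : Function.Exact (Algebra.linearMap k Z)
      ((TensorProduct.mk k Z A).flip 1 - Z.rcoact.toLinearMap) := by
    intro z
    refine ⟨fun hz ↦ hc z (sub_eq_zero.1
      (show z ⊗ₜ[k] (1 : A) - Z.rcoact z = 0 from hz)).symm, ?_⟩
    rintro ⟨c, rfl⟩
    change algebraMap k Z c ⊗ₜ 1 - Z.rcoact (algebraMap k Z c) = 0
    rw [Z.rcoact.commutes]
    exact sub_self _
  obtain ⟨u, rfl⟩ := (Module.Flat.rTensor_exact A (Module.Flat.lTensor_exact A hex) w).1 (by
    rw [LinearMap.lTensor_sub, LinearMap.rTensor_sub]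
    refine sub_eq_zero.2 (show (((TensorProduct.mk k Z A).flip 1).lTensor A).rTensor A w =
      (Z.rcoact.toLinearMap.lTensor A).rTensor A w from ?_)
    refine ((TensorProduct.assoc k A Z A).symm.rTensor A).injective ?_
    refine (TensorProduct.assoc k (A ⊗[k] Z) A A).injective (Eq.trans ?_ (hw.trans ?_))
    · exact LinearMap.congr_fun (f := (TensorProduct.assoc k (A ⊗[k] Z) A A).toLinearMap ∘ₗ
        (TensorProduct.assoc k A Z A).symm.toLinearMap.rTensor A ∘ₗ
          (((TensorProduct.mk k Z A).flip 1).lTensor A).rTensor A)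
        (g := (TensorProduct.mk k A A 1).lTensor (A ⊗[k] Z))
        (TensorProduct.ext_threefold fun a z b ↦ rfl) w
    · exact congrArg (TensorProduct.assoc k (A ⊗[k] Z) A A)
        (LinearMap.rTensor_comp_apply A (TensorProduct.assoc k A Z A).symm.toLinearMap
          (Z.rcoact.toLinearMap.lTensor A) w))
  refine ⟨(TensorProduct.rid k A).toLinearMap.rTensor A u, ?_⟩
  refine LinearMap.congr_fun (f := insertOne Z ∘ₗ (TensorProduct.rid k A).toLinearMap.rTensor A)
    (g := ((Algebra.linearMap k Z).lTensor A).rTensor A)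
    (TensorProduct.ext_threefold fun a c b ↦ ?_) u
  change ((c • a) ⊗ₜ[k] (1 : Z)) ⊗ₜ[k] b = (a ⊗ₜ algebraMap k Z c) ⊗ₜ b
  rw [smul_tmul, Algebra.algebraMap_eq_smul_one]

lemma coinvariant_insertOne (ω : A ⊗[k] A) :
    (TensorProduct.mk k A A 1).lTensor (A ⊗[k] Z) (insertOne Z ω) =
      TensorProduct.assoc k (A ⊗[k] Z) A A
        ((rcoactSnd Z).toLinearMap.rTensor A (insertOne Z ω)) := by
  induction ω with
  | zero => simp only [map_zero]
  | add x y hx hy => simp only [map_add, hx, hy]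
  | tmul a b =>
    change (a ⊗ₜ[k] (1 : Z)) ⊗ₜ[k] ((1 : A) ⊗ₜ[k] b) = TensorProduct.assoc k (A ⊗[k] Z) A A
      ((TensorProduct.assoc k A Z A).symm (a ⊗ₜ Z.rcoact 1) ⊗ₜ b)
    rw [map_one]
    rfl

variable (Z) in
/-- `a ⊗ (b ⊗ c) ↦ (a ⊗ b) ⊗ (1 ⊗ c)` -/
def insertOne₃ : A ⊗[k] (A ⊗[k] A) →ₗ[k] (A ⊗[k] A) ⊗[k] (Z ⊗[k] A) :=
  (TensorProduct.mk k Z A 1).lTensor (A ⊗[k] A) ∘ₗ (TensorProduct.assoc k A A A).symm.toLinearMap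

lemma insertOne₃_injective [Module.Flat k A] (hi : Function.Injective (algebraMap k Z)) :
    Function.Injective (insertOne₃ (A := A) Z) :=
  (Module.Flat.lTensor_preserves_injective_linearMap (M := A ⊗[k] A) _
    (Algebra.TensorProduct.includeRight_injective (A := Z) (B := A) hi)).comp
      (TensorProduct.assoc k A A A).symm.injective

lemma comul_insertOne (ω : A ⊗[k] A) :
    comul.rTensor (Z ⊗[k] A) (TensorProduct.assoc k A Z A (insertOne Z ω)) =
      insertOne₃ Z (TensorProduct.assoc k A A A (comul.rTensor A ω)) := by
  rw [insertOne₃, LinearMap.comp_apply, LinearEquiv.coe_coe, LinearEquiv.symm_apply_apply]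
  induction ω with
  | zero => simp only [map_zero]
  | add x y hx hy => simp only [map_add, hx, hy]
  | tmul a b => rfl

lemma mulComul_insertOne (ω : A ⊗[k] A) :
    mulComul k Z ((Z.coactL A).rTensor A (insertOne Z ω)) =
      insertOne₃ Z (comul.lTensor A ω) := by
  induction ω with
  | zero => simp only [map_zero]
  | add x y hx hy => simp only [map_add, hx, hy]
  | tmul a b =>
    change mulComul k Z (Z.coactL A (a ⊗ₜ 1) ⊗ₜ b) = insertOne₃ Z (a ⊗ₜ comul b)
    rw [coactL_tmul, map_one Z.lcoact]
    change ((LinearMap.mul' k A).lTensor A ∘ₗ (TensorProduct.assoc k A A A).toLinearMap).rTensor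
      (Z ⊗[k] A) (TensorProduct.tensorTensorTensorComm k (A ⊗[k] A) Z A A
        (((a ⊗ₜ 1) ⊗ₜ 1) ⊗ₜ comul b)) = _
    generalize comul (R := k) b = w
    induction w with
    | zero => simp only [tmul_zero, map_zero]
    | add x y hx hy => simp only [tmul_add, map_add, hx, hy]
    | tmul b c => simp [insertOne₃]

/-- The elements of `Z ⊗ (Y ⊗ A)` that satisfy the equations of the inverse object: the first one
leaves the elements `κ⁻¹(a ⊗ 1) ⊗ b`, and the second one restricts `a ⊗ b` to the image of `Δ`. -/
lemma inverse_conditions_iff [Module.Flat k A] (h : IsOpposite Z S ρ l p q)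
    (hi : Function.Injective (algebraMap k Z))
    (hc : ∀ z : Z, Z.rcoact z = z ⊗ₜ 1 → ∃ c : k, algebraMap k Z c = z)
    (v : Z ⊗[k] (Y ⊗[k] A)) :
    ((S.toLinearMap.rTensor (Y ⊗[k] A)).lTensor Z (Z.coactR (Y ⊗[k] A) v) =
        (coactFst ρ).lTensor Z v ∧
      ((antipodeLeft S).toLinearMap.lTensor Y).lTensor Z v = (coactSnd l).lTensor Z v) ↔
    ∃ a : A, extendL hZ h (comul a) = v := by
  rw [← (transferFst_injective (p := p) (q := q) Z hZ).eq_iff,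
    ← (transferSnd_injective (p := p) (q := q) Z hZ).eq_iff, transferFst_antipode Z h.antipode,
    transferFst_coaction Z h.rcoact, transferSnd_antipode Z h.antipode,
    transferSnd_coaction Z h.lcoact]
  have e : ∀ ω, extendL hZ h ω = v ↔ insertOne Z ω = kappaLFst Z p v := fun ω ↦ by
    rw [← (kappaLFst_bijective Z (p := p) hZ).1.eq_iff, kappaLFst_extendL]
  simp only [e]
  constructor
  · rintro ⟨h1, h2⟩
    obtain ⟨ω, hω⟩ := exists_insertOne_eq hc h1
    rw [← hω, comul_insertOne, mulComul_insertOne, (insertOne₃_injective hi).eq_iff] at h2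
    obtain ⟨a, rfl⟩ := exists_lcoact_eq_of_cotensor (Z := unit k A) (u := ω) h2
    exact ⟨a, hω⟩
  · rintro ⟨a, ha⟩
    rw [← ha]
    refine ⟨coinvariant_insertOne _, ?_⟩
    rw [comul_insertOne, mulComul_insertOne, Coalgebra.coassoc_apply]

/-- `a ↦ a₁' ⊗ (a₁'' ⊗ a₂)` followed by the coaction, with `κ(a' ⊗ a'') = a ⊗ 1`. -/
def unitToCotensorR (h : IsOpposite Z S ρ l p q) : A →ₐ[k] Z ⊗[k] (A ⊗[k] (Y ⊗[k] A)) :=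
  (cotensorL Z (tensor (trivial k A Y) (unit k A))).comp
    ((extendL hZ h).comp (Bialgebra.comulAlgHom k A))

lemma unitToCotensorR_injective [Module.Flat k A] (h : IsOpposite Z S ρ l p q)
    (hi : Function.Injective (algebraMap k Z)) : Function.Injective (unitToCotensorR hZ h) := by
  intro a b hab
  have h1 := congrArg (kappaLFst Z p) (coactR_injective Z (Y ⊗[k] A) hab)
  refine lcoact_injective (unit k A) (insertOne_injective hi ?_)
  exact (kappaLFst_extendL hZ h _).symm.trans (h1.trans (kappaLFst_extendL hZ h _))

lemma isBicolinear_unitToCotensorR (h : IsOpposite Z S ρ l p q) :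
    IsBicolinear (Z := unit k A) (T := tensor Z (ambient k A Y))
      (unitToCotensorR hZ h).toLinearMap := by
  constructor
  · intro (a : A)
    have e : ∀ w : A ⊗[k] A, (Z.coactR (Y ⊗[k] A)).lTensor A
        ((extendL hZ h).toLinearMap.lTensor A (comul.lTensor A w)) =
        (unitToCotensorR hZ h).toLinearMap.lTensor A w := by
      intro w
      induction w with
      | zero => simp only [map_zero]
      | add x y hx hy => simp only [map_add, hx, hy]
      | tmul a b => rfl
    refine (cotensorL_tensorL Z (tensor (trivial k A Y) (unit k A))
      (extendL hZ h (comul a))).symm.trans (Eq.trans ?_ (e (comul a)))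
    exact congrArg ((Z.coactR (Y ⊗[k] A)).lTensor A)
      ((lcoact_extendL hZ h (comul a)).trans (congrArg ((extendL hZ h).toLinearMap.lTensor A)
        (Coalgebra.coassoc_apply (R := k) a)))
  · intro (a : A)
    have e : ∀ w : A ⊗[k] A, (Z.coactR (Y ⊗[k] A)).rTensor A
        ((extendL hZ h).toLinearMap.rTensor A (comul.rTensor A w)) =
        (unitToCotensorR hZ h).toLinearMap.rTensor A w := by
      intro w
      induction w with
      | zero => simp only [map_zero]
      | add x y hx hy => simp only [map_add, hx, hy]
      | tmul a b => rfl
    refine (cotensorL_tensorR Z (tensor (trivial k A Y) (unit k A))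
      (extendL hZ h (comul a))).symm.trans (Eq.trans ?_ (e (comul a)))
    exact congrArg ((Z.coactR (Y ⊗[k] A)).rTensor A)
      ((rcoact_extendL hZ h (comul a)).trans (congrArg ((extendL hZ h).toLinearMap.rTensor A)
        (Coalgebra.coassoc_symm_apply (R := k) a)))

/-- The inverse object is a right inverse of `Z`. -/
theorem cotensor_inverseObject [Module.Flat k A] [Module.Flat k Z]
    (hZ : Function.Bijective Z.kappaL) (h : IsOpposite Z S ρ l p q)
    (hi : Function.Injective (algebraMap k Z))
    (hc : ∀ z : Z, Z.rcoact z = z ⊗ₜ 1 → ∃ c : k, algebraMap k Z c = z) :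
    Isomorphic (cotensor Z (inverseObject S ρ l)) (unit k A) := by
  let i : cotensor Z (inverseObject S ρ l) →ₐ[k] tensor Z (ambient k A Y) :=
    (Algebra.TensorProduct.map (AlgHom.id k Z) (inverseVal S ρ l)).comp (cotensorVal Z _)
  refine isomorphic_of_range_eq (k := k) (A := A) (W := tensor Z (ambient k A Y)) (i := i)
    (j := unitToCotensorR (A := A) hZ h) ?_ (unitToCotensorR_injective hZ h hi) ?_
    (isBicolinear_unitToCotensorR hZ h) fun w ↦ ?_
  · exact (Module.Flat.lTensor_preserves_injective_linearMap (M := Z) _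
      (inverseVal_injective S ρ l)).comp (cotensorVal_injective Z _)
  · exact (isBicolinear_map (isBicolinear_id Z) (isBicolinear_inverseVal S ρ l)).comp
      (isBicolinear_cotensorVal Z _)
  · refine (exists_lTensor_inverseVal_iff S ρ l Z w).trans ?_
    constructor
    · rintro ⟨h1, h2⟩
      obtain ⟨v, rfl⟩ := exists_coactR_eq (M := Y ⊗[k] A) h1
      obtain ⟨a, rfl⟩ := (inverse_conditions_iff hZ h hi hc v).1
        ((coactR_conditions_iff Z S ρ l v).1 h2)
      exact ⟨a, rfl⟩
    · rintro ⟨a, rfl⟩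
      exact ⟨coactR_coactR Z (Y ⊗[k] A) _, (coactR_conditions_iff Z S ρ l _).2
        ((inverse_conditions_iff hZ h hi hc _).2 ⟨a, rfl⟩)⟩

end Right

/-! ### The equations of the inverse object in `(A ⊗ Y ⊗ A) ⊗ Z` -/

section Left

variable (Z : BicomoduleAlgebra k A) {Y C : Type v} [Ring Y] [Algebra k Y] [Ring C] [Algebra k C]
  (S : A →ₐ[k] C) (ρ : Y →ₐ[k] C ⊗[k] Y) (l : Y →ₐ[k] Y ⊗[k] C)

/-- `a ⊗ y ↦ (a ⊗ y₁) ⊗ y₀` -/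
def coactFstL : A ⊗[k] Y →ₗ[k] (A ⊗[k] C) ⊗[k] Y :=
  (TensorProduct.assoc k A C Y).symm.toLinearMap ∘ₗ ρ.toLinearMap.lTensor A

/-- `a ⊗ y ↦ (a ⊗ y₀) ⊗ y₋₁` -/
def coactSndL : A ⊗[k] Y →ₗ[k] (A ⊗[k] Y) ⊗[k] C :=
  (TensorProduct.assoc k A Y C).symm.toLinearMap ∘ₗ l.toLinearMap.lTensor A

lemma leftAntipode_comp_assoc :
    (leftAntipode Y S).toLinearMap ∘ₗ (TensorProduct.assoc k A Y A).toLinearMap =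
      (TensorProduct.assoc k (A ⊗[k] C) Y A).toLinearMap ∘ₗ
        ((antipodeRight S).toLinearMap.rTensor Y).rTensor A :=
  TensorProduct.ext_threefold fun _ _ _ ↦ rfl

lemma leftCoaction_comp_assoc :
    (leftCoaction ρ).toLinearMap ∘ₗ (TensorProduct.assoc k A Y A).toLinearMap =
      (TensorProduct.assoc k (A ⊗[k] C) Y A).toLinearMap ∘ₗ (coactFstL ρ).rTensor A := by
  refine TensorProduct.ext_threefold fun a y b ↦ ?_
  change (TensorProduct.assoc k A C (Y ⊗[k] A)).symm (a ⊗ₜ TensorProduct.assoc k C Y A (ρ y ⊗ₜ b)) =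
    TensorProduct.assoc k (A ⊗[k] C) Y A ((TensorProduct.assoc k A C Y).symm (a ⊗ₜ ρ y) ⊗ₜ b)
  generalize ρ y = w
  induction w with
  | zero => simp only [zero_tmul, tmul_zero, map_zero]
  | add a b ha hb => simp only [add_tmul, tmul_add, map_add, ha, hb]
  | tmul c y => rfl

lemma rightAntipode_comp_assoc :
    (rightAntipode Y S).toLinearMap ∘ₗ (TensorProduct.assoc k A Y A).toLinearMap =
      ((TensorProduct.assoc k (A ⊗[k] Y) C A).trans
        (TensorProduct.assoc k A Y (C ⊗[k] A))).toLinearMap ∘ₗ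
        (S.toLinearMap.lTensor (A ⊗[k] Y)).rTensor A ∘ₗ comulL k A (A ⊗[k] Y) := by
  refine TensorProduct.ext_threefold fun a y b ↦ ?_
  change a ⊗ₜ (y ⊗ₜ S.toLinearMap.rTensor A (comul b)) = TensorProduct.assoc k A Y (C ⊗[k] A)
    (TensorProduct.assoc k (A ⊗[k] Y) C A ((S.toLinearMap.lTensor (A ⊗[k] Y)).rTensor A
      ((TensorProduct.assoc k (A ⊗[k] Y) A A).symm ((a ⊗ₜ y) ⊗ₜ comul b))))
  generalize comul (R := k) b = w
  induction w with
  | zero => simp only [tmul_zero, map_zero]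
  | add a b ha hb => simp only [tmul_add, map_add, ha, hb]
  | tmul c y => rfl

lemma rightCoaction_comp_assoc :
    (rightCoaction l).toLinearMap ∘ₗ (TensorProduct.assoc k A Y A).toLinearMap =
      ((TensorProduct.assoc k (A ⊗[k] Y) C A).trans
        (TensorProduct.assoc k A Y (C ⊗[k] A))).toLinearMap ∘ₗ (coactSndL l).rTensor A := by
  refine TensorProduct.ext_threefold fun a y b ↦ ?_
  change a ⊗ₜ TensorProduct.assoc k Y C A (l y ⊗ₜ b) = TensorProduct.assoc k A Y (C ⊗[k] A)
    (TensorProduct.assoc k (A ⊗[k] Y) C A ((TensorProduct.assoc k A Y C).symm (a ⊗ₜ l y) ⊗ₜ b))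
  generalize l y = w
  induction w with
  | zero => simp only [zero_tmul, tmul_zero, map_zero]
  | add a b ha hb => simp only [add_tmul, tmul_add, map_add, ha, hb]
  | tmul c y => rfl

/-- The equations cutting out the inverse object, on elements coming from `(A ⊗ Y) ⊗ Z`. -/
lemma coactL_conditions_iff (v : (A ⊗[k] Y) ⊗[k] Z) :
    ((leftAntipode Y S).toLinearMap.rTensor Z
        ((TensorProduct.assoc k A Y A).toLinearMap.rTensor Z (Z.coactL (A ⊗[k] Y) v)) =
        (leftCoaction ρ).toLinearMap.rTensor Z
          ((TensorProduct.assoc k A Y A).toLinearMap.rTensor Z (Z.coactL (A ⊗[k] Y) v)) ∧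
      (rightAntipode Y S).toLinearMap.rTensor Z
          ((TensorProduct.assoc k A Y A).toLinearMap.rTensor Z (Z.coactL (A ⊗[k] Y) v)) =
        (rightCoaction l).toLinearMap.rTensor Z
          ((TensorProduct.assoc k A Y A).toLinearMap.rTensor Z (Z.coactL (A ⊗[k] Y) v))) ↔
    ((antipodeRight S).toLinearMap.rTensor Y).rTensor Z v = (coactFstL ρ).rTensor Z v ∧
      (S.toLinearMap.lTensor (A ⊗[k] Y)).rTensor Z (Z.coactL (A ⊗[k] Y) v) =
        (coactSndL l).rTensor Z v := by
  refine and_congr ?_ ?_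
  · have hE : Function.Injective
        ((TensorProduct.assoc k (A ⊗[k] C) Y A).toLinearMap.rTensor Z) :=
      ((TensorProduct.assoc k (A ⊗[k] C) Y A).rTensor Z).injective
    rw [← LinearMap.rTensor_comp_apply, ← LinearMap.rTensor_comp_apply,
      leftAntipode_comp_assoc, leftCoaction_comp_assoc, LinearMap.rTensor_comp_apply,
      LinearMap.rTensor_comp_apply, hE.eq_iff, ← coactL_rTensor, ← coactL_rTensor,
      (coactL_injective Z ((A ⊗[k] C) ⊗[k] Y)).eq_iff]
  · have hE : Function.Injective
        (((TensorProduct.assoc k (A ⊗[k] Y) C A).trans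
          (TensorProduct.assoc k A Y (C ⊗[k] A))).toLinearMap.rTensor Z) :=
      (((TensorProduct.assoc k (A ⊗[k] Y) C A).trans
        (TensorProduct.assoc k A Y (C ⊗[k] A))).rTensor Z).injective
    rw [← LinearMap.rTensor_comp_apply, ← LinearMap.rTensor_comp_apply,
      rightAntipode_comp_assoc, rightCoaction_comp_assoc, LinearMap.rTensor_comp_apply,
      LinearMap.rTensor_comp_apply, LinearMap.rTensor_comp_apply, hE.eq_iff, ← coactL_coactL,
      ← coactL_rTensor, ← coactL_rTensor, (coactL_injective Z ((A ⊗[k] Y) ⊗[k] C)).eq_iff]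

variable (p : Y ≃ₗ[k] Z) (q : C ≃ₗ[k] A)

/-- `y ⊗ x ↦ (y ⊗ 1) ρ(x)`, where `y` is read in `Z`. -/
def kappaROp : Y ⊗[k] Z →ₗ[k] Z ⊗[k] A := Z.kappaR ∘ₗ p.toLinearMap.rTensor Z

lemma kappaROp_tmul (y : Y) (x : Z) :
    kappaROp Z p (y ⊗ₜ x) = (p y ⊗ₜ 1) * Z.rcoact x := kappaR_tmul Z (p y) x

/-- `a ⊗ y ⊗ x ↦ a ⊗ κ(y ⊗ x)` -/
def kappaRLast : (A ⊗[k] Y) ⊗[k] Z →ₗ[k] A ⊗[k] (Z ⊗[k] A) :=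
  (kappaROp Z p).lTensor A ∘ₗ (TensorProduct.assoc k A Y Z).toLinearMap

/-- `a ⊗ c ⊗ y ⊗ x ↦ a₁ ⊗ y x₀ ⊗ a₂ c x₁ ⊗ x₂`, the mirror image of `transferSnd`: it turns the
first equation of the inverse object into the condition that cuts out `A □ A`. -/
def transferFstL : ((A ⊗[k] C) ⊗[k] Y) ⊗[k] Z →ₗ[k] (A ⊗[k] Z) ⊗[k] (A ⊗[k] A) :=
  (comulShearL k A).lTensor (A ⊗[k] Z) ∘ₗ
    (TensorProduct.tensorTensorTensorComm k A A Z A).toLinearMap ∘ₗ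
      TensorProduct.map (comulShearR k A ∘ₗ q.toLinearMap.lTensor A) (kappaROp Z p) ∘ₗ
        (TensorProduct.assoc k (A ⊗[k] C) Y Z).toLinearMap

lemma transferFstL_tmul (w : A ⊗[k] C) (y : Y) (x : Z) :
    transferFstL Z p q ((w ⊗ₜ y) ⊗ₜ x) = (comulShearL k A).lTensor (A ⊗[k] Z)
      (TensorProduct.tensorTensorTensorComm k A A Z A
        (comulShearR k A (q.toLinearMap.lTensor A w) ⊗ₜ kappaROp Z p (y ⊗ₜ x))) := rfl

/-- `a ⊗ y ⊗ c ⊗ x ↦ a ⊗ c x₋₁ ⊗ y x₀ ⊗ x₁`, the mirror image of `transferFst`: it turns the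
second equation of the inverse object into coinvariance. -/
def transferSndL : ((A ⊗[k] Y) ⊗[k] C) ⊗[k] Z →ₗ[k] (A ⊗[k] A) ⊗[k] (Z ⊗[k] A) :=
  (kappaROp Z p).lTensor (A ⊗[k] A) ∘ₗ (TensorProduct.tensorTensorTensorComm k A Y A Z).toLinearMap
    ∘ₗ (Z.shearL ∘ₗ q.toLinearMap.rTensor Z).lTensor (A ⊗[k] Y) ∘ₗ
      (TensorProduct.assoc k (A ⊗[k] Y) C Z).toLinearMap

lemma transferSndL_tmul (a : A) (y : Y) (c : C) (x : Z) :
    transferSndL Z p q (((a ⊗ₜ y) ⊗ₜ c) ⊗ₜ x) = (kappaROp Z p).lTensor (A ⊗[k] A)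
      (TensorProduct.tensorTensorTensorComm k A Y A Z ((a ⊗ₜ y) ⊗ₜ Z.shearL (q c ⊗ₜ x))) := rfl

/-- The algebra map `z ⊗ b ↦ z₋₁ ⊗ z₀ ⊗ b`. -/
def lcoactFst : Z ⊗[k] A →ₐ[k] A ⊗[k] (Z ⊗[k] A) :=
  (Algebra.TensorProduct.assoc k k k A Z A).toAlgHom.comp
    (Algebra.TensorProduct.map Z.lcoact (AlgHom.id k A))

lemma lcoactFst_kappaR (x y : Z) : lcoactFst Z (Z.kappaR (x ⊗ₜ y)) =
    Algebra.TensorProduct.map (AlgHom.id k A) Algebra.TensorProduct.includeLeft (Z.lcoact x) *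
      Algebra.TensorProduct.map (AlgHom.id k A) Z.rcoact (Z.lcoact y) := by
  rw [kappaR_tmul, map_mul]
  congr 1
  · change TensorProduct.assoc k A Z A (Z.lcoact x ⊗ₜ 1) = _
    generalize Z.lcoact x = w
    induction w with
    | zero => simp only [zero_tmul, map_zero]
    | add a b ha hb => simp only [add_tmul, map_add, ha, hb]
    | tmul a z => rfl
  · exact Z.bicomodule y

variable (k) in
/-- `a ⊗ (m ⊗ (c ⊗ b)) ↦ (a₁ ⊗ m) ⊗ (a₂ c ⊗ b)` -/
def comulMul (M : Type v) [AddCommGroup M] [Module k M] :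
    A ⊗[k] (M ⊗[k] (A ⊗[k] A)) →ₗ[k] (A ⊗[k] M) ⊗[k] (A ⊗[k] A) :=
  ((LinearMap.mul' k A).rTensor A ∘ₗ (TensorProduct.assoc k A A A).symm.toLinearMap).lTensor
    (A ⊗[k] M) ∘ₗ (TensorProduct.tensorTensorTensorComm k A A M (A ⊗[k] A)).toLinearMap ∘ₗ
      comul.rTensor (M ⊗[k] (A ⊗[k] A))

variable {S ρ l p q}

lemma transferSndL_antipode (hS : ∀ a, q (S a) = HopfAlgebra.antipode k a)
    (v : (A ⊗[k] Y) ⊗[k] Z) :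
    transferSndL Z p q ((S.toLinearMap.lTensor (A ⊗[k] Y)).rTensor Z (Z.coactL (A ⊗[k] Y) v)) =
      ((TensorProduct.mk k A A).flip 1).rTensor (Z ⊗[k] A) (kappaRLast Z p v) := by
  refine LinearMap.congr_fun (f := transferSndL Z p q ∘ₗ
    (S.toLinearMap.lTensor (A ⊗[k] Y)).rTensor Z ∘ₗ Z.coactL (A ⊗[k] Y))
    (g := ((TensorProduct.mk k A A).flip 1).rTensor (Z ⊗[k] A) ∘ₗ kappaRLast Z p)
    (TensorProduct.ext_threefold fun a y x ↦ ?_) v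
  have h : ∀ w : A ⊗[k] Z, transferSndL Z p q ((S.toLinearMap.lTensor (A ⊗[k] Y)).rTensor Z
      ((TensorProduct.assoc k (A ⊗[k] Y) A Z).symm ((a ⊗ₜ y) ⊗ₜ w))) =
      (kappaROp Z p).lTensor (A ⊗[k] A) (TensorProduct.tensorTensorTensorComm k A Y A Z
        ((a ⊗ₜ y) ⊗ₜ Z.shearL ((HopfAlgebra.antipode k (A := A)).rTensor Z w))) := by
    intro w
    induction w with
    | zero => simp only [tmul_zero, map_zero]
    | add a b ha hb => simp only [tmul_add, map_add, ha, hb]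
    | tmul a z =>
      rw [LinearMap.rTensor_tmul, ← hS]
      rfl
  refine (h (Z.lcoact x)).trans ?_
  rw [shearL_antipode]
  rfl

lemma transferSndL_coaction (hl : ∀ y, TensorProduct.map p.toLinearMap q.toLinearMap (l y) =
      TensorProduct.comm k A Z (Z.lcoact (p y))) (v : (A ⊗[k] Y) ⊗[k] Z) :
    transferSndL Z p q ((coactSndL l).rTensor Z v) =
      (TensorProduct.assoc k A A (Z ⊗[k] A)).symm
        ((lcoactFst Z).toLinearMap.lTensor A (kappaRLast Z p v)) := by
  refine LinearMap.congr_fun (f := transferSndL Z p q ∘ₗ (coactSndL l).rTensor Z)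
    (g := (TensorProduct.assoc k A A (Z ⊗[k] A)).symm.toLinearMap ∘ₗ
      (lcoactFst Z).toLinearMap.lTensor A ∘ₗ kappaRLast Z p)
    (TensorProduct.ext_threefold fun a y x ↦ ?_) v
  have h1 : ∀ (w : A ⊗[k] Z) (c : C) (y : Y), (kappaROp Z p).lTensor (A ⊗[k] A)
      (TensorProduct.tensorTensorTensorComm k A Y A Z ((a ⊗ₜ y) ⊗ₜ ((q c ⊗ₜ 1) * w))) =
      (TensorProduct.assoc k A A (Z ⊗[k] A)).symm (a ⊗ₜ
        (Algebra.TensorProduct.map (AlgHom.id k A) Algebra.TensorProduct.includeLeft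
          (q c ⊗ₜ p y) * Algebra.TensorProduct.map (AlgHom.id k A) Z.rcoact w)) := by
    intro w c y
    induction w with
    | zero => simp only [mul_zero, tmul_zero, map_zero]
    | add a b ha hb => simp only [mul_add, tmul_add, map_add, ha, hb]
    | tmul a z =>
      simp only [Algebra.TensorProduct.tmul_mul_tmul, one_mul, Algebra.TensorProduct.map_tmul,
        TensorProduct.tensorTensorTensorComm_tmul, LinearMap.lTensor_tmul, kappaROp_tmul,
        AlgHom.id_apply, Algebra.TensorProduct.includeLeft_apply, TensorProduct.assoc_symm_tmul]
  have h2 : ∀ t : Y ⊗[k] C, transferSndL Z p q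
      ((TensorProduct.assoc k A Y C).symm (a ⊗ₜ t) ⊗ₜ x) =
      (TensorProduct.assoc k A A (Z ⊗[k] A)).symm (a ⊗ₜ
        (Algebra.TensorProduct.map (AlgHom.id k A) Algebra.TensorProduct.includeLeft
          ((TensorProduct.comm k A Z).symm (TensorProduct.map p.toLinearMap q.toLinearMap t)) *
            Algebra.TensorProduct.map (AlgHom.id k A) Z.rcoact (Z.lcoact x))) := by
    intro t
    induction t with
    | zero => simp only [zero_tmul, map_zero, tmul_zero, zero_mul]
    | add a b ha hb => simp only [add_tmul, map_add, tmul_add, add_mul, ha, hb]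
    | tmul y c =>
      rw [TensorProduct.assoc_symm_tmul, transferSndL_tmul, shearL_tmul, h1]
      rfl
  refine (h2 (l y)).trans ?_
  rw [hl, LinearEquiv.symm_apply_apply, ← lcoactFst_kappaR]
  rfl

lemma transferFstL_antipode (hS : ∀ a, q (S a) = HopfAlgebra.antipode k a)
    (v : (A ⊗[k] Y) ⊗[k] Z) :
    transferFstL Z p q (((antipodeRight S).toLinearMap.rTensor Y).rTensor Z v) =
      comul.lTensor (A ⊗[k] Z) ((TensorProduct.assoc k A Z A).symm (kappaRLast Z p v)) := by
  refine LinearMap.congr_fun (f := transferFstL Z p q ∘ₗ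
    ((antipodeRight S).toLinearMap.rTensor Y).rTensor Z)
    (g := comul.lTensor (A ⊗[k] Z) ∘ₗ (TensorProduct.assoc k A Z A).symm.toLinearMap ∘ₗ
      kappaRLast Z p)
    (TensorProduct.ext_threefold fun a y x ↦ ?_) v
  have h : ∀ w : A ⊗[k] A, q.toLinearMap.lTensor A (S.toLinearMap.lTensor A w) =
      (HopfAlgebra.antipode k (A := A)).lTensor A w := by
    intro w
    rw [← LinearMap.lTensor_comp_apply]
    congr 2
    exact LinearMap.ext hS
  change transferFstL Z p q (((S.toLinearMap.lTensor A (comul a)) ⊗ₜ y) ⊗ₜ x) =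
    comul.lTensor (A ⊗[k] Z) ((TensorProduct.assoc k A Z A).symm (a ⊗ₜ kappaROp Z p (y ⊗ₜ x)))
  rw [transferFstL_tmul, h, comulShearR_antipode]
  generalize kappaROp Z p (y ⊗ₜ x) = w
  induction w with
  | zero => simp only [tmul_zero, map_zero]
  | add a b ha hb => simp only [tmul_add, map_add, ha, hb]
  | tmul z b =>
    refine (congrArg ((a ⊗ₜ[k] z) ⊗ₜ[k] ·) (comulShearL_tmul 1 b)).trans ?_
    exact congrArg ((a ⊗ₜ[k] z) ⊗ₜ[k] ·) (one_mul (comul (R := k) b))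

lemma transferFstL_coaction (hρ : ∀ y, TensorProduct.map q.toLinearMap p.toLinearMap (ρ y) =
      TensorProduct.comm k Z A (Z.rcoact (p y))) (v : (A ⊗[k] Y) ⊗[k] Z) :
    transferFstL Z p q ((coactFstL ρ).rTensor Z v) =
      comulMul k Z ((Z.coactR A).lTensor A (kappaRLast Z p v)) := by
  refine LinearMap.congr_fun (f := transferFstL Z p q ∘ₗ (coactFstL ρ).rTensor Z)
    (g := comulMul k Z ∘ₗ (Z.coactR A).lTensor A ∘ₗ kappaRLast Z p)
    (TensorProduct.ext_threefold fun a y x ↦ ?_) v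
  -- `(z ⊗ c) ⊗ (z' ⊗ b) ↦ z z' ⊗ (c b₁ ⊗ b₂)`
  let H : (Z ⊗[k] A) ⊗[k] (Z ⊗[k] A) →ₗ[k] Z ⊗[k] (A ⊗[k] A) :=
    TensorProduct.map (LinearMap.mul' k Z) (comulShearL k A) ∘ₗ
      (TensorProduct.tensorTensorTensorComm k Z A Z A).toLinearMap
  have h1 : ∀ t : C ⊗[k] Y, transferFstL Z p q
      ((TensorProduct.assoc k A C Y).symm (a ⊗ₜ t) ⊗ₜ x) =
      comulMul k Z (a ⊗ₜ H (((TensorProduct.comm k Z A).symm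
        (TensorProduct.map q.toLinearMap p.toLinearMap t)) ⊗ₜ Z.rcoact x)) := by
    intro t
    induction t with
    | zero => simp only [zero_tmul, map_zero, tmul_zero]
    | add a b ha hb => simp only [add_tmul, map_add, tmul_add, ha, hb]
    | tmul c y =>
      rw [TensorProduct.assoc_symm_tmul, transferFstL_tmul, kappaROp_tmul]
      change (comulShearL k A).lTensor (A ⊗[k] Z) (TensorProduct.tensorTensorTensorComm k A A Z A
        (comulShearR k A (a ⊗ₜ q c) ⊗ₜ ((p y ⊗ₜ 1) * Z.rcoact x))) =
          comulMul k Z (a ⊗ₜ H ((p y ⊗ₜ q c) ⊗ₜ Z.rcoact x))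
      rw [comulShearR_tmul]
      generalize Z.rcoact x = s
      induction s with
      | zero => simp only [tmul_zero, map_zero, mul_zero]
      | add a b ha hb => simp only [tmul_add, mul_add, map_add, ha, hb]
      | tmul z b =>
        rw [show H ((p y ⊗ₜ q c) ⊗ₜ (z ⊗ₜ b)) = (p y * z) ⊗ₜ ((q c ⊗ₜ 1) * comul (R := k) b) from
          congrArg ((p y * z) ⊗ₜ[k] ·) (comulShearL_tmul (q c) b)]
        rw [Algebra.TensorProduct.tmul_mul_tmul, one_mul, comulMul, LinearMap.comp_apply,
          LinearMap.comp_apply, LinearMap.rTensor_tmul]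
        generalize comul (R := k) a = r
        induction r with
        | zero => simp only [zero_tmul, map_zero, zero_mul]
        | add a b ha hb => simp only [add_tmul, add_mul, map_add, ha, hb]
        | tmul a a' =>
          rw [Algebra.TensorProduct.tmul_mul_tmul, mul_one]
          refine (congrArg ((a ⊗ₜ[k] (p y * z)) ⊗ₜ[k] ·)
            (comulShearL_tmul (a' * q c) b)).trans ?_
          refine congrArg ((a ⊗ₜ[k] (p y * z)) ⊗ₜ[k] ·) ?_
          change ((a' * q c) ⊗ₜ 1) * comul (R := k) b = (LinearMap.mul' k A).rTensor A
            ((TensorProduct.assoc k A A A).symm (a' ⊗ₜ ((q c ⊗ₜ 1) * comul (R := k) b)))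
          generalize comul (R := k) b = e
          induction e with
          | zero => simp only [tmul_zero, map_zero, mul_zero]
          | add a b ha hb => simp only [tmul_add, mul_add, map_add, ha, hb]
          | tmul e e' => simp [mul_assoc]
  have h2 : ∀ s : Z ⊗[k] A, H (s ⊗ₜ Z.rcoact x) =
      TensorProduct.assoc k Z A A (s ⊗ₜ 1 * Z.rcoact.toLinearMap.rTensor A (Z.rcoact x)) := by
    intro s
    rw [(LinearEquiv.eq_symm_apply _).2 (Z.rcoassoc x)]
    induction s with
    | zero => simp only [zero_tmul, map_zero, zero_mul]
    | add a b ha hb => simp only [add_tmul, add_mul, map_add, ha, hb]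
    | tmul z' c =>
      generalize Z.rcoact x = s
      induction s with
      | zero => simp only [tmul_zero, map_zero, mul_zero]
      | add a b ha hb => simp only [tmul_add, mul_add, map_add, ha, hb]
      | tmul z b =>
        rw [show H ((z' ⊗ₜ c) ⊗ₜ (z ⊗ₜ b)) = (z' * z) ⊗ₜ ((c ⊗ₜ 1) * comul (R := k) b) from
          congrArg ((z' * z) ⊗ₜ[k] ·) (comulShearL_tmul c b), LinearMap.lTensor_tmul]
        generalize comul (R := k) b = e
        induction e with
        | zero => simp only [tmul_zero, map_zero, mul_zero]
        | add a b ha hb => simp only [tmul_add, mul_add, map_add, ha, hb]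
        | tmul e e' => simp
  refine (h1 (ρ y)).trans ?_
  rw [hρ, LinearEquiv.symm_apply_apply, h2]
  change _ = comulMul k Z (a ⊗ₜ Z.coactR A (kappaROp Z p (y ⊗ₜ x)))
  rw [kappaROp_tmul]
  congr 2
  change _ = TensorProduct.assoc k Z A A (Z.rcoact.toLinearMap.rTensor A _)
  congr 1
  generalize Z.rcoact x = s
  induction s with
  | zero => simp only [map_zero, mul_zero]
  | add a b ha hb => simp only [mul_add, map_add, ha, hb]
  | tmul a z => simp

lemma kappaROp_bijective (hZ : Function.Bijective Z.kappaR) :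
    Function.Bijective (kappaROp Z p) :=
  hZ.comp (p.rTensor Z).bijective

lemma kappaRLast_bijective (hZ : Function.Bijective Z.kappaR) :
    Function.Bijective (kappaRLast (A := A) Z p) :=
  ((LinearEquiv.ofBijective _ (kappaROp_bijective Z (p := p) hZ)).lTensor A).bijective.comp
    (TensorProduct.assoc k A Y Z).bijective

lemma transferSndL_injective (hZ : Function.Bijective Z.kappaR) :
    Function.Injective (transferSndL Z p q) :=
  ((LinearEquiv.ofBijective _ (kappaROp_bijective Z (p := p) hZ)).lTensor
    (A ⊗[k] A)).injective.comp ((TensorProduct.tensorTensorTensorComm k A Y A Z).injective.comp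
      ((((q.rTensor Z).trans (LinearEquiv.ofBijective _ (shearL_bijective Z))).lTensor
        (A ⊗[k] Y)).injective.comp (TensorProduct.assoc k (A ⊗[k] Y) C Z).injective))

lemma transferFstL_injective (hZ : Function.Bijective Z.kappaR) :
    Function.Injective (transferFstL Z p q) :=
  ((LinearEquiv.ofBijective _ comulShearL_bijective).lTensor
    (A ⊗[k] Z)).injective.comp ((TensorProduct.tensorTensorTensorComm k A A Z A).injective.comp
      ((TensorProduct.congr ((q.lTensor A).trans
        (LinearEquiv.ofBijective _ comulShearR_bijective))
          (LinearEquiv.ofBijective _ (kappaROp_bijective Z (p := p) hZ))).injective.comp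
            (TensorProduct.assoc k (A ⊗[k] C) Y Z).injective))

end Left

/-! ### The cotensor product of the inverse with a Galois object -/

section Left

variable {Z : BicomoduleAlgebra k A} {Y C : Type v} [Ring Y] [Algebra k Y] [Ring C] [Algebra k C]
  {S : A →ₐ[k] C} {ρ : Y →ₐ[k] C ⊗[k] Y} {l : Y →ₐ[k] Y ⊗[k] C}
  {p : Y ≃ₗ[k] Z} {q : C ≃ₗ[k] A}

lemma kappaROp_mul (h : IsOpposite Z S ρ l p q) (t t' : Y ⊗[k] Z) {b : A}
    (hb : kappaROp Z p t = 1 ⊗ₜ b) : kappaROp Z p (t * t') = (1 ⊗ₜ b) * kappaROp Z p t' := by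
  rw [← hb]
  induction t' with
  | zero => simp only [map_zero, mul_zero]
  | add x y hx hy => simp only [map_add, mul_add, hx, hy]
  | tmul y' x' =>
    have e : ∀ t : Y ⊗[k] Z, kappaROp Z p (t * (y' ⊗ₜ x')) =
        (p y' ⊗ₜ 1) * (kappaROp Z p t * Z.rcoact x') := by
      intro t
      induction t with
      | zero => simp only [map_zero, mul_zero, zero_mul]
      | add x y hx hy => simp only [map_add, mul_add, add_mul, hx, hy]
      | tmul y x =>
        rw [Algebra.TensorProduct.tmul_mul_tmul, kappaROp_tmul, kappaROp_tmul, h.mul, map_mul,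
          ← mul_assoc, ← mul_assoc, ← mul_assoc, Algebra.TensorProduct.tmul_mul_tmul, mul_one]
    rw [e, kappaROp_tmul, hb, ← mul_assoc, ← mul_assoc, Algebra.TensorProduct.tmul_mul_tmul,
      Algebra.TensorProduct.tmul_mul_tmul, one_mul, mul_one, one_mul, mul_one]

variable (hZ : Function.Bijective Z.kappaR)

/-- The algebra map `A → Y ⊗ Z` with `b ↦ κ⁻¹(1 ⊗ b)`. -/
def translationR (h : IsOpposite Z S ρ l p q) : A →ₐ[k] Y ⊗[k] Z :=
  AlgHom.ofLinearMap ((LinearEquiv.ofBijective _ (kappaROp_bijective Z (p := p) hZ)).symm ∘ₗ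
    TensorProduct.mk k Z A 1)
    ((LinearEquiv.symm_apply_eq _).2 (by
      change (1 : Z) ⊗ₜ[k] (1 : A) = kappaROp Z p (1 ⊗ₜ 1)
      rw [kappaROp_tmul, map_one Z.rcoact, h.one, mul_one]))
    (fun a b ↦ (LinearEquiv.symm_apply_eq _).2 (by
      have e : ∀ b, kappaROp Z p ((LinearEquiv.ofBijective _
          (kappaROp_bijective Z (p := p) hZ)).symm (1 ⊗ₜ b)) = 1 ⊗ₜ b := fun b ↦
        (LinearEquiv.ofBijective _ (kappaROp_bijective Z (p := p) hZ)).apply_symm_apply (1 ⊗ₜ b)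
      refine Eq.symm ((kappaROp_mul h _ _ (e a)).trans ?_)
      refine (congrArg (((1 : Z) ⊗ₜ[k] a) * ·) (e b)).trans ?_
      rw [Algebra.TensorProduct.tmul_mul_tmul, mul_one]
      rfl))

lemma kappaROp_translationR (h : IsOpposite Z S ρ l p q) (b : A) :
    kappaROp Z p (translationR hZ h b) = 1 ⊗ₜ b :=
  (LinearEquiv.ofBijective _ (kappaROp_bijective Z (p := p) hZ)).apply_symm_apply (1 ⊗ₜ b)

lemma rTensor_kappaROp_rcoact (t : Y ⊗[k] Z) :
    (kappaROp Z p).rTensor A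
      ((TensorProduct.assoc k Y Z A).symm (Z.rcoact.toLinearMap.lTensor Y t)) =
      (TensorProduct.assoc k Z A A).symm (comul.lTensor Z (kappaROp Z p t)) := by
  induction t with
  | zero => simp only [map_zero]
  | add x y hx hy => simp only [map_add, hx, hy]
  | tmul y x =>
    rw [kappaROp_tmul]
    have e : (TensorProduct.assoc k Z A A).symm (comul.lTensor Z ((p y ⊗ₜ 1) * Z.rcoact x)) =
        ((p y ⊗ₜ 1) ⊗ₜ 1) * (TensorProduct.assoc k Z A A).symm (comul.lTensor Z (Z.rcoact x)) := by
      generalize Z.rcoact x = s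
      induction s with
      | zero => simp only [map_zero, mul_zero]
      | add a b ha hb => simp only [mul_add, map_add, ha, hb]
      | tmul z a =>
        rw [Algebra.TensorProduct.tmul_mul_tmul, one_mul, LinearMap.lTensor_tmul,
          LinearMap.lTensor_tmul]
        generalize comul (R := k) a = w
        induction w with
        | zero => simp only [tmul_zero, map_zero, mul_zero]
        | add a b ha hb => simp only [tmul_add, mul_add, map_add, ha, hb]
        | tmul a b => simp
    rw [e, ← Z.rcoassoc, LinearEquiv.symm_apply_apply, LinearMap.lTensor_tmul,
      AlgHom.toLinearMap_apply]
    generalize Z.rcoact x = s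
    induction s with
    | zero => simp only [tmul_zero, map_zero, mul_zero]
    | add a b ha hb => simp only [tmul_add, mul_add, map_add, ha, hb]
    | tmul z a =>
      rw [TensorProduct.assoc_symm_tmul, LinearMap.rTensor_tmul, LinearMap.rTensor_tmul,
        kappaROp_tmul, Algebra.TensorProduct.tmul_mul_tmul, one_mul]
      rfl

lemma rcoact_translationR (h : IsOpposite Z S ρ l p q) (b : A) :
    (TensorProduct.assoc k Y Z A).symm (Z.rcoact.toLinearMap.lTensor Y (translationR hZ h b)) =
      (translationR hZ h).toLinearMap.rTensor A (comul b) := by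
  refine ((LinearEquiv.ofBijective _ (kappaROp_bijective Z (p := p) hZ)).rTensor A).injective ?_
  refine (rTensor_kappaROp_rcoact _).trans ?_
  rw [kappaROp_translationR, LinearMap.lTensor_tmul]
  change _ = (kappaROp Z p).rTensor A _
  generalize comul (R := k) b = w
  induction w with
  | zero => simp only [tmul_zero, map_zero]
  | add a b ha hb => simp only [tmul_add, map_add, ha, hb]
  | tmul a b =>
    rw [LinearMap.rTensor_tmul, LinearMap.rTensor_tmul, AlgHom.toLinearMap_apply,
      kappaROp_translationR, TensorProduct.assoc_symm_tmul]

/-- `a ⊗ b ↦ a ⊗ κ⁻¹(1 ⊗ b)` as an algebra map `A ⊗ A → (A ⊗ Y) ⊗ Z`. -/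
def extendR (h : IsOpposite Z S ρ l p q) : A ⊗[k] A →ₐ[k] (A ⊗[k] Y) ⊗[k] Z :=
  (Algebra.TensorProduct.assoc k k k A Y Z).symm.toAlgHom.comp
    (Algebra.TensorProduct.map (AlgHom.id k A) (translationR hZ h))

lemma extendR_tmul (h : IsOpposite Z S ρ l p q) (a b : A) :
    extendR hZ h (a ⊗ₜ b) = (TensorProduct.assoc k A Y Z).symm (a ⊗ₜ translationR hZ h b) := rfl

variable (Z) in
/-- `a ⊗ b ↦ a ⊗ (1 ⊗ b)` -/
def insertOneL : A ⊗[k] A →ₗ[k] A ⊗[k] (Z ⊗[k] A) := (TensorProduct.mk k Z A 1).lTensor A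

lemma kappaRLast_extendR (h : IsOpposite Z S ρ l p q) (ω : A ⊗[k] A) :
    kappaRLast Z p (extendR hZ h ω) = insertOneL Z ω := by
  induction ω with
  | zero => simp only [map_zero]
  | add x y hx hy => simp only [map_add, hx, hy]
  | tmul a b =>
    rw [extendR_tmul, kappaRLast, LinearMap.comp_apply, LinearEquiv.coe_coe,
      LinearEquiv.apply_symm_apply, LinearMap.lTensor_tmul, kappaROp_translationR]
    rfl

lemma rcoact_extendR (h : IsOpposite Z S ρ l p q) (ω : A ⊗[k] A) :
    (TensorProduct.assoc k (A ⊗[k] Y) Z A).symm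
      (Z.rcoact.toLinearMap.lTensor (A ⊗[k] Y) (extendR hZ h ω)) =
    (extendR hZ h).toLinearMap.rTensor A
      ((TensorProduct.assoc k A A A).symm (comul.lTensor A ω)) := by
  induction ω with
  | zero => simp only [map_zero]
  | add x y hx hy => simp only [map_add, hx, hy]
  | tmul a b =>
    have e : ∀ t : Y ⊗[k] Z, (TensorProduct.assoc k (A ⊗[k] Y) Z A).symm
        (Z.rcoact.toLinearMap.lTensor (A ⊗[k] Y) ((TensorProduct.assoc k A Y Z).symm (a ⊗ₜ t))) =
        (((TensorProduct.assoc k A Y Z).symm.toLinearMap ∘ₗ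
          TensorProduct.mk k A (Y ⊗[k] Z) a)).rTensor A
          ((TensorProduct.assoc k Y Z A).symm (Z.rcoact.toLinearMap.lTensor Y t)) := by
      intro t
      induction t with
      | zero => simp only [tmul_zero, map_zero]
      | add a b ha hb => simp only [tmul_add, map_add, ha, hb]
      | tmul y x =>
        rw [TensorProduct.assoc_symm_tmul, LinearMap.lTensor_tmul, LinearMap.lTensor_tmul]
        generalize Z.rcoact.toLinearMap x = s
        induction s with
        | zero => simp only [tmul_zero, map_zero]
        | add a b ha hb => simp only [tmul_add, map_add, ha, hb]
        | tmul a z => rfl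
    rw [extendR_tmul, e, rcoact_translationR, LinearMap.lTensor_tmul]
    generalize comul (R := k) b = w
    induction w with
    | zero => simp only [tmul_zero, map_zero]
    | add a b ha hb => simp only [tmul_add, map_add, ha, hb]
    | tmul a c => rfl

lemma lcoact_extendR (h : IsOpposite Z S ρ l p q) (ω : A ⊗[k] A) :
    TensorProduct.assoc k A (A ⊗[k] Y) Z
      (((TensorProduct.assoc k A A Y).toLinearMap ∘ₗ comul.rTensor Y).rTensor Z
        (extendR hZ h ω)) =
    (extendR hZ h).toLinearMap.lTensor A (TensorProduct.assoc k A A A (comul.rTensor A ω)) := by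
  induction ω with
  | zero => simp only [map_zero]
  | add x y hx hy => simp only [map_add, hx, hy]
  | tmul a b =>
    have e : ∀ w : A ⊗[k] A, (extendR hZ h).toLinearMap.lTensor A
        (TensorProduct.assoc k A A A (w ⊗ₜ b)) =
        ((TensorProduct.assoc k A Y Z).symm.toLinearMap ∘ₗ
          (TensorProduct.mk k A (Y ⊗[k] Z)).flip (translationR hZ h b)).lTensor A w := by
      intro w
      induction w with
      | zero => simp only [zero_tmul, map_zero]
      | add a b ha hb => simp only [add_tmul, map_add, ha, hb]
      | tmul b c => rfl
    rw [LinearMap.rTensor_tmul, e, extendR_tmul]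
    generalize translationR hZ h b = t
    induction t with
    | zero => simp only [tmul_zero, map_zero, LinearMap.comp_zero, LinearMap.lTensor_zero,
        LinearMap.zero_apply]
    | add x y hx hy =>
      simp only [tmul_add, map_add, LinearMap.comp_add, LinearMap.lTensor_add,
        LinearMap.add_apply, hx, hy]
    | tmul y x =>
      rw [TensorProduct.assoc_symm_tmul, LinearMap.rTensor_tmul, LinearMap.comp_apply,
        LinearMap.rTensor_tmul]
      generalize comul (R := k) a = w
      induction w with
      | zero => simp only [zero_tmul, map_zero]
      | add a b ha hb => simp only [add_tmul, map_add, ha, hb]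
      | tmul b c => rfl

lemma insertOneL_injective [Module.Flat k A] (hi : Function.Injective (algebraMap k Z)) :
    Function.Injective (insertOneL (A := A) Z) :=
  Module.Flat.lTensor_preserves_injective_linearMap (M := A) _
    (Algebra.TensorProduct.includeRight_injective (A := Z) (B := A) hi)

/-- Elements of `A ⊗ Z ⊗ A` that are left coinvariant in the middle factor come from `A ⊗ A`. -/
lemma exists_insertOneL_eq [Module.Flat k A]
    (hc : ∀ z : Z, Z.lcoact z = 1 ⊗ₜ z → ∃ c : k, algebraMap k Z c = z)
    {w : A ⊗[k] (Z ⊗[k] A)} (hw : ((TensorProduct.mk k A A).flip 1).rTensor (Z ⊗[k] A) w =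
      (TensorProduct.assoc k A A (Z ⊗[k] A)).symm ((lcoactFst Z).toLinearMap.lTensor A w)) :
    ∃ ω, insertOneL Z ω = w := by
  have hex : Function.Exact (Algebra.linearMap k Z)
      (TensorProduct.mk k A Z 1 - Z.lcoact.toLinearMap) := by
    intro z
    refine ⟨fun hz ↦ hc z (sub_eq_zero.1
      (show (1 : A) ⊗ₜ[k] z - Z.lcoact z = 0 from hz)).symm, ?_⟩
    rintro ⟨c, rfl⟩
    change 1 ⊗ₜ algebraMap k Z c - Z.lcoact (algebraMap k Z c) = 0
    rw [Z.lcoact.commutes, sub_eq_zero, Algebra.algebraMap_eq_smul_one, tmul_smul,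
      Algebra.algebraMap_eq_smul_one]
    rfl
  obtain ⟨u, rfl⟩ := (Module.Flat.lTensor_exact A (Module.Flat.rTensor_exact A hex) w).1 (by
    rw [LinearMap.rTensor_sub, LinearMap.lTensor_sub]
    refine sub_eq_zero.2 (show ((TensorProduct.mk k A Z 1).rTensor A).lTensor A w =
      (Z.lcoact.toLinearMap.rTensor A).lTensor A w from ?_)
    refine ((TensorProduct.assoc k A Z A).lTensor A).injective ?_
    refine (TensorProduct.assoc k A A (Z ⊗[k] A)).symm.injective (Eq.trans ?_ (hw.trans ?_))
    · exact LinearMap.congr_fun (f := (TensorProduct.assoc k A A (Z ⊗[k] A)).symm.toLinearMap ∘ₗ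
        (TensorProduct.assoc k A Z A).toLinearMap.lTensor A ∘ₗ
          ((TensorProduct.mk k A Z 1).rTensor A).lTensor A)
        (g := ((TensorProduct.mk k A A).flip 1).rTensor (Z ⊗[k] A))
        (TensorProduct.ext_threefold' fun a z b ↦ rfl) w
    · exact congrArg (TensorProduct.assoc k A A (Z ⊗[k] A)).symm
        (LinearMap.lTensor_comp_apply A (TensorProduct.assoc k A Z A).toLinearMap
          (Z.lcoact.toLinearMap.rTensor A) w))
  refine ⟨(TensorProduct.lid k A).toLinearMap.lTensor A u, ?_⟩
  refine LinearMap.congr_fun (f := insertOneL Z ∘ₗ (TensorProduct.lid k A).toLinearMap.lTensor A)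
    (g := ((Algebra.linearMap k Z).rTensor A).lTensor A)
    (TensorProduct.ext_threefold' fun a c b ↦ ?_) u
  change a ⊗ₜ[k] ((1 : Z) ⊗ₜ[k] (c • b)) = a ⊗ₜ (algebraMap k Z c ⊗ₜ b)
  rw [← smul_tmul, Algebra.algebraMap_eq_smul_one]

lemma coinvariant_insertOneL (ω : A ⊗[k] A) :
    ((TensorProduct.mk k A A).flip 1).rTensor (Z ⊗[k] A) (insertOneL Z ω) =
      (TensorProduct.assoc k A A (Z ⊗[k] A)).symm
        ((lcoactFst Z).toLinearMap.lTensor A (insertOneL Z ω)) := by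
  induction ω with
  | zero => simp only [map_zero]
  | add x y hx hy => simp only [map_add, hx, hy]
  | tmul a b =>
    change (a ⊗ₜ[k] (1 : A)) ⊗ₜ[k] ((1 : Z) ⊗ₜ[k] b) = (TensorProduct.assoc k A A (Z ⊗[k] A)).symm
      (a ⊗ₜ TensorProduct.assoc k A Z A (Z.lcoact 1 ⊗ₜ b))
    rw [map_one]
    rfl

variable (Z) in
/-- `a ⊗ (b ⊗ c) ↦ (a ⊗ 1) ⊗ (b ⊗ c)` -/
def insertOneL₃ : A ⊗[k] (A ⊗[k] A) →ₗ[k] (A ⊗[k] Z) ⊗[k] (A ⊗[k] A) :=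
  ((TensorProduct.mk k A Z).flip 1).rTensor (A ⊗[k] A)

lemma insertOneL₃_injective [Module.Flat k A] (hi : Function.Injective (algebraMap k Z)) :
    Function.Injective (insertOneL₃ (A := A) Z) :=
  Module.Flat.rTensor_preserves_injective_linearMap (M := A ⊗[k] A) _
    (Algebra.TensorProduct.includeLeft_injective (S := k) (A := A) (B := Z) hi)

lemma comul_insertOneL (ω : A ⊗[k] A) :
    comul.lTensor (A ⊗[k] Z) ((TensorProduct.assoc k A Z A).symm (insertOneL Z ω)) =
      insertOneL₃ Z (comul.lTensor A ω) := by
  induction ω with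
  | zero => simp only [map_zero]
  | add x y hx hy => simp only [map_add, hx, hy]
  | tmul a b => rfl

lemma comulMul_insertOneL (ω : A ⊗[k] A) :
    comulMul k Z ((Z.coactR A).lTensor A (insertOneL Z ω)) =
      insertOneL₃ Z (TensorProduct.assoc k A A A (comul.rTensor A ω)) := by
  induction ω with
  | zero => simp only [map_zero]
  | add x y hx hy => simp only [map_add, hx, hy]
  | tmul a b =>
    change comulMul k Z (a ⊗ₜ Z.coactR A (1 ⊗ₜ b)) =
      insertOneL₃ Z (TensorProduct.assoc k A A A (comul a ⊗ₜ b))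
    rw [coactR_tmul, map_one Z.rcoact]
    change ((LinearMap.mul' k A).rTensor A ∘ₗ
      (TensorProduct.assoc k A A A).symm.toLinearMap).lTensor (A ⊗[k] Z)
      (TensorProduct.tensorTensorTensorComm k A A Z (A ⊗[k] A)
        (comul a ⊗ₜ (1 ⊗ₜ (1 ⊗ₜ b)))) = _
    generalize comul (R := k) a = w
    induction w with
    | zero => simp only [zero_tmul, map_zero]
    | add x y hx hy => simp only [add_tmul, map_add, hx, hy]
    | tmul b c => simp [insertOneL₃]

/-- The elements of `(A ⊗ Y) ⊗ Z` that satisfy the equations of the inverse object: the second one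
leaves the elements `a ⊗ κ⁻¹(1 ⊗ b)`, and the first one restricts `a ⊗ b` to the image of `Δ`. -/
lemma inverse_conditionsL_iff [Module.Flat k A] (h : IsOpposite Z S ρ l p q)
    (hi : Function.Injective (algebraMap k Z))
    (hc : ∀ z : Z, Z.lcoact z = 1 ⊗ₜ z → ∃ c : k, algebraMap k Z c = z)
    (v : (A ⊗[k] Y) ⊗[k] Z) :
    (((antipodeRight S).toLinearMap.rTensor Y).rTensor Z v = (coactFstL ρ).rTensor Z v ∧
      (S.toLinearMap.lTensor (A ⊗[k] Y)).rTensor Z (Z.coactL (A ⊗[k] Y) v) =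
        (coactSndL l).rTensor Z v) ↔
    ∃ a : A, extendR hZ h (comul a) = v := by
  rw [← (transferFstL_injective (p := p) (q := q) Z hZ).eq_iff,
    ← (transferSndL_injective (p := p) (q := q) Z hZ).eq_iff, transferFstL_antipode Z h.antipode,
    transferFstL_coaction Z h.rcoact, transferSndL_antipode Z h.antipode,
    transferSndL_coaction Z h.lcoact]
  have e : ∀ ω, extendR hZ h ω = v ↔ insertOneL Z ω = kappaRLast Z p v := fun ω ↦ by
    rw [← (kappaRLast_bijective Z (p := p) hZ).1.eq_iff, kappaRLast_extendR]
  simp only [e]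
  constructor
  · rintro ⟨h1, h2⟩
    obtain ⟨ω, hω⟩ := exists_insertOneL_eq hc h2
    rw [← hω, comul_insertOneL, comulMul_insertOneL, (insertOneL₃_injective hi).eq_iff] at h1
    obtain ⟨a, rfl⟩ := exists_lcoact_eq_of_cotensor (Z := unit k A) (u := ω) h1.symm
    exact ⟨a, hω⟩
  · rintro ⟨a, ha⟩
    rw [← ha]
    refine ⟨?_, coinvariant_insertOneL _⟩
    rw [comul_insertOneL, comulMul_insertOneL, Coalgebra.coassoc_apply]

/-- `a ↦ (a₁ ⊗ a₂') ⊗ a₂''` followed by the coaction, with `κ(a' ⊗ a'') = 1 ⊗ a`. -/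
def unitToCotensorL (h : IsOpposite Z S ρ l p q) : A →ₐ[k] (A ⊗[k] (Y ⊗[k] A)) ⊗[k] Z :=
  ((Algebra.TensorProduct.map (Algebra.TensorProduct.assoc k k k A Y A).toAlgHom
    (AlgHom.id k Z)).comp (Algebra.TensorProduct.assoc k k k (A ⊗[k] Y) A Z).symm.toAlgHom).comp
    ((cotensorR (tensor (unit k A) (trivial k A Y)) Z).comp
      ((extendR hZ h).comp (Bialgebra.comulAlgHom k A)))

lemma unitToCotensorL_injective [Module.Flat k A] (h : IsOpposite Z S ρ l p q)
    (hi : Function.Injective (algebraMap k Z)) : Function.Injective (unitToCotensorL hZ h) := by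
  intro a b hab
  have h1 := congrArg (kappaRLast Z p) (coactL_injective Z (A ⊗[k] Y)
    (((TensorProduct.assoc k A Y A).rTensor Z).injective hab))
  refine lcoact_injective (unit k A) (insertOneL_injective hi ?_)
  exact (kappaRLast_extendR hZ h _).symm.trans (h1.trans (kappaRLast_extendR hZ h _))

/-- `(a ⊗ y) ⊗ (b ⊗ z) ↦ (a ⊗ (y ⊗ b)) ⊗ z` -/
def reassoc (Y Z : Type v) [AddCommGroup Y] [Module k Y] [AddCommGroup Z] [Module k Z] :
    (A ⊗[k] Y) ⊗[k] (A ⊗[k] Z) →ₗ[k] (A ⊗[k] (Y ⊗[k] A)) ⊗[k] Z :=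
  (TensorProduct.assoc k A Y A).toLinearMap.rTensor Z ∘ₗ
    (TensorProduct.assoc k (A ⊗[k] Y) A Z).symm.toLinearMap

lemma reassoc_left (s : (A ⊗[k] Y) ⊗[k] (A ⊗[k] Z)) :
    TensorProduct.assoc k A (A ⊗[k] (Y ⊗[k] A)) Z ((ambientL k A Y).rTensor Z
      (reassoc (A := A) Y Z s)) =
    (reassoc (A := A) Y Z).lTensor A (TensorProduct.assoc k A (A ⊗[k] Y) (A ⊗[k] Z)
      (((TensorProduct.assoc k A A Y).toLinearMap ∘ₗ comul.rTensor Y).rTensor (A ⊗[k] Z) s)) := by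
  refine LinearMap.congr_fun (f := (TensorProduct.assoc k A (A ⊗[k] (Y ⊗[k] A)) Z).toLinearMap ∘ₗ
    (ambientL k A Y).rTensor Z ∘ₗ reassoc (A := A) Y Z)
    (g := (reassoc (A := A) Y Z).lTensor A ∘ₗ
      (TensorProduct.assoc k A (A ⊗[k] Y) (A ⊗[k] Z)).toLinearMap ∘ₗ
      ((TensorProduct.assoc k A A Y).toLinearMap ∘ₗ comul.rTensor Y).rTensor (A ⊗[k] Z))
    (TensorProduct.ext_fourfold' fun a y b z ↦ ?_) s
  change TensorProduct.assoc k A (A ⊗[k] (Y ⊗[k] A)) Z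
      ((TensorProduct.assoc k A A (Y ⊗[k] A) (comul a ⊗ₜ (y ⊗ₜ b))) ⊗ₜ z) =
    (reassoc (A := A) Y Z).lTensor A (TensorProduct.assoc k A (A ⊗[k] Y) (A ⊗[k] Z)
      (TensorProduct.assoc k A A Y (comul a ⊗ₜ y) ⊗ₜ (b ⊗ₜ z)))
  generalize comul (R := k) a = w
  induction w with
  | zero => simp only [zero_tmul, map_zero]
  | add a b ha hb => simp only [add_tmul, map_add, ha, hb]
  | tmul a c => rfl

lemma reassoc_right (s : (A ⊗[k] Y) ⊗[k] (A ⊗[k] Z)) :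
    (TensorProduct.assoc k (A ⊗[k] (Y ⊗[k] A)) Z A).symm
      (Z.rcoact.toLinearMap.lTensor (A ⊗[k] (Y ⊗[k] A)) (reassoc (A := A) Y Z s)) =
    (reassoc (A := A) Y Z).rTensor A ((TensorProduct.assoc k (A ⊗[k] Y) (A ⊗[k] Z) A).symm
      (((TensorProduct.assoc k A Z A).symm.toLinearMap ∘ₗ
        Z.rcoact.toLinearMap.lTensor A).lTensor (A ⊗[k] Y) s)) := by
  refine LinearMap.congr_fun (f := (TensorProduct.assoc k (A ⊗[k] (Y ⊗[k] A)) Z A).symm.toLinearMap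
    ∘ₗ Z.rcoact.toLinearMap.lTensor (A ⊗[k] (Y ⊗[k] A)) ∘ₗ reassoc (A := A) Y Z)
    (g := (reassoc (A := A) Y Z).rTensor A ∘ₗ
      (TensorProduct.assoc k (A ⊗[k] Y) (A ⊗[k] Z) A).symm.toLinearMap ∘ₗ
      ((TensorProduct.assoc k A Z A).symm.toLinearMap ∘ₗ
        Z.rcoact.toLinearMap.lTensor A).lTensor (A ⊗[k] Y))
    (TensorProduct.ext_fourfold' fun a y b z ↦ ?_) s
  change (TensorProduct.assoc k (A ⊗[k] (Y ⊗[k] A)) Z A).symm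
      ((a ⊗ₜ (y ⊗ₜ b)) ⊗ₜ Z.rcoact z) =
    (reassoc (A := A) Y Z).rTensor A ((TensorProduct.assoc k (A ⊗[k] Y) (A ⊗[k] Z) A).symm
      ((a ⊗ₜ y) ⊗ₜ (TensorProduct.assoc k A Z A).symm (b ⊗ₜ Z.rcoact z)))
  generalize Z.rcoact z = w
  induction w with
  | zero => simp only [tmul_zero, map_zero]
  | add a b ha hb => simp only [tmul_add, map_add, ha, hb]
  | tmul a c => rfl

lemma isBicolinear_unitToCotensorL (h : IsOpposite Z S ρ l p q) :
    IsBicolinear (Z := unit k A) (T := tensor (ambient k A Y) Z)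
      (unitToCotensorL hZ h).toLinearMap := by
  constructor
  · intro (a : A)
    have e : ∀ w : A ⊗[k] A, (reassoc (A := A) Y Z).lTensor A
        ((Z.lcoact.toLinearMap.lTensor (A ⊗[k] Y)).lTensor A
        ((extendR hZ h).toLinearMap.lTensor A (comul.lTensor A w))) =
        (unitToCotensorL hZ h).toLinearMap.lTensor A w := by
      intro w
      induction w with
      | zero => simp only [map_zero]
      | add x y hx hy => simp only [map_add, hx, hy]
      | tmul a b => rfl
    refine (reassoc_left (Z := Z) (Z.lcoact.toLinearMap.lTensor (A ⊗[k] Y)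
      (extendR hZ h (comul a)))).trans (Eq.trans ?_ (e (comul a)))
    refine congrArg ((reassoc (A := A) Y Z).lTensor A) ?_
    refine (cotensorR_tensorL (tensor (unit k A) (trivial k A Y)) Z
      (extendR hZ h (comul a))).symm.trans ?_
    exact congrArg ((Z.lcoact.toLinearMap.lTensor (A ⊗[k] Y)).lTensor A)
      ((lcoact_extendR hZ h (comul a)).trans (congrArg ((extendR hZ h).toLinearMap.lTensor A)
        (Coalgebra.coassoc_apply (R := k) a)))
  · intro (a : A)
    have e : ∀ w : A ⊗[k] A, (reassoc (A := A) Y Z).rTensor A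
        ((Z.lcoact.toLinearMap.lTensor (A ⊗[k] Y)).rTensor A
        ((extendR hZ h).toLinearMap.rTensor A (comul.rTensor A w))) =
        (unitToCotensorL hZ h).toLinearMap.rTensor A w := by
      intro w
      induction w with
      | zero => simp only [map_zero]
      | add x y hx hy => simp only [map_add, hx, hy]
      | tmul a b => rfl
    refine (reassoc_right (Z := Z) (Z.lcoact.toLinearMap.lTensor (A ⊗[k] Y)
      (extendR hZ h (comul a)))).trans (Eq.trans ?_ (e (comul a)))
    refine congrArg ((reassoc (A := A) Y Z).rTensor A) ?_
    refine (cotensorR_tensorR (tensor (unit k A) (trivial k A Y)) Z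
      (extendR hZ h (comul a))).symm.trans ?_
    exact congrArg ((Z.lcoact.toLinearMap.lTensor (A ⊗[k] Y)).rTensor A)
      ((rcoact_extendR hZ h (comul a)).trans (congrArg ((extendR hZ h).toLinearMap.rTensor A)
        (Coalgebra.coassoc_symm_apply (R := k) a)))

lemma ambientR_comp_assoc :
    (ambientR k A Y) ∘ₗ (TensorProduct.assoc k A Y A).toLinearMap =
      (TensorProduct.assoc k A Y A).toLinearMap.rTensor A ∘ₗ comulL k A (A ⊗[k] Y) := by
  refine TensorProduct.ext_threefold fun a y b ↦ ?_
  change (TensorProduct.assoc k A (Y ⊗[k] A) A).symm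
      (a ⊗ₜ (TensorProduct.assoc k Y A A).symm (y ⊗ₜ comul b)) =
    (TensorProduct.assoc k A Y A).toLinearMap.rTensor A
      ((TensorProduct.assoc k (A ⊗[k] Y) A A).symm ((a ⊗ₜ y) ⊗ₜ comul b))
  generalize comul (R := k) b = w
  induction w with
  | zero => simp only [tmul_zero, map_zero]
  | add a b ha hb => simp only [tmul_add, map_add, ha, hb]
  | tmul a c => rfl

/-- The cotensor condition for `(A ⊗ Y ⊗ A) □ Z`, rebracketed. -/
lemma cotensor_condition_iff (u : ((A ⊗[k] Y) ⊗[k] A) ⊗[k] Z) :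
    TensorProduct.assoc k (A ⊗[k] (Y ⊗[k] A)) A Z ((ambientR k A Y).rTensor Z
      ((TensorProduct.assoc k A Y A).toLinearMap.rTensor Z u)) =
        Z.lcoact.toLinearMap.lTensor (A ⊗[k] (Y ⊗[k] A))
          ((TensorProduct.assoc k A Y A).toLinearMap.rTensor Z u) ↔
    Z.coactL ((A ⊗[k] Y) ⊗[k] A) u = (comulL k A (A ⊗[k] Y)).rTensor Z u := by
  have hE : Function.Injective (((TensorProduct.assoc k A Y A).toLinearMap.rTensor A).rTensor Z) :=
    (((TensorProduct.assoc k A Y A).rTensor A).rTensor Z).injective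
  rw [← LinearMap.rTensor_comp_apply, ambientR_comp_assoc, LinearMap.rTensor_comp_apply,
    ← (TensorProduct.assoc k (A ⊗[k] (Y ⊗[k] A)) A Z).eq_symm_apply, ← hE.eq_iff,
    ← coactL_rTensor]
  exact eq_comm

/-- The inverse object is a left inverse of `Z`. -/
theorem inverseObject_cotensor [Module.Flat k A] [Module.Flat k Z]
    (hZ : Function.Bijective Z.kappaR) (h : IsOpposite Z S ρ l p q)
    (hi : Function.Injective (algebraMap k Z))
    (hc : ∀ z : Z, Z.lcoact z = 1 ⊗ₜ z → ∃ c : k, algebraMap k Z c = z) :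
    Isomorphic (cotensor (inverseObject S ρ l) Z) (unit k A) := by
  let i : cotensor (inverseObject S ρ l) Z →ₐ[k] tensor (ambient k A Y) Z :=
    (Algebra.TensorProduct.map (inverseVal S ρ l) (AlgHom.id k Z)).comp (cotensorVal _ Z)
  refine isomorphic_of_range_eq (k := k) (A := A) (W := tensor (ambient k A Y) Z) (i := i)
    (j := unitToCotensorL (A := A) hZ h) ?_ (unitToCotensorL_injective hZ h hi) ?_
    (isBicolinear_unitToCotensorL hZ h) fun w ↦ ?_
  · exact (Module.Flat.rTensor_preserves_injective_linearMap (M := Z) _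
      (inverseVal_injective S ρ l)).comp (cotensorVal_injective _ Z)
  · exact (isBicolinear_map (isBicolinear_inverseVal S ρ l) (isBicolinear_id Z)).comp
      (isBicolinear_cotensorVal _ Z)
  · refine (exists_rTensor_inverseVal_iff S ρ l Z w).trans ?_
    constructor
    · rintro ⟨h1, h2⟩
      obtain ⟨w, rfl⟩ := ((TensorProduct.assoc k A Y A).rTensor Z).surjective w
      obtain ⟨v, rfl⟩ := exists_coactL_eq (M := A ⊗[k] Y) ((cotensor_condition_iff w).1 h1)
      obtain ⟨a, rfl⟩ := (inverse_conditionsL_iff hZ h hi hc v).1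
        ((coactL_conditions_iff Z S ρ l v).1 h2)
      exact ⟨a, rfl⟩
    · rintro ⟨a, rfl⟩
      exact ⟨(cotensor_condition_iff _).2 (coactL_coactL Z (A ⊗[k] Y) _),
        (coactL_conditions_iff Z S ρ l _).2
          ((inverse_conditionsL_iff hZ h hi hc _).2 ⟨a, rfl⟩)⟩

end Left

/-! ### The inverse of a biGalois object is biGalois -/

section Inverse

lemma Isomorphic.kappaR_bijective {Z T : BicomoduleAlgebra k A} (h : Isomorphic Z T)
    (hT : Function.Bijective T.kappaR) : Function.Bijective Z.kappaR := by
  obtain ⟨f, -, hr⟩ := h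
  have e : ∀ s, T.kappaR (TensorProduct.congr f.toLinearEquiv f.toLinearEquiv s) =
      f.toLinearEquiv.rTensor A (Z.kappaR s) := by
    intro s
    induction s with
    | zero => simp only [map_zero]
    | add x y hx hy => simp only [map_add, hx, hy]
    | tmul x y =>
      refine (kappaR_tmul T (f x) (f y)).trans ?_
      rw [kappaR_tmul, hr]
      generalize Z.rcoact y = w
      induction w with
      | zero => simp only [map_zero, mul_zero]
      | add a b ha hb => simp only [map_add, mul_add, ha, hb]
      | tmul z a =>
        rw [Algebra.TensorProduct.tmul_mul_tmul]
        change (f x ⊗ₜ[k] (1 : A)) * (f z ⊗ₜ a) = f (x * z) ⊗ₜ (1 * a)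
        rw [Algebra.TensorProduct.tmul_mul_tmul, map_mul]
  have h0 : T.kappaR ∘ TensorProduct.congr f.toLinearEquiv f.toLinearEquiv =
      f.toLinearEquiv.rTensor A ∘ Z.kappaR := funext e
  have h1 := hT.comp (TensorProduct.congr f.toLinearEquiv f.toLinearEquiv).bijective
  rw [h0] at h1
  exact ((f.toLinearEquiv.rTensor A).bijective.of_comp_iff' _).1 h1

lemma Isomorphic.kappaL_bijective {Z T : BicomoduleAlgebra k A} (h : Isomorphic Z T)
    (hT : Function.Bijective T.kappaL) : Function.Bijective Z.kappaL := by
  obtain ⟨f, hl, -⟩ := h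
  have e : ∀ s, T.kappaL (TensorProduct.congr f.toLinearEquiv f.toLinearEquiv s) =
      f.toLinearEquiv.lTensor A (Z.kappaL s) := by
    intro s
    induction s with
    | zero => simp only [map_zero]
    | add x y hx hy => simp only [map_add, hx, hy]
    | tmul x y =>
      refine (kappaL_tmul T (f x) (f y)).trans ?_
      rw [kappaL_tmul, hl]
      generalize Z.lcoact x = w
      induction w with
      | zero => simp only [map_zero, zero_mul]
      | add a b ha hb => simp only [map_add, add_mul, ha, hb]
      | tmul a z =>
        rw [Algebra.TensorProduct.tmul_mul_tmul]
        change (a ⊗ₜ[k] f z) * ((1 : A) ⊗ₜ f y) = (a * 1) ⊗ₜ f (z * y)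
        rw [Algebra.TensorProduct.tmul_mul_tmul, map_mul]
  have h0 : T.kappaL ∘ TensorProduct.congr f.toLinearEquiv f.toLinearEquiv =
      f.toLinearEquiv.lTensor A ∘ Z.kappaL := funext e
  have h1 := hT.comp (TensorProduct.congr f.toLinearEquiv f.toLinearEquiv).bijective
  rw [h0] at h1
  exact ((f.toLinearEquiv.lTensor A).bijective.of_comp_iff' _).1 h1

variable (k A) in
/-- A flat Hopf algebra is faithfully flat, because the counit splits the unit. -/
lemma faithfullyFlat_hopfAlgebra [Module.Flat k A] : Module.FaithfullyFlat k A := by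
  refine (Module.FaithfullyFlat.iff_flat_and_ideal_smul_eq_top k A).2 ⟨inferInstance, fun I hI ↦ ?_⟩
  have h1 : (1 : A) ∈ I • (⊤ : Submodule k A) := by
    rw [hI]
    exact Submodule.mem_top
  have h2 : I • (⊤ : Submodule k A) ≤ Submodule.comap (counit (R := k) (A := A)) I :=
    Submodule.smul_le.2 fun r hr a _ ↦ by
      rw [Submodule.mem_comap, map_smul, smul_eq_mul]
      exact I.mul_mem_right _ hr
  have h3 : counit (R := k) (1 : A) ∈ I := h2 h1
  rw [Bialgebra.counit_one] at h3
  exact (Ideal.eq_top_iff_one I).2 h3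

lemma kappaR_unit : (unit k A).kappaR = comulShearL k A :=
  TensorProduct.ext' fun c a ↦ (kappaR_tmul (unit k A) c a).trans
    (comulShearL_tmul (k := k) (A := A) c a).symm

lemma kappaL_unit : (unit k A).kappaL = comulShearR k A :=
  TensorProduct.ext' fun a c ↦ (kappaL_tmul (unit k A) a c).trans
    (comulShearR_tmul (k := k) (A := A) a c).symm

lemma kappaR_unit_bijective : Function.Bijective (unit k A).kappaR :=
  kappaR_unit (k := k) (A := A) ▸ comulShearL_bijective

lemma kappaL_unit_bijective : Function.Bijective (unit k A).kappaL :=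
  kappaL_unit (k := k) (A := A) ▸ comulShearR_bijective

variable (k A) in
lemma isBiGalois_unit [Nontrivial k] [Module.Flat k A] : (unit k A).IsBiGalois :=
  isBiGalois_of_bijective (faithfullyFlat_hopfAlgebra k A) kappaL_unit_bijective
    kappaR_unit_bijective

variable (Z : BicomoduleAlgebra k A)

/-- The right coaction `z ↦ z₁ ⊗ z₀` as an algebra map between opposite algebras. -/
def rcoactOp : Zᵐᵒᵖ →ₐ[k] Aᵐᵒᵖ ⊗[k] Zᵐᵒᵖ :=
  (Algebra.TensorProduct.comm k Zᵐᵒᵖ Aᵐᵒᵖ).toAlgHom.comp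
    ((Algebra.TensorProduct.opAlgEquiv k k Z A).symm.toAlgHom.comp (AlgHom.op Z.rcoact))

/-- The left coaction `z ↦ z₀ ⊗ z₋₁` as an algebra map between opposite algebras. -/
def lcoactOp : Zᵐᵒᵖ →ₐ[k] Zᵐᵒᵖ ⊗[k] Aᵐᵒᵖ :=
  (Algebra.TensorProduct.comm k Aᵐᵒᵖ Zᵐᵒᵖ).toAlgHom.comp
    ((Algebra.TensorProduct.opAlgEquiv k k A Z).symm.toAlgHom.comp (AlgHom.op Z.lcoact))

lemma isOpposite_op : IsOpposite Z (HopfAlgebra.antipodeAlgHomOp k A) Z.rcoactOp Z.lcoactOp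
    (MulOpposite.opLinearEquiv k).symm (MulOpposite.opLinearEquiv k).symm where
  antipode _ := rfl
  rcoact y := by
    change TensorProduct.map _ _ (TensorProduct.comm k Zᵐᵒᵖ Aᵐᵒᵖ (TensorProduct.map
      (MulOpposite.opLinearEquiv k).toLinearMap (MulOpposite.opLinearEquiv k).toLinearMap
        (Z.rcoact y.unop))) = TensorProduct.comm k Z A (Z.rcoact y.unop)
    generalize Z.rcoact y.unop = w
    induction w with
    | zero => simp only [map_zero]
    | add a b ha hb => simp only [map_add, ha, hb]
    | tmul z a => rfl
  lcoact y := by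
    change TensorProduct.map _ _ (TensorProduct.comm k Aᵐᵒᵖ Zᵐᵒᵖ (TensorProduct.map
      (MulOpposite.opLinearEquiv k).toLinearMap (MulOpposite.opLinearEquiv k).toLinearMap
        (Z.lcoact y.unop))) = TensorProduct.comm k A Z (Z.lcoact y.unop)
    generalize Z.lcoact y.unop = w
    induction w with
    | zero => simp only [map_zero]
    | add a b ha hb => simp only [map_add, ha, hb]
    | tmul z a => rfl
  mul _ _ := rfl
  one := rfl

variable {Z}

/-- Every faithfully flat biGalois object has a two-sided inverse for the cotensor product. -/
theorem IsBiGalois.exists_inverse [Nontrivial k] [Module.Flat k A] (hZ : Z.IsBiGalois) :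
    ∃ V : BicomoduleAlgebra k A, V.IsBiGalois ∧ Isomorphic (Z.cotensor V) (unit k A) ∧
      Isomorphic (V.cotensor Z) (unit k A) := by
  have := hZ.faithfullyFlat
  have h1 := cotensor_inverseObject hZ.left.bijective (isOpposite_op Z)
    hZ.left.algebraMap_injective hZ.right.coinvariants
  have h2 := inverseObject_cotensor hZ.right.bijective (isOpposite_op Z)
    hZ.left.algebraMap_injective hZ.left.coinvariants
  -- flatness and the Galois maps of the inverse descend from those of its products with `Z`
  refine ⟨_, isBiGalois_of_bijective ?_ ?_ ?_, h1, h2⟩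
  · obtain ⟨f, -⟩ := h1
    have := faithfullyFlat_hopfAlgebra k A
    exact faithfullyFlat_of_cotensor hZ.right.bijective
      (Module.FaithfullyFlat.of_linearEquiv k A f.toLinearEquiv)
  · exact (kappaL_cotensor_bijective_iff hZ.left.bijective).1
      (h2.kappaL_bijective kappaL_unit_bijective)
  · exact (kappaR_cotensor_bijective_iff hZ.right.bijective).1
      (h1.kappaR_bijective kappaR_unit_bijective)

end Inverse

end BicomoduleAlgebra

section Group

variable {k : Type u} {A : Type v} [CommRing k] [Ring A] [HopfAlgebra k A]

open BicomoduleAlgebra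

lemma BiGal.mk_eq_mk {Z T : BicomoduleAlgebra k A} (hZ : Z.IsBiGalois) (hT : T.IsBiGalois) :
    BiGal.mk Z hZ = BiGal.mk T hT ↔ Isomorphic Z T := Quotient.eq

variable [Nontrivial k] [Module.Flat k A]

/-- The product of classes of biGalois objects: `[Z][T] = [Z □ T]`. -/
def BiGal.mul : BiGal k A → BiGal k A → BiGal k A :=
  Quotient.map₂ (fun Z T ↦ ⟨cotensor Z.1 T.1, Z.2.cotensor T.2⟩)
    fun _ _ h _ _ h' ↦ Isomorphic.cotensor h h'

/-- The class of an inverse of a biGalois object. -/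
def BiGal.inv (x : BiGal k A) : BiGal k A :=
  BiGal.mk x.out.2.exists_inverse.choose x.out.2.exists_inverse.choose_spec.1

lemma BiGal.mul_assoc (x y z : BiGal k A) :
    BiGal.mul (BiGal.mul x y) z = BiGal.mul x (BiGal.mul y z) := by
  obtain ⟨⟨Z, hZ⟩, rfl⟩ := Quotient.exists_rep x
  obtain ⟨⟨T, hT⟩, rfl⟩ := Quotient.exists_rep y
  obtain ⟨⟨U, hU⟩, rfl⟩ := Quotient.exists_rep z
  have := hZ.faithfullyFlat
  have := hU.faithfullyFlat
  exact Quotient.sound (cotensor_assoc Z T U)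

lemma BiGal.unit_mul (x : BiGal k A) :
    BiGal.mul (BiGal.mk (unit k A) (isBiGalois_unit k A)) x = x := by
  obtain ⟨⟨Z, hZ⟩, rfl⟩ := Quotient.exists_rep x
  exact Quotient.sound (unit_cotensor Z)

lemma BiGal.inv_mul (x : BiGal k A) :
    BiGal.mul (BiGal.inv x) x = BiGal.mk (unit k A) (isBiGalois_unit k A) := by
  have h : BiGal.mul (BiGal.inv x) (BiGal.mk x.out.1 x.out.2) =
      BiGal.mk (unit k A) (isBiGalois_unit k A) :=
    Quotient.sound x.out.2.exists_inverse.choose_spec.2.2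
  have e : BiGal.mk x.out.1 x.out.2 = x := Quotient.out_eq x
  rwa [e] at h

variable (k A) in
/-- The biGalois group. It is not a global instance, so that a group structure on `BiGal k A`
can be given explicitly. -/
abbrev BiGal.group : Group (BiGal k A) :=
  @Group.ofLeftAxioms (BiGal k A) ⟨BiGal.mul⟩ ⟨BiGal.inv⟩
    ⟨BiGal.mk (unit k A) (isBiGalois_unit k A)⟩ BiGal.mul_assoc BiGal.unit_mul BiGal.inv_mul

attribute [local instance] BiGal.group

lemma BiGal.mk_mul_mk {Z T : BicomoduleAlgebra k A} (hZ : Z.IsBiGalois) (hT : T.IsBiGalois) :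
    BiGal.mk Z hZ * BiGal.mk T hT = BiGal.mk (cotensor Z T) (hZ.cotensor hT) := rfl

end Group

/-! ### Functionals and colinear maps -/

section Functional

variable {k : Type*} [CommRing k] {C : Type*} [Ring C] [Bialgebra k C]

/-- `c ↦ φ(c₁) c₂` -/
def actL (φ : WithConv (C →ₗ[k] k)) : C →ₗ[k] C := (scal C φ * toConv LinearMap.id).ofConv

/-- `c ↦ c₁ φ(c₂)` -/
def actR (φ : WithConv (C →ₗ[k] k)) : C →ₗ[k] C := (toConv LinearMap.id * scal C φ).ofConv

lemma actL_comp_actL (φ ψ : WithConv (C →ₗ[k] k)) : actL ψ ∘ₗ actL φ = actL (φ * ψ) := by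
  have h := comp_scal_mul (actL ψ) φ (toConv (LinearMap.id : C →ₗ[k] C))
  rw [ofConv_toConv, LinearMap.comp_id] at h
  have h' : toConv (actL ψ) = scal C ψ * toConv LinearMap.id := rfl
  rw [h', ← mul_assoc, ← map_mul] at h
  exact congrArg WithConv.ofConv h

lemma actR_comp_actR (φ ψ : WithConv (C →ₗ[k] k)) : actR ψ ∘ₗ actR φ = actR (ψ * φ) := by
  have h := comp_mul_scal (actR ψ) φ (toConv (LinearMap.id : C →ₗ[k] C))
  rw [ofConv_toConv, LinearMap.comp_id] at h
  have h' : toConv (actR ψ) = toConv LinearMap.id * scal C ψ := rfl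
  rw [h', mul_assoc, ← map_mul] at h
  exact congrArg WithConv.ofConv h

lemma actL_one : actL (1 : WithConv (C →ₗ[k] k)) = LinearMap.id := by
  rw [actL, map_one, one_mul]

lemma actR_one : actR (1 : WithConv (C →ₗ[k] k)) = LinearMap.id := by
  rw [actR, map_one, mul_one]

lemma actL_bijective (φ : (WithConv (C →ₗ[k] k))ˣ) : Function.Bijective (actL φ.val) := by
  refine Function.bijective_iff_has_inverse.2 ⟨actL φ⁻¹.val, fun c ↦ ?_, fun c ↦ ?_⟩
  · rw [← LinearMap.comp_apply, actL_comp_actL, φ.mul_inv, actL_one, LinearMap.id_apply]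
  · rw [← LinearMap.comp_apply, actL_comp_actL, φ.inv_mul, actL_one, LinearMap.id_apply]

lemma actR_bijective (φ : (WithConv (C →ₗ[k] k))ˣ) : Function.Bijective (actR φ.val) := by
  refine Function.bijective_iff_has_inverse.2 ⟨actR φ⁻¹.val, fun c ↦ ?_, fun c ↦ ?_⟩
  · rw [← LinearMap.comp_apply, actR_comp_actR, φ.inv_mul, actR_one, LinearMap.id_apply]
  · rw [← LinearMap.comp_apply, actR_comp_actR, φ.mul_inv, actR_one, LinearMap.id_apply]

/-- A functional is convolution-invertible as soon as its left and right actions are bijective: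
composing the inverses of the actions with the counit gives a right and a left inverse. -/
lemma isUnit_of_bijective {φ : WithConv (C →ₗ[k] k)} (hl : Function.Bijective (actL φ))
    (hr : Function.Bijective (actR φ)) : IsUnit φ := by
  let G := (LinearEquiv.ofBijective (actL φ) hl).symm.toLinearMap
  let H := (LinearEquiv.ofBijective (actR φ) hr).symm.toLinearMap
  have hG : counit ∘ₗ G ∘ₗ actL φ = counit (R := k) := LinearMap.ext fun c ↦
    congrArg counit ((LinearEquiv.ofBijective (actL φ) hl).symm_apply_apply c)
  have hH : counit ∘ₗ H ∘ₗ actR φ = counit (R := k) := LinearMap.ext fun c ↦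
    congrArg counit ((LinearEquiv.ofBijective (actR φ) hr).symm_apply_apply c)
  have h1 := comp_scal_mul (counit ∘ₗ G) φ (toConv (LinearMap.id : C →ₗ[k] C))
  have h2 := comp_mul_scal (counit ∘ₗ H) φ (toConv (LinearMap.id : C →ₗ[k] C))
  rw [ofConv_toConv, LinearMap.comp_id, scal_self] at h1 h2
  have e1 : φ * toConv (counit ∘ₗ G) = 1 := h1.symm.trans (congrArg toConv hG)
  have e2 : toConv (counit ∘ₗ H) * φ = 1 := h2.symm.trans (congrArg toConv hH)
  have e3 := left_inv_eq_right_inv e2 e1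
  exact ⟨⟨φ, _, e1, e3 ▸ e2⟩, rfl⟩

variable {D : Type*} [AddCommGroup D] [Module k D] [Coalgebra k D]

/-- A map `F : D → C` with `Δ(F(d)) = F(d₁) ⊗ m(d₂)` is determined by `m` and `ε ∘ F`. -/
lemma eq_scal_mul_of_comul {F m : WithConv (D →ₗ[k] C)}
    (h : ∀ d, comul (R := k) (F d) = TensorProduct.map F.ofConv m.ofConv (comul d)) :
    F = scal C (push (Bialgebra.counitAlgHom k C) F) * m := by
  let p : C ⊗[k] C →ₐ[k] C := Algebra.TensorProduct.lift
    ((Algebra.ofId k C).comp (Bialgebra.counitAlgHom k C)) (AlgHom.id k C)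
    fun x y ↦ Algebra.commutes _ _
  have hp : ∀ w : C ⊗[k] C, p w = TensorProduct.lid k C (counit.rTensor C w) := by
    intro w
    induction w with
    | zero => simp only [map_zero]
    | add a b ha hb => simp only [map_add, ha, hb]
    | tmul a b => exact (Algebra.smul_def _ _).symm
  have h1 := congrArg (push p) (Twist.map_comul_eq F m)
  rw [map_mul] at h1
  have h2 : push p (toConv (TensorProduct.map F.ofConv m.ofConv ∘ₗ comul)) = F := by
    apply WithConv.ext; ext d
    refine (congrArg p (h d)).symm.trans ?_
    rw [hp, Coalgebra.rTensor_counit_comul, TensorProduct.lid_tmul, one_smul]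
  rw [h2] at h1
  refine h1.trans ?_
  congr 1
  · apply WithConv.ext; ext d
    exact (hp (F.ofConv d ⊗ₜ 1)).trans (Algebra.algebraMap_eq_smul_one _).symm
  · apply WithConv.ext; ext d
    refine (hp (1 ⊗ₜ m.ofConv d)).trans ?_
    change counit (R := k) (1 : C) • m.ofConv d = _
    rw [Bialgebra.counit_one, one_smul]

/-- A map `F : D → C` with `Δ(F(d)) = m(d₁) ⊗ F(d₂)` is determined by `m` and `ε ∘ F`. -/
lemma eq_mul_scal_of_comul {F m : WithConv (D →ₗ[k] C)}
    (h : ∀ d, comul (R := k) (F d) = TensorProduct.map m.ofConv F.ofConv (comul d)) :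
    F = m * scal C (push (Bialgebra.counitAlgHom k C) F) := by
  let p : C ⊗[k] C →ₐ[k] C := Algebra.TensorProduct.lift (AlgHom.id k C)
    ((Algebra.ofId k C).comp (Bialgebra.counitAlgHom k C))
    fun x y ↦ (Algebra.commutes _ _).symm
  have hp : ∀ w : C ⊗[k] C, p w = TensorProduct.rid k C (counit.lTensor C w) := by
    intro w
    induction w with
    | zero => simp only [map_zero]
    | add a b ha hb => simp only [map_add, ha, hb]
    | tmul a b => exact (Algebra.commutes _ _).symm.trans (Algebra.smul_def _ _).symm
  have h1 := congrArg (push p) (Twist.map_comul_eq m F)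
  rw [map_mul] at h1
  have h2 : push p (toConv (TensorProduct.map m.ofConv F.ofConv ∘ₗ comul)) = F := by
    apply WithConv.ext; ext d
    refine (congrArg p (h d)).symm.trans ?_
    rw [hp, Coalgebra.lTensor_counit_comul, TensorProduct.rid_tmul, one_smul]
  rw [h2] at h1
  refine h1.trans ?_
  congr 1
  · apply WithConv.ext; ext d
    refine (hp (m.ofConv d ⊗ₜ 1)).trans ?_
    change counit (R := k) (1 : C) • m.ofConv d = _
    rw [Bialgebra.counit_one, one_smul]
  · apply WithConv.ext; ext d
    exact (hp (1 ⊗ₜ F.ofConv d)).trans (Algebra.algebraMap_eq_smul_one _).symm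

lemma comul_actL (φ : WithConv (C →ₗ[k] k)) (c : C) :
    comul (R := k) (actL φ c) = (actL φ).rTensor C (comul c) := by
  have e1 := comp_scal_mul comul φ (toConv (LinearMap.id : C →ₗ[k] C))
  have e2 := Twist.map_comul_eq (scal C φ * toConv LinearMap.id)
    (toConv (LinearMap.id : C →ₗ[k] C))
  have e3 := Twist.map_comul_eq (toConv (LinearMap.id : C →ₗ[k] C))
    (toConv (LinearMap.id : C →ₗ[k] C))
  rw [map_mul, Twist.push_scal, mul_assoc, ← e3, ofConv_toConv, TensorProduct.map_id,
    LinearMap.id_comp] at e2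
  exact congrArg (fun φ : WithConv (C →ₗ[k] C ⊗[k] C) ↦ φ c) (e1.trans e2.symm)

lemma comul_actR (φ : WithConv (C →ₗ[k] k)) (c : C) :
    comul (R := k) (actR φ c) = (actR φ).lTensor C (comul c) := by
  have e1 := comp_mul_scal comul φ (toConv (LinearMap.id : C →ₗ[k] C))
  have e2 := Twist.map_comul_eq (toConv (LinearMap.id : C →ₗ[k] C))
    (toConv LinearMap.id * scal C φ)
  have e3 := Twist.map_comul_eq (toConv (LinearMap.id : C →ₗ[k] C))
    (toConv (LinearMap.id : C →ₗ[k] C))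
  rw [map_mul, Twist.push_scal, ← mul_assoc, ← e3, ofConv_toConv, TensorProduct.map_id,
    LinearMap.id_comp] at e2
  exact congrArg (fun φ : WithConv (C →ₗ[k] C ⊗[k] C) ↦ φ c) (e1.trans e2.symm)

end Functional

/-! ### Bicleft bicomodule algebras -/

section Bicleft

variable {k : Type u} {A : Type v} [CommRing k] [Ring A] [HopfAlgebra k A]

open BicomoduleAlgebra

/-- `a ⊗ b ↦ F(a ⊗ b₁) ⊗ b₂` as a convolution product. -/
lemma rTensor_comul_eq (F : WithConv (A ⊗[k] A →ₗ[k] A)) :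
    toConv (F.ofConv.rTensor A ∘ₗ (TensorProduct.assoc k A A A).symm.toLinearMap ∘ₗ
      comul.lTensor A) = push Algebra.TensorProduct.includeLeft F *
        push Algebra.TensorProduct.includeRight (pull A (prR k A A) (toConv LinearMap.id)) := by
  rw [← Twist.map_comul_eq]
  apply WithConv.ext
  apply TensorProduct.ext'
  intro a b
  change F.ofConv.rTensor A ((TensorProduct.assoc k A A A).symm (a ⊗ₜ comul b)) =
    TensorProduct.map F.ofConv (prR k A A).toLinearMap (comul (a ⊗ₜ b))
  rw [TensorProduct.comul_tmul]
  have h : a ⊗ₜ[k] (1 : k) = counit.lTensor A (comul a) :=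
    (Coalgebra.lTensor_counit_comul a).symm
  have h2 : ∀ (u v : A ⊗[k] A), TensorProduct.map F.ofConv (prR k A A).toLinearMap
      (AlgebraTensorModule.tensorTensorTensorComm k k k k A A A A (u ⊗ₜ v)) =
      F.ofConv.rTensor A ((TensorProduct.assoc k A A A).symm
        (TensorProduct.rid k A (counit.lTensor A u) ⊗ₜ v)) := by
    intro u v
    induction u with
    | zero => simp only [zero_tmul, map_zero]
    | add x y hx hy => simp only [map_add, add_tmul, hx, hy]
    | tmul x y =>
      induction v with
      | zero => simp only [tmul_zero, map_zero]
      | add x y hx hy => simp only [map_add, tmul_add, hx, hy]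
      | tmul z w =>
        change F.ofConv (x ⊗ₜ z) ⊗ₜ (counit (R := k) y • w) =
          F.ofConv ((counit (R := k) y • x) ⊗ₜ z) ⊗ₜ w
        rw [← smul_tmul', map_smul, smul_tmul]
  rw [h2, ← h, TensorProduct.rid_tmul, one_smul]

/-- `a ⊗ b ↦ a₁ ⊗ F(a₂ ⊗ b)` as a convolution product. -/
lemma lTensor_comul_eq (F : WithConv (A ⊗[k] A →ₗ[k] A)) :
    toConv (F.ofConv.lTensor A ∘ₗ (TensorProduct.assoc k A A A).toLinearMap ∘ₗ
      comul.rTensor A) = push Algebra.TensorProduct.includeLeft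
        (pull A (prL k A A) (toConv LinearMap.id)) * push Algebra.TensorProduct.includeRight F := by
  rw [← Twist.map_comul_eq]
  apply WithConv.ext
  apply TensorProduct.ext'
  intro a b
  change F.ofConv.lTensor A ((TensorProduct.assoc k A A A) (comul a ⊗ₜ b)) =
    TensorProduct.map (prL k A A).toLinearMap F.ofConv (comul (a ⊗ₜ b))
  rw [TensorProduct.comul_tmul]
  have h : (1 : k) ⊗ₜ[k] b = counit.rTensor A (comul b) :=
    (Coalgebra.rTensor_counit_comul b).symm
  have h2 : ∀ (u v : A ⊗[k] A), TensorProduct.map (prL k A A).toLinearMap F.ofConv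
      (AlgebraTensorModule.tensorTensorTensorComm k k k k A A A A (u ⊗ₜ v)) =
      F.ofConv.lTensor A ((TensorProduct.assoc k A A A)
        (u ⊗ₜ TensorProduct.lid k A (counit.rTensor A v))) := by
    intro u v
    induction u with
    | zero => simp only [zero_tmul, map_zero]
    | add x y hx hy => simp only [map_add, add_tmul, hx, hy]
    | tmul x y =>
      induction v with
      | zero => simp only [tmul_zero, map_zero]
      | add x y hx hy => simp only [map_add, tmul_add, hx, hy]
      | tmul z w =>
        change (counit (R := k) z • x) ⊗ₜ F.ofConv (y ⊗ₜ w) =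
          x ⊗ₜ F.ofConv (y ⊗ₜ (counit (R := k) z • w))
        rw [tmul_smul, map_smul, smul_tmul]
  rw [h2, ← h, TensorProduct.lid_tmul, one_smul]

variable {Z : BicomoduleAlgebra k A} {ψ : A ≃ₗ[k] Z} {σ : WithConv (A ⊗[k] A →ₗ[k] k)}

/-- Along a colinear isomorphism `ψ : A ≅ Z` which turns the product of `Z` into
`σ(a₁, b₁) a₂ b₂`, the Galois map of `Z` becomes the action of `σ` on `A ⊗ A` followed by the
bijective Galois map of `A`. -/
lemma kappaR_map_eq (hr : ∀ a, Z.rcoact (ψ a) = ψ.toLinearMap.rTensor A (comul a))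
    (hm : ∀ a b, ψ a * ψ b = ψ ((scal A σ * toConv (LinearMap.mul' k A)) (a ⊗ₜ b)))
    (w : A ⊗[k] A) : Z.kappaR (TensorProduct.congr ψ ψ w) =
      ψ.toLinearMap.rTensor A (comulShearL k A (actL σ w)) := by
  have h1 := comp_scal_mul (comulShearL k A) σ (toConv (LinearMap.id : A ⊗[k] A →ₗ[k] _))
  have h2 := rTensor_comul_eq (scal A σ * toConv (LinearMap.mul' k A))
  have h3 := rTensor_comul_eq (toConv (LinearMap.mul' k A))
  have h4 : comulShearL k A = (LinearMap.mul' k A).rTensor A ∘ₗ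
      (TensorProduct.assoc k A A A).symm.toLinearMap ∘ₗ comul.lTensor A :=
    (kappaR_unit (k := k) (A := A)).symm
  rw [map_mul, Twist.push_scal, mul_assoc, ← h3] at h2
  rw [ofConv_toConv, LinearMap.comp_id, h4] at h1
  have h5 := congrArg (fun φ : WithConv (A ⊗[k] A →ₗ[k] A ⊗[k] A) ↦ φ w) (h1.trans h2.symm)
  rw [← h4] at h5
  refine Eq.trans ?_ (congrArg (ψ.toLinearMap.rTensor A) h5.symm)
  clear h1 h2 h3 h4 h5
  induction w with
  | zero => simp only [map_zero]
  | add x y hx hy =>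
    rw [map_add, map_add, hx, hy, ← map_add]
    exact congrArg _ (map_add (WithConv.ofConv _) x y).symm
  | tmul a b =>
    refine (kappaR_tmul Z (ψ a) (ψ b)).trans ?_
    rw [hr]
    change _ = ψ.toLinearMap.rTensor A ((scal A σ * toConv (LinearMap.mul' k A)).ofConv.rTensor A
      ((TensorProduct.assoc k A A A).symm (a ⊗ₜ comul b)))
    generalize comul (R := k) b = v
    induction v with
    | zero => simp only [map_zero, mul_zero, tmul_zero]
    | add x y hx hy => simp only [map_add, mul_add, tmul_add, hx, hy]
    | tmul x y =>
      rw [LinearMap.rTensor_tmul]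
      refine (Algebra.TensorProduct.tmul_mul_tmul _ _ _ _).trans ?_
      rw [one_mul]
      exact congrArg (· ⊗ₜ[k] y) (hm a x)

lemma kappaL_map_eq (hl : ∀ a, Z.lcoact (ψ a) = ψ.toLinearMap.lTensor A (comul a))
    (hm : ∀ a b, ψ a * ψ b = ψ ((toConv (LinearMap.mul' k A) * scal A σ) (a ⊗ₜ b)))
    (w : A ⊗[k] A) : Z.kappaL (TensorProduct.congr ψ ψ w) =
      ψ.toLinearMap.lTensor A (comulShearR k A (actR σ w)) := by
  have h1 := comp_mul_scal (comulShearR k A) σ (toConv (LinearMap.id : A ⊗[k] A →ₗ[k] _))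
  have h2 := lTensor_comul_eq (toConv (LinearMap.mul' k A) * scal A σ)
  have h3 := lTensor_comul_eq (toConv (LinearMap.mul' k A))
  have h4 : comulShearR k A = (LinearMap.mul' k A).lTensor A ∘ₗ
      (TensorProduct.assoc k A A A).toLinearMap ∘ₗ comul.rTensor A :=
    (kappaL_unit (k := k) (A := A)).symm
  rw [map_mul, Twist.push_scal, ← mul_assoc, ← h3] at h2
  rw [ofConv_toConv, LinearMap.comp_id, h4] at h1
  have h5 := congrArg (fun φ : WithConv (A ⊗[k] A →ₗ[k] A ⊗[k] A) ↦ φ w) (h1.trans h2.symm)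
  rw [← h4] at h5
  refine Eq.trans ?_ (congrArg (ψ.toLinearMap.lTensor A) h5.symm)
  clear h1 h2 h3 h4 h5
  induction w with
  | zero => simp only [map_zero]
  | add x y hx hy =>
    rw [map_add, map_add, hx, hy, ← map_add]
    exact congrArg _ (map_add (WithConv.ofConv _) x y).symm
  | tmul a b =>
    refine (kappaL_tmul Z (ψ a) (ψ b)).trans ?_
    rw [hl]
    change _ = ψ.toLinearMap.lTensor A ((toConv (LinearMap.mul' k A) * scal A σ).ofConv.lTensor A
      ((TensorProduct.assoc k A A A) (comul a ⊗ₜ b)))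
    generalize comul (R := k) a = v
    induction v with
    | zero => simp only [map_zero, zero_mul, zero_tmul]
    | add x y hx hy => simp only [map_add, add_mul, add_tmul, hx, hy]
    | tmul x y =>
      rw [LinearMap.lTensor_tmul]
      refine (Algebra.TensorProduct.tmul_mul_tmul _ _ _ _).trans ?_
      rw [mul_one]
      exact congrArg (x ⊗ₜ[k] ·) (hm y b)

lemma kappaR_bijective_iff (hr : ∀ a, Z.rcoact (ψ a) = ψ.toLinearMap.rTensor A (comul a))
    (hm : ∀ a b, ψ a * ψ b = ψ ((scal A σ * toConv (LinearMap.mul' k A)) (a ⊗ₜ b))) :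
    Function.Bijective Z.kappaR ↔ Function.Bijective (actL σ) := by
  have h : Z.kappaR ∘ TensorProduct.congr ψ ψ =
      (ψ.rTensor A ∘ comulShearL k A) ∘ actL σ := funext (kappaR_map_eq hr hm)
  rw [← Function.Bijective.of_comp_iff _ (TensorProduct.congr ψ ψ).bijective, h,
    Function.Bijective.of_comp_iff' ((ψ.rTensor A).bijective.comp comulShearL_bijective)]

lemma kappaL_bijective_iff (hl : ∀ a, Z.lcoact (ψ a) = ψ.toLinearMap.lTensor A (comul a))
    (hm : ∀ a b, ψ a * ψ b = ψ ((toConv (LinearMap.mul' k A) * scal A σ) (a ⊗ₜ b))) :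
    Function.Bijective Z.kappaL ↔ Function.Bijective (actR σ) := by
  have h : Z.kappaL ∘ TensorProduct.congr ψ ψ =
      (ψ.lTensor A ∘ comulShearR k A) ∘ actR σ := funext (kappaL_map_eq hl hm)
  rw [← Function.Bijective.of_comp_iff _ (TensorProduct.congr ψ ψ).bijective, h,
    Function.Bijective.of_comp_iff' ((ψ.lTensor A).bijective.comp comulShearR_bijective)]

end Bicleft

/-! ### The bicomodule algebras of lazy cocycles -/

section TwistGroup

variable {k : Type u} {A : Type v} [CommRing k] [Ring A] [HopfAlgebra k A]

open BicomoduleAlgebra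

lemma Twist.of_mul_of (σ : Z2L k A) (a b : A) :
    Twist.of σ a * Twist.of σ b = Twist.of σ (twistMul σ.val (a ⊗ₜ b)) := rfl

lemma twistMul_eq (σ : Z2L k A) :
    twistMul σ.val = toConv (LinearMap.mul' k A) * scal A σ.val.val := σ.2.2.1

lemma Twist.isBiGalois [Nontrivial k] [Module.Flat k A] (σ : Z2L k A) :
    (Twist.bicomoduleAlgebra σ).IsBiGalois := by
  have := faithfullyFlat_hopfAlgebra k A
  refine isBiGalois_of_bijective (Module.FaithfullyFlat.of_linearEquiv k A (Twist.of σ).symm) ?_ ?_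
  · refine (kappaL_bijective_iff (Z := Twist.bicomoduleAlgebra σ) (ψ := Twist.of σ)
      (Twist.lcoact_of σ) fun a b ↦ ?_).2 (actR_bijective σ.val)
    rw [← twistMul_eq]
    exact Twist.of_mul_of σ a b
  · exact (kappaR_bijective_iff (Z := Twist.bicomoduleAlgebra σ) (ψ := Twist.of σ)
      (Twist.rcoact_of σ) fun a b ↦ Twist.of_mul_of σ a b).2 (actL_bijective σ.val)

/-- `Δ` is multiplicative for the twisted products: it is an algebra map `A(στ) → A(σ) ⊗ A(τ)`. -/
lemma comul_twistMul_mul (σ τ : Z2L k A) (w : A ⊗[k] A) :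
    comul (R := k) (twistMul (σ * τ).val w) =
      TensorProduct.map (twistMul σ.val).ofConv (twistMul τ.val).ofConv (comul w) := by
  have hm : toConv (comul ∘ₗ LinearMap.mul' k A) =
      toConv (TensorProduct.map (LinearMap.mul' k A) (LinearMap.mul' k A) ∘ₗ comul) :=
    congrArg toConv (Bialgebra.mulCoalgHom k A).map_comp_comul.symm
  have e1 := comp_scal_mul comul (σ.val * τ.val).val (toConv (LinearMap.mul' k A))
  have e2 := Twist.map_comul_eq (twistMul σ.val) (twistMul τ.val)
  have e3 := Twist.map_comul_eq (toConv (LinearMap.mul' k A)) (toConv (LinearMap.mul' k A))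
  have e4 : push (Algebra.TensorProduct.includeLeft : A →ₐ[k] A ⊗[k] A)
      (toConv (LinearMap.mul' k A)) * scal (A ⊗[k] A) τ.val.val =
      scal (A ⊗[k] A) τ.val.val * push (Algebra.TensorProduct.includeLeft : A →ₐ[k] A ⊗[k] A)
      (toConv (LinearMap.mul' k A)) := by
    rw [← Twist.push_scal (Algebra.TensorProduct.includeLeft : A →ₐ[k] A ⊗[k] A), ← map_mul,
      ← map_mul, ← twistMul_eq]
    rfl
  have e5 : toConv (comul ∘ₗ (twistMul (σ * τ).val).ofConv) =
      toConv (TensorProduct.map (twistMul σ.val).ofConv (twistMul τ.val).ofConv ∘ₗ comul) := by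
    refine e1.trans ?_
    rw [e2, twistMul, twistMul, map_mul, map_mul, Twist.push_scal, Twist.push_scal, mul_assoc,
      ← mul_assoc _ (scal (A ⊗[k] A) τ.val.val), e4, mul_assoc, ← e3, Units.val_mul, map_mul,
      mul_assoc]
    exact congrArg (fun z ↦ scal (A ⊗[k] A) σ.val.val * (scal (A ⊗[k] A) τ.val.val * z)) hm
  exact congrArg (fun φ : WithConv (A ⊗[k] A →ₗ[k] A ⊗[k] A) ↦ φ w) e5

/-- `Δ` as an algebra map `A(στ) → A(σ) ⊗ A(τ)`. -/
def Twist.comulHom (σ τ : Z2L k A) : Twist (σ * τ) →ₐ[k] Twist σ ⊗[k] Twist τ :=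
  AlgHom.ofLinearMap (TensorProduct.map (of σ).toLinearMap (of τ).toLinearMap ∘ₗ comul ∘ₗ
    (of (σ * τ)).symm.toLinearMap)
    (by
      change TensorProduct.map (of σ).toLinearMap (of τ).toLinearMap (comul (1 : A)) = _
      rw [Bialgebra.comul_one]
      rfl)
    (by
      intro x y
      change TensorProduct.map (of σ).toLinearMap (of τ).toLinearMap
          (comul (twistMul (σ * τ).val ((of (σ * τ)).symm x ⊗ₜ (of (σ * τ)).symm y))) =
        TensorProduct.map (of σ).toLinearMap (of τ).toLinearMap (comul ((of (σ * τ)).symm x)) *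
          TensorProduct.map (of σ).toLinearMap (of τ).toLinearMap (comul ((of (σ * τ)).symm y))
      rw [comul_twistMul_mul, TensorProduct.comul_tmul]
      generalize comul (R := k) ((of (σ * τ)).symm x) = u
      generalize comul (R := k) ((of (σ * τ)).symm y) = w
      induction u with
      | zero => simp only [map_zero, zero_tmul, zero_mul]
      | add x y hx hy => simp only [map_add, add_tmul, add_mul, hx, hy]
      | tmul a b =>
        induction w with
        | zero => simp only [map_zero, tmul_zero, mul_zero]
        | add x y hx hy => simp only [map_add, tmul_add, mul_add, hx, hy]
        | tmul c d =>
          rw [AlgebraTensorModule.tensorTensorTensorComm_tmul, TensorProduct.map_tmul]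
          simp only [TensorProduct.map_tmul, Algebra.TensorProduct.tmul_mul_tmul]
          rfl)

lemma Twist.comulHom_of (σ τ : Z2L k A) (a : A) : Twist.comulHom σ τ (Twist.of (σ * τ) a) =
    TensorProduct.map (Twist.of σ).toLinearMap (Twist.of τ).toLinearMap (comul a) := rfl

lemma Twist.comulHom_eq (σ τ : Z2L k A) (a : A) : Twist.comulHom σ τ (Twist.of (σ * τ) a) =
    (Twist.of σ).rTensor (Twist τ) (Twist.lcoact τ (Twist.of τ a)) := by
  rw [Twist.comulHom_of, Twist.lcoact_of]
  generalize comul (R := k) a = w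
  induction w with
  | zero => simp only [map_zero]
  | add x y hx hy => simp only [map_add, hx, hy]
  | tmul x y => rfl

lemma Twist.lcoact_comulHom (σ τ : Z2L k A) (x : Twist (σ * τ)) :
    TensorProduct.assoc k A (Twist σ) (Twist τ)
      ((lcoact σ).toLinearMap.rTensor (Twist τ) (comulHom σ τ x)) =
        (comulHom σ τ).toLinearMap.lTensor A (lcoact (σ * τ) x) := by
  obtain ⟨a, rfl⟩ := (of (σ * τ)).surjective x
  have h1 : ∀ w : A ⊗[k] A, TensorProduct.assoc k A (Twist σ) (Twist τ)
      ((lcoact σ).toLinearMap.rTensor (Twist τ)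
        (TensorProduct.map (of σ).toLinearMap (of τ).toLinearMap w)) =
      (TensorProduct.map (of σ).toLinearMap (of τ).toLinearMap).lTensor A
        (TensorProduct.assoc k A A A (comul.rTensor A w)) := by
    intro w
    induction w with
    | zero => simp only [map_zero]
    | add x y hx hy => simp only [map_add, hx, hy]
    | tmul x y =>
      change TensorProduct.assoc k A (Twist σ) (Twist τ)
        ((of σ).toLinearMap.lTensor A (comul x) ⊗ₜ of τ y) = _
      rw [LinearMap.rTensor_tmul]
      generalize comul (R := k) x = v
      induction v with
      | zero => simp only [zero_tmul, map_zero]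
      | add x y hx hy => simp only [map_add, add_tmul, hx, hy]
      | tmul a b => rfl
  have h2 : ∀ w : A ⊗[k] A, (comulHom σ τ).toLinearMap.lTensor A
      ((of (σ * τ)).toLinearMap.lTensor A w) =
      (TensorProduct.map (of σ).toLinearMap (of τ).toLinearMap).lTensor A
        (comul.lTensor A w) := by
    intro w
    induction w with
    | zero => simp only [map_zero]
    | add x y hx hy => simp only [map_add, hx, hy]
    | tmul x y => rfl
  refine (h1 (comul a)).trans ?_
  rw [Coalgebra.coassoc_apply]
  exact (h2 (comul a)).symm

lemma Twist.rcoact_comulHom (σ τ : Z2L k A) (x : Twist (σ * τ)) :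
    (TensorProduct.assoc k (Twist σ) (Twist τ) A).symm
      ((rcoact τ).toLinearMap.lTensor (Twist σ) (comulHom σ τ x)) =
        (comulHom σ τ).toLinearMap.rTensor A (rcoact (σ * τ) x) := by
  obtain ⟨a, rfl⟩ := (of (σ * τ)).surjective x
  have h1 : ∀ w : A ⊗[k] A, (TensorProduct.assoc k (Twist σ) (Twist τ) A).symm
      ((rcoact τ).toLinearMap.lTensor (Twist σ)
        (TensorProduct.map (of σ).toLinearMap (of τ).toLinearMap w)) =
      (TensorProduct.map (of σ).toLinearMap (of τ).toLinearMap).rTensor A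
        ((TensorProduct.assoc k A A A).symm (comul.lTensor A w)) := by
    intro w
    induction w with
    | zero => simp only [map_zero]
    | add x y hx hy => simp only [map_add, hx, hy]
    | tmul x y =>
      change (TensorProduct.assoc k (Twist σ) (Twist τ) A).symm
        (of σ x ⊗ₜ (of τ).toLinearMap.rTensor A (comul y)) = _
      rw [LinearMap.lTensor_tmul]
      generalize comul (R := k) y = v
      induction v with
      | zero => simp only [tmul_zero, map_zero]
      | add x y hx hy => simp only [map_add, tmul_add, hx, hy]
      | tmul a b => rfl
  have h2 : ∀ w : A ⊗[k] A, (comulHom σ τ).toLinearMap.rTensor A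
      ((of (σ * τ)).toLinearMap.rTensor A w) =
      (TensorProduct.map (of σ).toLinearMap (of τ).toLinearMap).rTensor A
        (comul.rTensor A w) := by
    intro w
    induction w with
    | zero => simp only [map_zero]
    | add x y hx hy => simp only [map_add, hx, hy]
    | tmul x y => rfl
  refine (h1 (comul a)).trans ?_
  rw [Coalgebra.coassoc_symm_apply]
  exact (h2 (comul a)).symm

lemma Twist.isBicolinear_comulHom (σ τ : Z2L k A) :
    IsBicolinear (Z := bicomoduleAlgebra (σ * τ))
      (T := tensor (bicomoduleAlgebra σ) (bicomoduleAlgebra τ))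
      (comulHom σ τ).toLinearMap :=
  ⟨lcoact_comulHom σ τ, rcoact_comulHom σ τ⟩

lemma Twist.rTensor_rcoact_rTensor_of (σ τ : Z2L k A) (u : A ⊗[k] Twist τ) :
    TensorProduct.assoc k (Twist σ) A (Twist τ)
        ((rcoact σ).toLinearMap.rTensor (Twist τ) ((of σ).rTensor (Twist τ) u)) =
      (of σ).rTensor (A ⊗[k] Twist τ)
        (TensorProduct.assoc k A A (Twist τ) (comul.rTensor (Twist τ) u)) := by
  induction u with
  | zero => simp only [map_zero]
  | add x y hx hy => simp only [map_add, hx, hy]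
  | tmul x y =>
    change TensorProduct.assoc k (Twist σ) A (Twist τ)
      ((of σ).toLinearMap.rTensor A (comul x) ⊗ₜ y) = _
    rw [LinearMap.rTensor_tmul]
    generalize comul (R := k) x = v
    induction v with
    | zero => simp only [zero_tmul, map_zero]
    | add x y hx hy => simp only [map_add, add_tmul, hx, hy]
    | tmul a b => rfl

lemma Twist.lTensor_lcoact_rTensor_of (σ τ : Z2L k A) (u : A ⊗[k] Twist τ) :
    (lcoact τ).toLinearMap.lTensor (Twist σ) ((of σ).rTensor (Twist τ) u) =
      (of σ).rTensor (A ⊗[k] Twist τ) ((lcoact τ).toLinearMap.lTensor A u) := by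
  induction u with
  | zero => simp only [map_zero]
  | add x y hx hy => simp only [map_add, hx, hy]
  | tmul x y => rfl

/-- `A(σ) □ A(τ) ≅ A(στ)` -/
lemma Twist.cotensor [Module.Flat k A] (σ τ : Z2L k A) :
    Isomorphic ((bicomoduleAlgebra σ).cotensor (bicomoduleAlgebra τ))
      (bicomoduleAlgebra (σ * τ)) := by
  refine isomorphic_of_range_eq (W := tensor (bicomoduleAlgebra σ) (bicomoduleAlgebra τ))
    (i := cotensorVal (bicomoduleAlgebra σ) (bicomoduleAlgebra τ))
    (j := comulHom σ τ) (cotensorVal_injective _ _) ?_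
    (isBicolinear_cotensorVal _ _) (isBicolinear_comulHom σ τ) fun u ↦ ?_
  · intro x y h
    obtain ⟨a, rfl⟩ := (of (σ * τ)).surjective x
    obtain ⟨b, rfl⟩ := (of (σ * τ)).surjective y
    have h1 := lcoact_injective (bicomoduleAlgebra τ) (((of σ).rTensor (Twist τ)).injective
      ((comulHom_eq σ τ a).symm.trans (h.trans (comulHom_eq σ τ b))))
    exact congrArg (of (σ * τ)) ((of τ).injective h1)
  · refine (exists_cotensorVal_iff (Z := bicomoduleAlgebra σ) (T := bicomoduleAlgebra τ) u).trans ?_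
    obtain ⟨u, rfl⟩ := ((of σ).rTensor (Twist τ)).surjective u
    have h1 : (TensorProduct.assoc k (Twist σ) A (Twist τ)
          ((rcoact σ).toLinearMap.rTensor (Twist τ) ((of σ).rTensor (Twist τ) u)) =
        (lcoact τ).toLinearMap.lTensor (Twist σ) ((of σ).rTensor (Twist τ) u)) ↔
        TensorProduct.assoc k A A (Twist τ) (comul.rTensor (Twist τ) u) =
          (lcoact τ).toLinearMap.lTensor A u := by
      rw [rTensor_rcoact_rTensor_of, lTensor_lcoact_rTensor_of]
      exact ((of σ).rTensor (A ⊗[k] Twist τ)).injective.eq_iff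
    refine h1.trans ⟨fun h ↦ ?_, ?_⟩
    · obtain ⟨z, hz⟩ := exists_lcoact_eq_of_cotensor (Z := bicomoduleAlgebra τ) h
      obtain ⟨a, rfl⟩ := (of τ).surjective z
      exact ⟨of (σ * τ) a, (comulHom_eq σ τ a).trans (congrArg _ hz)⟩
    · rintro ⟨y, hy⟩
      obtain ⟨a, rfl⟩ := (of (σ * τ)).surjective y
      have h2 := ((of σ).rTensor (Twist τ)).injective ((comulHom_eq σ τ a).symm.trans hy)
      rw [← h2]
      exact (bicomoduleAlgebra τ).lcoassoc (of τ a)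

end TwistGroup

/-! ### Coboundaries and trivial twists -/

section Kernel

variable {k : Type u} {A : Type v} [CommRing k] [Ring A] [HopfAlgebra k A]

open BicomoduleAlgebra

lemma counit_comp_scal_mul_mul' (φ : WithConv (A ⊗[k] A →ₗ[k] k)) :
    push (Bialgebra.counitAlgHom k A) (scal A φ * toConv (LinearMap.mul' k A)) = φ := by
  have h : push (Bialgebra.counitAlgHom k A) (toConv (LinearMap.mul' k A)) = 1 :=
    map_one (pull k (Bialgebra.mulCoalgHom k A))
  rw [map_mul, h, mul_one, Twist.push_scal, scal_self]

lemma actL_twistMul (μ : WithConv (A →ₗ[k] k)) (σ : Z2L k A) :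
    toConv (actL μ ∘ₗ (twistMul σ.val).ofConv) =
      scal A (σ.val.val * pull k (Bialgebra.mulCoalgHom k A) μ) * toConv (LinearMap.mul' k A) := by
  refine (comp_scal_mul (actL μ) σ.val.val (toConv (LinearMap.mul' k A))).trans ?_
  have h : toConv (actL μ ∘ₗ LinearMap.mul' k A) =
      scal A (pull k (Bialgebra.mulCoalgHom k A) μ) * toConv (LinearMap.mul' k A) :=
    map_mul (pull A (Bialgebra.mulCoalgHom k A)) (scal A μ) (toConv LinearMap.id)
  rw [ofConv_toConv, h, map_mul, mul_assoc]

lemma mul'_map_actL (μ : WithConv (A →ₗ[k] k)) :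
    toConv (LinearMap.mul' k A ∘ₗ TensorProduct.map (actL μ) (actL μ)) =
      scal A (pull k (prL k A A) μ * pull k (prR k A A) μ) * toConv (LinearMap.mul' k A) := by
  have h1 := TensorProduct.map_convMul_map (f := scal A μ) (h := toConv (LinearMap.id : A →ₗ[k] A))
    (g := scal A μ) (k := toConv (LinearMap.id : A →ₗ[k] A))
  have h2 := TensorProduct.map_convMul_map (f := scal A μ) (h := (1 : WithConv (A →ₗ[k] A)))
    (g := (1 : WithConv (A →ₗ[k] A))) (k := scal A μ)
  rw [one_mul, mul_one, ← scal_pull_prL, ← scal_pull_prR, ← map_mul] at h2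
  rw [← h2, ofConv_toConv, TensorProduct.map_id] at h1
  have h3 := comp_scal_mul (LinearMap.mul' k A) (pull k (prL k A A) μ * pull k (prR k A A) μ)
    (toConv LinearMap.id)
  rw [h1] at h3
  exact h3

/-- The action of `μ` is multiplicative from `A(σ)` to `A` exactly when `σ = ∂(μ)`. -/
lemma actL_twistMul_eq_iff (μ : Conv1 k A) (σ : Z2L k A) :
    (∀ a b, actL μ.val (twistMul σ.val (a ⊗ₜ b)) = actL μ.val a * actL μ.val b) ↔
      diff μ = σ.val := by
  have h1 : (∀ a b, actL μ.val (twistMul σ.val (a ⊗ₜ b)) = actL μ.val a * actL μ.val b) ↔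
      toConv (actL μ.val ∘ₗ (twistMul σ.val).ofConv) =
        toConv (LinearMap.mul' k A ∘ₗ TensorProduct.map (actL μ.val) (actL μ.val)) := by
    constructor
    · intro h
      apply WithConv.ext
      exact TensorProduct.ext' h
    · intro h a b
      exact congrArg (fun φ : WithConv (A ⊗[k] A →ₗ[k] A) ↦ φ (a ⊗ₜ b)) h
  rw [h1, actL_twistMul, mul'_map_actL]
  have h2 : σ.val.val * pull k (Bialgebra.mulCoalgHom k A) μ.val =
      pull k (prL k A A) μ.val * pull k (prR k A A) μ.val ↔ diff μ = σ.val := by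
    rw [diff, map_inv, mul_inv_eq_iff_eq_mul, eq_comm, Units.ext_iff]
    rfl
  rw [← h2]
  refine ⟨fun h ↦ ?_, fun h ↦ by rw [h]⟩
  have h3 := congrArg (push (Bialgebra.counitAlgHom k A)) h
  rwa [counit_comp_scal_mul_mul', counit_comp_scal_mul_mul'] at h3

/-- A bicolinear automorphism of `A` is the action of a lazy functional. -/
lemma exists_eq_actL_of_bicolinear (g : A ≃ₗ[k] A)
    (hl : ∀ a, comul (R := k) (g a) = g.toLinearMap.lTensor A (comul a))
    (hr : ∀ a, comul (R := k) (g a) = g.toLinearMap.rTensor A (comul a)) :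
    ∃ μ : Conv1 k A, IsLazy1 μ.val ∧ (∀ a, μ.val a = counit (R := k) (g a)) ∧
      ∀ a, actL μ.val a = g a := by
  have e1 := eq_scal_mul_of_comul (F := toConv g.toLinearMap) (m := toConv LinearMap.id) hr
  have e2 := eq_mul_scal_of_comul (F := toConv g.toLinearMap) (m := toConv LinearMap.id) hl
  set φ : WithConv (A →ₗ[k] k) := push (Bialgebra.counitAlgHom k A) (toConv g.toLinearMap)
  have h1 : actL φ = g.toLinearMap := (congrArg WithConv.ofConv e1).symm
  have h2 : actR φ = g.toLinearMap := (congrArg WithConv.ofConv e2).symm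
  obtain ⟨μ, hμ⟩ := isUnit_of_bijective (φ := φ) (h1 ▸ g.bijective) (h2 ▸ g.bijective)
  refine ⟨μ, ?_, fun a ↦ ?_, fun a ↦ ?_⟩
  · rw [hμ]
    exact e1.symm.trans e2
  · rw [hμ]
    rfl
  · rw [hμ, h1]
    rfl

/-- `A(σ) ≅ A` as bicomodule algebras exactly when `σ` is a coboundary. -/
lemma Twist.isomorphic_unit_iff (σ : Z2L k A) :
    Isomorphic (bicomoduleAlgebra σ) (unit k A) ↔ σ ∈ B2L k A := by
  constructor
  · rintro ⟨f, hl, hr⟩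
    let g : A ≃ₗ[k] A := (of σ).trans f.toLinearEquiv
    have hg : ∀ a, g a = f (of σ a) := fun a ↦ rfl
    obtain ⟨μ, hμ, h1, h2⟩ := exists_eq_actL_of_bicolinear g
      (fun a ↦ by
        refine (hl (of σ a)).trans ?_
        exact (LinearMap.lTensor_comp_apply A f.toLinearMap (of σ).toLinearMap (comul a)).symm)
      (fun a ↦ by
        refine (hr (of σ a)).trans ?_
        exact (LinearMap.rTensor_comp_apply A f.toLinearMap (of σ).toLinearMap (comul a)).symm)
    refine ⟨⟨μ, ?_, hμ⟩, Subtype.ext ((actL_twistMul_eq_iff μ σ).1 fun a b ↦ ?_)⟩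
    · change μ.val (1 : A) = 1
      have h3 : g 1 = (1 : A) := map_one f
      rw [h1, h3, Bialgebra.counit_one]
    · rw [h2, h2, h2]
      exact map_mul f (of σ a) (of σ b)
  · rintro ⟨μ, rfl⟩
    set σ := diffHom k A μ with hσ
    have h1 := (actL_twistMul_eq_iff μ.val σ).2 rfl
    have h0 : actL μ.val.val (1 : A) = 1 := by
      change (scal A μ.val.val * toConv LinearMap.id : WithConv (A →ₗ[k] A)) (1 : A) = 1
      rw [LinearMap.convMul_apply, Bialgebra.comul_one, Algebra.TensorProduct.one_def]
      change algebraMap k A (μ.val.val (1 : A)) * 1 = 1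
      rw [show μ.val.val (1 : A) = 1 from μ.2.1, map_one, one_mul]
    have h2 : actL μ.val.val = actR μ.val.val := congrArg WithConv.ofConv μ.2.2
    let e : Twist σ ≃ₗ[k] A :=
      (of σ).symm.trans (LinearEquiv.ofBijective _ (actL_bijective μ.val))
    have he : e.toLinearMap ∘ₗ (of σ).toLinearMap = actL μ.val.val := rfl
    refine ⟨AlgEquiv.ofLinearEquiv e h0 fun x y ↦ ?_, fun x ↦ ?_, fun x ↦ ?_⟩
    · exact h1 ((of σ).symm x) ((of σ).symm y)
    · obtain ⟨a, rfl⟩ := (of σ).surjective x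
      change comul (actL μ.val.val a) = e.toLinearMap.lTensor A
        ((of σ).toLinearMap.lTensor A (comul a))
      rw [← LinearMap.lTensor_comp_apply, he, h2, comul_actR]
    · obtain ⟨a, rfl⟩ := (of σ).surjective x
      change comul (actL μ.val.val a) = e.toLinearMap.rTensor A
        ((of σ).toLinearMap.rTensor A (comul a))
      rw [← LinearMap.rTensor_comp_apply, he, comul_actL]

end Kernel

/-! ### Bicleft biGalois objects are twists -/

section Range

variable {k : Type u} {A : Type v} [CommRing k] [Ring A] [HopfAlgebra k A]

open BicomoduleAlgebra

lemma Twist.isBicleft (σ : Z2L k A) : (Twist.bicomoduleAlgebra σ).IsBicleft :=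
  ⟨Twist.of σ, Twist.lcoact_of σ, Twist.rcoact_of σ⟩

lemma isBicleft_iff {Z : BicomoduleAlgebra k A} : Z.IsBicleft ↔ BicomoduleIso (unit k A) Z :=
  Iff.rfl

/-- A bicolinear isomorphism `A ≅ Z` can be rescaled to preserve `1`, since it maps `1` to a
coinvariant, which is an invertible scalar. -/
lemma BicomoduleAlgebra.IsBicleft.exists_map_one {Z : BicomoduleAlgebra k A} (h : Z.IsBicleft)
    (hi : Function.Injective (algebraMap k Z))
    (hc : ∀ z : Z, Z.lcoact z = 1 ⊗ₜ z → ∃ c : k, algebraMap k Z c = z) :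
    ∃ ψ : A ≃ₗ[k] Z, ψ 1 = 1 ∧ (∀ a, Z.lcoact (ψ a) = ψ.toLinearMap.lTensor A (comul a)) ∧
      (∀ a, Z.rcoact (ψ a) = ψ.toLinearMap.rTensor A (comul a)) := by
  obtain ⟨ψ, hl, hr⟩ := h
  have h1 : Z.lcoact (ψ 1) = 1 ⊗ₜ ψ 1 := by
    rw [hl, Bialgebra.comul_one]
    rfl
  obtain ⟨c, hc⟩ := hc _ h1
  obtain ⟨b, hb⟩ := ψ.surjective 1
  -- the preimage `b` of `1` is coinvariant as well, so it is the scalar `ε(b)`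
  have h2 : comul (R := k) b = 1 ⊗ₜ b := by
    have h3 := hl b
    rw [hb, map_one, Algebra.TensorProduct.one_def, ← hb] at h3
    exact (ψ.lTensor A).injective h3.symm
  have h4 : b = counit (R := k) b • 1 := by
    have h5 := Coalgebra.lTensor_counit_comul (R := k) b
    rw [h2, LinearMap.lTensor_tmul] at h5
    have h6 := congrArg (TensorProduct.rid k A) h5
    rw [TensorProduct.rid_tmul, TensorProduct.rid_tmul, one_smul] at h6
    exact h6.symm
  have h7 : counit (R := k) b * c = 1 := by
    apply hi
    rw [map_mul, hc, ← Algebra.smul_def, ← map_smul, ← h4, hb, map_one]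
  let d : kˣ := ⟨counit (R := k) b, c, h7, (mul_comm _ _).trans h7⟩
  have hd : (ψ.trans (LinearEquiv.smulOfUnit d)).toLinearMap =
      counit (R := k) b • ψ.toLinearMap := rfl
  have hd' : ∀ a, ψ.trans (LinearEquiv.smulOfUnit d) a = counit (R := k) b • ψ a := fun a ↦ rfl
  refine ⟨ψ.trans (LinearEquiv.smulOfUnit d), ?_, fun a ↦ ?_, fun a ↦ ?_⟩
  · rw [hd', ← map_smul, ← h4, hb]
  · rw [hd, hd', map_smul, hl, LinearMap.lTensor_smul]
    rfl
  · rw [hd, hd', map_smul, hr, LinearMap.rTensor_smul]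
    rfl

/-- An associative product of the form `σ(a₁, b₁) a₂ b₂ = a₁ b₁ σ(a₂, b₂)` comes from a
cocycle. -/
lemma isLeftCocycle_of_assoc {σ : WithConv (A ⊗[k] A →ₗ[k] k)}
    {M : WithConv (A ⊗[k] A →ₗ[k] A)} (hM : M = scal A σ * toConv (LinearMap.mul' k A))
    (hσ : ∀ w, counit (R := k) (M w) = σ w)
    (h : ∀ a b c, M (M (a ⊗ₜ b) ⊗ₜ c) = M (a ⊗ₜ M (b ⊗ₜ c))) : IsLeftCocycle σ := by
  have hL : toConv (σ.ofConv ∘ₗ TensorProduct.map M.ofConv LinearMap.id) =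
      pull k (face3 k A) σ * pull k (face1 k A) σ := by
    have h1 := TensorProduct.map_convMul_map (f := scal A σ) (h := toConv (LinearMap.mul' k A))
      (g := (1 : WithConv (A →ₗ[k] A))) (k := toConv LinearMap.id)
    rw [one_mul, ← hM, ← scal_pull_prL] at h1
    have h2 := comp_scal_mul σ.ofConv (pull k (face3 k A) σ)
      (toConv (TensorProduct.map (LinearMap.mul' k A) (LinearMap.id : A →ₗ[k] A)))
    rw [scal_self] at h2
    exact (congrArg (fun φ : WithConv ((A ⊗[k] A) ⊗[k] A →ₗ[k] A ⊗[k] A) ↦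
      toConv (σ.ofConv ∘ₗ φ.ofConv)) h1).symm.trans h2
  have hR : toConv (σ.ofConv ∘ₗ TensorProduct.map LinearMap.id M.ofConv ∘ₗ
      (TensorProduct.assoc k A A A).toLinearMap) =
      pull k (face0 k A) σ * pull k (face2 k A) σ := by
    have h1 := TensorProduct.map_convMul_map (g := scal A σ) (k := toConv (LinearMap.mul' k A))
      (f := (1 : WithConv (A →ₗ[k] A))) (h := toConv LinearMap.id)
    rw [one_mul, ← hM, ← scal_pull_prR] at h1
    have h2 := comp_scal_mul σ.ofConv (pull k (prR k A (A ⊗[k] A)) σ)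
      (toConv (TensorProduct.map (LinearMap.id : A →ₗ[k] A) (LinearMap.mul' k A)))
    rw [scal_self] at h2
    have h3 := (congrArg (fun φ : WithConv (A ⊗[k] (A ⊗[k] A) →ₗ[k] A ⊗[k] A) ↦
      toConv (σ.ofConv ∘ₗ φ.ofConv)) h1).symm.trans h2
    have h4 := congrArg (pull k (Coalgebra.TensorProduct.assoc k k A A A).toCoalgHom) h3
    rw [map_mul] at h4
    exact h4
  unfold IsLeftCocycle
  rw [← hL, ← hR]
  apply WithConv.ext
  apply TensorProduct.ext_threefold
  intro a b c
  change σ (M (a ⊗ₜ b) ⊗ₜ c) = σ (a ⊗ₜ M (b ⊗ₜ c))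
  rw [← hσ, ← hσ, h]

/-- Every bicleft biGalois object is of the form `A(σ)`. -/
lemma BicomoduleAlgebra.IsBicleft.exists_twist {Z : BicomoduleAlgebra k A} (h : Z.IsBicleft)
    (hZ : Z.IsBiGalois) :
    ∃ σ : Z2L k A, Isomorphic (Twist.bicomoduleAlgebra σ) Z := by
  obtain ⟨ψ, h1, hl, hr⟩ := IsBicleft.exists_map_one h hZ.left.algebraMap_injective
    hZ.left.coinvariants
  let M : WithConv (A ⊗[k] A →ₗ[k] A) := toConv (ψ.symm.toLinearMap ∘ₗ LinearMap.mul' k Z ∘ₗ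
    TensorProduct.map ψ.toLinearMap ψ.toLinearMap)
  have hM : ∀ a b, ψ (M (a ⊗ₜ b)) = ψ a * ψ b := fun a b ↦ ψ.apply_symm_apply _
  -- colinearity of the transported product `M` on the right and on the left
  have e1 : M = scal A (push (Bialgebra.counitAlgHom k A) M) * toConv (LinearMap.mul' k A) := by
    refine eq_scal_mul_of_comul fun w ↦ (ψ.rTensor A).injective ?_
    refine (hr (M w)).symm.trans ?_
    induction w with
    | zero => simp only [map_zero]
    | add x y hx hy => simp only [map_add, hx, hy]
    | tmul a b =>
      rw [hM, map_mul, hr, hr, TensorProduct.comul_tmul]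
      generalize comul (R := k) a = u
      generalize comul (R := k) b = w
      induction u with
      | zero => simp only [map_zero, zero_tmul, zero_mul]
      | add x y hx hy => simp only [map_add, add_tmul, add_mul, hx, hy]
      | tmul x y =>
        induction w with
        | zero => simp only [map_zero, tmul_zero, mul_zero]
        | add x y hx hy => simp only [map_add, tmul_add, mul_add, hx, hy]
        | tmul z w =>
          refine (Algebra.TensorProduct.tmul_mul_tmul _ _ _ _).trans ?_
          exact congrArg (· ⊗ₜ[k] (y * w)) (hM x z).symm
  have e2 : M = toConv (LinearMap.mul' k A) * scal A (push (Bialgebra.counitAlgHom k A) M) := by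
    refine eq_mul_scal_of_comul fun w ↦ (ψ.lTensor A).injective ?_
    refine (hl (M w)).symm.trans ?_
    induction w with
    | zero => simp only [map_zero]
    | add x y hx hy => simp only [map_add, hx, hy]
    | tmul a b =>
      rw [hM, map_mul, hl, hl, TensorProduct.comul_tmul]
      generalize comul (R := k) a = u
      generalize comul (R := k) b = w
      induction u with
      | zero => simp only [map_zero, zero_tmul, zero_mul]
      | add x y hx hy => simp only [map_add, add_tmul, add_mul, hx, hy]
      | tmul x y =>
        induction w with
        | zero => simp only [map_zero, tmul_zero, mul_zero]
        | add x y hx hy => simp only [map_add, tmul_add, mul_add, hx, hy]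
        | tmul z w =>
          refine (Algebra.TensorProduct.tmul_mul_tmul _ _ _ _).trans ?_
          exact congrArg ((x * z) ⊗ₜ[k] ·) (hM y w).symm
  have hσ : ∀ w, counit (R := k) (M w) = push (Bialgebra.counitAlgHom k A) M w := fun w ↦ rfl
  generalize push (Bialgebra.counitAlgHom k A) M = φ at e1 e2 hσ
  have hm1 : ∀ a b, ψ a * ψ b = ψ ((scal A φ * toConv (LinearMap.mul' k A)) (a ⊗ₜ b)) := by
    intro a b
    rw [← e1, hM]
  have hm2 : ∀ a b, ψ a * ψ b = ψ ((toConv (LinearMap.mul' k A) * scal A φ) (a ⊗ₜ b)) := by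
    intro a b
    rw [← e2, hM]
  obtain ⟨σ, rfl⟩ := isUnit_of_bijective ((kappaR_bijective_iff hr hm1).1 hZ.right.bijective)
    ((kappaL_bijective_iff hl hm2).1 hZ.left.bijective)
  have hσ2 : σ ∈ Z2L k A := by
    refine ⟨fun a ↦ ⟨?_, ?_⟩, e1.symm.trans e2, isLeftCocycle_of_assoc e1 hσ fun a b c ↦ ?_⟩
    · rw [← hσ]
      refine congrArg counit (ψ.injective ?_)
      rw [hM, h1, mul_one]
    · rw [← hσ]
      refine congrArg counit (ψ.injective ?_)
      rw [hM, h1, one_mul]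
    · apply ψ.injective
      rw [hM, hM, hM, hM, mul_assoc]
  refine ⟨⟨σ, hσ2⟩, ?_⟩
  let e : Twist ⟨σ, hσ2⟩ ≃ₗ[k] Z := (Twist.of ⟨σ, hσ2⟩).symm.trans ψ
  have he : e.toLinearMap ∘ₗ (Twist.of ⟨σ, hσ2⟩).toLinearMap = ψ.toLinearMap := rfl
  refine ⟨AlgEquiv.ofLinearEquiv e h1 fun x y ↦ ?_, fun x ↦ ?_, fun x ↦ ?_⟩
  · exact (hm1 ((Twist.of ⟨σ, hσ2⟩).symm x) ((Twist.of ⟨σ, hσ2⟩).symm y)).symm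
  · obtain ⟨a, rfl⟩ := (Twist.of ⟨σ, hσ2⟩).surjective x
    refine (hl a).trans ?_
    rw [← he]
    exact LinearMap.lTensor_comp_apply _ _ _ _
  · obtain ⟨a, rfl⟩ := (Twist.of ⟨σ, hσ2⟩).surjective x
    refine (hr a).trans ?_
    rw [← he]
    exact LinearMap.rTensor_comp_apply _ _ _ _

end Range

/-! ### The group of bicleft biGalois objects -/

section Comparison

variable {k : Type u} {A : Type v} [CommRing k] [Nontrivial k] [Ring A] [HopfAlgebra k A]
  [Module.Flat k A]

open BicomoduleAlgebra

attribute [local instance] BiGal.group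

variable (k A) in
/-- The group morphism `σ ↦ [A(σ)]`. -/
def twistHom : Z2L k A →* BiGal k A :=
  MonoidHom.mk' (fun σ ↦ BiGal.mk (Twist.bicomoduleAlgebra σ) (Twist.isBiGalois σ))
    fun σ τ ↦ ((BiGal.mk_mul_mk _ _).trans
      ((BiGal.mk_eq_mk _ _).2 (Twist.cotensor σ τ))).symm

lemma BiGal.one_def : (1 : BiGal k A) = BiGal.mk (unit k A) (isBiGalois_unit k A) := rfl

variable (k A) in
lemma ker_twistHom : (twistHom k A).ker = B2L k A := by
  ext σ
  rw [MonoidHom.mem_ker, ← Twist.isomorphic_unit_iff, BiGal.one_def]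
  exact BiGal.mk_eq_mk _ _

variable (k A) in
lemma coe_range_twistHom : ((twistHom k A).range : Set (BiGal k A)) = Bicleft k A := by
  ext x
  constructor
  · rintro ⟨σ, rfl⟩
    exact ⟨_, Twist.isBiGalois σ, Twist.isBicleft σ, rfl⟩
  · rintro ⟨Z, hZ, h, rfl⟩
    obtain ⟨σ, hσ⟩ := BicomoduleAlgebra.IsBicleft.exists_twist h hZ
    exact ⟨σ, (BiGal.mk_eq_mk _ _).2 hσ⟩

variable (k A) in
/-- The bicomodule underlying `Z □ T □ V` does not depend on the product of `T`, so that conjugates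
of bicleft objects are bicleft. -/
lemma normal_range_twistHom : (twistHom k A).range.Normal where
  conj_mem := by
    intro x hx y
    have hx' : x ∈ Bicleft k A := coe_range_twistHom k A ▸ hx
    have key : y * x * y⁻¹ ∈ Bicleft k A := by
      obtain ⟨T, hT, h, rfl⟩ := hx'
      generalize hv : y⁻¹ = v
      obtain ⟨⟨Z, hZ⟩, rfl⟩ := Quotient.exists_rep y
      obtain ⟨⟨V, hV⟩, rfl⟩ := Quotient.exists_rep v
      change (BiGal.mk Z hZ)⁻¹ = BiGal.mk V hV at hv
      have := hV.faithfullyFlat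
      refine ⟨(Z.cotensor T).cotensor V, (hZ.cotensor hT).cotensor hV, ?_, rfl⟩
      -- the product with the trivial object in the middle is the trivial object
      have h1 : Isomorphic ((Z.cotensor (unit k A)).cotensor V) (unit k A) := by
        refine (BiGal.mk_eq_mk ((hZ.cotensor (isBiGalois_unit k A)).cotensor hV)
          (isBiGalois_unit k A)).1 ?_
        rw [← BiGal.mk_mul_mk (hZ.cotensor (isBiGalois_unit k A)) hV,
          ← BiGal.mk_mul_mk hZ (isBiGalois_unit k A), ← BiGal.one_def, mul_one, ← hv,
          mul_inv_cancel]
      refine isBicleft_iff.2 (h1.bicomoduleIso.symm.trans ?_)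
      exact ((Isomorphic.refl Z).bicomoduleIso.cotensor (isBicleft_iff.1 h)).cotensor
        (Isomorphic.refl V).bicomoduleIso
    exact (coe_range_twistHom k A ▸ key : y * x * y⁻¹ ∈ ((twistHom k A).range : Set (BiGal k A)))

variable (k A) in
/-- The isomorphism from lazy cohomology to the group of bicleft biGalois objects. -/
def H2LEquiv : H2L k A ≃* (twistHom k A).range :=
  (QuotientGroup.quotientMulEquivOfEq (ker_twistHom k A).symm).trans
    (QuotientGroup.quotientKerEquivRange (twistHom k A))

end Comparison

end LazyCohomology

end

theorem theorem3p9 {k : Type u} {A : Type v} [CommRing k] [Nontrivial k] [Ring A]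
    [HopfAlgebra k A] [Module.Flat k A] :
    -- `BiGal(A)` is a group under the cotensor product
    ∃ G : Group (LazyCohomology.BiGal k A),
      letI := G
      (∀ (Z T : LazyCohomology.BicomoduleAlgebra k A) (hZ : Z.IsBiGalois) (hT : T.IsBiGalois),
        ∃ h : (Z.cotensor T).IsBiGalois,
          LazyCohomology.BiGal.mk Z hZ * LazyCohomology.BiGal.mk T hT =
            LazyCohomology.BiGal.mk (Z.cotensor T) h) ∧
      -- `Bicleft(A)` is a normal subgroup, and `σ ↦ [A(σ)]` induces `H²_L(A) ≅ Bicleft(A)`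
      ∃ N : Subgroup (LazyCohomology.BiGal k A),
        (N : Set (LazyCohomology.BiGal k A)) = LazyCohomology.Bicleft k A ∧
        N.Normal ∧
        ∃ Φ : LazyCohomology.H2L k A ≃* N,
          ∀ σ : LazyCohomology.Z2L k A,
            ∃ h : (LazyCohomology.Twist.bicomoduleAlgebra σ).IsBiGalois,
              (Φ (QuotientGroup.mk σ) : LazyCohomology.BiGal k A) =
                LazyCohomology.BiGal.mk (LazyCohomology.Twist.bicomoduleAlgebra σ) h :=
  ⟨LazyCohomology.BiGal.group k A, fun _ _ hZ hT ↦ ⟨hZ.cotensor hT, rfl⟩, _,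
    LazyCohomology.coe_range_twistHom k A, LazyCohomology.normal_range_twistHom k A,
    LazyCohomology.H2LEquiv k A,
    fun σ ↦ ⟨LazyCohomology.Twist.isBiGalois σ, rfl⟩⟩
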